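/- Conventions. Let $k$ be a field of characteristic zero and $W$ a smooth scheme of finite type over $k$. For a sheaf of ideals $J\subset\mathcal O_W$ and $x\in W$ let $\nu_x(J)$ be the largest $n$ with $J_x\subset\mathfrak m_{W,x}^n$ ($\infty$ if $J_x=0$). For an integer $b\ge 1$ put $\mathrm{Sing}(J,b)=\{x\in W:\nu_x(J)\ge b\}$; the pair $(J,b)$ is called a couple on $W$. A transformation $(W,(J,b))\leftarrow(W_1,(J_1,b))$ is the blow-up $\pi:W_1\to W$ along a closed subscheme $Y$, smooth over $k$ and contained in $\mathrm{Sing}(J,b)$, together with the ideal $J_1$ determined by $J\mathcal O_{W_1}=I(H)^bJ_1$, $H=\pi^{-1}(Y)$ (the empty center is allowed; then $\pi$ is an isomorphism). Couples on smooth closed subschemes and their transformations are defined in the same way, and there the zero ideal is allowed. A smooth hypersurface is a closed subscheme, smooth over $k$, whose ideal is locally generated by one nonzerodivisor; it may be empty. If $Z\subset W$ is a closed subscheme and $W\leftarrow W_1\leftarrow\cdots\leftarrow W_r$ is a sequence of transformations of $(J,b)$, let $Z^{(i)}\subset W_i$ be the iterated strict transforms of $Z$. We say that the sequence induces a sequence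 of transformations of a couple $(K,d)$ on $Z$, if at every step the center $Y_i\subset W_i$ is a closed subscheme of $Z^{(i)}$ and $Z^{(i)}\leftarrow Z^{(i+1)}$ is a transformation of $(K_i,d)$ with center $Y_i$ (so that $K_0=K$, and $K_{i+1}$ is the resulting transform). If $z_1,\dots,z_r,y_1,\dots,y_n$ are global sections whose differentials form a basis of the (free) sheaf $\Omega_{W/k}$, if $Z$ is the closed subscheme with ideal $\langle z_1,\dots,z_r\rangle$, and $f_1,\dots,f_q$ are global sections of $\mathcal O_W$, the coefficient ideal of $f_1,\dots,f_q$ (relative to $b$ and these coordinates) is the ideal of $\mathcal O_Z$ $$\Big\langle\Big(\tfrac1{m_1!\cdots m_r!}\,\tfrac{\partial^{m_1+\dots+m_r}f_j}{\partial z_1^{m_1}\cdots\partial z_r^{m_r}}\Big|_Z\Big)^{\frac{b!}{b-(m_1+\dots+m_r)}}\ :\ 0\le m_1+\dots+m_r<b,\ 1\le j\le q\Big\rangle .$$ Theorem. Let $b\ge1$ and let $J\subset\mathcal O_W$ have maximum order $b$, i.e. $\max_{x\in W}\nu_x(J)=b$. (A) There are an open covering $\{U_\lambda\}_{\lambda\in\Lambda}$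 of $W$ and, for every $\lambda$, a closed smooth hypersurface $\overline W_\lambda\subset U_\lambda$ and a couple $(K_\lambda,b!)$ with $K_\lambda\subset\mathcal O_{\overline W_\lambda}$ such that, with $J_\lambda=J|_{U_\lambda}$: 0. If $\overline W_\lambda\ne\emptyset$, there are global sections $z,y_1,\dots,y_n$ of $\mathcal O_{U_\lambda}$ whose differentials form a basis of $\Omega_{U_\lambda/k}$, and generators $f_1,\dots,f_q$ of $J_\lambda$, such that $I(\overline W_\lambda)=\langle z\rangle$ and $K_\lambda$ is the coefficient ideal of $f_1,\dots,f_q$. 1. $\mathrm{Sing}(J_\lambda,b)\subset\overline W_\lambda$. 2. For every sequence of transformations $(W,(J,b))\leftarrow(W_1,(J_1,b))\leftarrow\cdots\leftarrow(W_r,(J_r,b))$, with restriction $(U_\lambda,(J_\lambda,b))\leftarrow\cdots\leftarrow(U_\lambda^{(r)},((J_\lambda)_r,b))$ to the inverse images of $U_\lambda$, the sets $U_\lambda^{(r)}$ cover $W_r$, the strict transform $\overline W_\lambda^{(r)}$ is a smooth hypersurface in $U_\lambda^{(r)}$, and $$\mathrm{Sing}(J_r,b)\cap U_\lambda^{(r)}=\mathrm{Sing}((J_\lambda)_r,b)\subset\overline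 W_\lambda^{(r)}.$$ 3. For every such sequence, its restriction to $U_\lambda$ induces a sequence of transformations of $(K_\lambda,b!)$, and $\mathrm{Sing}((J_\lambda)_r,b)=\mathrm{Sing}((K_\lambda)_r,b!)$. 4. Conversely, for every $\lambda$, every sequence of transformations of $(\overline W_\lambda,(K_\lambda,b!))$ is induced by a sequence of transformations of $(U_\lambda,(J_\lambda,b))$, and $\mathrm{Sing}((J_\lambda)_r,b)=\mathrm{Sing}((K_\lambda)_r,b!)$ for these sequences. (B) Suppose that $J=\langle f\rangle$ for a global section $f$, that $z_1,\dots,z_r,y_1,\dots,y_n$ are global sections of $\mathcal O_W$ whose differentials form a basis of $\Omega_{W/k}$, that $I(Z)=\langle z_1,\dots,z_r\rangle$, and that $\mathrm{Sing}(J_s,b)\subset Z^{(s)}$ for every sequence of transformations $(W,(J,b))\leftarrow\cdots\leftarrow(W_s,(J_s,b))$. Let $J^*\subset\mathcal O_Z$ be the coefficient ideal of $f$. Then every sequence of transformations of $(J,b)$ induces a sequence of transformations of $(J^*,b!)$, and $\mathrm{Sing}(J_s,b)=\mathrm{Sing}((J^*)_s,b!)$. Conversely, every sequence of transformations of $(Z,(J^*,b!))$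 is induced by a sequence of transformations of $(W,(J,b))$, again with $\mathrm{Sing}(J_s,b)=\mathrm{Sing}((J^*)_s,b!)$. -/

import Mathlib

open AlgebraicGeometry CategoryTheory CategoryTheory.Limits

universe u

noncomputable section

namespace Resolution

/-! ### Effective Cartier divisors, blow-ups, strict transforms -/

/-- The closed subscheme of `X` with ideal sheaf `I` is an effective Cartier divisor: locally `I`
is generated by one nonzerodivisor (equivalently, `I` is an invertible ideal sheaf). -/
def IsEffectiveCartier {X : Scheme.{u}} (I : X.IdealSheafData) : Prop :=
  ∀ x : X, ∃ V : X.affineOpens, x ∈ V.1 ∧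
    ∃ f : Γ(X, V.1), f ∈ nonZeroDivisors Γ(X, V.1) ∧ I.ideal V = Ideal.span {f}

/-- `π : X' ⟶ X` is the blow-up (monoidal transformation) of `X` along the closed subscheme with
ideal sheaf `I`: the total transform of `I` is invertible, and `π` is universal with this
property. -/
structure IsBlowup {X' X : Scheme.{u}} (π : X' ⟶ X) (I : X.IdealSheafData) : Prop where
  cartier : IsEffectiveCartier (I.comap π)
  existsUnique_lift : ∀ {T : Scheme.{u}} (g : T ⟶ X), IsEffectiveCartier (I.comap g) →
    ∃! h : T ⟶ X', h ≫ π = g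

/-- The complement of the exceptional locus `π⁻¹(V(Y))`. -/
def complExceptional {X' X : Scheme.{u}} (π : X' ⟶ X) (Y : X.IdealSheafData) : X'.Opens :=
  (Y.comap π).support.compl

/-- The ideal sheaf of the strict transform under `π` (the blow-up along `Y`) of the closed
subscheme with ideal sheaf `I`: the scheme-theoretic closure in `X'` of the part of `π⁻¹(V(I))`
that lies outside of the exceptional locus. -/
def strictTransform {X' X : Scheme.{u}} (π : X' ⟶ X) (Y I : X.IdealSheafData) :
    X'.IdealSheafData :=
  ((I.comap π).comap (complExceptional π Y).ι).map (complExceptional π Y).ι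

/-! ### Order of an ideal sheaf -/

/-- The stalk `J_x`, an ideal of the local ring at `x`. -/
def stalkIdeal {X : Scheme.{u}} (J : X.IdealSheafData) (x : X) : Ideal (X.presheaf.stalk x) :=
  ⨆ (V : X.affineOpens) (hx : x ∈ V.1), (J.ideal V).map (X.presheaf.germ V.1 x hx).hom

/-- The order of `J` at `x`: the largest `n` such that `J_x` lies in the `n`-th power of the
maximal ideal (it is `⊤` if there is no largest one, e.g. for `J_x = 0`). -/
def ord {X : Scheme.{u}} (J : X.IdealSheafData) (x : X) : ℕ∞ :=
  ⨆ (n : ℕ) (_ : stalkIdeal J x ≤ IsLocalRing.maximalIdeal (X.presheaf.stalk x) ^ n), (n : ℕ∞)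

/-! ### Couples and their transformations -/

/-- A couple `(J, b)` on a `k`-scheme `W`. (The zero ideal is allowed.) -/
structure Couple (k : Type u) [Field k] where
  W : Scheme.{u}
  str : W ⟶ Spec (CommRingCat.of k)
  J : W.IdealSheafData
  b : ℕ

variable {k : Type u} [Field k]

/-- `Sing(J, b)`: the points where `J` has order at least `b`. -/
def Couple.Sing (A : Couple k) : Set A.W := {x | (A.b : ℕ∞) ≤ ord A.J x}

/-- Restriction of a couple to an open subscheme. -/
def Couple.restrict (A : Couple k) (U : A.W.Opens) : Couple k where
  W := U.toScheme
  str := U.ι ≫ A.str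
  J := A.J.comap U.ι
  b := A.b

/-- The couple `(K, d)` on the closed subscheme of `A.W` with ideal sheaf `I`. -/
def Couple.onSubscheme (A : Couple k) (I : A.W.IdealSheafData) (K : I.subscheme.IdealSheafData)
    (d : ℕ) : Couple k where
  W := I.subscheme
  str := I.subschemeι ≫ A.str
  J := K
  b := d

/-- A transformation `(W, (J, b)) ⟵ (W₁, (J₁, b))`: the blow-up `π` of `W` at a closed
subscheme `Y`, smooth over `k` and contained in `Sing(J, b)`, where `J₁` is determined by
`J 𝒪_{W₁} = I(H)ᵇ J₁`, `H = π⁻¹(Y)`. -/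
structure Transformation (A B : Couple k) where
  center : A.W.IdealSheafData
  π : B.W ⟶ A.W
  str_eq : π ≫ A.str = B.str
  b_eq : B.b = A.b
  smooth_center : Smooth (center.subschemeι ≫ A.str)
  center_subset : (center.support : Set A.W) ⊆ A.Sing
  isBlowup : IsBlowup π center
  totalTransform_eq : A.J.comap π = (center.comap π) ^ A.b * B.J

/-- Finite sequences of transformations, from the couple `A` to the couple `B`. -/
inductive TransSeq : Couple k → Couple k → Type (u + 1)
  | nil (A : Couple k) : TransSeq A A
  | snoc {A B C : Couple k} (t : TransSeq A B) (f : Transformation B C) : TransSeq A C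

/-! ### Restriction of transformations to open subschemes -/

lemma ideal_comap_eq_map {X Y : Scheme.{u}} (K : Y.IdealSheafData) (f : X ⟶ Y)
    [IsOpenImmersion f] (V : X.affineOpens) : (K.comap f).ideal V =
      (K.ideal ⟨f ''ᵁ V, V.2.image_of_isOpenImmersion f⟩).map
        (f.appIso V).commRingCatIsoToRingEquiv := by
  rw [K.ideal_comap_of_isOpenImmersion f V]
  exact Ideal.comap_symm (I := K.ideal ⟨f ''ᵁ V, V.2.image_of_isOpenImmersion f⟩)
    (f.appIso V).commRingCatIsoToRingEquiv

lemma IsEffectiveCartier.comap_of_isOpenImmersion {X Y : Scheme.{u}} {I : Y.IdealSheafData}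
    (hI : IsEffectiveCartier I) (f : X ⟶ Y) [IsOpenImmersion f] :
    IsEffectiveCartier (I.comap f) := by
  intro x
  obtain ⟨V, hxV, s, hs, hIs⟩ := hI (f x)
  obtain ⟨g, hg, hxg⟩ := V.2.exists_basicOpen_le (V := V.1 ⊓ f.opensRange)
    ⟨f x, hxV, x, rfl⟩ hxV
  have key : ∃ h : Γ(Y, (Y.affineBasicOpen g).1), h ∈ nonZeroDivisors _ ∧
      I.ideal (Y.affineBasicOpen g) = Ideal.span {h} := by
    refine ⟨(Y.presheaf.map (homOfLE <| Y.basicOpen_le g).op).hom s, ?_, ?_⟩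
    · have := V.2.isLocalization_basicOpen g
      exact IsLocalization.map_nonZeroDivisors_le (Submonoid.powers g) Γ(Y, Y.basicOpen g)
        (Submonoid.mem_map_of_mem _ hs)
    · rw [← I.map_ideal_basicOpen V g, hIs, Ideal.map_span, Set.image_singleton]
      rfl
  have hW : IsAffineOpen (f ⁻¹ᵁ Y.basicOpen g) :=
    (V.2.basicOpen g).preimage_of_isOpenImmersion f (hg.trans inf_le_right)
  have himg : f ''ᵁ (f ⁻¹ᵁ Y.basicOpen g) = Y.basicOpen g := by
    rw [Scheme.Hom.image_preimage_eq_opensRange_inf]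
    exact inf_eq_right.mpr (hg.trans inf_le_right)
  have himg' : Y.affineBasicOpen g =
      (⟨f ''ᵁ (f ⁻¹ᵁ Y.basicOpen g), hW.image_of_isOpenImmersion f⟩ : Y.affineOpens) :=
    Subtype.ext himg.symm
  rw [himg'] at key
  obtain ⟨h, hh, hIh⟩ := key
  refine ⟨⟨_, hW⟩, hxg, (f.appIso (f ⁻¹ᵁ Y.basicOpen g)).commRingCatIsoToRingEquiv h, ?_, ?_⟩
  · rw [← MulEquivClass.map_nonZeroDivisors
      (f.appIso (f ⁻¹ᵁ Y.basicOpen g)).commRingCatIsoToRingEquiv]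
    exact Submonoid.mem_map_of_mem _ hh
  · rw [ideal_comap_eq_map, hIh, Ideal.map_span, Set.image_singleton]

lemma IsBlowup.restrict {X' X : Scheme.{u}} {π : X' ⟶ X} {I : X.IdealSheafData}
    (h : IsBlowup π I) (U : X.Opens) : IsBlowup (π ∣_ U) (I.comap U.ι) where
  cartier := by
    rw [← Scheme.IdealSheafData.comap_comp, morphismRestrict_ι,
      Scheme.IdealSheafData.comap_comp]
    exact h.cartier.comap_of_isOpenImmersion _
  existsUnique_lift {T} g hg := by
    rw [← Scheme.IdealSheafData.comap_comp] at hg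
    obtain ⟨l, hl, hu⟩ := h.existsUnique_lift _ hg
    have P := (isPullback_morphismRestrict π U).flip
    refine ⟨P.lift l g hl, P.lift_snd _ _ _, fun m hm ↦ ?_⟩
    refine P.hom_ext ?_ ?_
    · rw [P.lift_fst]
      have hm' : m ≫ π ∣_ U = g := hm
      refine hu _ ?_
      change (m ≫ (π ⁻¹ᵁ U).ι) ≫ π = g ≫ U.ι
      rw [Category.assoc, ← morphismRestrict_ι, ← Category.assoc, hm']
    · rw [P.lift_snd, hm]

lemma comap_mul_of_isOpenImmersion {X Y : Scheme.{u}} (I J : Y.IdealSheafData) (f : X ⟶ Y)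
    [IsOpenImmersion f] : (I * J).comap f = I.comap f * J.comap f := by
  ext V : 2
  rw [Scheme.IdealSheafData.ideal_mul, Pi.mul_apply, ideal_comap_eq_map, ideal_comap_eq_map,
    ideal_comap_eq_map,
    Scheme.IdealSheafData.ideal_mul, Pi.mul_apply, Ideal.map_mul]

lemma comap_pow_of_isOpenImmersion {X Y : Scheme.{u}} (I : Y.IdealSheafData) (f : X ⟶ Y)
    [IsOpenImmersion f] (n : ℕ) : (I ^ n).comap f = I.comap f ^ n := by
  induction n with
  | zero => rw [pow_zero, pow_zero]; exact Scheme.IdealSheafData.comap_top f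
  | succ n ih => rw [pow_succ, pow_succ, comap_mul_of_isOpenImmersion, ih]

lemma le_ord_comap {X Y : Scheme.{u}} (J : Y.IdealSheafData) (f : X ⟶ Y)
    [IsOpenImmersion f] (x : X) : ord J (f x) ≤ ord (J.comap f) x := by
  refine iSup_mono fun n ↦ iSup_mono' fun h ↦ ⟨?_, le_rfl⟩
  refine iSup₂_le fun V hx ↦ Ideal.map_le_iff_le_comap.mpr fun s hs ↦ ?_
  rw [J.ideal_comap_of_isOpenImmersion f V] at hs
  have hmem : f x ∈ f ''ᵁ V.1 := ⟨x, hx, rfl⟩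
  have h1 : (Y.presheaf.germ (f ''ᵁ V.1) (f x) hmem).hom ((f.appIso V).inv.hom s) ∈
      stalkIdeal J (f x) :=
    le_iSup₂_of_le (f := fun (V : Y.affineOpens) (hx : f x ∈ V.1) ↦
      (J.ideal V).map (Y.presheaf.germ V.1 (f x) hx).hom)
      ⟨f ''ᵁ V.1, V.2.image_of_isOpenImmersion f⟩ hmem le_rfl (Ideal.mem_map_of_mem _ hs)
  have h2 := Ideal.mem_map_of_mem (f.stalkMap x).hom (h h1)
  rw [Ideal.map_pow] at h2
  have hloc : (IsLocalRing.maximalIdeal (Y.presheaf.stalk (f x))).map (f.stalkMap x).hom ≤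
      IsLocalRing.maximalIdeal (X.presheaf.stalk x) :=
    Ideal.map_le_iff_le_comap.mpr
      (IsLocalRing.maximalIdeal_comap (f.stalkMap x).hom).ge
  have h3 := Ideal.pow_right_mono hloc n h2
  have h4 : (f.stalkMap x).hom ((Y.presheaf.germ (f ''ᵁ V.1) (f x) hmem).hom
      ((f.appIso V).inv.hom s)) = (X.presheaf.germ V.1 x hx).hom s := by
    have e1 : (f.appIso V).inv ≫ Y.presheaf.germ (f ''ᵁ V.1) (f x) hmem ≫ f.stalkMap x =
        X.presheaf.germ V.1 x hx := by
      rw [Scheme.Hom.germ_stalkMap, Scheme.Hom.appIso_inv_app_assoc]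
      exact X.presheaf.germ_res' _ x hmem
    exact congr($(e1).hom s)
  rw [h4] at h3
  exact h3

/-- Restriction of a transformation to an open subscheme `V` of the base. -/
def Transformation.restrict {A B : Couple k} (f : Transformation A B) (V : A.W.Opens) :
    Transformation (A.restrict V) (B.restrict (f.π ⁻¹ᵁ V)) where
  center := f.center.comap V.ι
  π := f.π ∣_ V
  str_eq := by
    change f.π ∣_ V ≫ V.ι ≫ A.str = (f.π ⁻¹ᵁ V).ι ≫ B.str
    rw [← f.str_eq, ← Category.assoc, morphismRestrict_ι, Category.assoc]
  b_eq := f.b_eq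
  smooth_center := by
    have := f.smooth_center
    have e : (f.center.comap V.ι).subschemeι ≫ V.ι ≫ A.str =
        (f.center.comapIso V.ι).hom ≫ pullback.snd V.ι f.center.subschemeι ≫
          f.center.subschemeι ≫ A.str := by
      rw [← Scheme.IdealSheafData.comapIso_hom_fst_assoc, pullback.condition_assoc]
    change Smooth ((f.center.comap V.ι).subschemeι ≫ V.ι ≫ A.str)
    rw [e]
    infer_instance
  center_subset := by
    intro x hx
    have hx' : V.ι x ∈ (f.center.support : Set A.W) := by
      have h := Scheme.IdealSheafData.support_comap f.center V.ι
      have hx2 : x ∈ ((f.center.comap V.ι).support : Set V.toScheme) := hx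
      rw [h] at hx2
      exact hx2
    exact le_trans (f.center_subset hx') (le_ord_comap A.J V.ι x)
  isBlowup := f.isBlowup.restrict V
  totalTransform_eq := by
    change (A.J.comap V.ι).comap (f.π ∣_ V) =
      ((f.center.comap V.ι).comap (f.π ∣_ V)) ^ A.b * B.J.comap (f.π ⁻¹ᵁ V).ι
    rw [← Scheme.IdealSheafData.comap_comp, ← Scheme.IdealSheafData.comap_comp,
      morphismRestrict_ι, Scheme.IdealSheafData.comap_comp, f.totalTransform_eq,
      comap_mul_of_isOpenImmersion, comap_pow_of_isOpenImmersion,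
      ← Scheme.IdealSheafData.comap_comp]

namespace TransSeq

/-- The pull-back of an open subset of the first scheme to the last scheme of a sequence. -/
def pullOpen {A B : Couple k} : TransSeq A B → A.W.Opens → B.W.Opens
  | nil _, U => U
  | snoc t f, U => f.π ⁻¹ᵁ t.pullOpen U

/-- Restriction of a sequence of transformations over an open subscheme `U` of the first scheme. -/
def restrict {A B : Couple k} : (t : TransSeq A B) → (U : A.W.Opens) →
    TransSeq (A.restrict U) (B.restrict (t.pullOpen U))
  | nil A, U => nil (A.restrict U)
  | snoc t f, U => snoc (t.restrict U) (f.restrict (t.pullOpen U))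

/-- The ideal sheaf, on the last scheme of the sequence, of the (iterated) strict transform of the
closed subscheme with ideal sheaf `I` of the first scheme. -/
def strict {A B : Couple k} : TransSeq A B → A.W.IdealSheafData → B.W.IdealSheafData
  | nil _, I => I
  | snoc t f, I => strictTransform f.π f.center (t.strict I)

/-- Let `i : C.W ⟶ A.W` be a closed immersion. `Induces i t s j` says that the sequence `t` of
transformations of `A` induces the sequence `s` of transformations of `C`: step by step, the
scheme of `s` is embedded in the scheme of `t` as the strict transform of the previous one,
compatibly with the blow-ups, each center of `t` lies in this embedded scheme, and as a subscheme
of it is the center of `s`. The last of these embeddings is `j`. -/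
inductive Induces {A C : Couple k} (i : C.W ⟶ A.W) : ∀ {B D : Couple k},
    TransSeq A B → TransSeq C D → (D.W ⟶ B.W) → Prop
  | nil : Induces i (TransSeq.nil A) (TransSeq.nil C) i
  | snoc {B D B' D' : Couple k} {t : TransSeq A B} {s : TransSeq C D} {j : D.W ⟶ B.W}
      (h : Induces i t s j) (f : Transformation B B') (g : Transformation D D')
      (j' : D'.W ⟶ B'.W) (closed : IsClosedImmersion j') (comm : j' ≫ f.π = g.π ≫ j)
      (ker_eq : j'.ker = strictTransform f.π f.center j.ker)
      (center_sub : j.ker ≤ f.center) (center_eq : g.center = f.center.comap j) :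
      Induces i (t.snoc f) (s.snoc g) j'

/-- The sequence `t` of transformations of `A` induces a sequence of transformations of `C`,
and the singular loci of the two final couples agree. -/
def Descends {A B : Couple k} (t : TransSeq A B) (C : Couple k) (i : C.W ⟶ A.W) : Prop :=
  (∃ (D : Couple k) (s : TransSeq C D) (j : D.W ⟶ B.W), Induces i t s j) ∧
    ∀ (D : Couple k) (s : TransSeq C D) (j : D.W ⟶ B.W), Induces i t s j →
      B.Sing = j '' D.Sing

/-- The converse: the sequence `s` of transformations of `C` is induced by a sequence of
transformations of `A`, and the singular loci of the two final couples agree. -/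
def Ascends {C D : Couple k} (s : TransSeq C D) (A : Couple k) (i : C.W ⟶ A.W) : Prop :=
  ∃ (B : Couple k) (t : TransSeq A B) (j : D.W ⟶ B.W), Induces i t s j ∧ B.Sing = j '' D.Sing

end TransSeq

/-! ### Smooth hypersurfaces, coordinates and coefficient ideals -/

/-- The closed subscheme with ideal sheaf `I` is a smooth hypersurface of the `k`-scheme `X`
(it may be empty). -/
def IsSmoothHypersurface {X : Scheme.{u}} (p : X ⟶ Spec (CommRingCat.of k))
    (I : X.IdealSheafData) : Prop :=
  IsEffectiveCartier I ∧ Smooth (I.subschemeι ≫ p)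

/-- The `k`-algebra structure of the sections of a `k`-scheme over an open subset. -/
abbrev sectionsAlgebra {X : Scheme.{u}} (p : X ⟶ Spec (CommRingCat.of k)) (V : X.Opens) :
    Algebra k Γ(X, V) :=
  ((Scheme.ΓSpecIso (CommRingCat.of k)).inv ≫ p.appLE ⊤ V le_top).hom.toAlgebra

/-- Restriction of a global section to an open subset. -/
def res {X : Scheme.{u}} (V : X.Opens) (s : Γ(X, ⊤)) : Γ(X, V) :=
  (X.presheaf.map (homOfLE le_top).op).hom s

/-- The sheaf of differentials of `X` over `k` is free with basis the differentials of the global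
sections `x i`. -/
def IsCoordinateSystem {X : Scheme.{u}} (p : X ⟶ Spec (CommRingCat.of k)) {ι : Type}
    (x : ι → Γ(X, ⊤)) : Prop :=
  ∀ V : X.affineOpens, letI := sectionsAlgebra p V.1
    LinearIndependent Γ(X, V.1) (fun i ↦ KaehlerDifferential.D k Γ(X, V.1) (res V.1 (x i))) ∧
      Submodule.span Γ(X, V.1)
        (Set.range fun i ↦ KaehlerDifferential.D k Γ(X, V.1) (res V.1 (x i))) = ⊤

open scoped Nat in
/-- `K` is the coefficient ideal, on the closed subscheme with ideal sheaf `I`, of the global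
sections in `F`, with respect to `b` and to the coordinates `z, y`. That is, with `∂ᵢ = ∂/∂zᵢ`,
it is generated by the restrictions of
`((1 / (m₁! ⋯ mᵣ!)) ∂₁^m₁ ⋯ ∂ᵣ^mᵣ f) ^ (b! / (b - |m|))`, for `f ∈ F` and `|m| < b`. -/
def IsCoefficientIdeal {X : Scheme.{u}} (p : X ⟶ Spec (CommRingCat.of k)) (b : ℕ) {r n : ℕ}
    (z : Fin r → Γ(X, ⊤)) (y : Fin n → Γ(X, ⊤)) (F : Set Γ(X, ⊤)) {I : X.IdealSheafData}
    (K : I.subscheme.IdealSheafData) : Prop :=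
  ∃ C : X.IdealSheafData, K = C.comap I.subschemeι ∧
    ∀ V : X.affineOpens, letI := sectionsAlgebra p V.1
      ∃ d : Fin r → Derivation k Γ(X, V.1) Γ(X, V.1),
        (∀ i j, d i (res V.1 (z j)) = if i = j then 1 else 0) ∧
        (∀ i j, d i (res V.1 (y j)) = 0) ∧
        C.ideal V = Ideal.span {g | ∃ f ∈ F, ∃ m : Fin r → ℕ, ∑ i, m i < b ∧
          g = (((∏ i, ((m i)! : k))⁻¹) •
            ((List.ofFn fun i ↦ (d i : Γ(X, V.1) →ₗ[k] Γ(X, V.1)) ^ m i).prod :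
              Module.End k Γ(X, V.1)) (res V.1 f)) ^ (b ! / (b - ∑ i, m i))}

end Resolution

end

open Resolution

/-! The coefficient ideal is handled through Taylor homomorphisms. At a point of `Z` let `ρ : A → R`
be the surjection from the local ring of `W` to that of `Z`. A Taylor homomorphism is a ring map `φ
: A → R[X]/(X)ᵇ` that lifts `ρ` and sends the equations `zᵢ` of `Z` to `Xᵢ`. In coordinates the
coefficients of `φ f` are the divided derivatives of `f` restricted to `Z`. The relation `IsCoeffAt`
remembers only `φ` and not the remaining coordinates `y`, and this is why it survives blow-ups.

Two facts carry the comparison of `J` with its coefficient ideal. By `IsTaylorHom.mem_pow_iff`, `f ∈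
Mᵇ` if and only if the coefficient of `X^α` lies in `(MR)^(b - |α|)` for all `|α| < b`; the
exponents `b!/(b - |α|)` turn this into a single condition of order `b!`, and the singular loci
agree because orders are multiplicative in regular local rings. By `IsCoeffAt.blowup`, the relation
passes to the transforms: if `q` is an equation of the exceptional divisor on `Z'`, then `φ`
followed by `X ↦ qX` makes the ideal of the center principal, so it extends to the local ring of the
blow-up, and the coefficients get divided by `q^(b - |α|)`, which is the transformation law of `(K,
b!)`.

Blow-ups are given by their universal property only. Its local form `HasBlowupLift` is applied to
well-chosen local rings: truncated polynomials (Taylor homomorphisms), dual numbers (derivations),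
rings of fractions (explicit description, smoothness, strict transforms). Existence of blow-ups,
needed to ascend from `Z` to `W`, is proved by gluing affine charts.

For the induction along a sequence, each center must lie in the strict transform of `Z`. It lies in
the singular locus, hence set-theoretically in the strict transform, and it is reduced. The
inclusion of singular loci is assumed in (B). In (A) it comes from maximal contact: the equation of
the hypersurface is obtained from `J` by at most `b - 1` derivations. A derivation `D` lifts to the
blow-up as `h D`, with `h` the exceptional equation, so `b - 1` derivations consume `b - 1` of the
`b` factors `h` of `J`; the last one is the factor that the hypersurface loses. Such hypersurfaces
exist locally in characteristic zero, since `b` derivations of an ideal of order at most `b` produce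
a unit. -/

noncomputable section
namespace Resolution

/-! ### Truncated polynomial rings -/

section Trunc

open MvPolynomial

/-- The truncated polynomial ring `R[X₁, …, Xᵣ] / (X₁, …, Xᵣ)ᵇ`. -/
def Trunc (r b : ℕ) (R : Type*) [CommRing R] : Type _ :=
  MvPolynomial (Fin r) R ⧸ (idealOfVars (Fin r) R) ^ b

instance (r b : ℕ) (R : Type*) [CommRing R] : CommRing (Trunc r b R) :=
  inferInstanceAs (CommRing (MvPolynomial (Fin r) R ⧸ (idealOfVars (Fin r) R) ^ b))

variable {r b : ℕ} {R R' : Type*} [CommRing R] [CommRing R']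

namespace Trunc

/-- The quotient map from the polynomial ring. -/
def mk (r b : ℕ) (R : Type*) [CommRing R] : MvPolynomial (Fin r) R →+* Trunc r b R :=
  Ideal.Quotient.mk _

lemma mk_surjective : Function.Surjective (mk r b R) := Ideal.Quotient.mk_surjective

lemma mk_eq_mk_iff (p q : MvPolynomial (Fin r) R) :
    mk r b R p = mk r b R q ↔ p - q ∈ idealOfVars (Fin r) R ^ b := Ideal.Quotient.eq

/-- The coefficients of a truncated polynomial (meaningful for exponents of degree `< b`). -/
def coeff (α : Fin r →₀ ℕ) (t : Trunc r b R) : R :=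
  MvPolynomial.coeff α (Function.surjInv mk_surjective t)

lemma coeff_mk {α : Fin r →₀ ℕ} (hα : α.degree < b) (p : MvPolynomial (Fin r) R) :
    coeff α (mk r b R p) = MvPolynomial.coeff α p := by
  have h := Function.surjInv_eq (mk_surjective (b := b)) (mk r b R p)
  rw [mk_eq_mk_iff, mem_pow_idealOfVars_iff'] at h
  have := h α hα
  rwa [MvPolynomial.coeff_sub, sub_eq_zero] at this

lemma ext {s t : Trunc r b R} (h : ∀ α : Fin r →₀ ℕ, α.degree < b → coeff α s = coeff α t) :
    s = t := by
  obtain ⟨p, rfl⟩ := mk_surjective s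
  obtain ⟨q, rfl⟩ := mk_surjective t
  rw [mk_eq_mk_iff, mem_pow_idealOfVars_iff']
  intro α hα
  rw [MvPolynomial.coeff_sub, sub_eq_zero, ← coeff_mk hα, ← coeff_mk hα]
  exact h α hα

lemma coeff_add {α : Fin r →₀ ℕ} (hα : α.degree < b) (s t : Trunc r b R) :
    coeff α (s + t) = coeff α s + coeff α t := by
  obtain ⟨p, rfl⟩ := mk_surjective s
  obtain ⟨q, rfl⟩ := mk_surjective t
  rw [← map_add, coeff_mk hα, coeff_mk hα, coeff_mk hα, MvPolynomial.coeff_add]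

lemma coeff_zero {α : Fin r →₀ ℕ} (hα : α.degree < b) :
    coeff α (0 : Trunc r b R) = 0 := by
  rw [← map_zero (mk r b R), coeff_mk hα, MvPolynomial.coeff_zero]

/-- Constants. -/
def C : R →+* Trunc r b R := (mk r b R).comp MvPolynomial.C

/-- The variables. -/
def X (i : Fin r) : Trunc r b R := mk r b R (MvPolynomial.X i)

lemma coeff_C_mul {α : Fin r →₀ ℕ} (hα : α.degree < b) (a : R) (t : Trunc r b R) :
    coeff α (C a * t) = a * coeff α t := by
  obtain ⟨q, rfl⟩ := mk_surjective t
  rw [C, RingHom.comp_apply, ← map_mul, coeff_mk hα, coeff_mk hα, MvPolynomial.coeff_C_mul]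

lemma coeff_mul {α : Fin r →₀ ℕ} (hα : α.degree < b) (s t : Trunc r b R) :
    coeff α (s * t) = ∑ x ∈ Finset.HasAntidiagonal.antidiagonal α, coeff x.1 s * coeff x.2 t := by
  classical
  obtain ⟨p, rfl⟩ := mk_surjective s
  obtain ⟨q, rfl⟩ := mk_surjective t
  rw [← map_mul, coeff_mk hα, MvPolynomial.coeff_mul]
  refine Finset.sum_congr rfl fun x hx ↦ ?_
  have h : x.1.degree + x.2.degree < b := by
    rw [← map_add, Finset.HasAntidiagonal.mem_antidiagonal.mp hx]; exact hα
  rw [coeff_mk (by omega), coeff_mk (by omega)]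

/-- The constant coefficient. -/
def const (hb : 0 < b) : Trunc r b R →+* R :=
  Ideal.Quotient.lift _ constantCoeff fun p hp ↦
    (mem_pow_idealOfVars_iff' b p).mp hp 0 (by simpa using hb)

@[simp] lemma const_mk (hb : 0 < b) (p : MvPolynomial (Fin r) R) :
    const hb (mk r b R p) = constantCoeff p := rfl

@[simp] lemma const_C (hb : 0 < b) (a : R) : const hb (C a : Trunc r b R) = a := by
  simp [C]

@[simp] lemma const_X (hb : 0 < b) (i : Fin r) : const hb (X i : Trunc r b R) = 0 := by
  simp [X]

lemma coeff_zero_eq_const (hb : 0 < b) (t : Trunc r b R) : coeff 0 t = const hb t := by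
  obtain ⟨p, rfl⟩ := mk_surjective t
  rw [const_mk, coeff_mk (by simpa using hb)]; rfl

lemma map_mk_idealOfVars : (idealOfVars (Fin r) R).map (mk r b R) =
    Ideal.span (Set.range (X : Fin r → Trunc r b R)) := by
  have h := Ideal.map_span (mk r b R) (Set.range (MvPolynomial.X : Fin r → _))
  rwa [← Set.range_comp] at h

lemma mem_ker_const_iff (hb : 0 < b) (t : Trunc r b R) :
    const hb t = 0 ↔ t ∈ Ideal.span (Set.range (X : Fin r → Trunc r b R)) := by
  constructor
  · obtain ⟨p, rfl⟩ := mk_surjective t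
    intro h
    have : p ∈ idealOfVars (Fin r) R := by
      rw [← pow_one (idealOfVars (Fin r) R), mem_pow_idealOfVars_iff']
      intro α hα
      have : α = 0 := by
        rw [← Finsupp.degree_eq_zero_iff]; omega
      subst this
      exact h
    have := Ideal.mem_map_of_mem (mk r b R) this
    rwa [map_mk_idealOfVars] at this
  · intro h
    change t ∈ RingHom.ker (const hb)
    refine Ideal.span_le.mpr ?_ h
    rintro _ ⟨i, rfl⟩
    simp

lemma span_X_pow : Ideal.span (Set.range (X : Fin r → Trunc r b R)) ^ b = ⊥ := by
  rw [← map_mk_idealOfVars, ← Ideal.map_pow]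
  exact Ideal.map_quotient_self _

/-- A truncated polynomial is its constant term plus a nilpotent element, so it is a unit once its
constant term is one. Hence `Trunc` over a local ring is local, and is an admissible target for
`HasBlowupLift`. -/
instance isLocalHom_const (hb : 0 < b) : IsLocalHom (const hb : Trunc r b R →+* R) where
  map_nonunit t ht := by
    have h1 : const hb (t - C (const hb t)) = 0 := by simp
    rw [mem_ker_const_iff] at h1
    have h2 : IsNilpotent (t - C (const hb t)) :=
      ⟨b, by simpa [span_X_pow] using Ideal.pow_mem_pow h1 b⟩
    have h3 := h2.isUnit_add_left_of_commute (ht.map (C : R →+* Trunc r b R)) (Commute.all _ _)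
    rwa [add_sub_cancel] at h3

lemma isLocalRing [IsLocalRing R] (hb : 0 < b) : IsLocalRing (Trunc r b R) :=
  RingHom.domain_isLocalRing (const hb)

lemma C_mem_nonZeroDivisors {a : R} (ha : a ∈ nonZeroDivisors R) :
    (C a : Trunc r b R) ∈ nonZeroDivisors (Trunc r b R) := by
  rw [mem_nonZeroDivisors_iff_right]
  intro t ht
  refine ext fun α hα ↦ ?_
  have := congr_arg (coeff α) ht
  rw [mul_comm, coeff_C_mul hα, coeff_zero hα, mul_comm] at this
  rw [coeff_zero hα]
  exact (mem_nonZeroDivisors_iff_right.mp ha) _ this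

lemma idealOfVars_pow_le_comap (f : R →+* R') (h : R') :
    (idealOfVars (Fin r) R) ^ b ≤ ((idealOfVars (Fin r) R') ^ b).comap
      (eval₂Hom (MvPolynomial.C.comp f) fun i ↦ MvPolynomial.C h * MvPolynomial.X i) := by
  rw [← Ideal.map_le_iff_le_comap, Ideal.map_pow]
  refine Ideal.pow_right_mono ?_ b
  rw [idealOfVars, Ideal.map_span, Ideal.span_le]
  rintro _ ⟨_, ⟨i, rfl⟩, rfl⟩
  simp only [coe_eval₂Hom, eval₂_X]
  exact Ideal.mul_mem_left _ _ (Ideal.subset_span ⟨i, rfl⟩)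

/-- The map `Σ a_α X^α ↦ Σ f(a_α) (h X)^α`. -/
def scale (f : R →+* R') (h : R') : Trunc r b R →+* Trunc r b R' :=
  Ideal.quotientMap _ (eval₂Hom (MvPolynomial.C.comp f) fun i ↦ MvPolynomial.C h * MvPolynomial.X i)
    (idealOfVars_pow_le_comap f h)

lemma scale_mk (f : R →+* R') (h : R') (p : MvPolynomial (Fin r) R) :
    scale f h (mk r b R p) = mk r b R' (eval₂Hom (MvPolynomial.C.comp f)
      (fun i ↦ MvPolynomial.C h * MvPolynomial.X i) p) := rfl

@[simp] lemma scale_C (f : R →+* R') (h : R') (a : R) :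
    scale f h (C a : Trunc r b R) = C (f a) := by
  simp [scale_mk, C]

@[simp] lemma scale_X (f : R →+* R') (h : R') (i : Fin r) :
    scale f h (X i : Trunc r b R) = C h * X i := by
  simp [scale_mk, X, C]

lemma const_scale (hb : 0 < b) (f : R →+* R') (h : R') (t : Trunc r b R) :
    const hb (scale f h t) = f (const hb t) := by
  obtain ⟨p, rfl⟩ := mk_surjective t
  rw [const_mk]
  simp only [scale_mk, const_mk]
  induction p using MvPolynomial.induction_on with
  | C a => simp
  | add p q hp hq => simp only [map_add, hp, hq]
  | mul_X p i hp => simp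

/-- The factor `h ^ |α|` is the reason why coefficients are divided by the power `b - |α|`, and not
`b`, of the exceptional equation under a blow-up. -/
lemma coeff_scale {α : Fin r →₀ ℕ} (hα : α.degree < b) (f : R →+* R') (h : R')
    (t : Trunc r b R) : coeff α (scale f h t) = h ^ α.degree * f (coeff α t) := by
  classical
  obtain ⟨p, rfl⟩ := mk_surjective t
  rw [coeff_mk hα]
  simp only [scale_mk]
  rw [coeff_mk hα]
  clear hα
  induction p using MvPolynomial.induction_on' with
  | add p q hp hq => simp only [map_add, MvPolynomial.coeff_add, hp, hq, mul_add]
  | monomial β a =>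
    have : (eval₂Hom (MvPolynomial.C.comp f) fun i ↦ MvPolynomial.C h * MvPolynomial.X i)
        (monomial β a) = monomial β (h ^ β.degree * f a) := by
      rw [coe_eval₂Hom, eval₂_monomial, RingHom.comp_apply]
      have h1 : (β.prod fun n e ↦ (MvPolynomial.C h * MvPolynomial.X n : MvPolynomial (Fin r) R') ^ e)
          = MvPolynomial.C (h ^ β.degree) * monomial β 1 := by
        simp only [mul_pow]
        rw [Finsupp.prod_mul, monomial_eq (s := β), map_one, one_mul]
        congr 1
        rw [Finsupp.prod, Finsupp.degree_apply, Finset.prod_pow_eq_pow_sum, map_pow]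
      rw [h1, ← mul_assoc, ← map_mul, C_mul_monomial, mul_one, mul_comm]
    rw [this, coeff_monomial, coeff_monomial]
    split_ifs with hh
    · rw [hh]
    · simp

end Trunc

end Trunc

end Resolution
end

noncomputable section
namespace Resolution

/-! ### Taylor homomorphisms and coefficient ideals of local rings -/

section Taylor

variable {A R : Type*} [CommRing A] [CommRing R]

/-- A ring homomorphism `φ : A → R[X₁, …, Xᵣ] / (X)ᵇ` that expands the elements of `A` in
generators `z` of the kernel of `ρ : A → R`. -/
structure IsTaylorHom {r b : ℕ} (hb : 0 < b) (ρ : A →+* R) (z : Fin r → A)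
    (φ : A →+* Trunc r b R) : Prop where
  surjective : Function.Surjective ρ
  const_eq : ∀ a, Trunc.const hb (φ a) = ρ a
  map_z : ∀ i, φ (z i) = Trunc.X i
  ker_eq : RingHom.ker ρ = Ideal.span (Set.range z)

variable {r b : ℕ} {hb : 0 < b} {ρ : A →+* R} {z : Fin r → A} {φ : A →+* Trunc r b R}

lemma Trunc.mk_eq_sum (p : MvPolynomial (Fin r) R) :
    Trunc.mk r b R p = ∑ α ∈ p.support, Trunc.C (p.coeff α) * ∏ i, Trunc.X i ^ α i := by
  conv_lhs => rw [p.as_sum]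
  rw [map_sum]
  refine Finset.sum_congr rfl fun α _ ↦ ?_
  rw [MvPolynomial.monomial_eq, map_mul, Finsupp.prod_fintype _ _ (by simp), map_prod]
  simp [Trunc.C, Trunc.X]

namespace IsTaylorHom

variable (h : IsTaylorHom hb ρ z φ)

include h

/-- Successive approximation: the constant term is reached through `ρ`, the remainder lies in the
ideal of the `Xᵢ = φ zᵢ`, and the `b`-th power of that ideal is zero. -/
lemma surjective_taylor : Function.Surjective φ := by
  have key : ∀ n : ℕ, ∀ t, ∃ a, t - φ a ∈
      Ideal.span (Set.range (Trunc.X : Fin r → Trunc r b R)) ^ n := by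
    intro n
    induction n with
    | zero => exact fun t ↦ ⟨0, by simp⟩
    | succ n ih =>
      intro t
      obtain ⟨a, ha⟩ := h.surjective (Trunc.const hb t)
      have h1 : Trunc.const hb (t - φ a) = 0 := by rw [map_sub, h.const_eq, ha, sub_self]
      rw [Trunc.mem_ker_const_iff, Ideal.mem_span_range_iff_exists_fun] at h1
      obtain ⟨c, hc⟩ := h1
      choose d hd using fun i ↦ ih (c i)
      refine ⟨a + ∑ i, d i * z i, ?_⟩
      have : t - φ (a + ∑ i, d i * z i) = ∑ i, (c i - φ (d i)) * Trunc.X i := by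
        rw [map_add, ← sub_sub, ← hc, map_sum, ← Finset.sum_sub_distrib]
        simp only [map_mul, h.map_z, sub_mul]
      rw [this, pow_succ]
      exact Ideal.sum_mem _ fun i _ ↦ Ideal.mul_mem_mul (hd i) (Ideal.subset_span ⟨i, rfl⟩)
  intro t
  obtain ⟨a, ha⟩ := key b t
  rw [Trunc.span_X_pow, Ideal.mem_bot, sub_eq_zero] at ha
  exact ⟨a, ha.symm⟩

/-- If `f` lies in `(ker ρ)ⁿ` with `n < b`, it is a form of degree `n` in the `zᵢ`. The coefficients
of `φ f` in degree `n` are the images under `ρ` of the coefficients of the form. When `φ f = 0`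
these vanish, so `f` lies in the next power. -/
lemma ker_le : RingHom.ker φ ≤ RingHom.ker ρ ^ b := by
  intro f hf
  rw [RingHom.mem_ker] at hf
  have key : ∀ n ≤ b, f ∈ RingHom.ker ρ ^ n := by
    intro n
    induction n with
    | zero => simp
    | succ n ih =>
      intro hn
      have h1 := ih (by omega)
      rw [h.ker_eq, Ideal.mem_span_pow_iff_exists_isHomogeneous] at h1
      obtain ⟨G, hG, hGf⟩ := h1
      have hcoef : ∀ α, G.coeff α ∈ RingHom.ker ρ := by
        intro α
        by_cases hα : G.coeff α = 0
        · rw [hα]; exact zero_mem _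
        have hd : α.degree = n := by
          rw [← hG hα, Finsupp.weight_apply, Finsupp.degree_apply, Finsupp.sum]
          simp
        have h2 : Trunc.coeff α (φ f) = 0 := by rw [hf, Trunc.coeff_zero (by omega)]
        have h3 : φ f = ∑ β ∈ G.support, φ (G.coeff β) * ∏ i, Trunc.X i ^ β i := by
          rw [← hGf, MvPolynomial.eval_eq', map_sum]
          refine Finset.sum_congr rfl fun β _ ↦ ?_
          simp [h.map_z]
        -- Both exponents have degree `n`, so the term of index `β` contributes to the coefficient
        -- of index `α` only through its constant part, and only for `β = α`.
        have h4 : ∀ β ∈ G.support, Trunc.coeff α (φ (G.coeff β) * ∏ i, Trunc.X i ^ β i) =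
            if β = α then ρ (G.coeff α) else 0 := by
          intro β hβ
          have hdβ : β.degree = n := by
            rw [← hG (MvPolynomial.mem_support_iff.mp hβ), Finsupp.weight_apply,
              Finsupp.degree_apply, Finsupp.sum]
            simp
          obtain ⟨p, hp⟩ := Trunc.mk_surjective (φ (G.coeff β))
          have h5 : (∏ i, Trunc.X i ^ β i : Trunc r b R) =
              Trunc.mk r b R (MvPolynomial.monomial β 1) := by
            rw [MvPolynomial.monomial_eq, map_mul, Finsupp.prod_fintype _ _ (by simp), map_prod]
            simp [Trunc.X]
          rw [h5, ← hp, ← map_mul, Trunc.coeff_mk (by omega), MvPolynomial.coeff_mul_monomial']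
          have h6 : β ≤ α ↔ β = α := by
            refine ⟨fun hle ↦ ?_, fun e ↦ e.le⟩
            obtain ⟨γ, rfl⟩ := le_iff_exists_add.mp hle
            rw [map_add] at hd
            have : γ = 0 := by rw [← Finsupp.degree_eq_zero_iff]; omega
            simp [this]
          simp only [h6]
          split_ifs with e
          · subst e
            have h7 := h.const_eq (G.coeff β)
            rw [← hp] at h7
            rw [← h7]
            simp [MvPolynomial.constantCoeff_eq]
          · rfl
        rw [h3] at h2
        have h8 : ∀ (s : Finset (Fin r →₀ ℕ)) (g : (Fin r →₀ ℕ) → Trunc r b R),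
            Trunc.coeff α (∑ β ∈ s, g β) = ∑ β ∈ s, Trunc.coeff α (g β) := by
          classical
          intro s g
          induction s using Finset.induction_on with
          | empty => simp [Trunc.coeff_zero (b := b) (R := R) (α := α) (by omega)]
          | insert a s ha ih' =>
            rw [Finset.sum_insert ha, Finset.sum_insert ha, Trunc.coeff_add (by omega), ih']
        rw [h8, Finset.sum_congr rfl h4, Finset.sum_ite_eq' G.support α,
          if_pos (MvPolynomial.mem_support_iff.mpr hα)] at h2
        exact h2
      rw [← hGf, MvPolynomial.eval_eq', pow_succ']
      refine Ideal.sum_mem _ fun β hβ ↦ Ideal.mul_mem_mul (hcoef β) ?_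
      have hdβ : β.degree = n := by
        rw [← hG (MvPolynomial.mem_support_iff.mp hβ), Finsupp.weight_apply,
          Finsupp.degree_apply, Finsupp.sum]
        simp
      rw [← hdβ, Finsupp.degree_eq_sum, ← Finset.prod_pow_eq_pow_sum]
      refine Ideal.prod_mem_prod fun i _ ↦ Ideal.pow_mem_pow ?_ _
      rw [h.ker_eq]
      exact Ideal.subset_span ⟨i, rfl⟩
  exact key b le_rfl

/-- In a product of `c` elements of `M`, each factor contributes to a given coefficient either its
constant term, which lies in `MR`, or at least one unit of degree. At most `|α|` factors are of the
second kind. -/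
lemma coeff_mem_of_mem_pow (M : Ideal A) (c : ℕ) {f : A} (hf : f ∈ M ^ c)
    (α : Fin r →₀ ℕ) (hα : α.degree < b) :
    Trunc.coeff α (φ f) ∈ (M.map ρ) ^ (c - α.degree) := by
  induction c generalizing f α with
  | zero => simp
  | succ c ih =>
    rw [pow_succ] at hf
    induction hf using Submodule.mul_induction_on' with
    | mem_mul_mem g hg m hm =>
      rw [map_mul, Trunc.coeff_mul hα]
      refine Ideal.sum_mem _ fun x hx ↦ ?_
      have hx' : x.1.degree + x.2.degree = α.degree := by
        rw [← map_add, Finset.HasAntidiagonal.mem_antidiagonal.mp hx]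
      have h1 := ih hg x.1 (by omega)
      have h2 : Trunc.coeff x.2 (φ m) ∈ M.map ρ ^ (1 - x.2.degree) := by
        by_cases h0 : x.2 = 0
        · rw [h0, Trunc.coeff_zero_eq_const hb, h.const_eq]
          simpa using Ideal.mem_map_of_mem ρ hm
        · have : x.2.degree ≠ 0 := by rwa [Ne, Finsupp.degree_eq_zero_iff]
          rw [show 1 - x.2.degree = 0 by omega]
          simp
      have h3 := Ideal.mul_mem_mul h1 h2
      rw [← pow_add] at h3
      exact Ideal.pow_le_pow_right (by omega) h3
    | add f g _ _ hf hg => rw [map_add, Trunc.coeff_add hα]; exact add_mem hf hg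

/-- A preimage under `φ` of the constant `ρ m` differs from `m` by an element of `ker ρ ⊆ M`, so it
lies in `M` as well. -/
lemma map_C_le (M : Ideal A) (hM : RingHom.ker ρ ≤ M) :
    (M.map ρ).map (Trunc.C : R →+* Trunc r b R) ≤ M.map φ := by
  rw [Ideal.map_map, Ideal.map_le_iff_le_comap]
  intro m hm
  obtain ⟨a, ha⟩ := h.surjective_taylor (Trunc.C (ρ m))
  rw [Ideal.mem_comap, RingHom.comp_apply, ← ha]
  refine Ideal.mem_map_of_mem _ ?_
  have : a - m ∈ M := hM (by
    rw [RingHom.mem_ker, map_sub, ← h.const_eq, ha, Trunc.const_C, sub_self])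
  simpa using add_mem this hm

/-- For the converse, constants from `MR` and the `Xᵢ` both lie in the image of `M`, so every term
of `φ f` lies in the image of `Mᵇ`. As `φ` is surjective, `f` agrees with an element of `Mᵇ` modulo
`ker φ ⊆ (ker ρ)ᵇ ⊆ Mᵇ`. -/
lemma mem_pow_iff (M : Ideal A) (hM : RingHom.ker ρ ≤ M) (f : A) :
    f ∈ M ^ b ↔ ∀ α : Fin r →₀ ℕ, α.degree < b →
      Trunc.coeff α (φ f) ∈ (M.map ρ) ^ (b - α.degree) := by
  refine ⟨fun hf α hα ↦ h.coeff_mem_of_mem_pow M b hf α hα, fun H ↦ ?_⟩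
  have hC := h.map_C_le M hM
  have hX : ∀ i, (Trunc.X i : Trunc r b R) ∈ M.map φ := fun i ↦ by
    rw [← h.map_z]
    refine Ideal.mem_map_of_mem _ (hM ?_)
    rw [h.ker_eq]
    exact Ideal.subset_span ⟨i, rfl⟩
  have hf : φ f ∈ (M ^ b).map φ := by
    rw [Ideal.map_pow]
    obtain ⟨p, hp⟩ := Trunc.mk_surjective (φ f)
    rw [← hp, Trunc.mk_eq_sum]
    refine Ideal.sum_mem _ fun α _ ↦ ?_
    have hprod : (∏ i, Trunc.X i ^ α i : Trunc r b R) ∈ M.map φ ^ α.degree := by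
      rw [Finsupp.degree_eq_sum, ← Finset.prod_pow_eq_pow_sum]
      exact Ideal.prod_mem_prod fun i _ ↦ Ideal.pow_mem_pow (hX i) _
    by_cases hα : α.degree < b
    · have h1 := H α hα
      rw [← hp, Trunc.coeff_mk hα] at h1
      have h2 := Ideal.mem_map_of_mem (Trunc.C : R →+* Trunc r b R) h1
      rw [Ideal.map_pow] at h2
      have h3 := Ideal.mul_mem_mul (Ideal.pow_right_mono hC _ h2) hprod
      rw [← pow_add] at h3
      exact Ideal.pow_le_pow_right (by omega) h3
    · exact Ideal.mul_mem_left _ _ (Ideal.pow_le_pow_right (by omega) hprod)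
  rw [Ideal.mem_map_iff_of_surjective _ h.surjective_taylor] at hf
  obtain ⟨g, hg, hgf⟩ := hf
  have h1 : f - g ∈ M ^ b := Ideal.pow_right_mono hM b (h.ker_le (by
    rw [RingHom.mem_ker, map_sub, hgf, sub_self]))
  simpa using add_mem h1 hg

end IsTaylorHom

/-- `K` is a coefficient ideal of `J`, with respect to `b`, along the surjection `ρ : A → R`. -/
def IsCoeffAt (b : ℕ) (ρ : A →+* R) (J : Ideal A) (K : Ideal R) : Prop :=
  ∃ (hb : 0 < b) (r : ℕ) (z : Fin r → A) (φ : A →+* Trunc r b R), IsTaylorHom hb ρ z φ ∧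
    ∃ F : Set A, J = Ideal.span F ∧
      K = Ideal.span {g | ∃ f ∈ F, ∃ α : Fin r →₀ ℕ, α.degree < b ∧
        g = Trunc.coeff α (φ f) ^ (b.factorial / (b - α.degree))}

lemma factorial_div_mul {b d : ℕ} (hd : d < b) : b.factorial / (b - d) * (b - d) = b.factorial :=
  Nat.div_mul_cancel (Nat.dvd_factorial (by omega) (by omega))

lemma factorial_div_pos {b d : ℕ} (hd : d < b) : 0 < b.factorial / (b - d) :=
  Nat.div_pos ((Nat.sub_le b d).trans (Nat.self_le_factorial b)) (by omega)

/-- The conditions of weight `b - |α|` on the coefficients are brought to the common weight `b!` by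
the exponents of the coefficient ideal. The hypothesis `hpow` removes these exponents again. -/
lemma IsCoeffAt.le_pow_iff {b : ℕ} {ρ : A →+* R} {J : Ideal A} {K : Ideal R}
    (h : IsCoeffAt b ρ J K) (M : Ideal A) (hM : RingHom.ker ρ ≤ M)
    (hpow : ∀ (a : R) (e c : ℕ), 0 < e → a ^ e ∈ (M.map ρ) ^ (e * c) → a ∈ (M.map ρ) ^ c) :
    J ≤ M ^ b ↔ K ≤ (M.map ρ) ^ b.factorial := by
  obtain ⟨hb, r, z, φ, hφ, F, rfl, rfl⟩ := h
  rw [Ideal.span_le, Ideal.span_le]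
  constructor
  · rintro H _ ⟨f, hf, α, hα, rfl⟩
    have h1 := (hφ.mem_pow_iff M hM f).mp (H hf) α hα
    have h2 := Ideal.pow_mem_pow h1 (b.factorial / (b - α.degree))
    rwa [← pow_mul, mul_comm, factorial_div_mul hα] at h2
  · intro H f hf
    refine (hφ.mem_pow_iff M hM f).mpr fun α hα ↦ ?_
    refine hpow _ _ _ (factorial_div_pos hα) ?_
    rw [factorial_div_mul hα]
    exact H ⟨f, hf, α, hα, rfl⟩

end Taylor

end Resolution
end

noncomputable section
namespace Resolution

/-! ### Principal ideals -/

section Principal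

variable {A B : Type*} [CommRing A] [CommRing B]

lemma span_singleton_mul_cancel {a : A} (ha : a ∈ nonZeroDivisors A) {I J : Ideal A}
    (h : Ideal.span {a} * I = Ideal.span {a} * J) : I = J := by
  have key : ∀ I J : Ideal A, Ideal.span {a} * I ≤ Ideal.span {a} * J → I ≤ J := by
    intro I J h x hx
    have := h (Ideal.mul_mem_mul (Ideal.mem_span_singleton_self a) hx)
    obtain ⟨y, hy, e⟩ := Ideal.mem_span_singleton_mul.mp this
    rwa [← (mul_cancel_left_mem_nonZeroDivisors ha).mp e]
  exact le_antisymm (key _ _ h.le) (key _ _ h.ge)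

/-- Otherwise all images are non-unit multiples of `e`, so `e` lies in `e` times the maximal ideal,
which is absurd for a nonzerodivisor. This yields local equations of the exceptional divisor that
come from the center. -/
lemma exists_mem_span_singleton_eq [IsLocalRing B] (f : A →+* B) (I : Ideal A) {e : B}
    (he : e ∈ nonZeroDivisors B) (h : I.map f = Ideal.span {e}) :
    ∃ a ∈ I, Ideal.span {f a} = Ideal.span {e} := by
  by_contra! H
  have h1 : I.map f ≤ Ideal.span {e} * IsLocalRing.maximalIdeal B := by
    rw [Ideal.map_le_iff_le_comap]
    intro a ha
    have h2 : f a ∈ Ideal.span {e} := h ▸ Ideal.mem_map_of_mem f ha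
    obtain ⟨c, hc⟩ := Ideal.mem_span_singleton'.mp h2
    rw [Ideal.mem_comap, ← hc, mul_comm c]
    refine Ideal.mul_mem_mul (Ideal.mem_span_singleton_self e) ?_
    rw [IsLocalRing.mem_maximalIdeal, mem_nonunits_iff]
    intro hu
    refine H a ha ?_
    rw [← hc]
    exact Ideal.span_singleton_mul_left_unit hu e
  rw [h] at h1
  obtain ⟨m, hm, hme⟩ := Ideal.mem_span_singleton_mul.mp (h1 (Ideal.mem_span_singleton_self e))
  have : m = 1 := (mul_cancel_left_mem_nonZeroDivisors he).mp (by rw [hme, mul_one])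
  rw [this] at hm
  exact (IsLocalRing.maximalIdeal.isMaximal B).ne_top (Ideal.eq_top_of_isUnit_mem _ hm isUnit_one)

lemma mem_nonZeroDivisors_of_span_eq {a b : A} (hb : b ∈ nonZeroDivisors A)
    (h : Ideal.span {a} = Ideal.span {b}) : a ∈ nonZeroDivisors A := by
  obtain ⟨c, hc⟩ := Ideal.mem_span_singleton'.mp (h ▸ Ideal.mem_span_singleton_self b :
    b ∈ Ideal.span {a})
  rw [← hc] at hb
  exact (mul_mem_nonZeroDivisors.mp hb).2

end Principal

/-! ### The local algebra of a blow-up -/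

section LocalBlowup

/-- The lifting property of the local ring `A'` of a blow-up of the local ring `A` along the ideal
`Y`, with respect to a homomorphism `ρ' : A' → R'`. -/
def HasBlowupLift {A A' R' : Type u} [CommRing A] [CommRing A'] [CommRing R']
    (π : A →+* A') (ρ' : A' →+* R') (Y : Ideal A) : Prop :=
  ∀ {S : Type u} [CommRing S] [IsLocalRing S] (ψ : A →+* S) (c : S →+* R') [IsLocalHom c] (s : S),
    c.comp ψ = ρ'.comp π → s ∈ nonZeroDivisors S → c s ∈ nonZeroDivisors R' →
    Y.map ψ = Ideal.span {s} → ∃ φ : A' →+* S, φ.comp π = ψ ∧ c.comp φ = ρ'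

variable {A A' R R' : Type u} [CommRing A] [CommRing A'] [CommRing R] [CommRing R']

/-- The Taylor homomorphism of the strict transform is the extension to `A'` of `φ` followed by `X ↦
qX`. The substitution gives every term of positive degree a factor `q`, so the center becomes
principal in `Trunc` and `hlift` applies. The new equations are `z' = z / p`. -/
lemma IsTaylorHom.exists_blowup [IsLocalRing A'] [IsLocalRing R'] {r b : ℕ} {hb : 0 < b} {z : Fin r → A} {ρ : A →+* R} {ρ' : A' →+* R'}
    {π : A →+* A'} {π' : R →+* R'} {φ : A →+* Trunc r b R}
    {Y : Ideal A} (hφ : IsTaylorHom hb ρ z φ) [IsLocalHom ρ'] (hρ' : Function.Surjective ρ')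
    (hcomm : ρ'.comp π = π'.comp ρ) (hY : RingHom.ker ρ ≤ Y)
    (hlift : HasBlowupLift π ρ' Y)
    {e : A'} (he : e ∈ nonZeroDivisors A') (he' : ρ' e ∈ nonZeroDivisors R')
    (hYe : Y.map π = Ideal.span {e})
    (hstrict : Y.map π * RingHom.ker ρ' = (RingHom.ker ρ).map π) :
    ∃ p ∈ nonZeroDivisors A', ρ' p ∈ nonZeroDivisors R' ∧ Y.map π = Ideal.span {p} ∧
      ∃ (z' : Fin r → A') (φ' : A' →+* Trunc r b R'), IsTaylorHom hb ρ' z' φ' ∧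
        (∀ a, φ' (π a) = Trunc.scale π' (ρ' p) (φ a)) ∧ φ' p = Trunc.C (ρ' p) := by
  have hcomm' : ∀ a, ρ' (π a) = π' (ρ a) := fun a ↦ congr($hcomm a)
  have hYR : Y.map (π'.comp ρ) = Ideal.span {ρ' e} := by
    rw [← hcomm, ← Ideal.map_map, hYe, Ideal.map_span, Set.image_singleton]
  obtain ⟨y, hy, hye⟩ := exists_mem_span_singleton_eq _ _ he' hYR
  -- Replace `y` by an element `g` with the same restriction and with constant Taylor expansion.
  -- Then `φ'` maps the exceptional equation `p = π g` to a constant, and no higher terms disturb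
  -- the comparison of coefficients.
  obtain ⟨g, hg⟩ := hφ.surjective_taylor (Trunc.C (ρ y))
  have hρg : ρ g = ρ y := by rw [← hφ.const_eq, hg, Trunc.const_C]
  have hgY : g ∈ Y := by
    have : g - y ∈ Y := hY (by rw [RingHom.mem_ker, map_sub, hρg, sub_self])
    simpa using add_mem this hy
  have hπg : ρ' (π g) = π' (ρ y) := by rw [hcomm', hρg]
  rw [RingHom.comp_apply, ← hπg] at hye
  -- `π g` generates the exceptional ideal
  have hge : Ideal.span {π g} = Ideal.span {e} := by
    have h1 : π g ∈ Ideal.span {e} := hYe ▸ Ideal.mem_map_of_mem π hgY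
    obtain ⟨v, hv⟩ := Ideal.mem_span_singleton'.mp h1
    have h2 : ρ' e ∈ Ideal.span {ρ' (π g)} := hye ▸ Ideal.mem_span_singleton_self _
    obtain ⟨w, hw⟩ := Ideal.mem_span_singleton'.mp h2
    rw [← hv, map_mul, ← mul_assoc] at hw
    have h3 : w * ρ' v = 1 := (mul_cancel_right_mem_nonZeroDivisors he').mp (by rw [hw, one_mul])
    have h4 : IsUnit v := IsUnit.of_map ρ' v (IsUnit.of_mul_eq_one w (by rw [mul_comm, h3]))
    rw [← hv]
    exact Ideal.span_singleton_mul_left_unit h4 e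
  have hg0 := mem_nonZeroDivisors_of_span_eq he hge
  have hg0' := mem_nonZeroDivisors_of_span_eq he' hye
  rw [← hge] at hYe
  rw [← hye] at hYR
  clear hge hye he he'
  set p := π g with hp
  set q := ρ' p with hq
  let ψ : A →+* Trunc r b R' := (Trunc.scale π' q).comp φ
  have hψ : ∀ a, ψ a = Trunc.scale π' q (φ a) := fun _ ↦ rfl
  have := Trunc.isLocalRing (r := r) (R := R') hb
  have hψg : ψ g = Trunc.C q := by rw [hψ, hg, Trunc.scale_C, hπg]
  have hψY : Y.map ψ = Ideal.span {Trunc.C q} := by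
    refine le_antisymm ?_ ?_
    · rw [Ideal.map_le_iff_le_comap]
      intro a ha
      have h1 : ρ' (π a) ∈ Ideal.span {q} := by
        rw [← hYR, ← hcomm]; exact Ideal.mem_map_of_mem _ ha
      obtain ⟨c, hc⟩ := Ideal.mem_span_singleton'.mp h1
      -- The constant part of `φ a` is `ρ a`, whose image is divisible by `q` since `a ∈ Y`; the
      -- remaining part lies in the ideal of the `Xᵢ` and becomes divisible by `q` through the
      -- scaling.
      have h2 : φ a - Trunc.C (ρ a) ∈ Ideal.span (Set.range (Trunc.X : Fin r → Trunc r b R)) := by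
        rw [← Trunc.mem_ker_const_iff hb, map_sub, hφ.const_eq, Trunc.const_C, sub_self]
      obtain ⟨d, hd⟩ := Ideal.mem_span_range_iff_exists_fun.mp h2
      rw [Ideal.mem_comap, hψ, ← sub_add_cancel (φ a) (Trunc.C (ρ a)), ← hd, map_add, map_sum]
      refine add_mem (Ideal.sum_mem _ fun i _ ↦ ?_) ?_
      · rw [map_mul, Trunc.scale_X]
        exact Ideal.mul_mem_left _ _ (Ideal.mul_mem_right _ _ (Ideal.mem_span_singleton_self _))
      · rw [Trunc.scale_C, ← hcomm', ← hc, map_mul]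
        exact Ideal.mul_mem_left _ _ (Ideal.mem_span_singleton_self _)
    · rw [Ideal.span_singleton_le_iff_mem, ← hψg]
      exact Ideal.mem_map_of_mem _ hgY
  obtain ⟨φ', h1, h2⟩ := hlift ψ (Trunc.const hb) (Trunc.C q)
    (RingHom.ext fun a ↦ by
      rw [RingHom.comp_apply, hψ, Trunc.const_scale, hφ.const_eq, RingHom.comp_apply, hcomm'])
    (Trunc.C_mem_nonZeroDivisors hg0') (by rwa [Trunc.const_C]) hψY
  have hφ'π : ∀ a, φ' (π a) = Trunc.scale π' q (φ a) := fun a ↦ congr($h1 a)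
  have hφ'p : φ' p = Trunc.C q := by rw [hp, hφ'π, ← hψ, hψg]
  have hz : ∀ i, ∃ z', z' * p = π (z i) := fun i ↦ by
    rw [← Ideal.mem_span_singleton', ← hYe]
    refine Ideal.mem_map_of_mem _ (hY ?_)
    rw [hφ.ker_eq]
    exact Ideal.subset_span ⟨i, rfl⟩
  choose z' hz' using hz
  have hCq := Trunc.C_mem_nonZeroDivisors (r := r) (b := b) hg0'
  refine ⟨p, hg0, hg0', hYe, z', φ', ⟨hρ', fun a ↦ congr($h2 a), fun i ↦ ?_, ?_⟩, hφ'π, hφ'p⟩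
  · have h3 : φ' (z' i) * Trunc.C q = Trunc.X i * Trunc.C q := by
      calc φ' (z' i) * Trunc.C q = φ' (z' i) * φ' p := by rw [hφ'p]
        _ = Trunc.scale π' q (φ (z i)) := by rw [← map_mul φ', hz', hφ'π]
        _ = Trunc.X i * Trunc.C q := by rw [hφ.map_z, Trunc.scale_X, mul_comm]
    have h4 : (φ' (z' i) - Trunc.X i) * Trunc.C q = 0 := by rw [sub_mul, h3, sub_self]
    exact sub_eq_zero.mp ((mem_nonZeroDivisors_iff_right.mp hCq) _ h4)
  -- The kernel of `ρ'` is found by cancelling `p`: the ideal `p · ker ρ'` is generated by the `π zᵢ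
  -- = p z'ᵢ`.
  · refine span_singleton_mul_cancel hg0 ?_
    rw [← hYe, hstrict, hφ.ker_eq, hYe, Ideal.map_span, ← Set.range_comp]
    refine le_antisymm (Ideal.span_le.mpr ?_) (Ideal.mul_le.mpr ?_)
    · rintro _ ⟨i, rfl⟩
      have hi : z' i ∈ Ideal.span (Set.range z') := Ideal.subset_span ⟨i, rfl⟩
      have h3 := Ideal.mul_mem_mul (Ideal.mem_span_singleton_self p) hi
      rw [mul_comm p, hz'] at h3
      exact h3
    · intro a ha c hc
      obtain ⟨d, rfl⟩ := Ideal.mem_span_singleton'.mp ha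
      rw [mul_assoc]
      refine Ideal.mul_mem_left _ _ ?_
      obtain ⟨d, rfl⟩ := Ideal.mem_span_range_iff_exists_fun.mp hc
      rw [Finset.mul_sum]
      refine Ideal.sum_mem _ fun i _ ↦ ?_
      rw [mul_left_comm]
      refine Ideal.mul_mem_left _ _ (Ideal.subset_span ⟨i, ?_⟩)
      rw [Function.comp_apply, ← hz', mul_comm]

/-- If `π f = pᵇ f'` and `q = ρ' p`, comparison of coefficients gives `q^|α| π'(c_α f) = qᵇ c_α f'`,
hence `π'(c_α f) = q^(b - |α|) c_α f'`. After raising to the power `b!/(b - |α|)` the factor is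
`q^(b!)` for every `α`. -/
lemma IsCoeffAt.blowup [IsLocalRing A'] [IsLocalRing R'] {b : ℕ} {ρ : A →+* R} {ρ' : A' →+* R'}
    {π : A →+* A'} {π' : R →+* R'} {J : Ideal A} {K : Ideal R} {J' : Ideal A'} {K' : Ideal R'}
    {Y : Ideal A} (h : IsCoeffAt b ρ J K) [IsLocalHom ρ'] (hρ' : Function.Surjective ρ')
    (hcomm : ρ'.comp π = π'.comp ρ) (hY : RingHom.ker ρ ≤ Y)
    (hlift : HasBlowupLift π ρ' Y)
    {e : A'} (he : e ∈ nonZeroDivisors A') (he' : ρ' e ∈ nonZeroDivisors R')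
    (hYe : Y.map π = Ideal.span {e})
    (hstrict : Y.map π * RingHom.ker ρ' = (RingHom.ker ρ).map π)
    (hJ : J.map π = Y.map π ^ b * J')
    (hK : K.map π' = (Y.map ρ).map π' ^ b.factorial * K') :
    IsCoeffAt b ρ' J' K' := by
  obtain ⟨hb, r, z, φ, hφ, F, rfl, rfl⟩ := h
  obtain ⟨p, hg0, hg0', hYe, z', φ', hφ', hφ'π, hφ'p⟩ :=
    hφ.exists_blowup hρ' hcomm hY hlift he he' hYe hstrict
  have hYR : Y.map (π'.comp ρ) = Ideal.span {ρ' p} := by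
    rw [← hcomm, ← Ideal.map_map, hYe, Ideal.map_span, Set.image_singleton]
  refine ⟨hb, r, z', φ', hφ', {f' | ∃ f ∈ F, π f = p ^ b * f'}, ?_, ?_⟩
  · have hpb := pow_mem hg0 b
    have hF : ∀ f ∈ F, ∃ f', π f = p ^ b * f' := fun f hf ↦ by
      have : π f ∈ (Ideal.span F).map π := Ideal.mem_map_of_mem _ (Ideal.subset_span hf)
      rw [hJ, hYe, Ideal.span_singleton_pow] at this
      obtain ⟨f', _, e⟩ := Ideal.mem_span_singleton_mul.mp this
      exact ⟨f', e.symm⟩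
    refine span_singleton_mul_cancel hpb ?_
    rw [← Ideal.span_singleton_pow, ← hYe, ← hJ, hYe, Ideal.map_span, Ideal.span_singleton_pow]
    refine le_antisymm (Ideal.span_le.mpr ?_) ?_
    · rintro _ ⟨f, hf, rfl⟩
      obtain ⟨f', e⟩ := hF f hf
      rw [e]
      exact Ideal.mul_mem_mul (Ideal.mem_span_singleton_self _) (Ideal.subset_span ⟨f, hf, e⟩)
    · rw [Ideal.span_mul_span', Ideal.span_le]
      rintro _ ⟨_, rfl, f', ⟨f, hf, e⟩, rfl⟩
      exact Ideal.subset_span ⟨f, hf, e⟩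
  · have hpb := pow_mem hg0' b.factorial
    have hF : ∀ f ∈ F, ∃ f', π f = p ^ b * f' := fun f hf ↦ by
      have : π f ∈ (Ideal.span F).map π := Ideal.mem_map_of_mem _ (Ideal.subset_span hf)
      rw [hJ, hYe, Ideal.span_singleton_pow] at this
      obtain ⟨f', _, e⟩ := Ideal.mem_span_singleton_mul.mp this
      exact ⟨f', e.symm⟩
    have hcoef : ∀ f f', π f = p ^ b * f' → ∀ α : Fin r →₀ ℕ, α.degree < b →
        π' (Trunc.coeff α (φ f) ^ (b.factorial / (b - α.degree))) =
          ρ' p ^ b.factorial * Trunc.coeff α (φ' f') ^ (b.factorial / (b - α.degree)) := by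
      intro f f' e α hα
      have h3 := congr_arg (fun x ↦ Trunc.coeff α (φ' x)) e
      simp only [hφ'π, map_mul, map_pow, hφ'p] at h3
      rw [Trunc.coeff_scale hα, ← map_pow Trunc.C, Trunc.coeff_C_mul hα,
        show ρ' p ^ b = ρ' p ^ α.degree * ρ' p ^ (b - α.degree) by rw [← pow_add]; congr 1; omega,
        mul_assoc, mul_cancel_left_mem_nonZeroDivisors (pow_mem hg0' _)] at h3
      rw [map_pow, h3, mul_pow, ← pow_mul, mul_comm (b - α.degree), factorial_div_mul hα]
    rw [Ideal.map_map, hYR, Ideal.span_singleton_pow] at hK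
    refine span_singleton_mul_cancel hpb ?_
    rw [← hK, Ideal.map_span]
    refine le_antisymm (Ideal.span_le.mpr ?_) ?_
    · rintro _ ⟨_, ⟨f, hf, α, hα, rfl⟩, rfl⟩
      obtain ⟨f', e⟩ := hF f hf
      rw [hcoef f f' e α hα]
      exact Ideal.mul_mem_mul (Ideal.mem_span_singleton_self _)
        (Ideal.subset_span ⟨f', ⟨f, hf, e⟩, α, hα, rfl⟩)
    · rw [Ideal.span_mul_span', Ideal.span_le]
      rintro _ ⟨_, rfl, _, ⟨f', ⟨f, hf, e⟩, α, hα, rfl⟩, rfl⟩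
      refine Ideal.subset_span ⟨_, ⟨f, hf, α, hα, rfl⟩, ?_⟩
      exact hcoef f f' e α hα

end LocalBlowup

end Resolution
end

noncomputable section
namespace Resolution

/-! ### Ideals generated by derivatives -/

section Derivatives

variable {A : Type*} [CommRing A]

/-- The ideal generated by `J` and the derivatives of the elements of `J`. -/
def diffIdeal (K : Type*) [CommRing K] [Algebra K A] (J : Ideal A) : Ideal A :=
  J ⊔ Ideal.span {g | ∃ (D : Derivation K A A), ∃ f ∈ J, g = D f}

variable {K : Type*} [CommRing K] [Algebra K A]

lemma le_diffIdeal (J : Ideal A) : J ≤ diffIdeal K J := le_sup_left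

lemma deriv_mem_diffIdeal (D : Derivation K A A) {J : Ideal A} {f : A} (hf : f ∈ J) :
    D f ∈ diffIdeal K J := Ideal.mem_sup_right (Ideal.subset_span ⟨D, f, hf, rfl⟩)

lemma diffIdeal_le_iff {J I : Ideal A} : diffIdeal K J ≤ I ↔
    J ≤ I ∧ ∀ (D : Derivation K A A), ∀ f ∈ J, D f ∈ I := by
  rw [diffIdeal, sup_le_iff, Ideal.span_le]
  refine and_congr_right fun _ ↦ ⟨fun h D f hf ↦ h ⟨D, f, hf, rfl⟩, ?_⟩
  rintro h _ ⟨D, f, hf, rfl⟩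
  exact h D f hf

lemma diffIdeal_mono {J J' : Ideal A} (h : J ≤ J') : diffIdeal K J ≤ diffIdeal K J' :=
  diffIdeal_le_iff.mpr ⟨h.trans (le_diffIdeal _), fun D _ hf ↦ deriv_mem_diffIdeal D (h hf)⟩

lemma deriv_mem_pow (D : Derivation K A A) (I : Ideal A) (n : ℕ) {f : A} (hf : f ∈ I ^ (n + 1)) :
    D f ∈ I ^ n := by
  induction n generalizing f with
  | zero => simp
  | succ n ih =>
    rw [pow_succ] at hf
    induction hf using Submodule.mul_induction_on' with
    | mem_mul_mem g hg y hy =>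
      rw [D.leibniz, smul_eq_mul, smul_eq_mul]
      refine add_mem (Ideal.mul_mem_right _ _ hg) ?_
      rw [pow_succ']
      exact Ideal.mul_mem_mul hy (ih hg)
    | add f g _ _ hf hg => rw [map_add]; exact add_mem hf hg

/-- A derivation lowers the exponent of a symbolic power of a prime by at most one. It serves both
for closed or non-closed points of the singular locus, with `q` maximal, and for smooth centers,
with `q` the ideal of the center. -/
lemma diffIdeal_iterate_le_of_symbolic {q : Ideal A} [q.IsPrime] (n : ℕ) {J : Ideal A}
    (h : ∀ f ∈ J, ∃ s ∉ q, s * f ∈ q ^ (n + 1)) : (diffIdeal K)^[n] J ≤ q := by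
  induction n generalizing J with
  | zero =>
    intro f hf
    obtain ⟨s, hs, hsf⟩ := h f hf
    rw [zero_add, pow_one] at hsf
    exact (Ideal.IsPrime.mem_or_mem inferInstance hsf).resolve_left hs
  | succ n ih =>
    rw [Function.iterate_succ_apply]
    let Q : Ideal A :=
      { carrier := {f | ∃ s ∉ q, s * f ∈ q ^ (n + 1)}
        zero_mem' := ⟨1, (Ideal.ne_top_iff_one q).mp (Ideal.IsPrime.ne_top inferInstance), by simp⟩
        add_mem' := by
          rintro f g ⟨s, hs, hsf⟩ ⟨t, ht, htg⟩
          refine ⟨s * t, fun h ↦ (Ideal.IsPrime.mem_or_mem inferInstance h).elim hs ht, ?_⟩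
          rw [mul_add]
          refine add_mem ?_ ?_
          · rw [mul_right_comm]; exact Ideal.mul_mem_right _ _ hsf
          · rw [mul_assoc]; exact Ideal.mul_mem_left _ _ htg
        smul_mem' := by
          rintro c f ⟨s, hs, hsf⟩
          refine ⟨s, hs, ?_⟩
          rw [smul_eq_mul, mul_left_comm]
          exact Ideal.mul_mem_left _ _ hsf }
    have key : diffIdeal K J ≤ Q := by
      refine diffIdeal_le_iff.mpr ⟨fun f hf ↦ ?_, fun D f hf ↦ ?_⟩
      · obtain ⟨s, hs, hsf⟩ := h f hf
        exact ⟨s, hs, Ideal.pow_le_pow_right (by omega) hsf⟩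
      · obtain ⟨s, hs, hsf⟩ := h f hf
        refine ⟨s * s, fun h ↦ (Ideal.IsPrime.mem_or_mem inferInstance h).elim hs hs, ?_⟩
        -- A second factor `s` is needed because `D (s * f)` produces, besides `s * D f`, the term
        -- `f * D s`.
        have e : s * s * D f = s * D (s * f) - (s * f) * D s := by
          rw [D.leibniz, smul_eq_mul, smul_eq_mul]; ring
        rw [e]
        exact sub_mem (Ideal.mul_mem_left _ _ (deriv_mem_pow D q _ hsf))
          (Ideal.mul_mem_right _ _ (Ideal.pow_le_pow_right (by omega) hsf))
    exact ih fun f hf ↦ key hf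

/-! ### Dual derivations -/

variable {ι : Type*} [Fintype ι] [DecidableEq ι] {x : ι → A} {D : ι → Derivation K A A}

/-- Euler's formula: `∑ xᵢ Dᵢ` acts on `Iⁿ / Iⁿ⁺¹` as multiplication by `n`, where `I` is generated
by the `xᵢ`. -/
lemma euler_mem (hD : ∀ i j, D i (x j) = if i = j then 1 else 0) (n : ℕ) {f : A}
    (hf : f ∈ Ideal.span (Set.range x) ^ n) :
    ∑ i, x i * D i f - n * f ∈ Ideal.span (Set.range x) ^ (n + 1) := by
  have hx : ∀ i, x i ∈ Ideal.span (Set.range x) := fun i ↦ Ideal.subset_span ⟨i, rfl⟩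
  have h1 : ∀ f, ∑ i, x i * D i f ∈ Ideal.span (Set.range x) := fun f ↦
    Ideal.sum_mem _ fun i _ ↦ Ideal.mul_mem_right _ _ (hx i)
  have hmul : ∀ f g, ∑ i, x i * D i (f * g) =
      f * ∑ i, x i * D i g + g * ∑ i, x i * D i f := fun f g ↦ by
    rw [Finset.mul_sum, Finset.mul_sum, ← Finset.sum_add_distrib]
    refine Finset.sum_congr rfl fun i _ ↦ ?_
    rw [Derivation.leibniz, smul_eq_mul, smul_eq_mul]; ring
  have hadd : ∀ f g, ∑ i, x i * D i (f + g) = ∑ i, x i * D i f + ∑ i, x i * D i g :=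
    fun f g ↦ by simp only [map_add, mul_add, Finset.sum_add_distrib]
  induction n generalizing f with
  | zero => simpa using h1 f
  | succ n ih =>
    rw [pow_succ] at hf
    induction hf using Submodule.mul_induction_on' with
    | mem_mul_mem g hg y hy =>
      have h2 : ∑ i, x i * D i y - y ∈ Ideal.span (Set.range x) ^ 2 := by
        induction hy using Submodule.span_induction with
        | zero => simp
        | mem y hy =>
          obtain ⟨j, rfl⟩ := hy
          simp [hD]
        | add y y' _ _ hy hy' =>
          rw [hadd, add_sub_add_comm]
          exact add_mem hy hy'
        | smul c y hy' hy =>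
          rw [smul_eq_mul, hmul, show c * ∑ i, x i * D i y + y * ∑ i, x i * D i c - c * y =
            c * (∑ i, x i * D i y - y) + y * ∑ i, x i * D i c by ring]
          refine add_mem (Ideal.mul_mem_left _ _ hy) ?_
          rw [pow_two]
          exact Ideal.mul_mem_mul hy' (h1 c)
      rw [hmul, show g * ∑ i, x i * D i y + y * ∑ i, x i * D i g - ((n + 1 : ℕ) : A) * (g * y) =
        g * (∑ i, x i * D i y - y) + (∑ i, x i * D i g - n * g) * y by push_cast; ring]
      refine add_mem ?_ ?_
      · have := Ideal.mul_mem_mul hg h2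
        rwa [← pow_add] at this
      · have := Ideal.mul_mem_mul (ih hg) hy
        rwa [← pow_succ] at this
    | add f g _ _ hf hg =>
      rw [hadd, mul_add, add_sub_add_comm]
      exact add_mem hf hg

/-- By induction `f` and its derivatives lie in `Iⁿ⁺¹`, so Euler's operator maps `f` into `Iⁿ⁺²`. As
it also acts as multiplication by `n + 1` modulo `Iⁿ⁺²`, invertibility of `n + 1` gives `f ∈ Iⁿ⁺²`.
-/
lemma le_pow_of_diffIdeal_iterate_le (hD : ∀ i j, D i (x j) = if i = j then 1 else 0)
    (hA : ∀ n : ℕ, n ≠ 0 → IsUnit (n : A)) (n : ℕ) {J : Ideal A}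
    (h : (diffIdeal K)^[n] J ≤ Ideal.span (Set.range x)) : J ≤ Ideal.span (Set.range x) ^ (n + 1) := by
  induction n generalizing J with
  | zero => simpa using h
  | succ n ih =>
    rw [Function.iterate_succ_apply] at h
    obtain ⟨h1, h2⟩ := diffIdeal_le_iff.mp (ih h)
    intro f hf
    have h3 := euler_mem hD (n + 1) (h1 hf)
    have h4 : ∑ i, x i * D i f ∈ Ideal.span (Set.range x) ^ (n + 1 + 1) := by
      refine Ideal.sum_mem _ fun i _ ↦ ?_
      rw [pow_succ']
      exact Ideal.mul_mem_mul (Ideal.subset_span ⟨i, rfl⟩) (h2 _ f hf)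
    have h5 := sub_mem h4 h3
    rw [sub_sub_cancel] at h5
    exact (Ideal.unit_mul_mem_iff_mem _ (hA (n + 1) (by omega))).mp h5

-- By the chain rule the difference is what comes from differentiating the coefficients of `P`,
-- hence a form of degree `d` in the `xᵢ`.
open MvPolynomial in
lemma deriv_eval_sub_mem (δ : Derivation K A A) (x : ι → A) {d : ℕ} {P : MvPolynomial ι A}
    (hP : P.IsHomogeneous d) :
    δ (eval x P) - ∑ j, eval x (pderiv j P) * δ (x j) ∈ Ideal.span (Set.range x) ^ d := by
  have hxm : ∀ i, x i ∈ Ideal.span (Set.range x) := fun i ↦ Ideal.subset_span ⟨i, rfl⟩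
  let E : MvPolynomial ι A → A := fun P ↦ δ (eval x P) - ∑ j, eval x (pderiv j P) * δ (x j)
  have hmul : ∀ P Q, E (P * Q) = eval x P * E Q + eval x Q * E P := fun P Q ↦ by
    simp only [E, map_mul, Derivation.leibniz, smul_eq_mul, map_add, mul_sub, Finset.mul_sum,
      add_mul, Finset.sum_add_distrib, mul_assoc]
    ring
  have hadd : ∀ P Q, E (P + Q) = E P + E Q := fun P Q ↦ by
    simp only [E, map_add, add_mul, Finset.sum_add_distrib]; ring
  have h0 : E 0 = 0 := by simp [E]
  let M : Submonoid (MvPolynomial ι A) :=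
    { carrier := {P | E P = 0}
      one_mem' := by simp [E]
      mul_mem' := fun {P Q} (hP : E P = 0) (hQ : E Q = 0) ↦ by
        change E (P * Q) = 0
        rw [hmul, hP, hQ]; simp }
  have hX : ∀ i, MvPolynomial.X i ∈ M := fun i ↦ by
    change δ _ - ∑ j, _ = 0
    simp [pderiv_X, Pi.single_apply, apply_ite (eval x)]
  change E P ∈ _
  have hsum : ∀ (s : Finset (ι →₀ ℕ)) (g : (ι →₀ ℕ) → MvPolynomial ι A),
      E (∑ β ∈ s, g β) = ∑ β ∈ s, E (g β) := fun s g ↦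
    map_sum (⟨⟨E, h0⟩, hadd⟩ : MvPolynomial ι A →+ A) g s
  rw [P.as_sum, hsum]
  refine Ideal.sum_mem _ fun β hβ ↦ ?_
  have hm : (monomial β 1 : MvPolynomial ι A) ∈ M := by
    rw [monomial_eq, map_one, one_mul]
    exact M.prod_mem fun i _ ↦ pow_mem (hX i) _
  have hd : β.degree = d := by
    rw [← hP (mem_support_iff.mp hβ), Finsupp.weight_apply, Finsupp.degree_apply, Finsupp.sum]
    simp
  rw [show (monomial β (P.coeff β)) = C (P.coeff β) * monomial β 1 by rw [C_mul_monomial, mul_one],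
    hmul, show E (monomial β 1) = 0 from hm, mul_zero, zero_add]
  refine Ideal.mul_mem_right _ _ ?_
  rw [eval_monomial, one_mul, ← hd, Finsupp.prod, Finsupp.degree_apply,
    ← Finset.prod_pow_eq_pow_sum]
  exact Ideal.prod_mem_prod fun i _ ↦ Ideal.pow_mem_pow (hxm i) _

open MvPolynomial in
/-- Elements with dual derivations are quasi-regular. -/
lemma coeff_mem_of_eval_mem_pow (hD : ∀ i j, D i (x j) = if i = j then 1 else 0)
    (hA : ∀ n : ℕ, n ≠ 0 → IsUnit (n : A)) {d : ℕ} {P : MvPolynomial ι A}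
    (hP : P.IsHomogeneous d) (h : eval x P ∈ Ideal.span (Set.range x) ^ (d + 1)) (β : ι →₀ ℕ) :
    P.coeff β ∈ Ideal.span (Set.range x) := by
  induction d generalizing P β with
  | zero =>
    rw [← totalDegree_zero_iff_isHomogeneous, totalDegree_eq_zero_iff_eq_C] at hP
    rw [hP, eval_C, zero_add, pow_one] at h
    rw [hP, coeff_C]
    split_ifs
    · exact h
    · exact zero_mem _
  | succ d ih =>
    by_cases hβ : P.coeff β = 0
    · rw [hβ]; exact zero_mem _
    have hd : β.degree = d + 1 := by
      rw [← hP hβ, Finsupp.weight_apply, Finsupp.degree_apply, Finsupp.sum]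
      simp
    obtain ⟨i, hi⟩ : ∃ i, β i ≠ 0 := by
      by_contra! H
      have : β = 0 := Finsupp.ext H
      rw [this] at hd
      simp at hd
    -- Applying the derivation dual to `xᵢ` reduces the claim to `∂P/∂Xᵢ`, of degree one less. Its
    -- coefficient at `β - eᵢ` is `βᵢ` times that of `P` at `β`, and `βᵢ ≠ 0` is invertible.
    have h1 := deriv_eval_sub_mem (D i) x hP
    have h2 : ∑ j, eval x (pderiv j P) * D i (x j) = eval x (pderiv i P) := by simp [hD]
    rw [h2] at h1
    have h3 := sub_mem (deriv_mem_pow (D i) _ _ h) h1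
    rw [sub_sub_cancel] at h3
    have h4 := ih (hP.pderiv (i := i)) h3 (β - Finsupp.single i 1)
    rw [coeff_pderiv] at h4
    have h5 : β - Finsupp.single i 1 + Finsupp.single i 1 = β :=
      tsub_add_cancel_of_le (by simpa [Nat.one_le_iff_ne_zero] using hi)
    rw [h5, mul_comm] at h4
    refine (Ideal.unit_mul_mem_iff_mem _ (?_)).mp h4
    have hm : ∀ m : ℕ, IsUnit ((m : A) + 1) := fun m ↦ by exact_mod_cast hA (m + 1) (by omega)
    exact hm _

section Local

variable [IsLocalRing A] (hD : ∀ i j, D i (x j) = if i = j then 1 else 0)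
  (hA : ∀ n : ℕ, n ≠ 0 → IsUnit (n : A))
  (hx : Ideal.span (Set.range x) = IsLocalRing.maximalIdeal A)

include hD hA hx

-- By quasi-regularity the graded ring of the maximal ideal is a polynomial ring over the residue
-- field. It is a domain, so a product of nonzero initial forms is nonzero.
open MvPolynomial in
lemma mul_notMem_pow {a c : A} {n l : ℕ} (ha : a ∈ IsLocalRing.maximalIdeal A ^ n)
    (ha' : a ∉ IsLocalRing.maximalIdeal A ^ (n + 1)) (hc : c ∈ IsLocalRing.maximalIdeal A ^ l)
    (hc' : c ∉ IsLocalRing.maximalIdeal A ^ (l + 1)) :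
    a * c ∉ IsLocalRing.maximalIdeal A ^ (n + l + 1) := by
  have hxm : ∀ i, x i ∈ Ideal.span (Set.range x) := fun i ↦ Ideal.subset_span ⟨i, rfl⟩
  rw [← hx] at ha ha' hc hc' ⊢
  intro h
  have key : ∀ {P : MvPolynomial ι A} {d : ℕ}, P.IsHomogeneous d →
      P.map (IsLocalRing.residue A) = 0 → eval x P ∈ Ideal.span (Set.range x) ^ (d + 1) := by
    intro P d hP h0
    rw [eval_eq', pow_succ']
    refine Ideal.sum_mem _ fun β hβ ↦ Ideal.mul_mem_mul ?_ ?_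
    · rw [hx, ← IsLocalRing.residue_eq_zero_iff, ← coeff_map, h0, coeff_zero]
    · have hd : β.degree = d := by
        rw [← hP (mem_support_iff.mp hβ), Finsupp.weight_apply, Finsupp.degree_apply, Finsupp.sum]
        simp
      rw [← hd, Finsupp.degree_eq_sum, ← Finset.prod_pow_eq_pow_sum]
      exact Ideal.prod_mem_prod fun i _ ↦ Ideal.pow_mem_pow (hxm i) _
  obtain ⟨P, hP, rfl⟩ := (Ideal.mem_span_pow_iff_exists_isHomogeneous _ _).mp ha
  obtain ⟨Q, hQ, rfl⟩ := (Ideal.mem_span_pow_iff_exists_isHomogeneous _ _).mp hc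
  rw [← map_mul] at h
  have h1 := coeff_mem_of_eval_mem_pow hD hA (hP.mul hQ) h
  have h2 : (P * Q).map (IsLocalRing.residue A) = 0 := by
    ext β
    rw [coeff_map, coeff_zero, IsLocalRing.residue_eq_zero_iff, ← hx]
    exact h1 β
  rw [map_mul, mul_eq_zero] at h2
  exact h2.elim (fun h ↦ ha' (key hP h)) (fun h ↦ hc' (key hQ h))

omit hx hA hD in
lemma exists_order {a : A} {c : ℕ} (ha : a ∉ IsLocalRing.maximalIdeal A ^ c) :
    ∃ n < c, a ∈ IsLocalRing.maximalIdeal A ^ n ∧ a ∉ IsLocalRing.maximalIdeal A ^ (n + 1) := by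
  induction c with
  | zero => simp at ha
  | succ c ih =>
    by_cases h : a ∈ IsLocalRing.maximalIdeal A ^ c
    · exact ⟨c, by omega, h, ha⟩
    · obtain ⟨n, hn, h'⟩ := ih h
      exact ⟨n, by omega, h'⟩

/-- Orders are additive: an element of order `n < c` has an `e`-th power of order `e n < e c`. -/
lemma mem_pow_of_pow_mem_pow {a : A} {e c : ℕ} (he : 0 < e)
    (h : a ^ e ∈ IsLocalRing.maximalIdeal A ^ (e * c)) : a ∈ IsLocalRing.maximalIdeal A ^ c := by
  by_contra H
  obtain ⟨n, hn, h1, h2⟩ := exists_order H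
  have h3 : ∀ j : ℕ, a ^ j ∉ IsLocalRing.maximalIdeal A ^ (j * n + 1) := by
    intro j
    induction j with
    | zero =>
      rw [pow_zero, zero_mul, zero_add, pow_one]
      exact (Ideal.ne_top_iff_one _).mp (IsLocalRing.maximalIdeal.isMaximal A).ne_top
    | succ j ih =>
      rw [pow_succ a, Nat.succ_mul]
      refine mul_notMem_pow hD hA hx ?_ ih h1 h2
      rw [mul_comm j, pow_mul]
      exact Ideal.pow_mem_pow h1 j
  exact h3 e (Ideal.pow_le_pow_right (by nlinarith) h)

/-- By Krull's intersection theorem every nonzero element has a finite order, and orders add. -/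
lemma isDomain_of_dual [IsNoetherianRing A] : IsDomain A := by
  have key : ∀ a : A, a ≠ 0 → ∃ n, a ∈ IsLocalRing.maximalIdeal A ^ n ∧
      a ∉ IsLocalRing.maximalIdeal A ^ (n + 1) := by
    intro a ha
    have h1 := Ideal.iInf_pow_eq_bot_of_isLocalRing (IsLocalRing.maximalIdeal A)
      (IsLocalRing.maximalIdeal.isMaximal A).ne_top
    have h2 : a ∉ ⨅ i : ℕ, IsLocalRing.maximalIdeal A ^ i := by rwa [h1]
    rw [Submodule.mem_iInf, not_forall] at h2
    obtain ⟨c, hc⟩ := h2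
    obtain ⟨n, -, h3⟩ := exists_order hc
    exact ⟨n, h3⟩
  have : NoZeroDivisors A := ⟨fun {a c} h ↦ by
    by_contra! H
    obtain ⟨n, h1, h2⟩ := key a H.1
    obtain ⟨l, h3, h4⟩ := key c H.2
    refine mul_notMem_pow hD hA hx h1 h2 h3 h4 ?_
    rw [h]; exact zero_mem _⟩
  exact NoZeroDivisors.to_isDomain A

end Local

end Derivatives

end Resolution
end

noncomputable section
namespace Resolution

/-! ### Formally smooth local algebras -/

section FormallySmooth

open scoped TensorProduct

variable {k A : Type*} [CommRing k] [CommRing A] [Algebra k A]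

/-- The generators lift a basis of `I / 𝔪I`. The second clause, independence modulo `𝔪I`, makes the
matrix of derivatives in `exists_dual_of_formallySmooth` invertible. -/
lemma exists_minimal_generators [IsLocalRing A] (I : Ideal A) (hI : I.FG) :
    ∃ (n : ℕ) (x : Fin n → A), Ideal.span (Set.range x) = I ∧
      ∀ c : Fin n → A, ∑ i, c i * x i ∈ IsLocalRing.maximalIdeal A * I →
        ∀ i, c i ∈ IsLocalRing.maximalIdeal A := by
  have : Module.Finite A I := Module.Finite.of_fg hI
  let κ := IsLocalRing.ResidueField A
  let b := Module.finBasis κ (κ ⊗[A] I)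
  have hs : Function.Surjective (TensorProduct.mk A κ I 1) :=
    TensorProduct.mk_surjective _ _ _ Ideal.Quotient.mk_surjective
  choose y hy using fun i ↦ hs (b i)
  have hspan := IsLocalRing.span_eq_top_of_tmul_eq_basis (R := A) (f := y) b hy
  refine ⟨_, fun i ↦ (y i : A), ?_, fun c hc i ↦ ?_⟩
  · have := congr_arg (Submodule.map I.subtype) hspan
    rw [Submodule.map_span, ← Set.range_comp, Submodule.map_top, Submodule.range_subtype] at this
    exact this
  · have h1 : IsLocalRing.maximalIdeal A * I ≤
        (LinearMap.ker (TensorProduct.mk A κ I 1)).map I.subtype := by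
      refine Ideal.mul_le.mpr fun m hm y hy ↦ ⟨m • ⟨y, hy⟩, ?_, rfl⟩
      have h0 : algebraMap A κ m = 0 := (IsLocalRing.residue_eq_zero_iff m).mpr hm
      rw [SetLike.mem_coe, LinearMap.mem_ker, TensorProduct.mk_apply, ← TensorProduct.smul_tmul,
        Algebra.smul_def, h0, zero_mul, TensorProduct.zero_tmul]
    obtain ⟨t, ht, h2⟩ := h1 hc
    have e : t = ∑ i, c i • y i := by
      ext; rw [← Submodule.subtype_apply, h2]; simp
    rw [SetLike.mem_coe, LinearMap.mem_ker, e, TensorProduct.mk_apply,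
      TensorProduct.tmul_sum] at ht
    have h3 : ∑ i, IsLocalRing.residue A (c i) • b i = 0 := by
      rw [← ht]
      refine Finset.sum_congr rfl fun i _ ↦ ?_
      rw [← hy, TensorProduct.mk_apply, TensorProduct.tmul_smul]
      rfl
    exact (IsLocalRing.residue_eq_zero_iff _).mp
      (Fintype.linearIndependent_iff.mp b.linearIndependent _ h3 i)

/-- The kernel of a surjection of formally smooth algebras, with local source, is generated by
elements that have dual derivations. -/
lemma exists_dual_of_formallySmooth {R : Type*} [CommRing R] [Nontrivial R] [Algebra k R]
    [Algebra A R] [IsScalarTower k A R] [IsLocalRing A] [IsNoetherianRing A]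
    [Algebra.FormallySmooth k A] [Algebra.FormallySmooth k R]
    (hR : Function.Surjective (algebraMap A R)) :
    ∃ (n : ℕ) (x : Fin n → A) (D : Fin n → Derivation k A A),
      Ideal.span (Set.range x) = RingHom.ker (algebraMap A R) ∧
        ∀ i j, D i (x j) = if i = j then 1 else 0 := by
  let I := RingHom.ker (algebraMap A R)
  have hI : I ≤ IsLocalRing.maximalIdeal A := IsLocalRing.le_maximalIdeal (RingHom.ker_ne_top _)
  obtain ⟨n, x, hx, hmin⟩ := exists_minimal_generators I (IsNoetherian.noetherian I)
  have hxI : ∀ i, x i ∈ I := fun i ↦ by rw [← hx]; exact Ideal.subset_span ⟨i, rfl⟩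
  -- The Jacobian criterion: smoothness of `R` splits `I/I² → R ⊗ Ω`. The splitting, lifted to a map
  -- from `Ω` to the free module on the generators, gives derivations.
  obtain ⟨l, hl⟩ := (Algebra.FormallySmooth.iff_split_injection (R := k) hR).mp inferInstance
  let p : (Fin n → A) →ₗ[A] I.Cotangent :=
    Fintype.linearCombination A (fun i ↦ I.toCotangent ⟨x i, hxI i⟩)
  have hp : Function.Surjective p := by
    intro t
    obtain ⟨⟨t, ht⟩, rfl⟩ := I.toCotangent_surjective t
    have ht' := ht
    rw [← hx, Ideal.mem_span_range_iff_exists_fun] at ht'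
    obtain ⟨c, rfl⟩ := ht'
    refine ⟨c, ?_⟩
    rw [Fintype.linearCombination_apply]
    simp_rw [← map_smul, ← map_sum]
    congr 1
    ext; simp
  obtain ⟨δ, hδ⟩ := Module.projective_lifting_property p
    (l ∘ₗ (TensorProduct.mk A R (Ω[A⁄k]) 1)) hp
  let D₀ : Fin n → Derivation k A A := fun i ↦
    ((LinearMap.proj i).comp δ).compDer (KaehlerDifferential.D k A)
  let M : Matrix (Fin n) (Fin n) A := Matrix.of fun i j ↦ D₀ i (x j)
  -- The lifted derivations are dual to the generators only up to coefficients of relations in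
  -- `I/I²`, which lie in the maximal ideal by minimality. The inverse matrix corrects them.
  have hM : M.map (IsLocalRing.residue A) = 1 := by
    ext i j
    have h1 : p (δ (KaehlerDifferential.D k A (x j))) = I.toCotangent ⟨x j, hxI j⟩ := by
      have h2 := LinearMap.congr_fun hδ (KaehlerDifferential.D k A (x j))
      rw [LinearMap.comp_apply] at h2
      rw [h2]
      exact LinearMap.congr_fun hl (I.toCotangent ⟨x j, hxI j⟩)
    rw [Fintype.linearCombination_apply] at h1
    simp_rw [← map_smul, ← map_sum] at h1
    rw [Ideal.toCotangent_eq] at h1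
    have h3 : ∑ l, (D₀ l (x j) - if l = j then 1 else 0) * x l ∈
        IsLocalRing.maximalIdeal A * I := by
      simp only [sub_mul, Finset.sum_sub_distrib, ite_mul, one_mul, zero_mul]
      rw [Finset.sum_ite_eq' Finset.univ j, if_pos (Finset.mem_univ _)]
      have h4 := Ideal.mul_mono_left hI (by simpa [pow_two] using h1)
      exact h4
    have h5 := hmin _ h3 i
    rw [← IsLocalRing.residue_eq_zero_iff, map_sub, sub_eq_zero] at h5
    have h6 : IsLocalRing.residue A (M i j) = if i = j then 1 else 0 :=
      h5.trans (by split_ifs <;> simp)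
    rw [Matrix.map_apply, h6, Matrix.one_apply]
  have hdet : IsUnit M.det := by
    rw [← IsLocalRing.residue_ne_zero_iff_isUnit, RingHom.map_det, RingHom.mapMatrix_apply, hM,
      Matrix.det_one]
    exact one_ne_zero
  refine ⟨n, x, fun i ↦ ∑ j, M⁻¹ i j • D₀ j, hx, fun i j ↦ ?_⟩
  have h6 := congr_fun₂ (Matrix.nonsing_inv_mul M hdet) i j
  rw [Matrix.mul_apply, Matrix.one_apply] at h6
  rw [← h6]
  have h7 : ∀ (s : Finset (Fin n)) (a : A), (∑ j ∈ s, M⁻¹ i j • D₀ j) a =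
      ∑ j ∈ s, M⁻¹ i j * D₀ j a := fun s a ↦
    map_sum (⟨⟨fun D : Derivation k A A ↦ D a, rfl⟩, fun _ _ ↦ rfl⟩ : Derivation k A A →+ A) _ s
  exact h7 _ _

variable {ι : Type*} [Fintype ι] [DecidableEq ι] {x : ι → A} {D : ι → Derivation k A A}

/-- Start with any lift `f` and take `f + ∑ νᵢ f ∘ Dᵢ` with `νᵢ = sᵢ - f xᵢ ∈ N`. This is
multiplicative because `N² = 0`, and duality makes its value at `xᵢ` equal to `sᵢ`. -/
lemma exists_lift_of_dual [Algebra.FormallySmooth k A]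
    (hD : ∀ i j, D i (x j) = if i = j then 1 else 0) {B : Type*} [CommRing B] [Algebra k B]
    (N : Ideal B) (hN : N ^ 2 = ⊥) (g : A →ₐ[k] B ⧸ N) (s : ι → B)
    (hs : ∀ i, Ideal.Quotient.mk N (s i) = g (x i)) :
    ∃ g' : A →ₐ[k] B, (Ideal.Quotient.mkₐ k N).comp g' = g ∧ ∀ i, g' (x i) = s i := by
  obtain ⟨f, hf⟩ := Algebra.FormallySmooth.comp_surjective k A N hN g
  have hf' : ∀ a, Ideal.Quotient.mk N (f a) = g a := fun a ↦ congr($hf a)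
  let ν : ι → B := fun i ↦ s i - f (x i)
  have hν : ∀ i, ν i ∈ N := fun i ↦ by
    rw [← Ideal.Quotient.eq, hs, hf']
  have hνν : ∀ i j, ν i * ν j = 0 := fun i j ↦ by
    rw [← Ideal.mem_bot, ← hN, pow_two]
    exact Ideal.mul_mem_mul (hν i) (hν j)
  let δ : A → B := fun a ↦ ∑ i, ν i * f (D i a)
  have hδδ : ∀ a c, δ a * δ c = 0 := fun a c ↦ by
    simp only [δ, Finset.sum_mul_sum]
    refine Finset.sum_eq_zero fun i _ ↦ Finset.sum_eq_zero fun j _ ↦ ?_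
    rw [mul_mul_mul_comm, hνν, zero_mul]
  have hδ : ∀ a, δ a ∈ N := fun a ↦ Ideal.sum_mem _ fun i _ ↦ Ideal.mul_mem_right _ _ (hν i)
  have hmul : ∀ a c, δ (a * c) = f a * δ c + f c * δ a := fun a c ↦ by
    simp only [δ, Derivation.leibniz, smul_eq_mul, map_add, map_mul, Finset.mul_sum,
      ← Finset.sum_add_distrib]
    exact Finset.sum_congr rfl fun i _ ↦ by ring
  refine ⟨AlgHom.ofLinearMap (f.toLinearMap +
    ∑ i, (LinearMap.mulLeft k (ν i)).comp (f.toLinearMap.comp (D i).toLinearMap)) ?_ ?_, ?_, ?_⟩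
  · simp
  · intro a c
    have e : ∀ a, (f.toLinearMap + ∑ i, (LinearMap.mulLeft k (ν i)).comp
        (f.toLinearMap.comp (D i).toLinearMap)) a = f a + δ a := fun a ↦ by
      simp [δ]
    rw [e, e, e, map_mul, hmul]
    linear_combination - hδδ a c
  · ext a
    have : Ideal.Quotient.mk N (f a + δ a) = g a := by
      rw [map_add, hf', Ideal.Quotient.eq_zero_iff_mem.mpr (hδ a), add_zero]
    rw [← this]
    simp [δ]
  · intro j
    have : f (x j) + δ (x j) = s j := by simp [δ, hD, ν]
    rw [← this]
    simp [δ]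

/-- A formally smooth algebra is formally smooth over the polynomial ring in elements that have
dual derivations. -/
lemma formallySmooth_aeval_of_dual [Algebra.FormallySmooth k A]
    (hD : ∀ i j, D i (x j) = if i = j then 1 else 0) :
    letI := (MvPolynomial.aeval (R := k) x).toRingHom.toAlgebra
    Algebra.FormallySmooth (MvPolynomial ι k) A := by
  let := (MvPolynomial.aeval (R := k) x).toRingHom.toAlgebra
  refine Algebra.FormallySmooth.of_comp_surjective fun B _ _ N hN g ↦ ?_
  let : Algebra k B := Algebra.compHom B (MvPolynomial.C : k →+* MvPolynomial ι k)
  have hC : ∀ c : k, algebraMap (MvPolynomial ι k) A (MvPolynomial.C c) = algebraMap k A c :=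
    fun c ↦ by
      change MvPolynomial.aeval x (MvPolynomial.C c) = _
      simp
  have hX : ∀ i, algebraMap (MvPolynomial ι k) A (MvPolynomial.X i) = x i := fun i ↦ by
    change MvPolynomial.aeval x (MvPolynomial.X i) = _
    simp
  let g₀ : A →ₐ[k] B ⧸ N :=
    { g.toRingHom with
      commutes' := fun c ↦ by
        have := g.commutes (MvPolynomial.C c)
        rw [hC] at this
        exact this }
  obtain ⟨g', h1, h2⟩ := exists_lift_of_dual hD N hN g₀
    (fun i ↦ algebraMap (MvPolynomial ι k) B (MvPolynomial.X i)) fun i ↦ by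
      have := g.commutes (MvPolynomial.X i)
      rw [hX] at this
      exact this.symm
  refine ⟨{ g'.toRingHom with commutes' := fun P ↦ ?_ }, ?_⟩
  · change g'.toRingHom (MvPolynomial.aeval x P) = _
    induction P using MvPolynomial.induction_on with
    | C c =>
      rw [MvPolynomial.aeval_C]
      exact g'.commutes c
    | add P Q hP hQ => rw [map_add, map_add, map_add, hP, hQ]
    | mul_X P i hP =>
      rw [map_mul, map_mul, map_mul, hP, MvPolynomial.aeval_X]
      congr 1
      exact h2 i
  · ext a
    exact congr($h1 a)

end FormallySmooth

end Resolution
end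

noncomputable section
namespace Resolution

/-! ### The local ring of a blow-up as a ring of fractions -/

section Fractions

variable {A A' : Type u} [CommRing A] [CommRing A']

/-- `g` is an element of `Iˢ` whose image generates `(Iˢ) A' = (hˢ)`. -/
def IsDenominator (π : A →+* A') (I : Ideal A) (h : A) (s : ℕ) (g : A) : Prop :=
  g ∈ I ^ s ∧ ∃ u : A', IsUnit u ∧ π g = u * π h ^ s

variable {π : A →+* A'} {I : Ideal A} {h : A}

lemma IsDenominator.mul {s t : ℕ} {g g' : A} (hg : IsDenominator π I h s g)
    (hg' : IsDenominator π I h t g') : IsDenominator π I h (s + t) (g * g') := by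
  obtain ⟨hg, u, hu, e⟩ := hg
  obtain ⟨hg', u', hu', e'⟩ := hg'
  refine ⟨by rw [pow_add]; exact Ideal.mul_mem_mul hg hg', u * u', hu.mul hu', ?_⟩
  rw [map_mul, e, e', pow_add]; ring

lemma isDenominator_one : IsDenominator π I h 0 1 := ⟨by simp, 1, isUnit_one, by simp⟩

lemma isDenominator_self (hh : h ∈ I) : IsDenominator π I h 1 h :=
  ⟨by simpa using hh, 1, isUnit_one, by simp⟩

lemma IsDenominator.mem_nonZeroDivisors {s : ℕ} {g : A} (hg : IsDenominator π I h s g)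
    (hn : π h ∈ nonZeroDivisors A') : π g ∈ nonZeroDivisors A' := by
  obtain ⟨-, u, hu, e⟩ := hg
  rw [e]
  exact mul_mem hu.mem_nonZeroDivisors (pow_mem hn s)

lemma IsDenominator.exists_mul_eq {s : ℕ} {g f : A} (hg : IsDenominator π I h s g)
    (hI : I.map π = Ideal.span {π h}) (hf : f ∈ I ^ s) : ∃ a, π g * a = π f := by
  obtain ⟨-, u, hu, e⟩ := hg
  have h1 := Ideal.mem_map_of_mem π hf
  rw [Ideal.map_pow, hI, Ideal.span_singleton_pow] at h1
  obtain ⟨a, ha⟩ := Ideal.mem_span_singleton'.mp h1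
  obtain ⟨v, hv⟩ := hu.exists_right_inv
  exact ⟨v * a, by rw [e, ← ha]; linear_combination (a * π h ^ s) * hv⟩

/-- The local ring of a blow-up of a domain consists of fractions. -/
lemma HasBlowupLift.exists_fraction [IsDomain A] [IsLocalRing A']
    (hlift : HasBlowupLift π (RingHom.id A') I) (hh : h ∈ I) (hn : π h ∈ nonZeroDivisors A')
    (hI : I.map π = Ideal.span {π h}) : Function.Injective π ∧
      ∀ a, ∃ (s : ℕ) (f g : A), f ∈ I ^ s ∧ IsDenominator π I h s g ∧ π g * a = π f := by
  let K := FractionRing A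
  have hK : Function.Injective (algebraMap A K) := IsFractionRing.injective A K
  have hg0 : ∀ {s g}, IsDenominator π I h s g → g ≠ 0 := by
    rintro s g hg rfl
    have := hg.mem_nonZeroDivisors hn
    rw [map_zero] at this
    exact zero_notMem_nonZeroDivisors this
  -- `S` consists of the fractions that ought to form the local ring of the blow-up. It maps to `A'`
  -- by a local homomorphism `c`, and the ideal `I` is principal in it. The lifting property gives a
  -- section `φ : A' → S` of `c`, so that every element of `A'` is a fraction.
  let S : Subring K :=
    { carrier := {t | ∃ (s : ℕ) (f g : A), f ∈ I ^ s ∧ IsDenominator π I h s g ∧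
        t * algebraMap A K g = algebraMap A K f}
      zero_mem' := ⟨0, 0, 1, by simp, isDenominator_one, by simp⟩
      one_mem' := ⟨0, 1, 1, by simp, isDenominator_one, by simp⟩
      add_mem' := by
        rintro t t' ⟨s, f, g, hf, hg, e⟩ ⟨s', f', g', hf', hg', e'⟩
        refine ⟨s + s', f * g' + f' * g, g * g', ?_, hg.mul hg', ?_⟩
        · refine add_mem ?_ ?_
          · rw [pow_add]; exact Ideal.mul_mem_mul hf hg'.1
          · rw [pow_add, mul_comm f']; exact Ideal.mul_mem_mul hg.1 hf'
        · rw [map_add, map_mul, map_mul, map_mul, ← e, ← e']; ring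
      neg_mem' := by
        rintro t ⟨s, f, g, hf, hg, e⟩
        exact ⟨s, -f, g, neg_mem hf, hg, by rw [map_neg, ← e]; ring⟩
      mul_mem' := by
        rintro t t' ⟨s, f, g, hf, hg, e⟩ ⟨s', f', g', hf', hg', e'⟩
        refine ⟨s + s', f * f', g * g', ?_, hg.mul hg', ?_⟩
        · rw [pow_add]; exact Ideal.mul_mem_mul hf hf'
        · rw [map_mul, map_mul, ← e, ← e']; ring }
  have hS : ∀ t : S, ∃ a : A', ∀ (s : ℕ) (f g : A), f ∈ I ^ s → IsDenominator π I h s g →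
      (t : K) * algebraMap A K g = algebraMap A K f → π g * a = π f := by
    rintro ⟨t, s, f, g, hf, hg, e⟩
    obtain ⟨a, ha⟩ := hg.exists_mul_eq hI hf
    refine ⟨a, fun s' f' g' hf' hg' e' ↦ ?_⟩
    have h1 : f * g' = f' * g := hK (by rw [map_mul, map_mul, ← e, ← e']; ring)
    have h2 := congr_arg π h1
    rw [map_mul, map_mul, ← ha] at h2
    refine (mul_cancel_left_mem_nonZeroDivisors (hg.mem_nonZeroDivisors hn)).mp ?_
    linear_combination h2
  choose c₀ hc₀ using hS
  have huniq : ∀ (t : S) (s : ℕ) (f g : A) (a : A'), f ∈ I ^ s → IsDenominator π I h s g →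
      (t : K) * algebraMap A K g = algebraMap A K f → π g * a = π f → c₀ t = a := by
    intro t s f g a hf hg e ha
    refine (mul_cancel_left_mem_nonZeroDivisors (hg.mem_nonZeroDivisors hn)).mp ?_
    rw [ha, hc₀ t s f g hf hg e]
  let c : S →+* A' :=
    { toFun := c₀
      map_zero' := huniq _ 0 0 1 _ (by simp) isDenominator_one (by simp) (by simp)
      map_one' := huniq _ 0 1 1 _ (by simp) isDenominator_one (by simp) (by simp)
      map_add' := by
        rintro t t'
        obtain ⟨s, f, g, hf, hg, e⟩ := t.2
        obtain ⟨s', f', g', hf', hg', e'⟩ := t'.2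
        refine huniq _ (s + s') (f * g' + f' * g) (g * g') _ ?_ (hg.mul hg') ?_ ?_
        · refine add_mem ?_ ?_
          · rw [pow_add]; exact Ideal.mul_mem_mul hf hg'.1
          · rw [pow_add, mul_comm f']; exact Ideal.mul_mem_mul hg.1 hf'
        · rw [map_add, map_mul, map_mul, map_mul, ← e, ← e', Subring.coe_add]; ring
        · rw [map_add, map_mul, map_mul, map_mul, ← hc₀ _ _ _ _ hf hg e,
            ← hc₀ _ _ _ _ hf' hg' e']; ring
      map_mul' := by
        rintro t t'
        obtain ⟨s, f, g, hf, hg, e⟩ := t.2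
        obtain ⟨s', f', g', hf', hg', e'⟩ := t'.2
        refine huniq _ (s + s') (f * f') (g * g') _ ?_ (hg.mul hg') ?_ ?_
        · rw [pow_add]; exact Ideal.mul_mem_mul hf hf'
        · rw [map_mul, map_mul, ← e, ← e', Subring.coe_mul]; ring
        · rw [map_mul, map_mul, ← hc₀ _ _ _ _ hf hg e, ← hc₀ _ _ _ _ hf' hg' e']; ring }
  -- If the value of `f / g` is a unit, then `f` is a denominator too, and `g / f` belongs to `S`.
  have hc : IsLocalHom c := ⟨fun t ht ↦ by
    obtain ⟨s, f, g, hf, hg, e⟩ := t.2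
    have h1 : π g * c t = π f := hc₀ _ _ _ _ hf hg e
    obtain ⟨hgI, u, hu, hgu⟩ := hg
    have hf' : IsDenominator π I h s f :=
      ⟨hf, u * c t, hu.mul ht, by rw [← h1, hgu]; ring⟩
    have hfK : algebraMap A K f ≠ 0 := fun h0 ↦ hg0 hf' (hK (by rw [h0, map_zero]))
    let t' : S := ⟨algebraMap A K g / algebraMap A K f, s, g, f, hgI, hf', by
      rw [div_mul_cancel₀ _ hfK]⟩
    refine IsUnit.of_mul_eq_one t' (Subtype.ext ?_)
    change (t : K) * (algebraMap A K g / algebraMap A K f) = 1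
    rw [← mul_div_assoc, e, div_self hfK]⟩
  have : IsLocalRing S := RingHom.domain_isLocalRing c
  let ψ : A →+* S := (algebraMap A K).codRestrict S fun a ↦
    ⟨0, a, 1, by simp, isDenominator_one, by simp⟩
  have hψ : Function.Injective ψ := fun a a' e ↦ hK congr(($e : K))
  have hh0 : h ≠ 0 := hg0 (isDenominator_self hh)
  have hcψ : ∀ a, c (ψ a) = π a := fun a ↦
    huniq _ 0 a 1 _ (by simp) isDenominator_one (by simp [ψ]) (by simp)
  obtain ⟨φ, h1, h2⟩ := hlift ψ c (ψ h) (RingHom.ext fun a ↦ hcψ a)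
    (mem_nonZeroDivisors_of_ne_zero fun e ↦ hh0 (hψ (by rw [e, map_zero])))
    (by rwa [hcψ]) (by
      refine le_antisymm (Ideal.map_le_iff_le_comap.mpr fun y hy ↦ ?_) ?_
      · have hhK : algebraMap A K h ≠ 0 := fun h0 ↦ hh0 (hK (by rw [h0, map_zero]))
        refine Ideal.mem_span_singleton'.mpr ⟨⟨algebraMap A K y / algebraMap A K h, 1, y, h,
          by simpa using hy, isDenominator_self hh, by rw [div_mul_cancel₀ _ hhK]⟩,
          Subtype.ext ?_⟩
        exact div_mul_cancel₀ _ hhK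
      · rw [Ideal.span_singleton_le_iff_mem]
        exact Ideal.mem_map_of_mem _ hh)
  refine ⟨fun a a' e ↦ hψ ?_, fun a ↦ ?_⟩
  · rw [← h1, RingHom.comp_apply, RingHom.comp_apply, e]
  · obtain ⟨s, f, g, hf, hg, e⟩ := (φ a).2
    exact ⟨s, f, g, hf, hg, by
      rw [← hc₀ _ _ _ _ hf hg e]
      exact congr(π g * $h2 a).symm⟩

end Fractions

/-! ### Taylor homomorphisms of all orders, and strict transforms -/

section Strict

variable {k : Type*} {A A' R : Type u} [CommRing k] [CommRing A] [CommRing A'] [CommRing R]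

/-- Dual derivations make `A` formally smooth over the polynomial ring in `z, y`. As `Trunc`
surjects onto `R` with nilpotent kernel, `ρ` lifts with the prescribed values `Xᵢ` and `ρ yⱼ` on the
coordinates. The `z, y` need not be a full coordinate system; `y` may be empty. -/
lemma exists_isTaylorHom [Algebra k A] [Algebra k R] [Algebra.FormallySmooth k A] (ρ : A →ₐ[k] R)
    (hρ : Function.Surjective ρ) {r n : ℕ} {z : Fin r → A} {y : Fin n → A}
    {D : Fin r ⊕ Fin n → Derivation k A A}
    (hD : ∀ i j, D i (Sum.elim z y j) = if i = j then 1 else 0)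
    (hz : RingHom.ker ρ.toRingHom = Ideal.span (Set.range z)) {b : ℕ} (hb : 0 < b) :
    ∃ φ : A →+* Trunc r b R, IsTaylorHom hb ρ.toRingHom z φ ∧
      (∀ j, φ (y j) = Trunc.C (ρ (y j))) ∧
      ∀ c : k, φ (algebraMap k A c) = Trunc.C (algebraMap k R c) := by
  let P := MvPolynomial (Fin r ⊕ Fin n) k
  let := (MvPolynomial.aeval (R := k) (Sum.elim z y)).toRingHom.toAlgebra
  have := formallySmooth_aeval_of_dual hD
  let τ : P →+* Trunc r b R := MvPolynomial.eval₂Hom (Trunc.C.comp (algebraMap k R))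
    (Sum.elim Trunc.X fun j ↦ Trunc.C (ρ (y j)))
  let : Algebra P (Trunc r b R) := τ.toAlgebra
  let : Algebra P R := ((Trunc.const hb).comp τ).toAlgebra
  let c : Trunc r b R →ₐ[P] R := { Trunc.const hb with commutes' := fun _ ↦ rfl }
  have hzρ : ∀ i, ρ (z i) = 0 := fun i ↦ by
    change z i ∈ RingHom.ker ρ.toRingHom
    rw [hz]; exact Ideal.subset_span ⟨i, rfl⟩
  let f : A →ₐ[P] R := { ρ.toRingHom with
    commutes' := fun p ↦ by
      change ρ (MvPolynomial.aeval (R := k) (Sum.elim z y) p) = Trunc.const hb (τ p)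
      induction p using MvPolynomial.induction_on with
      | C a =>
        have : τ (MvPolynomial.C a) = Trunc.C (algebraMap k R a) := MvPolynomial.eval₂_C _ _ _
        rw [this]; simp
      | add p q hp hq => rw [map_add, map_add, map_add, map_add, hp, hq]
      | mul_X p i hp =>
        rw [map_mul, map_mul, map_mul, map_mul, hp]
        congr 1
        have : τ (MvPolynomial.X i) = Sum.elim Trunc.X (fun j ↦ Trunc.C (ρ (y j))) i :=
          MvPolynomial.eval₂_X _ _ _
        rw [this]
        rcases i with i | i <;> simp [hzρ] }
  have hc : Function.Surjective c := fun a ↦ ⟨Trunc.C a, Trunc.const_C hb a⟩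
  have hnil : IsNilpotent (RingHom.ker (c : Trunc r b R →+* R)) := by
    refine ⟨b, ?_⟩
    have : RingHom.ker (c : Trunc r b R →+* R) =
        Ideal.span (Set.range (Trunc.X : Fin r → Trunc r b R)) := by
      ext t
      exact Trunc.mem_ker_const_iff hb t
    rw [this, Trunc.span_X_pow]; rfl
  let φ := Algebra.FormallySmooth.liftOfSurjective f c hc hnil
  have hφ : ∀ a, Trunc.const hb (φ a) = ρ a := fun a ↦
    Algebra.FormallySmooth.liftOfSurjective_apply f c hc hnil a
  have hX : ∀ i, φ (Sum.elim z y i) = Sum.elim Trunc.X (fun j ↦ Trunc.C (ρ (y j))) i := fun i ↦ by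
    have h1 := φ.commutes (MvPolynomial.X i)
    have h2 : algebraMap P A (MvPolynomial.X i) = Sum.elim z y i :=
      MvPolynomial.aeval_X _ _
    rw [h2] at h1
    rw [h1]
    exact MvPolynomial.eval₂_X _ _ _
  refine ⟨φ.toRingHom, ⟨hρ, hφ, fun i ↦ hX (.inl i), hz⟩, fun j ↦ hX (.inr j), fun a ↦ ?_⟩
  have h1 := φ.commutes (MvPolynomial.C a)
  have h2 : algebraMap P A (MvPolynomial.C a) = algebraMap k A a := MvPolynomial.aeval_C _ _
  rw [h2] at h1
  exact h1.trans (MvPolynomial.eval₂_C _ _ _)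

/-- An Artin–Rees statement with sharp exponent. The constant term of `φ f` vanishes, and every
other term contains some `Xᵢ = φ zᵢ`; once this factor is split off, the rest lies in the image of
`I ^ d`. -/
lemma IsTaylorHom.ker_inf_pow_le {r d : ℕ} {hb : 0 < d + 1} {ρ : A →+* R} {z : Fin r → A}
    {φ : A →+* Trunc r (d + 1) R} (h : IsTaylorHom hb ρ z φ) {I : Ideal A}
    (hI : RingHom.ker ρ ≤ I) : RingHom.ker ρ ⊓ I ^ (d + 1) ≤ RingHom.ker ρ * I ^ d := by
  rintro f ⟨hf0, hf⟩
  have hf0 : ρ f = 0 := hf0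
  have hcoef := (h.mem_pow_iff I hI f).mp hf
  obtain ⟨p, hp⟩ := Trunc.mk_surjective (φ f)
  set K := (RingHom.ker ρ).map φ with hK
  have hKI : K ≤ I.map φ := Ideal.map_mono hI
  have hX : ∀ i, (Trunc.X i : Trunc r (d + 1) R) ∈ K := fun i ↦ by
    rw [← h.map_z]
    refine Ideal.mem_map_of_mem _ ?_
    rw [h.ker_eq]; exact Ideal.subset_span ⟨i, rfl⟩
  have hfφ : φ f ∈ (RingHom.ker ρ * I ^ d).map φ := by
    rw [Ideal.map_mul, Ideal.map_pow, ← hK]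
    obtain ⟨p, hp⟩ := Trunc.mk_surjective (φ f)
    rw [← hp, Trunc.mk_eq_sum]
    refine Ideal.sum_mem _ fun α _ ↦ ?_
    by_cases h0 : α = 0
    · have h1 := h.const_eq f
      rw [← hp, Trunc.const_mk, hf0] at h1
      have h2 : p.coeff α = 0 := by rw [h0]; exact h1
      rw [h2, map_zero, zero_mul]
      exact zero_mem _
    have hpos : α.degree ≠ 0 := by rwa [Ne, Finsupp.degree_eq_zero_iff]
    have hprod : (∏ i, Trunc.X i ^ α i : Trunc r (d + 1) R) ∈
        K * I.map φ ^ (α.degree - 1) := by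
      have h1 : (∏ i, Trunc.X i ^ α i : Trunc r (d + 1) R) ∈ K ^ α.degree := by
        rw [Finsupp.degree_eq_sum, ← Finset.prod_pow_eq_pow_sum]
        exact Ideal.prod_mem_prod fun i _ ↦ Ideal.pow_mem_pow (hX i) _
      rw [show α.degree = α.degree - 1 + 1 by omega, pow_succ'] at h1
      exact Ideal.mul_mono_right (Ideal.pow_right_mono hKI _) h1
    have hco : (Trunc.C (p.coeff α) : Trunc r (d + 1) R) ∈ I.map φ ^ (d + 1 - α.degree) := by
      by_cases hα : α.degree < d + 1
      · have h1 := hcoef α hα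
        rw [← hp, Trunc.coeff_mk hα] at h1
        have h2 := Ideal.mem_map_of_mem (Trunc.C : R →+* Trunc r (d + 1) R) h1
        rw [Ideal.map_pow] at h2
        exact Ideal.pow_right_mono (h.map_C_le I hI) _ h2
      · rw [show d + 1 - α.degree = 0 by omega]; simp
    have h3 := Ideal.mul_mem_mul hprod hco
    rw [mul_assoc, ← pow_add, mul_comm (∏ i, _ : Trunc r (d + 1) R)] at h3
    have h4 : d ≤ α.degree - 1 + (d + 1 - α.degree) := by omega
    exact Ideal.mul_mono_right (Ideal.pow_le_pow_right h4) h3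
  rw [Ideal.mem_map_iff_of_surjective _ h.surjective_taylor] at hfφ
  obtain ⟨g, hg, hgf⟩ := hfφ
  have h1 : f - g ∈ RingHom.ker ρ * I ^ d := by
    have h0 : φ (f - g) = 0 := (map_sub φ f g).trans (sub_eq_zero.mpr hgf.symm)
    have h2 : f - g ∈ RingHom.ker ρ ^ (d + 1) := h.ker_le h0
    rw [pow_succ'] at h2
    exact Ideal.mul_mono_right (Ideal.pow_right_mono hI d) h2
  simpa using add_mem h1 hg

/-- The strict transform of the closed subscheme defined by the kernel of `ρ`. -/
lemma map_mul_strict_eq {π : A →+* A'} {ρ : A →+* R} {I : Ideal A} {h : A} {S : Ideal A'}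
    [IsDomain A] [IsDomain R] [IsLocalRing A']
    (hlift : HasBlowupLift π (RingHom.id A') I) (hh : h ∈ I) (hn : π h ∈ nonZeroDivisors A')
    (hI : I.map π = Ideal.span {π h}) (hρ : RingHom.ker ρ ≤ I)
    (htaylor : ∀ d, RingHom.ker ρ ⊓ I ^ (d + 1) ≤ RingHom.ker ρ * I ^ d)
    (hS : ∀ a, a ∈ S ↔ ∃ n : ℕ, π h ^ n * a ∈ (RingHom.ker ρ).map π) :
    I.map π * S = (RingHom.ker ρ).map π := by
  obtain ⟨hinj, hfrac⟩ := hlift.exists_fraction hh hn hI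
  have hden : ∀ a ∈ (RingHom.ker ρ).map π, ∃ (s : ℕ) (f g : A), f ∈ RingHom.ker ρ ∧
      IsDenominator π I h s g ∧ π g * a = π f := by
    intro a ha
    induction ha using Submodule.span_induction with
    | zero => exact ⟨0, 0, 1, zero_mem _, isDenominator_one, by simp⟩
    | mem a ha =>
      obtain ⟨f, hf, rfl⟩ := ha
      exact ⟨0, f, 1, hf, isDenominator_one, by simp⟩
    | add a a' _ _ iha iha' =>
      obtain ⟨s, f, g, hf, hg, e⟩ := iha
      obtain ⟨s', f', g', hf', hg', e'⟩ := iha'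
      refine ⟨s + s', f * g' + f' * g, g * g', ?_, hg.mul hg', ?_⟩
      · exact add_mem (Ideal.mul_mem_right _ _ hf) (Ideal.mul_mem_right _ _ hf')
      · rw [map_add, map_mul, map_mul, map_mul, ← e, ← e']; ring
    | smul c a _ iha =>
      obtain ⟨s, f, g, hf, hg, e⟩ := iha
      obtain ⟨s', f', g', hf', hg', e'⟩ := hfrac c
      refine ⟨s + s', f * f', g * g', Ideal.mul_mem_right _ _ hf, hg.mul hg', ?_⟩
      rw [smul_eq_mul, map_mul, map_mul, ← e, ← e']; ring
  -- A fraction whose numerator lies in `ker ρ ∩ Iˢ`. By `htaylor`, `h` times the numerator lies in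
  -- `ker ρ · Iˢ`, and dividing by `hˢ` leaves an element of the extended kernel.
  have hcan : ∀ (s : ℕ) (f : A) (a u : A'), IsUnit u → f ∈ RingHom.ker ρ → f ∈ I ^ s →
      π f = u * π h ^ s * a → π h * a ∈ (RingHom.ker ρ).map π := by
    intro s f a u hu hf hfs e
    have h1 : f * h ∈ RingHom.ker ρ * I ^ s := htaylor s
      ⟨Ideal.mul_mem_right _ _ hf, by rw [pow_succ]; exact Ideal.mul_mem_mul hfs hh⟩
    have h2 := Ideal.mem_map_of_mem π h1
    rw [Ideal.map_mul, Ideal.map_pow, hI, Ideal.span_singleton_pow, mul_comm] at h2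
    obtain ⟨c, hc, e'⟩ := Ideal.mem_span_singleton_mul.mp h2
    refine (Ideal.unit_mul_mem_iff_mem _ hu).mp ?_
    have : u * (π h * a) = c := by
      refine (mul_cancel_left_mem_nonZeroDivisors (pow_mem hn s)).mp ?_
      rw [e', map_mul, e]; ring
    rwa [this]
  refine le_antisymm ?_ ?_
  · rw [hI]
    intro _ ht
    obtain ⟨a, ha, rfl⟩ := Ideal.mem_span_singleton_mul.mp ht
    obtain ⟨n, hn'⟩ := (hS a).mp ha
    obtain ⟨s, f, g, hf, ⟨hgI, u, hu, hgu⟩, e⟩ := hden _ hn'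
    obtain ⟨s₁, f₁, g₁, hf₁, ⟨hg₁I, u₁, hu₁, hgu₁⟩, e₁⟩ := hfrac a
    -- Clearing denominators gives an equation in `A`. Since `ker ρ` is prime, one of `g`, `h` and
    -- the numerator `f₁` of `a` belongs to it, and each case gives `h a` in the extended kernel.
    have h1 : g * h ^ n * f₁ = g₁ * f := hinj (by
      rw [map_mul, map_mul, map_mul, map_pow, ← e, ← e₁]; ring)
    have h2 : g * h ^ n * f₁ ∈ RingHom.ker ρ := by
      rw [h1]; exact Ideal.mul_mem_left _ _ hf
    have hprime : (RingHom.ker ρ).IsPrime := RingHom.ker_isPrime ρ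
    rcases hprime.mem_or_mem h2 with h3 | h3
    · rcases hprime.mem_or_mem h3 with h4 | h4
      · refine Ideal.mul_mem_right _ _ ?_
        have := hcan s g 1 u hu h4 hgI (by rw [hgu, mul_one])
        rwa [mul_one] at this
      · exact Ideal.mul_mem_right _ _ (Ideal.mem_map_of_mem _ (hprime.mem_of_pow_mem _ h4))
    · exact hcan s₁ f₁ a u₁ hu₁ h3 hf₁ (by rw [← e₁, hgu₁])
  · rw [Ideal.map_le_iff_le_comap]
    intro z hz
    have h1 := Ideal.mem_map_of_mem π (hρ hz)
    rw [hI] at h1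
    obtain ⟨c, hc⟩ := Ideal.mem_span_singleton'.mp h1
    rw [Ideal.mem_comap, ← hc, mul_comm c, hI]
    refine Ideal.mul_mem_mul (Ideal.mem_span_singleton_self _) ((hS c).mpr ⟨1, ?_⟩)
    rw [pow_one, mul_comm, hc]
    exact Ideal.mem_map_of_mem _ hz

end Strict

end Resolution
end

noncomputable section
namespace Resolution

/-! ### Smoothness of blow-ups -/

section Chart

open MvPolynomial

variable {k A A' : Type u} [CommRing k] [CommRing A] [CommRing A'] [Algebra k A] [Algebra k A']

/-- The relations `x_{i₀} T_i = x_i`, `T_{i₀} = 1` of an affine chart of a blow-up. -/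
def chartIdeal {n : ℕ} (x : Fin n → A) (i₀ : Fin n) : Ideal (MvPolynomial (Fin n) A) :=
  Ideal.span (Set.range fun i ↦ C (x i₀) * X i - C (x i)) ⊔ Ideal.span {X i₀ - 1}

variable {n : ℕ} {x : Fin n → A} {D : Fin n → Derivation k A A} {i₀ : Fin n}

lemma chartIdeal_le_ker {B : Type*} [CommRing B] (f : MvPolynomial (Fin n) A →+* B)
    (h1 : ∀ i, f (C (x i₀)) * f (X i) = f (C (x i))) (h2 : f (X i₀) = 1) :
    ∀ p ∈ chartIdeal x i₀, f p = 0 := by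
  have : chartIdeal x i₀ ≤ RingHom.ker f := by
    refine sup_le (Ideal.span_le.mpr ?_) (Ideal.span_le.mpr ?_)
    · rintro _ ⟨i, rfl⟩
      simp [RingHom.mem_ker, h1]
    · rintro _ rfl
      simp [RingHom.mem_ker, h2]
  exact fun p hp ↦ this hp

/-- To lift a map of the chart along `B → B/N`, choose lifts `η` of `x_{i₀}` and `sᵢ` of `Tᵢ`, with
`s_{i₀} = 1`. The dual derivations allow the map on `A` to be lifted with `xᵢ ↦ η sᵢ`, so the
relations of the chart hold on the nose. -/
lemma chart_formallySmooth [Algebra.FormallySmooth k A]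
    (hD : ∀ i j, D i (x j) = if i = j then 1 else 0) (i₀ : Fin n) :
    Algebra.FormallySmooth k (MvPolynomial (Fin n) A ⧸ chartIdeal x i₀) := by
  refine Algebra.FormallySmooth.of_comp_surjective fun B _ _ N hN g ↦ ?_
  let q : MvPolynomial (Fin n) A →+* MvPolynomial (Fin n) A ⧸ chartIdeal x i₀ :=
    Ideal.Quotient.mk (chartIdeal x i₀)
  have hq : ∀ i, q (C (x i₀)) * q (X i) = q (C (x i)) := fun i ↦ by
    rw [← map_mul]
    exact Ideal.Quotient.eq.mpr (Ideal.mem_sup_left (Ideal.subset_span ⟨i, rfl⟩))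
  have hq' : q (X i₀) = 1 :=
    Ideal.Quotient.eq.mpr (Ideal.mem_sup_right (Ideal.mem_span_singleton_self _))
  have hs : ∀ i, ∃ s : B, Ideal.Quotient.mk N s = g (q (X i)) ∧ (i = i₀ → s = 1) := by
    intro i
    by_cases hi : i = i₀
    · exact ⟨1, by rw [hi, hq', map_one, map_one], fun _ ↦ rfl⟩
    · obtain ⟨s, hs⟩ := Ideal.Quotient.mk_surjective (g (q (X i)))
      exact ⟨s, hs, fun h ↦ absurd h hi⟩
  choose s hs hs' using hs
  obtain ⟨η, hη⟩ := Ideal.Quotient.mk_surjective (g (q (C (x i₀))))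
  let gA : A →ₐ[k] B ⧸ N := g.comp
    ((Ideal.Quotient.mkₐ k (chartIdeal x i₀)).comp (IsScalarTower.toAlgHom k A _))
  obtain ⟨l, hl, hlx⟩ := exists_lift_of_dual hD N hN gA (fun i ↦ η * s i) fun i ↦ by
    rw [map_mul, hη, hs, ← map_mul, hq]; rfl
  have hlx' : l (x i₀) = η := by rw [hlx, hs' i₀ rfl, mul_one]
  let L : MvPolynomial (Fin n) A →+* B := eval₂Hom l.toRingHom s
  have hLC : ∀ a, L (C a) = l a := fun a ↦ eval₂_C _ _ _
  have hLX : ∀ i, L (X i) = s i := fun i ↦ eval₂_X _ _ _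
  have hL : ∀ p ∈ chartIdeal x i₀, L p = 0 := chartIdeal_le_ker L
    (fun i ↦ by rw [hLC, hLX, hLC, hlx', hlx]) (by rw [hLX, hs' i₀ rfl])
  let G : MvPolynomial (Fin n) A ⧸ chartIdeal x i₀ →ₐ[k] B :=
    { Ideal.Quotient.lift (chartIdeal x i₀) L hL with
      commutes' := fun c ↦ (hLC (algebraMap k A c)).trans (l.commutes c) }
  have hG : ∀ p, G (q p) = L p := fun p ↦ rfl
  refine ⟨G, AlgHom.coe_ringHom_injective (Ideal.Quotient.ringHom_ext
    (MvPolynomial.ringHom_ext (fun a ↦ ?_) fun i ↦ ?_))⟩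
  · change Ideal.Quotient.mk N (G (q (C a))) = g (q (C a))
    rw [hG, hLC]
    exact congr($hl a)
  · change Ideal.Quotient.mk N (G (q (X i))) = g (q (X i))
    rw [hG, hLX, hs]

/-- Homogenize with `T_{i₀}`, which equals `1` in the chart. -/
lemma exists_isHomogeneous_chart (x : Fin n → A) (i₀ : Fin n) (p : MvPolynomial (Fin n) A) :
    ∃ d, ∀ e ≥ d, ∃ P : MvPolynomial (Fin n) A, P.IsHomogeneous e ∧
      Ideal.Quotient.mk (chartIdeal x i₀) P = Ideal.Quotient.mk (chartIdeal x i₀) p := by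
  have hq' : Ideal.Quotient.mk (chartIdeal x i₀) (X i₀) = 1 :=
    Ideal.Quotient.eq.mpr (Ideal.mem_sup_right (Ideal.mem_span_singleton_self _))
  induction p using MvPolynomial.induction_on with
  | C a =>
    refine ⟨0, fun e _ ↦ ⟨C a * X i₀ ^ e, ?_, by simp [hq']⟩⟩
    have := (isHomogeneous_C (Fin n) a).mul (isHomogeneous_X_pow (R := A) i₀ e)
    rwa [zero_add] at this
  | add p q hp hq =>
    obtain ⟨d, hd⟩ := hp
    obtain ⟨d', hd'⟩ := hq
    refine ⟨max d d', fun e he ↦ ?_⟩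
    obtain ⟨P, hP, hP'⟩ := hd e (le_trans (le_max_left _ _) he)
    obtain ⟨Q, hQ, hQ'⟩ := hd' e (le_trans (le_max_right _ _) he)
    exact ⟨P + Q, hP.add hQ, by rw [map_add, map_add, hP', hQ']⟩
  | mul_X p i hp =>
    obtain ⟨d, hd⟩ := hp
    refine ⟨d + 1, fun e he ↦ ?_⟩
    obtain ⟨P, hP, hP'⟩ := hd (e - 1) (by omega)
    refine ⟨P * X i, ?_, by rw [map_mul, map_mul, hP']⟩
    have := hP.mul (isHomogeneous_X A i)
    rwa [show e - 1 + 1 = e by omega] at this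

lemma eval_smul_isHomogeneous {B : Type*} [CommRing B] {P : MvPolynomial (Fin n) A} {d : ℕ}
    (hP : P.IsHomogeneous d) (f : A →+* B) (c : B) (t : Fin n → B) :
    eval₂ f (fun i ↦ c * t i) P = c ^ d * eval₂ f t P := by
  rw [eval₂_eq', eval₂_eq', Finset.mul_sum]
  refine Finset.sum_congr rfl fun β hβ ↦ ?_
  have hd : β.degree = d := by
    rw [← hP (mem_support_iff.mp hβ), Finsupp.weight_apply, Finsupp.degree_apply, Finsupp.sum]
    simp
  simp only [mul_pow]
  rw [Finset.prod_mul_distrib, Finset.prod_pow_eq_pow_sum, ← Finsupp.degree_eq_sum, hd]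
  ring

lemma formallySmooth_of_bijective {k A B : Type*} [CommRing k] [CommRing A] [CommRing B]
    [Algebra k A] [Algebra k B] [Algebra.FormallySmooth k A] (f : A →+* B)
    (hf : Function.Bijective f) (hk : ∀ c, f (algebraMap k A c) = algebraMap k B c) :
    Algebra.FormallySmooth k B :=
  Algebra.FormallySmooth.of_equiv
    (AlgEquiv.ofBijective ({ f with commutes' := hk } : A →ₐ[k] B) hf)

/-- `A'` is identified with a localization of the chart. It is a quotient of it because elements of
`A'` are fractions of forms of equal degree in the `xᵢ`, where the powers of `x_{i₀}` cancel. The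
kernel is zero by Nakayama's lemma: a kernel element comes from a form `P` with `P(x) = 0`,
quasi-regularity puts its coefficients into the ideal of the center, so it is divisible by `x_{i₀}`,
with quotient again in the kernel. -/
lemma HasBlowupLift.formallySmooth [IsDomain A] [IsNoetherianRing A] [IsLocalRing A']
    [Algebra.FormallySmooth k A] {π : A →+* A'}
    (hπk : ∀ c, π (algebraMap k A c) = algebraMap k A' c)
    (hD : ∀ i j, D i (x j) = if i = j then 1 else 0)
    (hA : ∀ n : ℕ, n ≠ 0 → IsUnit (n : A))
    (hlift : HasBlowupLift π (RingHom.id A') (Ideal.span (Set.range x)))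
    (hn : π (x i₀) ∈ nonZeroDivisors A')
    (hI : (Ideal.span (Set.range x)).map π = Ideal.span {π (x i₀)})
    (hm : π (x i₀) ∈ IsLocalRing.maximalIdeal A') : Algebra.FormallySmooth k A' := by
  have hxI : ∀ i, x i ∈ Ideal.span (Set.range x) := fun i ↦ Ideal.subset_span ⟨i, rfl⟩
  obtain ⟨hinj, hfrac⟩ := hlift.exists_fraction (hxI i₀) hn hI
  have ht : ∀ i, ∃ t, π (x i₀) * t = π (x i) := fun i ↦ by
    have := Ideal.mem_map_of_mem π (hxI i)
    rw [hI] at this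
    obtain ⟨t, ht⟩ := Ideal.mem_span_singleton'.mp this
    exact ⟨t, by rw [mul_comm, ht]⟩
  choose t ht using ht
  have ht₀ : t i₀ = 1 := (mul_cancel_left_mem_nonZeroDivisors hn).mp (by rw [ht, mul_one])
  let T := MvPolynomial (Fin n) A ⧸ chartIdeal x i₀
  let q : MvPolynomial (Fin n) A →+* T := Ideal.Quotient.mk (chartIdeal x i₀)
  have hq : ∀ i, q (C (x i₀)) * q (X i) = q (C (x i)) := fun i ↦ by
    rw [← map_mul]
    exact Ideal.Quotient.eq.mpr (Ideal.mem_sup_left (Ideal.subset_span ⟨i, rfl⟩))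
  let Θ₀ : MvPolynomial (Fin n) A →+* A' := eval₂Hom π t
  have hΘC : ∀ a, Θ₀ (C a) = π a := fun a ↦ eval₂_C _ _ _
  have hΘX : ∀ i, Θ₀ (X i) = t i := fun i ↦ eval₂_X _ _ _
  let Θ : T →+* A' := Ideal.Quotient.lift (chartIdeal x i₀) Θ₀ (chartIdeal_le_ker Θ₀
    (fun i ↦ by rw [hΘC, hΘX, hΘC, ht]) (by rw [hΘX, ht₀]))
  have hΘq : ∀ p, Θ (q p) = Θ₀ p := fun p ↦ rfl
  have hhom : ∀ {P : MvPolynomial (Fin n) A} {d : ℕ}, P.IsHomogeneous d →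
      π (eval x P) = π (x i₀) ^ d * Θ (q P) := by
    intro P d hP
    have h1 := eval_smul_isHomogeneous hP π (π (x i₀)) t
    simp only [ht] at h1
    rw [hΘq]
    refine Eq.trans ?_ h1
    rw [MvPolynomial.eval, coe_eval₂Hom, hom_eval₂]; rfl
  have hker : RingHom.ker Θ ≤ Ideal.span {q (C (x i₀))} * RingHom.ker Θ := by
    intro a ha
    obtain ⟨p, rfl⟩ := Ideal.Quotient.mk_surjective a
    obtain ⟨d, hd⟩ := exists_isHomogeneous_chart x i₀ p
    obtain ⟨P, hP, hPp⟩ := hd d le_rfl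
    have ha : Θ (q p) = 0 := ha
    have h1 := hhom hP
    have hPp : q P = q p := hPp
    rw [hPp, ha, mul_zero, ← map_zero π] at h1
    have h2 := coeff_mem_of_eval_mem_pow (D := fun i ↦ (D i).restrictScalars ℤ) hD hA hP
      (by rw [hinj h1]; exact zero_mem _)
    have h3 : ∀ c ∈ Ideal.span (Set.range x), q (C c) ∈ Ideal.span {q (C (x i₀))} := by
      intro c hc
      obtain ⟨e, rfl⟩ := Ideal.mem_span_range_iff_exists_fun.mp hc
      rw [map_sum, map_sum]
      refine Ideal.sum_mem _ fun i _ ↦ ?_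
      rw [map_mul, map_mul, ← hq i]
      exact Ideal.mul_mem_left _ _ (Ideal.mul_mem_right _ _ (Ideal.mem_span_singleton_self _))
    have h4 : q P ∈ Ideal.span {q (C (x i₀))} := by
      rw [P.as_sum, map_sum]
      refine Ideal.sum_mem _ fun β _ ↦ ?_
      rw [show (monomial β (P.coeff β)) = C (P.coeff β) * monomial β 1 by
        rw [C_mul_monomial, mul_one], map_mul]
      exact Ideal.mul_mem_right _ _ (h3 _ (h2 β))
    rw [hPp] at h4
    obtain ⟨c, hc⟩ := Ideal.mem_span_singleton'.mp h4
    change q p ∈ _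
    rw [← hc, mul_comm]
    refine Ideal.mul_mem_mul (Ideal.mem_span_singleton_self _) ?_
    rw [RingHom.mem_ker]
    refine (mul_cancel_right_mem_nonZeroDivisors hn).mp ?_
    rw [zero_mul, ← hΘC, ← hΘq, ← map_mul, hc, ha]
  let 𝔭 : Ideal T := (IsLocalRing.maximalIdeal A').comap Θ
  have : 𝔭.IsPrime := Ideal.comap_isPrime _ _
  have hunit : ∀ s : 𝔭.primeCompl, IsUnit (Θ s) := fun s ↦ by
    by_contra h
    exact s.2 h
  obtain ⟨L, _, _, hL⟩ : ∃ (L : Type u) (_ : CommRing L) (_ : Algebra T L),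
      IsLocalization.AtPrime L 𝔭 := ⟨Localization.AtPrime 𝔭, inferInstance, inferInstance,
        inferInstance⟩
  let : Algebra k L := ((algebraMap T L).comp (algebraMap k T)).toAlgebra
  have := IsScalarTower.of_algebraMap_eq (R := k) (S := T) (A := L) fun _ ↦ rfl
  have : IsLocalRing L := IsLocalization.AtPrime.isLocalRing L 𝔭
  have : IsNoetherianRing L := IsLocalization.isNoetherianRing 𝔭.primeCompl L inferInstance
  let θ : L →+* A' := IsLocalization.lift (M := 𝔭.primeCompl) hunit
  have hθ : ∀ a : T, θ (algebraMap T L a) = Θ a := fun a ↦ IsLocalization.lift_eq _ _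
  have hθinj : Function.Injective θ := by
    rw [RingHom.injective_iff_ker_eq_bot]
    have h1 : RingHom.ker θ ≤ Ideal.span {algebraMap T L (q (C (x i₀)))} * RingHom.ker θ := by
      intro a ha
      obtain ⟨b, s, rfl⟩ := IsLocalization.exists_mk'_eq 𝔭.primeCompl a
      have h2 : b ∈ RingHom.ker Θ := by
        have h3 : θ (IsLocalization.mk' L b s * algebraMap T L s) = 0 := by
          rw [map_mul, show θ (IsLocalization.mk' L b s) = 0 from ha, zero_mul]
        rwa [IsLocalization.mk'_spec, hθ] at h3
      obtain ⟨c, hc, e⟩ := Ideal.mem_span_singleton_mul.mp (hker h2)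
      rw [← e, IsLocalization.mk'_eq_mul_mk'_one, map_mul, mul_assoc]
      refine Ideal.mul_mem_mul (Ideal.mem_span_singleton_self _) (Ideal.mul_mem_right _ _ ?_)
      rw [RingHom.mem_ker, hθ]
      exact hc
    refine Submodule.eq_bot_of_le_smul_of_le_jacobson_bot
      (Ideal.span {algebraMap T L (q (C (x i₀)))}) (RingHom.ker θ) (IsNoetherian.noetherian _) h1 ?_
    refine le_trans ?_ (IsLocalRing.maximalIdeal_le_jacobson _)
    rw [Ideal.span_singleton_le_iff_mem]
    refine (IsLocalization.AtPrime.to_map_mem_maximal_iff L 𝔭 _).mpr ?_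
    change Θ (q (C (x i₀))) ∈ IsLocalRing.maximalIdeal A'
    rw [hΘq, hΘC]
    exact hm
  have hθsurj : Function.Surjective θ := by
    intro a
    obtain ⟨s, f, g, hf, ⟨hg, u, hu, hgu⟩, e⟩ := hfrac a
    obtain ⟨F, hF, hFf⟩ := (Ideal.mem_span_pow_iff_exists_isHomogeneous _ _).mp hf
    obtain ⟨G, hG, hGg⟩ := (Ideal.mem_span_pow_iff_exists_isHomogeneous _ _).mp hg
    rw [← hGg] at hgu e
    rw [← hFf] at e
    rw [hhom hG, mul_comm u] at hgu
    have h1 := (mul_cancel_left_mem_nonZeroDivisors (pow_mem hn s)).mp hgu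
    rw [hhom hG, hhom hF, mul_assoc] at e
    have h2 := (mul_cancel_left_mem_nonZeroDivisors (pow_mem hn s)).mp e
    have h3 : q G ∈ 𝔭.primeCompl := fun h ↦ by
      have h4 : Θ (q G) ∈ IsLocalRing.maximalIdeal A' := h
      rw [h1] at h4
      exact h4 hu
    refine ⟨IsLocalization.mk' L (q F) ⟨q G, h3⟩, ?_⟩
    rw [IsLocalization.lift_mk'_spec, ← h2]
  have := chart_formallySmooth (k := k) hD i₀
  have : Algebra.FormallySmooth T L := Algebra.FormallySmooth.of_isLocalization 𝔭.primeCompl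
  have : Algebra.FormallySmooth k L := Algebra.FormallySmooth.comp k T L
  refine formallySmooth_of_bijective θ ⟨hθinj, hθsurj⟩ fun c ↦ ?_
  rw [IsScalarTower.algebraMap_apply k T L, hθ, ← hπk, ← hΘC, ← hΘq]
  rfl

end Chart

end Resolution
end

noncomputable section
namespace Resolution

/-! ### Derivations and blow-ups -/

section DerivationLift

variable {A A' : Type u}

/-- The element `a + c ε` of the ring of dual numbers. -/
def dual (a c : A) : TrivSqZeroExt A A := (a, c)

@[simp] lemma fst_dual (a c : A) : (dual a c).fst = a := rfl

@[simp] lemma snd_dual (a c : A) : (dual a c).snd = c := rfl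

variable [CommRing A] [CommRing A']

lemma TrivSqZeroExt.snd_mul_self (s t : TrivSqZeroExt A A) :
    (s * t).snd = s.fst * t.snd + t.fst * s.snd := by
  rw [TrivSqZeroExt.snd_mul, op_smul_eq_smul, smul_eq_mul, smul_eq_mul]

/-- The derivation `h D` is encoded as the ring map `a ↦ π a + π h · π(D a) ε` into the dual numbers
over `A'`. The factor `h` makes the image of `I` principal, generated by `π h`, so the map extends
to `A'`; its `ε`-part is the lifted derivation. -/
lemma HasBlowupLift.exists_derivation [IsLocalRing A'] {π : A →+* A'} {I : Ideal A} {h : A}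
    (hlift : HasBlowupLift π (RingHom.id A') I) (hh : h ∈ I) (hn : π h ∈ nonZeroDivisors A')
    (hI : I.map π = Ideal.span {π h}) (D : Derivation ℤ A A) :
    ∃ D' : Derivation ℤ A' A', ∀ a, D' (π a) = π h * π (D a) := by
  let c : TrivSqZeroExt A' A' →+* A' := (TrivSqZeroExt.fstHom ℤ A' A').toRingHom
  have hc' : ∀ t, c t = t.fst := fun _ ↦ rfl
  have hc : IsLocalHom c := ⟨fun t ht ↦ TrivSqZeroExt.isUnit_iff_isUnit_fst.mpr ht⟩
  have : IsLocalRing (TrivSqZeroExt A' A') := RingHom.domain_isLocalRing c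
  let ψ : A →+* TrivSqZeroExt A' A' :=
    { toFun := fun a ↦ dual (π a) (π h * π (D a))
      map_one' := TrivSqZeroExt.ext (map_one π) (by simp)
      map_zero' := TrivSqZeroExt.ext (map_zero π) (by simp)
      map_add' := fun a a' ↦ TrivSqZeroExt.ext (map_add π a a') (by
        simp only [snd_dual, TrivSqZeroExt.snd_add, map_add, mul_add])
      map_mul' := fun a a' ↦ TrivSqZeroExt.ext (map_mul π a a') (by
        rw [TrivSqZeroExt.snd_mul_self, snd_dual, snd_dual, snd_dual, fst_dual, fst_dual,
          D.leibniz, smul_eq_mul, smul_eq_mul, map_add, map_mul, map_mul]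
        ring) }
  have hψ : ∀ a, ψ a = dual (π a) (π h * π (D a)) := fun a ↦ rfl
  have hY : I.map ψ = Ideal.span {dual (π h) 0} := by
    refine le_antisymm (Ideal.map_le_iff_le_comap.mpr fun y hy ↦ ?_) ?_
    · have h1 := Ideal.mem_map_of_mem π hy
      rw [hI] at h1
      obtain ⟨d, hd⟩ := Ideal.mem_span_singleton'.mp h1
      refine Ideal.mem_span_singleton'.mpr ⟨dual d (π (D y)), TrivSqZeroExt.ext ?_ ?_⟩
      · exact hd
      · rw [TrivSqZeroExt.snd_mul_self, hψ]
        simp only [snd_dual, fst_dual]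
        ring
    · rw [Ideal.span_singleton_le_iff_mem]
      -- Multiplication by the unit `1 - π(D h) ε` removes the `ε`-part of `ψ h`.
      have h1 : dual 1 (-π (D h)) * ψ h = dual (π h) 0 := by
        refine TrivSqZeroExt.ext (one_mul _) ?_
        rw [TrivSqZeroExt.snd_mul_self, hψ]
        simp only [snd_dual, fst_dual]
        ring
      rw [← h1]
      exact Ideal.mul_mem_left _ _ (Ideal.mem_map_of_mem _ hh)
  have hnz : dual (π h) 0 ∈ nonZeroDivisors (TrivSqZeroExt A' A') := by
    rw [mem_nonZeroDivisors_iff_right]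
    intro t ht
    have e1 : t.fst * π h = 0 := congr_arg TrivSqZeroExt.fst ht
    have e2 := congr_arg TrivSqZeroExt.snd ht
    rw [TrivSqZeroExt.snd_mul_self, snd_dual, fst_dual, mul_zero, zero_add,
      TrivSqZeroExt.snd_zero, mul_comm] at e2
    exact TrivSqZeroExt.ext ((mem_nonZeroDivisors_iff_right.mp hn) _ e1)
      ((mem_nonZeroDivisors_iff_right.mp hn) _ e2)
  obtain ⟨φ, h1, h2⟩ := hlift ψ c (dual (π h) 0) (RingHom.ext fun a ↦ rfl) hnz hn hY
  have hfst : ∀ a, (φ a).fst = a := fun a ↦ congr($h2 a)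
  refine ⟨Derivation.mk' (AddMonoidHom.toIntLinearMap
    ⟨⟨fun a ↦ (φ a).snd, by rw [map_zero, TrivSqZeroExt.snd_zero]⟩, fun a a' ↦ by
      simp only [map_add, TrivSqZeroExt.snd_add]⟩) fun a a' ↦ ?_, fun a ↦ ?_⟩
  · change (φ (a * a')).snd = a * (φ a').snd + a' * (φ a).snd
    rw [map_mul, TrivSqZeroExt.snd_mul_self, hfst, hfst]
  · change (φ (π a)).snd = _
    rw [show φ (π a) = ψ a from congr($h1 a), hψ, snd_dual]

/-- Apply the lift of `h D` to `π f = h^(c+1) g` and cancel one `h`: the result is `h^c` times a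
combination of `g` and a derivative of `g`. A derivation thus costs exactly one exceptional factor.
-/
lemma HasBlowupLift.map_diffIdeal_le [IsLocalRing A'] {π : A →+* A'} {I : Ideal A} {h : A}
    (hlift : HasBlowupLift π (RingHom.id A') I) (hh : h ∈ I) (hn : π h ∈ nonZeroDivisors A')
    (hI : I.map π = Ideal.span {π h}) {J : Ideal A} {J' : Ideal A'} {c : ℕ}
    (hJ : J.map π ≤ Ideal.span {π h} ^ (c + 1) * J') :
    (diffIdeal ℤ J).map π ≤ Ideal.span {π h} ^ c * diffIdeal ℤ J' := by
  rw [Ideal.map_le_iff_le_comap, diffIdeal_le_iff]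
  refine ⟨?_, fun D f hf ↦ ?_⟩
  · rw [← Ideal.map_le_iff_le_comap]
    exact hJ.trans (Ideal.mul_mono (Ideal.pow_le_pow_right (by omega)) (le_diffIdeal _))
  · obtain ⟨D', hD'⟩ := hlift.exists_derivation hh hn hI D
    have h1 := hJ (Ideal.mem_map_of_mem π hf)
    rw [Ideal.span_singleton_pow] at h1
    obtain ⟨g, hg, e⟩ := Ideal.mem_span_singleton_mul.mp h1
    rw [Ideal.mem_comap, Ideal.span_singleton_pow]
    have h2 : π (D f) = π h ^ c * (((c + 1 : ℕ) : A') * π (D h) * g + D' g) := by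
      refine (mul_cancel_left_mem_nonZeroDivisors hn).mp ?_
      rw [← hD', ← e, D'.leibniz, D'.leibniz_pow, hD', smul_eq_mul, smul_eq_mul, nsmul_eq_mul,
        smul_eq_mul, add_tsub_cancel_right]
      ring
    rw [h2]
    refine Ideal.mul_mem_mul (Ideal.mem_span_singleton_self _) (add_mem ?_ ?_)
    · exact Ideal.mul_mem_left _ _ (le_diffIdeal _ hg)
    · exact deriv_mem_diffIdeal _ hg

lemma HasBlowupLift.map_diffIdeal_iterate_le [IsLocalRing A'] {π : A →+* A'} {I : Ideal A} {h : A}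
    (hlift : HasBlowupLift π (RingHom.id A') I) (hh : h ∈ I) (hn : π h ∈ nonZeroDivisors A')
    (hI : I.map π = Ideal.span {π h}) {J : Ideal A} {J' : Ideal A'} {c : ℕ} (i : ℕ)
    (hJ : J.map π ≤ Ideal.span {π h} ^ (c + i) * J') :
    ((diffIdeal ℤ)^[i] J).map π ≤ Ideal.span {π h} ^ c * (diffIdeal ℤ)^[i] J' := by
  induction i generalizing J J' with
  | zero => exact hJ
  | succ i ih =>
    exact ih (hlift.map_diffIdeal_le hh hn hI hJ)

end DerivationLift

end Resolution
end

/-! ### Inverse images, stalks and orders of ideal sheaves -/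

noncomputable section
namespace Resolution

open Scheme.IdealSheafData

/-- Both sides have the same upper bounds `a`: inverse image is adjoint to direct image, and direct
image along a morphism of affine schemes is contraction of ideals. -/
lemma ideal_comap_top_of_isAffine {X Y : Scheme.{u}} [IsAffine X] [IsAffine Y] (f : X ⟶ Y)
    (I : Y.IdealSheafData) :
    (I.comap f).ideal ⟨⊤, isAffineOpen_top X⟩ =
      (I.ideal ⟨⊤, isAffineOpen_top Y⟩).map f.appTop.hom := by
  have key : ∀ a : Ideal Γ(X, ⊤), (I.comap f).ideal ⟨⊤, isAffineOpen_top X⟩ ≤ a ↔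
      (I.ideal ⟨⊤, isAffineOpen_top Y⟩).map f.appTop.hom ≤ a := by
    intro a
    have h1 : (ofIdealTop a).ideal ⟨⊤, isAffineOpen_top X⟩ = a :=
      equivOfIsAffine.apply_symm_apply a
    have h2 : ((ofIdealTop a).map f).ideal ⟨⊤, isAffineOpen_top Y⟩ = a.comap f.appTop.hom := by
      rw [ideal_map_of_isAffineHom]
      exact congrArg (Ideal.comap f.appTop.hom) h1
    rw [Ideal.map_le_iff_le_comap, ← h2]
    conv_lhs => rw [← h1]
    constructor
    · intro h
      exact (le_map_iff_comap_le.mpr (le_of_isAffine h)) _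
    · intro h
      exact (le_map_iff_comap_le.mp (le_of_isAffine h)) _
  exact le_antisymm ((key _).mpr le_rfl) ((key _).mp le_rfl)

lemma ideal_comap_of_isOpenImmersion_le {X Y : Scheme.{u}} (f : X ⟶ Y) [IsOpenImmersion f]
    (I : Y.IdealSheafData) (U : Y.affineOpens) (V : X.affineOpens) (e : V.1 ≤ f ⁻¹ᵁ U.1) :
    (I.comap f).ideal V = (I.ideal U).map (f.appLE U.1 V.1 e).hom := by
  have hle : f ''ᵁ V.1 ≤ U.1 := by
    rintro _ ⟨x, hx, rfl⟩
    exact e hx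
  rw [ideal_comap_eq_map, ← I.map_ideal (U := ⟨f ''ᵁ V.1, V.2.image_of_isOpenImmersion f⟩)
    (V := U) hle]
  change Ideal.map (f.appIso V.1).hom.hom _ = _
  rw [Ideal.map_map, ← CommRingCat.hom_comp]
  congr 2
  rw [Scheme.Hom.appIso_hom', Scheme.Hom.map_appLE]

/-- The map is replaced by its restriction `V → U` between affine schemes, where the previous
computation applies. -/
lemma ideal_comap_of_le {X Y : Scheme.{u}} (f : X ⟶ Y)
    (I : Y.IdealSheafData) (U : Y.affineOpens) (V : X.affineOpens) (e : V.1 ≤ f ⁻¹ᵁ U.1) :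
    (I.comap f).ideal V = (I.ideal U).map (f.appLE U.1 V.1 e).hom := by
  have : IsAffine V.1 := V.2
  have : IsAffine U.1 := U.2
  let T : (V.1.toScheme).affineOpens := ⟨⊤, isAffineOpen_top _⟩
  let T' : (U.1.toScheme).affineOpens := ⟨⊤, isAffineOpen_top _⟩
  have eV : T.1 ≤ V.1.ι ⁻¹ᵁ V.1 := by simp [T]
  have eU : T'.1 ≤ U.1.ι ⁻¹ᵁ U.1 := by simp [T']
  have h1 := ideal_comap_of_isOpenImmersion_le V.1.ι (I.comap f) V T eV
  have hf : V.1.ι ≫ f = f.resLE U.1 V.1 e ≫ U.1.ι := by simp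
  rw [← comap_comp, hf, comap_comp] at h1
  have h2 := ideal_comap_top_of_isAffine (f.resLE U.1 V.1 e) (I.comap U.1.ι)
  rw [ideal_comap_of_isOpenImmersion_le U.1.ι I U T' eU, Ideal.map_map, ← CommRingCat.hom_comp]
    at h2
  have h3 := h1.symm.trans h2
  have h4 : U.1.ι.appLE U.1 T'.1 eU ≫ (f.resLE U.1 V.1 e).appTop =
      f.appLE U.1 V.1 e ≫ V.1.ι.appLE V.1 T.1 eV := by
    change U.1.ι.appLE U.1 T'.1 eU ≫ (f.resLE U.1 V.1 e).app ⊤ = _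
    rw [Scheme.Hom.app_eq_appLE, Scheme.Hom.appLE_comp_appLE, Scheme.Hom.appLE_comp_appLE]
    congr 1
    exact hf.symm
  rw [h4, CommRingCat.hom_comp, ← Ideal.map_map] at h3
  have h5 : IsIso (V.1.ι.appLE V.1 T.1 eV) := by
    have : V.1.ι.appLE V.1 T.1 eV = V.1.topIso.inv := by
      rw [Scheme.Opens.topIso_inv, Scheme.Opens.ι_appLE]
      rfl
    rw [this]
    infer_instance
  have h6 : Function.Bijective (V.1.ι.appLE V.1 T.1 eV).hom :=
    ConcreteCategory.bijective_of_isIso (V.1.ι.appLE V.1 T.1 eV)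
  have := congrArg (Ideal.comap (V.1.ι.appLE V.1 T.1 eV).hom) h3
  rwa [Ideal.comap_map_of_bijective _ h6, Ideal.comap_map_of_bijective _ h6] at this

/-- Two affine neighbourhoods contain a common basic open neighbourhood, so all terms of the
supremum coincide. -/
lemma stalkIdeal_eq {X : Scheme.{u}} (J : X.IdealSheafData) (x : X) (V : X.affineOpens)
    (hx : x ∈ V.1) : stalkIdeal J x = (J.ideal V).map (X.presheaf.germ V.1 x hx).hom := by
  refine le_antisymm (iSup₂_le fun U hU ↦ ?_) (le_iSup₂_of_le V hx le_rfl)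
  obtain ⟨f, g, hfg, hxf⟩ := exists_basicOpen_le_affine_inter U.2 V.2 x ⟨hU, hx⟩
  let B : X.affineOpens := X.affineBasicOpen f
  have hBU : B ≤ U := X.basicOpen_le f
  have hBV : B ≤ V := (hfg.le.trans (X.basicOpen_le g) : X.basicOpen f ≤ V.1)
  have h1 : ∀ (U : X.affineOpens) (hU : x ∈ U.1) (h : B ≤ U),
      (J.ideal U).map (X.presheaf.germ U.1 x hU).hom =
        (J.ideal B).map (X.presheaf.germ B.1 x hxf).hom := by
    intro U hU h
    have e : X.presheaf.map (homOfLE h).op ≫ X.presheaf.germ B.1 x hxf =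
        X.presheaf.germ U.1 x hU := X.presheaf.germ_res (homOfLE h) x hxf
    rw [← J.map_ideal h, Ideal.map_map, ← CommRingCat.hom_comp, e]
  rw [h1 U hU hBU, h1 V hx hBV]

lemma germ_mem_stalkIdeal {X : Scheme.{u}} (J : X.IdealSheafData) {x : X} {V : X.affineOpens}
    (hx : x ∈ V.1) {s : Γ(X, V.1)} (hs : s ∈ J.ideal V) :
    (X.presheaf.germ V.1 x hx).hom s ∈ stalkIdeal J x := by
  rw [stalkIdeal_eq J x V hx]
  exact Ideal.mem_map_of_mem _ hs

lemma exists_affine_mem {X : Scheme.{u}} (x : X) : ∃ V : X.affineOpens, x ∈ V.1 := by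
  obtain ⟨_, ⟨V, hV, rfl⟩, hx, -⟩ := X.isBasis_affineOpens.exists_subset_of_mem_open
    (Set.mem_univ x) isOpen_univ
  exact ⟨⟨V, hV⟩, hx⟩

lemma exists_affine_mem_le {X : Scheme.{u}} (U : X.Opens) (x : X) (hx : x ∈ U) :
    ∃ V : X.affineOpens, x ∈ V.1 ∧ V.1 ≤ U := by
  obtain ⟨_, ⟨V, hV, rfl⟩, hx, h⟩ := X.isBasis_affineOpens.exists_subset_of_mem_open hx U.2
  exact ⟨⟨V, hV⟩, hx, h⟩

lemma le_iff_stalkIdeal {X : Scheme.{u}} {I J : X.IdealSheafData} :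
    I ≤ J ↔ ∀ x, stalkIdeal I x ≤ stalkIdeal J x := by
  constructor
  · exact fun h x ↦ iSup₂_mono fun V hx ↦ Ideal.map_mono (h V)
  · intro h V
    refine V.2.ideal_le_iff.mpr fun x hx ↦ ?_
    rw [← stalkIdeal_eq I x V hx, ← stalkIdeal_eq J x V hx]
    exact h x

lemma ext_stalkIdeal {X : Scheme.{u}} {I J : X.IdealSheafData}
    (h : ∀ x, stalkIdeal I x = stalkIdeal J x) : I = J :=
  le_antisymm (le_iff_stalkIdeal.mpr fun x ↦ (h x).le) (le_iff_stalkIdeal.mpr fun x ↦ (h x).ge)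

@[simp]
lemma stalkIdeal_mul {X : Scheme.{u}} (I J : X.IdealSheafData) (x : X) :
    stalkIdeal (I * J) x = stalkIdeal I x * stalkIdeal J x := by
  obtain ⟨V, hx⟩ := exists_affine_mem x
  rw [stalkIdeal_eq _ x V hx, stalkIdeal_eq _ x V hx, stalkIdeal_eq _ x V hx, ideal_mul,
    Pi.mul_apply, Ideal.map_mul]

@[simp]
lemma stalkIdeal_pow {X : Scheme.{u}} (I : X.IdealSheafData) (x : X) (n : ℕ) :
    stalkIdeal (I ^ n) x = stalkIdeal I x ^ n := by
  obtain ⟨V, hx⟩ := exists_affine_mem x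
  rw [stalkIdeal_eq _ x V hx, stalkIdeal_eq _ x V hx, ideal_pow, Pi.pow_apply, Ideal.map_pow]

@[simp]
lemma stalkIdeal_top {X : Scheme.{u}} (x : X) : stalkIdeal (⊤ : X.IdealSheafData) x = ⊤ := by
  obtain ⟨V, hx⟩ := exists_affine_mem x
  rw [stalkIdeal_eq _ x V hx, ideal_top, Pi.top_apply, Ideal.map_top]

lemma stalkIdeal_comap {X Y : Scheme.{u}} (f : X ⟶ Y) (I : Y.IdealSheafData) (x : X) :
    stalkIdeal (I.comap f) x = (stalkIdeal I (f x)).map (f.stalkMap x).hom := by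
  obtain ⟨U, hU⟩ := exists_affine_mem (f x)
  obtain ⟨V, hV, hVU⟩ := exists_affine_mem_le (f ⁻¹ᵁ U.1) x hU
  rw [stalkIdeal_eq _ x V hV, stalkIdeal_eq _ _ U hU, ideal_comap_of_le f I U V hVU,
    Ideal.map_map, Ideal.map_map, ← CommRingCat.hom_comp, ← CommRingCat.hom_comp,
    Scheme.Hom.germ_stalkMap]
  congr 2
  rw [Scheme.Hom.appLE, Category.assoc, X.presheaf.germ_res]

lemma mem_support_iff_stalkIdeal {X : Scheme.{u}} (I : X.IdealSheafData) (x : X) :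
    x ∈ I.support ↔ stalkIdeal I x ≠ ⊤ := by
  obtain ⟨V, hx⟩ := exists_affine_mem x
  rw [mem_support_iff_of_mem hx, stalkIdeal_eq I x V hx]
  constructor
  · intro h htop
    have hle : (I.ideal V).map (X.presheaf.germ V.1 x hx).hom ≤
        IsLocalRing.maximalIdeal (X.presheaf.stalk x) := by
      rw [Ideal.map_le_iff_le_comap]
      intro s hs
      rw [Ideal.mem_comap, IsLocalRing.mem_maximalIdeal, mem_nonunits_iff]
      intro hu
      rw [Scheme.mem_zeroLocus_iff] at h
      exact h s hs ((X.mem_basicOpen s x hx).mpr hu)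
    exact (IsLocalRing.maximalIdeal.isMaximal _).ne_top (top_le_iff.mp (htop ▸ hle))
  · intro h
    rw [Scheme.mem_zeroLocus_iff]
    intro s hs hxs
    exact h (Ideal.eq_top_of_isUnit_mem _ (Ideal.mem_map_of_mem _ hs)
      ((X.mem_basicOpen s x hx).mp hxs))

lemma mem_support_iff_stalkIdeal_le {X : Scheme.{u}} (I : X.IdealSheafData) (x : X) :
    x ∈ I.support ↔ stalkIdeal I x ≤ IsLocalRing.maximalIdeal (X.presheaf.stalk x) := by
  rw [mem_support_iff_stalkIdeal]
  exact ⟨IsLocalRing.le_maximalIdeal, fun h h' ↦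
    (IsLocalRing.maximalIdeal.isMaximal _).ne_top (top_le_iff.mp (h' ▸ h))⟩

lemma le_ord_iff {X : Scheme.{u}} (J : X.IdealSheafData) (x : X) (n : ℕ) :
    (n : ℕ∞) ≤ ord J x ↔
      stalkIdeal J x ≤ IsLocalRing.maximalIdeal (X.presheaf.stalk x) ^ n := by
  refine ⟨fun h ↦ ?_, fun h ↦ le_iSup₂_of_le n h le_rfl⟩
  by_contra hn
  have : ord J x ≤ ((n - 1 : ℕ) : ℕ∞) := by
    refine iSup₂_le fun m hm ↦ ?_
    by_contra! hlt
    have hlt' : n - 1 < m := by exact_mod_cast hlt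
    exact hn (hm.trans (Ideal.pow_le_pow_right (by omega)))
  have h2 : n ≤ n - 1 := by exact_mod_cast h.trans this
  have h3 : n = 0 := by omega
  subst h3
  exact hn (by simp)

lemma mem_Sing_iff {k : Type u} [Field k] (A : Couple k) (x : A.W) :
    x ∈ A.Sing ↔ stalkIdeal A.J x ≤ IsLocalRing.maximalIdeal (A.W.presheaf.stalk x) ^ A.b :=
  le_ord_iff A.J x A.b

/-- A section whose germ dies on `Z` is killed by a section `u` of `Z` that does not vanish at the
point. Closed immersions are surjective on affine sections, so `u` lifts to `v`, which is a unit at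
the point, and `v s` lies in the kernel. -/
lemma stalkIdeal_ker {Z X : Scheme.{u}} (i : Z ⟶ X) [IsClosedImmersion i] (z : Z) :
    stalkIdeal i.ker (i z) = RingHom.ker (i.stalkMap z).hom := by
  obtain ⟨V, hV⟩ := exists_affine_mem (i z)
  rw [stalkIdeal_eq _ _ V hV, Scheme.Hom.ker_apply]
  have hcomm : X.presheaf.germ V.1 (i z) hV ≫ i.stalkMap z =
      i.app V.1 ≫ Z.presheaf.germ (i ⁻¹ᵁ V.1) z hV := Scheme.Hom.germ_stalkMap i V.1 z hV
  apply le_antisymm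
  · rw [Ideal.map_le_iff_le_comap]
    intro s hs
    rw [Ideal.mem_comap, RingHom.mem_ker, ← CommRingCat.comp_apply, hcomm, CommRingCat.comp_apply,
      RingHom.mem_ker.mp hs, map_zero]
  · intro a ha
    let := X.presheaf.algebra_section_stalk (U := V.1) ⟨i z, hV⟩
    have hloc := V.2.isLocalization_stalk ⟨i z, hV⟩
    obtain ⟨s, t, rfl⟩ := IsLocalization.exists_mk'_eq
      (V.2.primeIdealOf ⟨i z, hV⟩).asIdeal.primeCompl a
    have hs : (i.stalkMap z).hom ((X.presheaf.germ V.1 (i z) hV).hom s) = 0 := by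
      have h1 := IsLocalization.mk'_spec (X.presheaf.stalk (i z)) s t
      have h2 := congrArg (i.stalkMap z).hom h1
      rw [map_mul, RingHom.mem_ker.mp ha, zero_mul] at h2
      exact h2.symm
    rw [← CommRingCat.comp_apply, hcomm, CommRingCat.comp_apply] at hs
    have hZ : IsAffineOpen (i ⁻¹ᵁ V.1) := V.2.preimage i
    let := Z.presheaf.algebra_section_stalk (U := i ⁻¹ᵁ V.1) ⟨z, hV⟩
    have hlocZ := hZ.isLocalization_stalk ⟨z, hV⟩
    obtain ⟨u, hu⟩ := (IsLocalization.map_eq_zero_iff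
      (hZ.primeIdealOf ⟨z, hV⟩).asIdeal.primeCompl (Z.presheaf.stalk z) _).mp hs
    obtain ⟨v, hv⟩ := i.app_surjective V.1 V.2 u.1
    have hvs : v * s ∈ RingHom.ker (i.app V.1).hom := by
      rw [RingHom.mem_ker, map_mul]
      exact (congrArg (· * _) hv).trans hu
    have hvu : IsUnit ((X.presheaf.germ V.1 (i z) hV).hom v) := by
      have h3 : IsUnit ((i.stalkMap z).hom ((X.presheaf.germ V.1 (i z) hV).hom v)) := by
        rw [← CommRingCat.comp_apply, hcomm, CommRingCat.comp_apply]
        have := IsLocalization.map_units (Z.presheaf.stalk z) u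
        rw [← hv] at this
        exact this
      exact (isUnit_map_iff (i.stalkMap z).hom _).mp h3
    have h4 : (X.presheaf.germ V.1 (i z) hV).hom s ∈
        (RingHom.ker (i.app V.1).hom).map (X.presheaf.germ V.1 (i z) hV).hom := by
      have h5 := Ideal.mem_map_of_mem (X.presheaf.germ V.1 (i z) hV).hom hvs
      rw [map_mul] at h5
      exact (Ideal.unit_mul_mem_iff_mem _ hvu).mp h5
    rw [IsLocalization.mk'_eq_mul_mk'_one]
    exact Ideal.mul_mem_right _ _ h4

lemma stalkIdeal_ker_eq_top {Z X : Scheme.{u}} (i : Z ⟶ X) [IsClosedImmersion i] (x : X)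
    (hx : x ∉ Set.range i) : stalkIdeal i.ker x = ⊤ := by
  by_contra h
  have h1 := (mem_support_iff_stalkIdeal i.ker x).mpr h
  have h2 : (i.ker.support : Set X) = closure (Set.range i) := Scheme.Hom.support_ker i
  rw [i.isClosedEmbedding.isClosed_range.closure_eq] at h2
  exact hx (h2 ▸ h1)

/-- An effective Cartier divisor is generated by a nonzerodivisor at every point. -/
lemma IsEffectiveCartier.exists_stalkIdeal_eq {X : Scheme.{u}} {I : X.IdealSheafData}
    (h : IsEffectiveCartier I) (x : X) :
    ∃ e ∈ nonZeroDivisors (X.presheaf.stalk x), stalkIdeal I x = Ideal.span {e} := by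
  obtain ⟨V, hx, f, hf, hI⟩ := h x
  let := X.presheaf.algebra_section_stalk (U := V.1) ⟨x, hx⟩
  have hloc := V.2.isLocalization_stalk ⟨x, hx⟩
  refine ⟨(X.presheaf.germ V.1 x hx).hom f, ?_, ?_⟩
  · exact IsLocalization.map_nonZeroDivisors_le
      (V.2.primeIdealOf ⟨x, hx⟩).asIdeal.primeCompl _ (Submonoid.mem_map_of_mem _ hf)
  · rw [stalkIdeal_eq I x V hx, hI, Ideal.map_span, Set.image_singleton]

end Resolution
end

noncomputable section
namespace Resolution

open Scheme.IdealSheafData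

/-! ### Cartier divisors and stalks -/

open scoped Classical in
lemma exists_notMem_smul_le {A L : Type*} [CommRing A] [CommRing L] [Algebra A L]
    (𝔭 : Ideal A) [𝔭.IsPrime] [IsLocalization.AtPrime L 𝔭] {N M : Ideal A} (hN : N.FG)
    (h : N ≤ (M.map (algebraMap A L)).comap (algebraMap A L)) :
    ∃ t ∉ 𝔭, ∀ a ∈ N, t * a ∈ M := by
  obtain ⟨S, rfl⟩ := hN
  have h1 : ∀ a ∈ S, ∃ t ∉ 𝔭, t * a ∈ M := by
    intro a ha
    have h2 : algebraMap A L a ∈ M.map (algebraMap A L) := h (Ideal.subset_span ha)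
    obtain ⟨t, ht, h3⟩ := (IsLocalization.algebraMap_mem_map_algebraMap_iff 𝔭.primeCompl L _ _).mp h2
    exact ⟨t, ht, h3⟩
  choose! t ht htM using h1
  refine ⟨∏ a ∈ S, t a, ?_, ?_⟩
  · intro h2
    obtain ⟨a, ha, h3⟩ := (Ideal.IsPrime.prod_mem_iff (hp := ‹𝔭.IsPrime›)).mp h2
    exact ht a ha h3
  · intro a ha
    induction ha using Submodule.span_induction with
    | mem a ha =>
      rw [← Finset.prod_erase_mul S t ha, mul_assoc]
      exact M.mul_mem_left _ (htM a ha)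
    | zero => simp
    | add a b _ _ h1 h2 => rw [mul_add]; exact add_mem h1 h2
    | smul c a _ h1 => rw [smul_eq_mul, mul_left_comm]; exact M.mul_mem_left _ h1

/-- Spreading out: that `a` generates `I` and has no annihilator are statements on finitely
generated ideals at `𝔭`, so they hold after inverting one element for each. -/
lemma exists_away_eq_span {A : Type*} {L : Type*} [CommRing A] [IsNoetherianRing A] [CommRing L]
    [IsLocalRing L] [Algebra A L] (𝔭 : Ideal A) [𝔭.IsPrime] [IsLocalization.AtPrime L 𝔭]
    (I : Ideal A) {e : L} (he : e ∈ nonZeroDivisors L)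
    (hI : I.map (algebraMap A L) = Ideal.span {e}) :
    ∃ g ∉ 𝔭, ∃ a : A, ∀ (B : Type _) [CommRing B] [Algebra A B] [IsLocalization.Away g B],
      algebraMap A B a ∈ nonZeroDivisors B ∧
        I.map (algebraMap A B) = Ideal.span {algebraMap A B a} := by
  obtain ⟨a, ha, hae⟩ := exists_mem_span_singleton_eq _ _ he hI
  have hgen : I.map (algebraMap A L) = (Ideal.span {a}).map (algebraMap A L) := by
    rw [Ideal.map_span, Set.image_singleton]
    exact hI.trans hae.symm
  obtain ⟨t, ht, htI⟩ := exists_notMem_smul_le (L := L) 𝔭 (M := Ideal.span {a})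
    (IsNoetherian.noetherian I) (Ideal.map_le_iff_le_comap.mp hgen.le)
  let N : Ideal A := LinearMap.ker (LinearMap.mulLeft A a)
  have hN : ∀ s, s ∈ N ↔ a * s = 0 := fun s ↦ by simp [N]
  have hanz : algebraMap A L a ∈ nonZeroDivisors L := mem_nonZeroDivisors_of_span_eq he hae
  obtain ⟨t', ht', htN⟩ := exists_notMem_smul_le (L := L) 𝔭 (N := N) (M := ⊥)
    (IsNoetherian.noetherian N) (by
      intro s hs
      have h1 := congrArg (algebraMap A L) ((hN s).mp hs)
      rw [map_mul, map_zero] at h1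
      rw [Ideal.mem_comap, Ideal.map_bot]
      exact (mul_right_mem_nonZeroDivisors_eq_zero_iff hanz).mp (by rwa [mul_comm] at h1))
  refine ⟨t * t', 𝔭.primeCompl.mul_mem ht ht', a, fun B _ _ hB ↦ ?_⟩
  have hu : IsUnit (algebraMap A B (t * t')) := IsLocalization.Away.algebraMap_isUnit (t * t')
  have hut : IsUnit (algebraMap A B t) ∧ IsUnit (algebraMap A B t') := by
    rwa [map_mul, IsUnit.mul_iff] at hu
  constructor
  · rw [mem_nonZeroDivisors_iff_right]
    intro c hc
    obtain ⟨s, m, rfl⟩ := IsLocalization.exists_mk'_eq (Submonoid.powers (t * t')) c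
    have h1 : algebraMap A B (s * a) = 0 := by
      rw [map_mul, ← IsLocalization.mk'_spec B s m, mul_right_comm, hc, zero_mul]
    obtain ⟨⟨_, n, rfl⟩, hn⟩ :=
      (IsLocalization.map_eq_zero_iff (Submonoid.powers (t * t')) B _).mp h1
    have h2 : (t * t') ^ n * s ∈ N := by
      rw [hN, ← hn]
      ring
    have h3 := htN _ h2
    rw [Ideal.mem_bot] at h3
    have h4 := congrArg (algebraMap A B) h3
    rw [map_mul, map_mul, map_zero, hut.2.mul_right_eq_zero, map_pow,
      (hu.pow n).mul_right_eq_zero] at h4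
    exact (IsLocalization.mk'_eq_zero_iff s m).mpr
      ((IsLocalization.map_eq_zero_iff (Submonoid.powers (t * t')) B s).mp h4)
  · apply le_antisymm
    · rw [Ideal.map_le_iff_le_comap]
      intro s hs
      have h1 := Ideal.mem_map_of_mem (algebraMap A B) (htI s hs)
      rw [Ideal.map_span, Set.image_singleton, map_mul, Ideal.unit_mul_mem_iff_mem _ hut.1] at h1
      exact h1
    · rw [Ideal.span_singleton_le_iff_mem]
      exact Ideal.mem_map_of_mem _ ha

/-- On a locally noetherian scheme, an ideal sheaf whose stalks are generated by a nonzerodivisor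
is an effective Cartier divisor. -/
lemma isEffectiveCartier_of_stalk {X : Scheme.{u}} [IsLocallyNoetherian X]
    {I : X.IdealSheafData} (h : ∀ x, ∃ e ∈ nonZeroDivisors (X.presheaf.stalk x),
      stalkIdeal I x = Ideal.span {e}) : IsEffectiveCartier I := by
  intro x
  obtain ⟨V, hx⟩ := exists_affine_mem x
  have hnoeth : IsNoetherianRing Γ(X, V.1) := IsLocallyNoetherian.component_noetherian V
  obtain ⟨e, he, hIe⟩ := h x
  rw [stalkIdeal_eq I x V hx] at hIe
  let := X.presheaf.algebra_section_stalk (U := V.1) ⟨x, hx⟩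
  have hloc := V.2.isLocalization_stalk ⟨x, hx⟩
  obtain ⟨g, hg, a, ha⟩ := exists_away_eq_span (L := X.presheaf.stalk x)
    (V.2.primeIdealOf ⟨x, hx⟩).asIdeal (I.ideal V) he hIe
  have hgx : x ∈ X.basicOpen g := by
    rw [X.mem_basicOpen g x hx]
    exact IsLocalization.map_units (X.presheaf.stalk x)
      (⟨g, hg⟩ : (V.2.primeIdealOf ⟨x, hx⟩).asIdeal.primeCompl)
  have hlocg := V.2.isLocalization_basicOpen g
  obtain ⟨h1, h2⟩ := ha Γ(X, X.basicOpen g)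
  exact ⟨X.affineBasicOpen g, hgx, _, h1, (I.map_ideal_basicOpen V g).symm.trans h2⟩

/-! ### The stalks of strict transforms -/

/-- The algebra of scheme-theoretic closures: contraction from `A_f` is saturation by powers of `f`,
and saturation commutes with localization. Any generator `e` of the ideal of `f` in `L` may be used
instead of `f`. -/
lemma mem_map_comap_away_iff {A B L : Type*} [CommRing A] [CommRing B] [CommRing L] [Algebra A B]
    [Algebra A L] (𝔭 : Ideal A) [𝔭.IsPrime] [IsLocalization.AtPrime L 𝔭] (f : A)
    [IsLocalization.Away f B] (K : Ideal A) {e : L} (he : Ideal.span {e} =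
      Ideal.span {algebraMap A L f}) (a : L) :
    a ∈ ((K.map (algebraMap A B)).comap (algebraMap A B)).map (algebraMap A L) ↔
      ∃ n : ℕ, e ^ n * a ∈ K.map (algebraMap A L) := by
  have hM : ∀ s, s ∈ (K.map (algebraMap A B)).comap (algebraMap A B) ↔
      ∃ n : ℕ, f ^ n * s ∈ K := by
    intro s
    rw [Ideal.mem_comap,
      IsLocalization.algebraMap_mem_map_algebraMap_iff (Submonoid.powers f) B K s]
    constructor
    · rintro ⟨_, ⟨n, rfl⟩, h⟩
      exact ⟨n, h⟩
    · rintro ⟨n, h⟩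
      exact ⟨_, ⟨n, rfl⟩, h⟩
  have hswap : (∃ n : ℕ, e ^ n * a ∈ K.map (algebraMap A L)) ↔
      ∃ n : ℕ, algebraMap A L f ^ n * a ∈ K.map (algebraMap A L) := by
    obtain ⟨c, hc⟩ := Ideal.mem_span_singleton'.mp (he ▸ Ideal.mem_span_singleton_self e)
    obtain ⟨d, hd⟩ := Ideal.mem_span_singleton'.mp
      (he ▸ Ideal.mem_span_singleton_self (algebraMap A L f))
    constructor
    · rintro ⟨n, h⟩
      refine ⟨n, ?_⟩
      rw [← hd, mul_pow, mul_assoc]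
      exact Ideal.mul_mem_left _ _ h
    · rintro ⟨n, h⟩
      refine ⟨n, ?_⟩
      rw [← hc, mul_pow, mul_assoc]
      exact Ideal.mul_mem_left _ _ h
  have hmem : ∀ (N : Ideal A) (s : A), algebraMap A L s ∈ N.map (algebraMap A L) ↔
      ∃ t ∉ 𝔭, t * s ∈ N := by
    intro N s
    rw [IsLocalization.algebraMap_mem_map_algebraMap_iff 𝔭.primeCompl]
    rfl
  obtain ⟨s, t, rfl⟩ := IsLocalization.exists_mk'_eq 𝔭.primeCompl a
  have hmk : ∀ (N : Ideal A) (c : L),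
      c * IsLocalization.mk' L s t ∈ N.map (algebraMap A L) ↔
        c * algebraMap A L s ∈ N.map (algebraMap A L) := by
    intro N c
    rw [← IsLocalization.mk'_spec L s t, ← mul_assoc,
      Ideal.mul_unit_mem_iff_mem _ (IsLocalization.map_units _ t)]
  rw [hswap, ← one_mul (IsLocalization.mk' L s t), hmk, one_mul, hmem]
  simp only [one_mul, hmk, ← map_pow, ← map_mul, hmem, hM]
  constructor
  · rintro ⟨t, ht, n, h⟩
    exact ⟨n, t, ht, by rwa [mul_left_comm] at h⟩
  · rintro ⟨n, t, ht, h⟩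
    exact ⟨t, ht, n, by rwa [mul_left_comm] at h⟩

/-- Where the Cartier divisor `E` is defined by `f`, the complement of its support is the basic open
subset of `f`. The closure from there is therefore a contraction from the localization at `f`. -/
lemma mem_stalkIdeal_map_comap {X : Scheme.{u}} [IsLocallyNoetherian X]
    {E : X.IdealSheafData} (hE : IsEffectiveCartier E) (K : X.IdealSheafData) (x : X)
    {e : X.presheaf.stalk x} (he : stalkIdeal E x = Ideal.span {e}) (a : X.presheaf.stalk x)
    {U : X.Opens} (hUE : U = E.support.compl) :
    a ∈ stalkIdeal ((K.comap U.ι).map U.ι) x ↔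
      ∃ n : ℕ, e ^ n * a ∈ stalkIdeal K x := by
  obtain ⟨V, hx, f, hf, hEf⟩ := hE x
  have hmemU : ∀ y, y ∈ U ↔ y ∉ E.support := fun y ↦ by subst hUE; rfl
  have hU : U.ι ''ᵁ (U.ι ⁻¹ᵁ V.1) = X.basicOpen f := by
    rw [Scheme.Hom.image_preimage_eq_opensRange_inf, Scheme.Opens.opensRange_ι]
    ext y
    constructor
    · rintro ⟨hyU, hyV⟩
      by_contra hy
      refine (hmemU y).mp hyU ?_
      rw [mem_support_iff_of_mem hyV, hEf, Scheme.mem_zeroLocus_iff]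
      intro s hs hys
      obtain ⟨c, rfl⟩ := Ideal.mem_span_singleton'.mp hs
      rw [X.basicOpen_mul] at hys
      exact hy hys.2
    · intro hy
      have hyV := X.basicOpen_le f hy
      refine ⟨(hmemU y).mpr fun hyE ↦ ?_, hyV⟩
      rw [mem_support_iff_of_mem hyV, hEf, Scheme.mem_zeroLocus_iff] at hyE
      exact hyE f (Ideal.mem_span_singleton_self f) hy
  have haff : IsAffineOpen (U.ι ⁻¹ᵁ V.1) :=
    (U.ι.isAffineOpen_iff_of_isOpenImmersion).mp (hU ▸ V.2.basicOpen f)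
  have hle : U.ι ''ᵁ (U.ι ⁻¹ᵁ V.1) ≤ V.1 := hU ▸ X.basicOpen_le f
  have hloc := V.2.isLocalization_of_eq_basicOpen f (homOfLE hle) hU
  let := (X.presheaf.map (homOfLE hle).op).hom.toAlgebra
  let := X.presheaf.algebra_section_stalk (U := V.1) ⟨x, hx⟩
  have hlocx := V.2.isLocalization_stalk ⟨x, hx⟩
  have hspan : Ideal.span {e} = Ideal.span {algebraMap Γ(X, V.1) (X.presheaf.stalk x) f} := by
    rw [← he, stalkIdeal_eq E x V hx, hEf, Ideal.map_span, Set.image_singleton]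
    rfl
  have key := mem_map_comap_away_iff (B := Γ(X, U.ι ''ᵁ (U.ι ⁻¹ᵁ V.1)))
    (V.2.primeIdealOf ⟨x, hx⟩).asIdeal f (K.ideal V) hspan a
  rw [stalkIdeal_eq _ x V hx, stalkIdeal_eq _ x V hx, ideal_map _ _ _ haff,
    ideal_comap_of_le U.ι K V ⟨_, haff⟩ le_rfl, ← Scheme.Hom.app_eq_appLE]
  exact key

lemma mem_stalkIdeal_strictTransform {X' X : Scheme.{u}} [IsLocallyNoetherian X'] (π : X' ⟶ X)
    {Y I : X.IdealSheafData} (hY : IsEffectiveCartier (Y.comap π)) (x : X')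
    {e : X'.presheaf.stalk x} (he : stalkIdeal (Y.comap π) x = Ideal.span {e})
    (a : X'.presheaf.stalk x) :
    a ∈ stalkIdeal (strictTransform π Y I) x ↔ ∃ n : ℕ, e ^ n * a ∈ stalkIdeal (I.comap π) x :=
  mem_stalkIdeal_map_comap hY (I.comap π) x he a rfl

/-! ### Lifting over local rings -/

lemma exists_SpecMap_fromSpecStalk {X : Scheme.{u}} {R : CommRingCat.{u}} [IsLocalRing R]
    (f : Spec R ⟶ X) (x : X) (hx : f (IsLocalRing.closedPoint R) = x) :
    ∃ φ : X.presheaf.stalk x ⟶ R, Spec.map φ ≫ X.fromSpecStalk x = f := by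
  subst hx
  exact ⟨_, Scheme.Spec_stalkClosedPointTo_fromSpecStalk f⟩

lemma SpecMap_fromSpecStalk_inj {X : Scheme.{u}} {R : CommRingCat.{u}} {x : X}
    {φ ψ : X.presheaf.stalk x ⟶ R}
    (h : Spec.map φ ≫ X.fromSpecStalk x = Spec.map ψ ≫ X.fromSpecStalk x) : φ = ψ :=
  Spec.map_injective ((cancel_mono _).mp h)

lemma isEffectiveCartier_comap_fromSpecStalk {X : Scheme.{u}} {R : CommRingCat.{u}} {x : X}
    (φ : X.presheaf.stalk x ⟶ R) (I : X.IdealSheafData) {s : R} (hs : s ∈ nonZeroDivisors R)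
    (h : (stalkIdeal I x).map φ.hom = Ideal.span {s}) :
    IsEffectiveCartier (I.comap (Spec.map φ ≫ X.fromSpecStalk x)) := by
  intro y
  obtain ⟨U, hU⟩ := exists_affine_mem x
  have hle : (⊤ : (Spec (X.presheaf.stalk x)).Opens) ≤ X.fromSpecStalk x ⁻¹ᵁ U.1 := by
    intro y _
    have : X.fromSpecStalk x y ⤳ x := by
      have h1 : X.fromSpecStalk x y ∈ Set.range (X.fromSpecStalk x) := ⟨y, rfl⟩
      rw [Scheme.range_fromSpecStalk] at h1
      exact h1
    exact this.mem_open U.1.2 hU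
  have h1 : (I.comap (X.fromSpecStalk x)).ideal ⟨⊤, isAffineOpen_top _⟩ =
      (stalkIdeal I x).map (Scheme.ΓSpecIso (X.presheaf.stalk x)).inv.hom := by
    rw [ideal_comap_of_le _ I U ⟨⊤, isAffineOpen_top _⟩ hle, stalkIdeal_eq I x U hU,
      Ideal.map_map, ← CommRingCat.hom_comp, Scheme.Hom.appLE, Scheme.fromSpecStalk_app hU]
    simp only [Category.assoc, ← Functor.map_comp]
    congr 2
  refine ⟨⟨⊤, isAffineOpen_top _⟩, trivial, (Scheme.ΓSpecIso R).inv.hom s, ?_, ?_⟩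
  · have := MulEquivClass.map_nonZeroDivisors
      (Scheme.ΓSpecIso R).symm.commRingCatIsoToRingEquiv
    rw [← this]
    exact Submonoid.mem_map_of_mem _ hs
  · rw [comap_comp, ideal_comap_top_of_isAffine, h1, Ideal.map_map, ← CommRingCat.hom_comp,
      ← Set.image_singleton, ← Ideal.map_span, ← h, Ideal.map_map, ← CommRingCat.hom_comp]
    congr 2
    exact (Scheme.ΓSpecIso_inv_naturality φ).symm

/-- The map `Spec S → X` given by `ψ` lifts to the blow-up. Restricted along `c` the lift must agree
with the given map from `Spec R`, by uniqueness, for which `c s` has to be a nonzerodivisor. As `c`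
and `ρ` are local, the closed point of `Spec S` goes to `x`, and the lift factors through the local
ring at `x`. -/
lemma IsBlowup.hasBlowupLift {X' X : Scheme.{u}} {π : X' ⟶ X} {Y : X.IdealSheafData}
    (h : IsBlowup π Y) (x : X') {R : Type u} [CommRing R] [IsLocalRing R]
    (ρ : X'.presheaf.stalk x →+* R) [IsLocalHom ρ] :
    HasBlowupLift (π.stalkMap x).hom ρ (stalkIdeal Y (π x)) := by
  intro S _ _ ψ c _ s hcomm hs hcs hY
  let S' := CommRingCat.of S
  let R' := CommRingCat.of R
  let ψ' : X.presheaf.stalk (π x) ⟶ S' := CommRingCat.ofHom ψ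
  let c' : S' ⟶ R' := CommRingCat.ofHom c
  let ρ' : X'.presheaf.stalk x ⟶ R' := CommRingCat.ofHom ρ
  have hcomm' : ψ' ≫ c' = π.stalkMap x ≫ ρ' := CommRingCat.hom_ext hcomm
  have hg := isEffectiveCartier_comap_fromSpecStalk ψ' Y hs hY
  obtain ⟨l, hl, -⟩ := h.existsUnique_lift _ hg
  have hg' := isEffectiveCartier_comap_fromSpecStalk (ψ' ≫ c') Y hcs (by
    rw [CommRingCat.hom_comp, ← Ideal.map_map]
    change ((stalkIdeal Y (π x)).map ψ).map c = _
    rw [hY, Ideal.map_span, Set.image_singleton])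
  have huniq : Spec.map c' ≫ l = Spec.map ρ' ≫ X'.fromSpecStalk x := by
    refine (h.existsUnique_lift _ hg').unique ?_ ?_
    · rw [Category.assoc, hl, Spec.map_comp, Category.assoc]
    · rw [hcomm', Category.assoc, ← Scheme.SpecMap_stalkMap_fromSpecStalk, Spec.map_comp,
        Category.assoc]
  have : IsLocalRing S' := ‹IsLocalRing S›
  have : IsLocalRing R' := ‹IsLocalRing R›
  have : IsLocalHom c'.hom := ‹IsLocalHom c›
  have : IsLocalHom ρ'.hom := ‹IsLocalHom ρ›
  have hclosed : l (IsLocalRing.closedPoint S') = x := by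
    have h1 : Spec.map c' (IsLocalRing.closedPoint R') = IsLocalRing.closedPoint S' :=
      IsLocalRing.comap_closedPoint c'.hom
    have h2 : Spec.map ρ' (IsLocalRing.closedPoint R') =
      IsLocalRing.closedPoint (X'.presheaf.stalk x) := IsLocalRing.comap_closedPoint ρ'.hom
    have h3 : (Spec.map c' ≫ l) (IsLocalRing.closedPoint R') =
        (Spec.map ρ' ≫ X'.fromSpecStalk x) (IsLocalRing.closedPoint R') := by rw [huniq]
    change l (Spec.map c' _) = X'.fromSpecStalk x (Spec.map ρ' _) at h3
    rwa [h1, h2, Scheme.fromSpecStalk_closedPoint] at h3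
  obtain ⟨φ, hφ⟩ := exists_SpecMap_fromSpecStalk l x hclosed
  have e1 : π.stalkMap x ≫ φ = ψ' := SpecMap_fromSpecStalk_inj (by
    rw [Spec.map_comp, Category.assoc, Scheme.SpecMap_stalkMap_fromSpecStalk, ← Category.assoc,
      hφ, hl])
  have e2 : φ ≫ c' = ρ' := SpecMap_fromSpecStalk_inj (by
    rw [Spec.map_comp, Category.assoc, hφ, huniq])
  exact ⟨φ.hom, congrArg CommRingCat.Hom.hom e1, congrArg CommRingCat.Hom.hom e2⟩

end Resolution
end

noncomputable section
namespace Resolution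

/-! ### Affine charts of blow-ups -/

section Chart

variable {A : Type u} [CommRing A]

/-- The ring hom `φ` makes every element of `S` a nonzerodivisor generating the ideal `I`. -/
def Generates {A C : Type*} [CommRing A] [CommRing C] (I : Ideal A) (S : Finset A) (φ : A →+* C) :
    Prop :=
  ∀ s ∈ S, I.map φ = Ideal.span {φ s} ∧ φ s ∈ nonZeroDivisors C

/-- The subring of `A[1/∏ s]` generated over `A` by the fractions `a / s` with `a ∈ I`
and `s ∈ S`. -/
def chartRing (I : Ideal A) (S : Finset A) : Subalgebra A (Localization.Away (∏ s ∈ S, s)) :=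
  Algebra.adjoin A {x | ∃ a ∈ I, ∃ s ∈ S, x * algebraMap A _ s = algebraMap A _ a}

variable {I : Ideal A} {S : Finset A}

lemma isUnit_algebraMap_away_prod {s : A} (hs : s ∈ S) :
    IsUnit (algebraMap A (Localization.Away (∏ s ∈ S, s)) s) := by
  have h : IsUnit (algebraMap A (Localization.Away (∏ s ∈ S, s)) (∏ s ∈ S, s)) :=
    IsLocalization.Away.algebraMap_isUnit _
  exact isUnit_of_dvd_unit (map_dvd _ (Finset.dvd_prod_of_mem _ hs)) h

lemma generates_chartRing (hS : ∀ s ∈ S, s ∈ I) :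
    Generates I S (algebraMap A (chartRing I S)) := by
  intro s hs
  obtain ⟨v, hv⟩ := isUnit_algebraMap_away_prod hs
  constructor
  · apply le_antisymm
    · rw [Ideal.map_le_iff_le_comap]
      intro a ha
      rw [Ideal.mem_comap, Ideal.mem_span_singleton']
      refine ⟨⟨algebraMap A _ a * ↑v⁻¹, Algebra.subset_adjoin ⟨a, ha, s, hs, ?_⟩⟩, ?_⟩
      · rw [← hv, mul_assoc, Units.inv_mul, mul_one]
      · apply Subtype.ext
        change algebraMap A (Localization.Away (∏ s ∈ S, s)) a * ↑v⁻¹ * algebraMap A _ s =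
          algebraMap A (Localization.Away (∏ s ∈ S, s)) a
        rw [← hv, mul_assoc, Units.inv_mul, mul_one]
    · rw [Ideal.span_singleton_le_iff_mem]
      exact Ideal.mem_map_of_mem _ (hS s hs)
  · rw [mem_nonZeroDivisors_iff_right]
    intro c hc
    apply Subtype.ext
    have h1 : (c : Localization.Away (∏ s ∈ S, s)) * algebraMap A _ s = 0 :=
      congrArg Subtype.val hc
    exact (isUnit_algebraMap_away_prod hs).mul_left_eq_zero.mp h1

/-- Every element of the chart ring comes from `A` after multiplication by a power of `∏ s`, which
becomes a nonzerodivisor in `C`. -/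
lemma chartRing_hom_ext {C : Type*} [CommRing C] {ψ ψ' : chartRing I S →+* C}
    (hψ : ψ.comp (algebraMap A _) = ψ'.comp (algebraMap A _))
    (h : ∀ s ∈ S, ψ (algebraMap A _ s) ∈ nonZeroDivisors C) : ψ = ψ' := by
  ext b
  obtain ⟨n, a, hna⟩ := IsLocalization.Away.surj (∏ s ∈ S, s) b.1
  have h1 : b * algebraMap A (chartRing I S) (∏ s ∈ S, s) ^ n = algebraMap A (chartRing I S) a := by
    apply Subtype.ext
    exact hna
  have h2 := congrArg ψ h1
  have h3 := congrArg ψ' h1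
  have h4 : ∀ a, ψ' (algebraMap A _ a) = ψ (algebraMap A _ a) := fun a ↦ congr($hψ.symm a)
  rw [map_mul, map_pow, h4, h4, ← h2, map_mul, map_pow] at h3
  have h5 : ψ (algebraMap A (chartRing I S) (∏ s ∈ S, s)) ^ n ∈ nonZeroDivisors C := by
    rw [map_prod, map_prod]
    exact pow_mem (prod_mem h) n
  exact ((mul_cancel_right_mem_nonZeroDivisors h5).mp h3).symm

/-- Extend `φ` to a map between the localizations at `∏ s` and at its image. It takes `a / s` into
`C`, because `φ a` is divisible by `φ s`, and `C` embeds in its localization. -/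
lemma exists_chartRing_lift {C : Type*} [CommRing C] (φ : A →+* C)
    (h : Generates I S φ) : ∃ ψ : chartRing I S →+* C, ψ.comp (algebraMap A _) = φ := by
  let p : A := ∏ s ∈ S, s
  have hp : φ p ∈ nonZeroDivisors C := by
    rw [map_prod]
    exact prod_mem fun s hs ↦ (h s hs).2
  let CL := Localization.Away (φ p)
  have hinj : Function.Injective (algebraMap C CL) :=
    IsLocalization.injective CL (Submonoid.powers_le.mpr hp)
  have hu : IsUnit ((algebraMap C CL).comp φ p) := IsLocalization.Away.algebraMap_isUnit (φ p)
  let f : Localization.Away p →+* CL := IsLocalization.Away.lift p hu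
  have hf : ∀ a, f (algebraMap A _ a) = algebraMap C CL (φ a) :=
    fun a ↦ IsLocalization.Away.lift_eq p hu a
  have hrange : ∀ x ∈ chartRing I S, f x ∈ (algebraMap C CL).range := by
    intro x hx
    refine Algebra.adjoin_induction (fun x hx ↦ ?_) (fun a ↦ ⟨φ a, (hf a).symm⟩)
      (fun x y _ _ h1 h2 ↦ by rw [map_add]; exact add_mem h1 h2)
      (fun x y _ _ h1 h2 ↦ by rw [map_mul]; exact mul_mem h1 h2) hx
    obtain ⟨a, ha, s, hs, hxs⟩ := hx
    have h1 : φ a ∈ Ideal.span {φ s} := (h s hs).1 ▸ Ideal.mem_map_of_mem φ ha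
    obtain ⟨c, hc⟩ := Ideal.mem_span_singleton'.mp h1
    refine ⟨c, ?_⟩
    have h2 := congrArg f hxs
    rw [map_mul, hf, hf, ← hc, map_mul] at h2
    have h3 : algebraMap C CL (φ s) ∈ nonZeroDivisors CL :=
      IsLocalization.map_nonZeroDivisors_le (Submonoid.powers (φ p)) CL
        (Submonoid.mem_map_of_mem _ (h s hs).2)
    exact ((mul_cancel_right_mem_nonZeroDivisors h3).mp h2).symm
  let e : C ≃+* (algebraMap C CL).range :=
    RingEquiv.ofBijective (algebraMap C CL).rangeRestrict
      ⟨fun x y hxy ↦ hinj (congrArg Subtype.val hxy), (algebraMap C CL).rangeRestrict_surjective⟩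
  refine ⟨e.symm.toRingHom.comp ((f.comp (chartRing I S).val.toRingHom).codRestrict _
    fun x ↦ hrange x.1 x.2), ?_⟩
  ext a
  apply e.injective
  change e (e.symm _) = _
  rw [e.apply_symm_apply]
  exact Subtype.ext (hf a)

lemma finiteType_chartRing [IsNoetherianRing A] : Algebra.FiniteType A (chartRing I S) := by
  classical
  obtain ⟨T, hT⟩ := IsNoetherian.noetherian I
  rw [← Subalgebra.fg_iff_finiteType]
  let L := Localization.Away (∏ s ∈ S, s)
  have hinv : ∀ s : S, ∃ v : L, v * algebraMap A L s = 1 := fun s ↦ by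
    obtain ⟨v, hv⟩ := isUnit_algebraMap_away_prod s.2
    exact ⟨↑v⁻¹, by rw [← hv, Units.inv_mul]⟩
  choose v hv using hinv
  refine ⟨(T ×ˢ S.attach).image fun x ↦ algebraMap A L x.1 * v x.2, ?_⟩
  apply le_antisymm
  · rw [Algebra.adjoin_le_iff]
    intro x hx
    rw [Finset.mem_coe, Finset.mem_image] at hx
    obtain ⟨⟨a, s⟩, h1, rfl⟩ := hx
    rw [Finset.mem_product] at h1
    exact Algebra.subset_adjoin ⟨a, hT ▸ Ideal.subset_span h1.1, s, s.2, by
      rw [mul_assoc, hv, mul_one]⟩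
  · refine Algebra.adjoin_le ?_
    rintro x ⟨a, ha, s, hs, hxs⟩
    have hx : x = algebraMap A L a * v ⟨s, hs⟩ := by
      have h1 := hv ⟨s, hs⟩
      calc x = x * (v ⟨s, hs⟩ * algebraMap A L s) := by rw [h1, mul_one]
        _ = x * algebraMap A L s * v ⟨s, hs⟩ := by ring
        _ = _ := by rw [hxs]
    rw [hx]
    rw [← hT] at ha
    clear hx hxs
    induction ha using Submodule.span_induction with
    | mem a ha =>
      refine Algebra.subset_adjoin ?_
      rw [Finset.mem_coe, Finset.mem_image]
      exact ⟨(a, ⟨s, hs⟩), Finset.mem_product.mpr ⟨ha, Finset.mem_attach _ _⟩, rfl⟩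
    | zero => rw [map_zero, zero_mul]; exact zero_mem _
    | add a b _ _ h1 h2 => rw [map_add, add_mul]; exact add_mem h1 h2
    | smul c a _ h1 =>
      rw [smul_eq_mul, map_mul, mul_assoc]
      exact mul_mem (Subalgebra.algebraMap_mem _ c) h1

/-- A chart for more generators over a basic open subset is a localization. -/
lemma exists_isLocalization_chartRing {A' : Type u} [CommRing A'] [Algebra A A'] (g : A)
    [IsLocalization.Away g A'] {S' : Finset A'} (hS : ∀ s ∈ S, s ∈ I) (hS0 : S.Nonempty)
    (hS' : ∀ s ∈ S', s ∈ I.map (algebraMap A A')) (hSS' : ∀ s ∈ S, algebraMap A A' s ∈ S')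
    (χ : chartRing I S →+* chartRing (I.map (algebraMap A A')) S')
    (hχ : χ.comp (algebraMap A _) = (algebraMap A' _).comp (algebraMap A A')) :
    ∃ c, @IsLocalization.Away _ _ c _ _ χ.toAlgebra := by
  classical
  let I' := I.map (algebraMap A A')
  let B := chartRing I S
  let B' := chartRing I' S'
  have hχ' : ∀ a, χ (algebraMap A B a) = algebraMap A' B' (algebraMap A A' a) :=
    fun a ↦ congr($hχ a)
  obtain ⟨h, hh⟩ := hS0
  have hgenB := generates_chartRing hS
  have hgenB' := generates_chartRing hS'
  have h1 : ∀ s' ∈ S', ∃ n : ℕ, ∃ a ∈ I, ∃ q : B, s' * algebraMap A A' g ^ n = algebraMap A A' a ∧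
      q * algebraMap A B h = algebraMap A B a := by
    intro s' hs'
    obtain ⟨⟨⟨a, ha⟩, ⟨_, n, rfl⟩⟩, hn⟩ := (IsLocalization.mem_map_algebraMap_iff
      (Submonoid.powers g) A').mp (hS' s' hs')
    have h2 : algebraMap A B a ∈ Ideal.span {algebraMap A B h} :=
      (hgenB h hh).1 ▸ Ideal.mem_map_of_mem _ ha
    obtain ⟨q, hq⟩ := Ideal.mem_span_singleton'.mp h2
    exact ⟨n, a, ha, q, by simpa using hn, hq⟩
  choose! n a ha q hn hq using h1
  -- `q s'` is the quotient of `s'` by `h`, up to a power of `g`. Where `g` and all the `q s'` are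
  -- invertible, each `s' ∈ S'` generates the same ideal as `h`, which is the condition for a map
  -- out of the larger chart ring.
  let c : B := algebraMap A B g * ∏ s' ∈ S', q s'
  let L := Localization.Away c
  have huL : IsUnit (algebraMap B L c) := IsLocalization.Away.algebraMap_isUnit c
  have hugL : IsUnit (algebraMap B L (algebraMap A B g)) :=
    isUnit_of_dvd_unit (map_dvd _ (Dvd.intro _ rfl)) huL
  have huqL : ∀ s' ∈ S', IsUnit (algebraMap B L (q s')) := fun s' hs' ↦
    isUnit_of_dvd_unit (map_dvd _ ((Finset.dvd_prod_of_mem _ hs').trans (Dvd.intro_left _ rfl))) huL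
  have hgu : IsUnit (algebraMap A A' g) := IsLocalization.Away.algebraMap_isUnit g
  -- the map from `A'` to the localization
  let φ : A' →+* L := IsLocalization.Away.lift (g := (algebraMap B L).comp (algebraMap A B)) g hugL
  have hφ : ∀ a, φ (algebraMap A A' a) = algebraMap B L (algebraMap A B a) :=
    fun a ↦ IsLocalization.Away.lift_eq g hugL a
  have hnzL : algebraMap B L (algebraMap A B h) ∈ nonZeroDivisors L :=
    IsLocalization.map_nonZeroDivisors_le (Submonoid.powers c) L
      (Submonoid.mem_map_of_mem _ (hgenB h hh).2)
  have hassoc : ∀ s' ∈ S', Associated (φ s') (algebraMap B L (algebraMap A B h)) := by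
    intro s' hs'
    have h2 := congrArg φ (hn s' hs')
    have h3 := congrArg (algebraMap B L) (hq s' hs')
    rw [map_mul, map_pow, hφ, hφ, ← h3, map_mul] at h2
    have e1 : Associated (φ s') (φ s' * algebraMap B L (algebraMap A B g) ^ n s') :=
      ⟨(hugL.pow _).unit, rfl⟩
    have e2 : Associated (algebraMap B L (q s') * algebraMap B L (algebraMap A B h))
        (algebraMap B L (algebraMap A B h)) :=
      Associated.symm ⟨(huqL s' hs').unit, mul_comm _ _⟩
    exact (e1.trans (h2 ▸ Associated.refl _)).trans e2
  have hI'φ : I'.map φ = (I.map (algebraMap A B)).map (algebraMap B L) := by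
    rw [Ideal.map_map, Ideal.map_map]
    congr 1
    exact RingHom.ext hφ
  have hgenφ : Generates I' S' φ := by
    intro s' hs'
    constructor
    · rw [hI'φ, (hgenB h hh).1, Ideal.map_span, Set.image_singleton]
      exact le_antisymm (Ideal.span_singleton_le_span_singleton.mpr (hassoc s' hs').dvd)
        (Ideal.span_singleton_le_span_singleton.mpr (hassoc s' hs').symm.dvd)
    · obtain ⟨v, hv⟩ := (hassoc s' hs').symm
      rw [← hv]
      exact mul_mem hnzL v.isUnit.mem_nonZeroDivisors
  obtain ⟨ψ, hψ⟩ := exists_chartRing_lift φ hgenφ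
  have hψ' : ∀ a, ψ (algebraMap A' B' a) = φ a := fun a ↦ congr($hψ a)
  -- the map from the localization
  have hχnz : ∀ s ∈ S, χ (algebraMap A B s) ∈ nonZeroDivisors B' := by
    intro s hs
    rw [hχ']
    exact (hgenB' _ (hSS' s hs)).2
  have huχ : IsUnit (χ c) := by
    rw [map_mul, hχ', map_prod]
    refine (hgu.map _).mul (IsUnit.prod_iff.mpr fun s' hs' ↦ ?_)
    have h2 := congrArg χ (hq s' hs')
    rw [map_mul, hχ', hχ', ← hn s' hs', map_mul] at h2
    have h3 : algebraMap A' B' (algebraMap A A' h) ∈ Ideal.span {algebraMap A' B' s'} :=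
      (hgenB' s' hs').1 ▸ Ideal.mem_map_of_mem _ (Ideal.mem_map_of_mem _ (hS h hh))
    obtain ⟨d, hd⟩ := Ideal.mem_span_singleton'.mp h3
    rw [← hd, ← mul_assoc, mul_comm (algebraMap A' B' s')] at h2
    have h4 := (mul_cancel_right_mem_nonZeroDivisors (hgenB' s' hs').2).mp h2
    exact isUnit_of_dvd_unit (Dvd.intro _ h4) ((hgu.pow _).map _)
  let θ : L →+* B' := IsLocalization.Away.lift (g := χ) c huχ
  have hθ : ∀ b, θ (algebraMap B L b) = χ b := fun b ↦ IsLocalization.Away.lift_eq c huχ b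
  have hθφ : ∀ a, θ (φ a) = algebraMap A' B' a := by
    intro a'
    have : θ.comp φ = algebraMap A' B' := by
      apply IsLocalization.ringHom_ext (Submonoid.powers g)
      refine RingHom.ext fun a ↦ ?_
      change θ (φ (algebraMap A A' a)) = _
      rw [hφ, hθ, hχ']
      rfl
    exact congr($this a')
  have e1 : θ.comp ψ = RingHom.id B' := by
    apply chartRing_hom_ext
    · ext a
      change (θ (ψ (algebraMap A' B' a)) : Localization.Away (∏ s ∈ S', s)) = _
      rw [hψ', hθφ]
      rfl
    · intro s' hs'
      change θ (ψ (algebraMap A' B' s')) ∈ _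
      rw [hψ', hθφ]
      exact (hgenB' s' hs').2
  have hψχ : ψ.comp χ = algebraMap B L := by
    apply chartRing_hom_ext
    · ext a
      change ψ (χ (algebraMap A B a)) = _
      rw [hχ', hψ', hφ]
      rfl
    · intro s hs
      change ψ (χ (algebraMap A B s)) ∈ _
      rw [hχ', hψ']
      exact (hgenφ _ (hSS' s hs)).2
  have e2 : ψ.comp θ = RingHom.id L := by
    apply IsLocalization.ringHom_ext (Submonoid.powers c)
    ext b
    change ψ (θ (algebraMap B L b)) = _
    rw [hθ]
    exact congr($hψχ b)
  refine ⟨c, ?_⟩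
  let := χ.toAlgebra
  let E : L ≃ₐ[B] B' := AlgEquiv.ofRingEquiv (f := RingEquiv.ofRingHom θ ψ e1 e2) hθ
  exact IsLocalization.isLocalization_of_algEquiv (Submonoid.powers c) E

end Chart

end Resolution
end

noncomputable section
namespace Resolution

open Scheme.IdealSheafData

/-! ### Existence of blow-ups -/

/-- An index for an affine chart of the blow-up along `I`: an affine open subset together with a
nonempty finite set of sections of `I`. -/
structure ChartIndex {X : Scheme.{u}} (I : X.IdealSheafData) where
  V : X.affineOpens
  S : Finset Γ(X, V.1)
  mem : ∀ s ∈ S, s ∈ I.ideal V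
  nonempty : S.Nonempty

namespace ChartIndex

variable {X : Scheme.{u}} {I : X.IdealSheafData}

/-- Restriction of sections. -/
abbrev restr {U V : X.Opens} (h : U ≤ V) : Γ(X, V) ⟶ Γ(X, U) := X.presheaf.map (homOfLE h).op

/-- A smaller chart lies over a basic open subset and uses more sections: adding a section to `S`
restricts to the locus where it, too, generates the exceptional ideal. With this order the
transition maps are open immersions, and intersections of charts are covered by charts. -/
instance : LE (ChartIndex I) where
  le i j := ∃ h : i.V.1 ≤ j.V.1, (∃ g : Γ(X, j.V.1), i.V.1 = X.basicOpen g) ∧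
    ∀ s ∈ j.S, (restr h).hom s ∈ i.S

lemma exists_basicOpen_trans {U V W : X.Opens} (hW : IsAffineOpen W) {g : Γ(X, W)}
    (hV : V = X.basicOpen g) {f : Γ(X, V)} (hU : U = X.basicOpen f) :
    ∃ f' : Γ(X, W), U = X.basicOpen f' := by
  subst hV hU
  obtain ⟨f', h⟩ := hW.basicOpen_basicOpen_is_basicOpen g f
  exact ⟨f', h.symm⟩

instance : Preorder (ChartIndex I) where
  le_refl i := ⟨le_rfl, ⟨1, by rw [X.basicOpen_of_isUnit isUnit_one]⟩, fun s hs ↦ by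
    have : (restr (le_refl i.V.1)).hom s = s := by
      have : restr (le_refl i.V.1) = 𝟙 _ := X.presheaf.map_id _
      rw [this]
      rfl
    rwa [this]⟩
  le_trans i j k := by
    rintro ⟨h1, ⟨g1, e1⟩, s1⟩ ⟨h2, ⟨g2, e2⟩, s2⟩
    refine ⟨h1.trans h2, exists_basicOpen_trans k.V.2 e2 e1, fun s hs ↦ ?_⟩
    have e : restr h2 ≫ restr h1 = restr (h1.trans h2) := (X.presheaf.map_comp _ _).symm
    rw [← e]
    exact s1 _ (s2 _ hs)

/-- The coordinate ring of a chart. -/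
abbrev ring (i : ChartIndex I) : CommRingCat.{u} := CommRingCat.of (chartRing (I.ideal i.V) i.S)

/-- The structure map of the coordinate ring of a chart. -/
abbrev incl (i : ChartIndex I) : Γ(X, i.V.1) ⟶ i.ring := CommRingCat.ofHom (algebraMap _ _)

lemma generates_incl (i : ChartIndex I) : Generates (I.ideal i.V) i.S i.incl.hom :=
  generates_chartRing i.mem

lemma hom_ext {i : ChartIndex I} {R : CommRingCat.{u}} {ψ ψ' : i.ring ⟶ R}
    (h : i.incl ≫ ψ = i.incl ≫ ψ')
    (hs : ∀ s ∈ i.S, (i.incl ≫ ψ).hom s ∈ nonZeroDivisors R) : ψ = ψ' :=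
  CommRingCat.hom_ext (chartRing_hom_ext (congrArg CommRingCat.Hom.hom h) hs)

lemma exists_lift (i : ChartIndex I) {R : CommRingCat.{u}} (φ : Γ(X, i.V.1) ⟶ R)
    (h : Generates (I.ideal i.V) i.S φ.hom) : ∃ ψ : i.ring ⟶ R, i.incl ≫ ψ = φ := by
  obtain ⟨ψ, hψ⟩ := exists_chartRing_lift φ.hom h
  exact ⟨CommRingCat.ofHom ψ, CommRingCat.hom_ext hψ⟩

lemma restr_fromSpec {U V : X.Opens} (h : U ≤ V) (hU : IsAffineOpen U) (hV : IsAffineOpen V) :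
    Spec.map (restr h) ≫ hV.fromSpec = hU.fromSpec := hV.map_fromSpec hU _

lemma restr_fromSpec_assoc {U V : X.Opens} (h : U ≤ V) (hU : IsAffineOpen U)
    (hV : IsAffineOpen V) {Y : Scheme.{u}} (f : X ⟶ Y) :
    Spec.map (restr h) ≫ hV.fromSpec ≫ f = hU.fromSpec ≫ f := by
  rw [← Category.assoc, restr_fromSpec h hU hV]

lemma map_restr {U V : X.affineOpens} (h : U.1 ≤ V.1) {R : CommRingCat.{u}} (φ : Γ(X, U.1) ⟶ R) :
    (I.ideal V).map (restr h ≫ φ).hom = (I.ideal U).map φ.hom := by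
  rw [CommRingCat.hom_comp, ← Ideal.map_map]
  congr 1
  exact I.map_ideal (U := U) (V := V) h

lemma exists_map {i j : ChartIndex I} (h : i ≤ j) :
    ∃ χ : j.ring ⟶ i.ring, j.incl ≫ χ = restr h.1 ≫ i.incl := by
  refine j.exists_lift _ fun s hs ↦ ?_
  obtain ⟨h1, h2⟩ := i.generates_incl _ (h.2.2 s hs)
  exact ⟨(map_restr h.1 i.incl).trans h1, h2⟩

/-- The transition map between coordinate rings of charts. -/
def map {i j : ChartIndex I} (h : i ≤ j) : j.ring ⟶ i.ring := (exists_map h).choose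

lemma incl_map {i j : ChartIndex I} (h : i ≤ j) : j.incl ≫ map h = restr h.1 ≫ i.incl :=
  (exists_map h).choose_spec

lemma incl_map_assoc {i j : ChartIndex I} (h : i ≤ j) {R : CommRingCat.{u}} (ψ : i.ring ⟶ R) :
    j.incl ≫ map h ≫ ψ = restr h.1 ≫ i.incl ≫ ψ := by
  rw [← Category.assoc, incl_map, Category.assoc]

lemma map_nonZeroDivisors {i j : ChartIndex I} (h : i ≤ j) (s) (hs : s ∈ j.S) :
    (restr h.1 ≫ i.incl).hom s ∈ nonZeroDivisors i.ring :=
  (i.generates_incl _ (h.2.2 s hs)).2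

lemma map_refl (i : ChartIndex I) : map (le_refl i) = 𝟙 i.ring := by
  refine hom_ext ?_ fun s hs ↦ ?_
  · rw [incl_map]
    have : restr (le_refl i).1 = 𝟙 _ := X.presheaf.map_id _
    rw [this, Category.id_comp, Category.comp_id]
  · rw [incl_map]
    exact map_nonZeroDivisors (le_refl i) s hs

lemma map_trans {i j k : ChartIndex I} (h : i ≤ j) (h' : j ≤ k) :
    map (h.trans h') = map h' ≫ map h := by
  refine hom_ext ?_ fun s hs ↦ ?_
  · rw [incl_map, incl_map_assoc, incl_map, ← Category.assoc]
    congr 1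
    exact X.presheaf.map_comp (homOfLE h'.1).op (homOfLE h.1).op
  · rw [incl_map]
    exact map_nonZeroDivisors (h.trans h') s hs

/-- The diagram of charts. -/
def functor (I : X.IdealSheafData) : ChartIndex I ⥤ Scheme.{u} where
  obj i := Spec i.ring
  map f := Spec.map (map (leOfHom f))
  map_id i := by
    have : map (leOfHom (𝟙 i)) = 𝟙 i.ring := map_refl i
    rw [this, Spec.map_id]
  map_comp {i j k} f g := by
    rw [← Spec.map_comp, ← map_trans]

lemma isOpenImmersion_map {i j : ChartIndex I} (h : i ≤ j) :
    IsOpenImmersion (Spec.map (map h)) := by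
  obtain ⟨g, hg⟩ := h.2.1
  let := (restr h.1).hom.toAlgebra
  have hloc : IsLocalization.Away g Γ(X, i.V.1) :=
    j.V.2.isLocalization_of_eq_basicOpen g (homOfLE h.1) hg
  have hmap : (I.ideal j.V).map (algebraMap Γ(X, j.V.1) Γ(X, i.V.1)) = I.ideal i.V :=
    I.map_ideal (U := i.V) (V := j.V) h.1
  have key : ∀ (I' : Ideal Γ(X, i.V.1)) (e : (I.ideal j.V).map (algebraMap _ _) = I')
      (χ : chartRing (I.ideal j.V) j.S →+* chartRing I' i.S)
      (_ : χ.comp (algebraMap _ _) = (algebraMap Γ(X, i.V.1) _).comp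
        (algebraMap Γ(X, j.V.1) Γ(X, i.V.1))), (∀ s ∈ i.S, s ∈ I') →
      ∃ c, @IsLocalization.Away _ _ c _ _ χ.toAlgebra := by
    rintro I' rfl χ hχ hi
    exact exists_isLocalization_chartRing g j.mem j.nonempty hi (fun s hs ↦ h.2.2 s hs) χ hχ
  obtain ⟨c, hc⟩ := key _ hmap (map h).hom
    (congrArg CommRingCat.Hom.hom (incl_map h)) i.mem
  let := (map h).hom.toAlgebra
  exact IsOpenImmersion.of_isLocalization (S := i.ring) c

instance {i j : ChartIndex I} (f : i ⟶ j) : IsOpenImmersion ((functor I).map f) :=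
  isOpenImmersion_map (leOfHom f)

/-- The map from a chart to the base. -/
def toBase (i : ChartIndex I) : Spec i.ring ⟶ X := Spec.map i.incl ≫ i.V.2.fromSpec

lemma map_toBase {i j : ChartIndex I} (h : i ≤ j) :
    Spec.map (map h) ≫ j.toBase = i.toBase := by
  rw [toBase, toBase, ← Spec.map_comp_assoc, incl_map, Spec.map_comp_assoc,
    restr_fromSpec h.1 i.V.2 j.V.2]

/-- Two maps to charts over the same map to the base factor through a common smaller chart. -/
lemma exists_common {i j : ChartIndex I} {R : CommRingCat.{u}} (β : i.ring ⟶ R) (β' : j.ring ⟶ R)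
    {V : X.affineOpens} (hi : V.1 ≤ i.V.1) (hj : V.1 ≤ j.V.1)
    (gi : ∃ g : Γ(X, i.V.1), V.1 = X.basicOpen g) (gj : ∃ g : Γ(X, j.V.1), V.1 = X.basicOpen g)
    (φ : Γ(X, V.1) ⟶ R) (hβ : i.incl ≫ β = restr hi ≫ φ) (hβ' : j.incl ≫ β' = restr hj ≫ φ)
    {e : R} (he : e ∈ nonZeroDivisors R) (hI : (I.ideal V).map φ.hom = Ideal.span {e}) :
    ∃ (l : ChartIndex I) (hli : l ≤ i) (hlj : l ≤ j) (γ : l.ring ⟶ R),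
      map hli ≫ γ = β ∧ map hlj ≫ γ = β' := by
  classical
  -- The common part of the charts `i` and `j` over `V` is the chart where the sections of both sets
  -- generate the ideal.
  let l : ChartIndex I :=
    { V := V
      S := i.S.image (restr hi).hom ∪ j.S.image (restr hj).hom
      mem := by
        intro s hs
        rcases Finset.mem_union.mp hs with hs | hs
        · obtain ⟨t, ht, rfl⟩ := Finset.mem_image.mp hs
          rw [← I.map_ideal (U := V) (V := i.V) hi]
          exact Ideal.mem_map_of_mem _ (i.mem t ht)
        · obtain ⟨t, ht, rfl⟩ := Finset.mem_image.mp hs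
          rw [← I.map_ideal (U := V) (V := j.V) hj]
          exact Ideal.mem_map_of_mem _ (j.mem t ht)
      nonempty := (i.nonempty.image _).mono Finset.subset_union_left }
  have hgen : ∀ {k : ChartIndex I} (hk : V.1 ≤ k.V.1) (β : k.ring ⟶ R)
      (_ : k.incl ≫ β = restr hk ≫ φ), ∀ t ∈ k.S,
      (I.ideal V).map φ.hom = Ideal.span {φ.hom ((restr hk).hom t)} ∧
        φ.hom ((restr hk).hom t) ∈ nonZeroDivisors R := by
    intro k hk β hβ t ht
    have h1 : (I.ideal V).map φ.hom = Ideal.span {φ.hom ((restr hk).hom t)} := by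
      rw [← map_restr hk, ← hβ, CommRingCat.hom_comp, ← Ideal.map_map,
        (k.generates_incl t ht).1, Ideal.map_span, Set.image_singleton]
      congr 2
      exact congr($(hβ).hom t)
    exact ⟨h1, mem_nonZeroDivisors_of_span_eq he (h1.symm.trans hI)⟩
  obtain ⟨γ, hγ⟩ := l.exists_lift φ (by
    intro s hs
    rcases Finset.mem_union.mp hs with hs | hs
    · obtain ⟨t, ht, rfl⟩ := Finset.mem_image.mp hs
      exact hgen hi β hβ t ht
    · obtain ⟨t, ht, rfl⟩ := Finset.mem_image.mp hs
      exact hgen hj β' hβ' t ht)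
  have hli : l ≤ i := ⟨hi, gi, fun s hs ↦
    Finset.mem_union_left _ (Finset.mem_image_of_mem _ hs)⟩
  have hlj : l ≤ j := ⟨hj, gj, fun s hs ↦
    Finset.mem_union_right _ (Finset.mem_image_of_mem _ hs)⟩
  refine ⟨l, hli, hlj, γ, hom_ext ?_ fun s hs ↦ ?_, hom_ext ?_ fun s hs ↦ ?_⟩
  · rw [incl_map_assoc, hγ, hβ]
  · rw [incl_map_assoc, hγ]
    exact (hgen hi β hβ s hs).2
  · rw [incl_map_assoc, hγ, hβ']
  · rw [incl_map_assoc, hγ]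
    exact (hgen hj β' hβ' s hs).2

/-- A morphism into a scheme whose range lies in an affine open subset. -/
lemma exists_SpecMap_fromSpec {R : CommRingCat.{u}} (f : Spec R ⟶ X) {V : X.Opens}
    (hV : IsAffineOpen V) (h : ∀ y, f y ∈ V) :
    ∃ φ : Γ(X, V) ⟶ R, Spec.map φ ≫ hV.fromSpec = f := by
  refine ⟨Spec.preimage (IsOpenImmersion.lift hV.fromSpec f ?_), ?_⟩
  · rintro _ ⟨y, rfl⟩
    rw [hV.range_fromSpec]
    exact h y
  · rw [Spec.map_preimage]
    exact IsOpenImmersion.lift_fac _ _ _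

lemma SpecMap_fromSpec_inj {R : CommRingCat.{u}} {V : X.Opens} (hV : IsAffineOpen V)
    {φ ψ : Γ(X, V) ⟶ R} (h : Spec.map φ ≫ hV.fromSpec = Spec.map ψ ≫ hV.fromSpec) : φ = ψ :=
  Spec.map_injective ((cancel_mono _).mp h)

lemma toBase_mem (i : ChartIndex I) (x : Spec i.ring) : i.toBase x ∈ i.V.1 := by
  have : i.V.2.fromSpec (Spec.map i.incl x) ∈ Set.range i.V.2.fromSpec := ⟨_, rfl⟩
  rw [i.V.2.range_fromSpec] at this
  exact this

lemma mem_of_isLocalRing {R : CommRingCat.{u}} [IsLocalRing R] (f : Spec R ⟶ X) (V : X.Opens)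
    (h : f (IsLocalRing.closedPoint R) ∈ V) (y : Spec R) : f y ∈ V := by
  have h1 : y ⤳ IsLocalRing.closedPoint R := IsLocalRing.specializes_closedPoint y
  exact (h1.map f.continuous).mem_open V.2 h

lemma preimage_fromSpecStalk_nonZeroDivisors {B : CommRingCat.{u}} (x : Spec B) {b : B}
    (hb : b ∈ nonZeroDivisors B) :
    (Spec.preimage ((Spec B).fromSpecStalk x)).hom b ∈
      nonZeroDivisors ((Spec B).presheaf.stalk x) := by
  have hwt : Spec.preimage ((Spec B).fromSpecStalk x) = StructureSheaf.toStalk B x := by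
    apply Spec.map_injective
    rw [Spec.map_preimage]
    exact AlgebraicGeometry.Spec.fromSpecStalk_eq' B x
  rw [hwt]
  let y : PrimeSpectrum B := x
  let : Algebra B ((Spec.structureSheaf B).presheaf.stalk y) :=
    (StructureSheaf.toStalk B x).hom.toAlgebra
  have : IsLocalization.AtPrime ((Spec.structureSheaf B).presheaf.stalk y) y.asIdeal :=
    StructureSheaf.IsLocalization.to_stalk B y
  exact IsLocalization.map_nonZeroDivisors_le y.asIdeal.primeCompl
    ((Spec.structureSheaf B).presheaf.stalk y) (Submonoid.mem_map_of_mem _ hb)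

/-- The condition under which a diagram of open immersions can be glued. The local ring at the point
`xi` maps to both charts over the same map to `X`, because both agree in the chart `k`.
`exists_common` for this local ring produces the smaller chart, and the closed point gives the point
in it. -/
lemma exists_common_point {i j k : ChartIndex I} (fi : i ≤ k) (fj : j ≤ k) (xi : Spec i.ring)
    (xj : Spec j.ring) (hx' : Spec.map (map fi) xi = Spec.map (map fj) xj) :
    ∃ (l : ChartIndex I) (hli : l ≤ i) (hlj : l ≤ j) (x : Spec l.ring),
      Spec.map (map hli) x = xi ∧ Spec.map (map hlj) x = xj := by
  have := isOpenImmersion_map fi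
  have := isOpenImmersion_map fj
  let R := (Spec i.ring).presheaf.stalk xi
  let w : Spec R ⟶ Spec i.ring := (Spec i.ring).fromSpecStalk xi
  -- `p` is the closed point of the spectrum of a local ring, so an open set that contains its image
  -- contains the whole image.
  obtain ⟨p, hw, hp⟩ : ∃ p : Spec R, w p = xi ∧ ∀ {Y : Scheme.{u}} (f : Spec R ⟶ Y) (V : Y.Opens),
      f p ∈ V → ∀ y, f y ∈ V := ⟨IsLocalRing.closedPoint ((Spec i.ring).presheaf.stalk xi),
    Scheme.fromSpecStalk_closedPoint,
    fun f V h ↦ mem_of_isLocalRing (R := (Spec i.ring).presheaf.stalk xi) f V h⟩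
  have hrange : ∀ y, (w ≫ Spec.map (map fi)) y ∈ (Spec.map (map fj)).opensRange := by
    apply hp
    rw [Scheme.Hom.comp_apply, hw, hx']
    exact ⟨xj, rfl⟩
  let w' : Spec R ⟶ Spec j.ring := IsOpenImmersion.lift (Spec.map (map fj))
    (w ≫ Spec.map (map fi)) (by rintro _ ⟨y, rfl⟩; exact hrange y)
  have hw'f : w' ≫ Spec.map (map fj) = w ≫ Spec.map (map fi) :=
    IsOpenImmersion.lift_fac _ _ _
  have hw' : w' p = xj := by
    apply (Spec.map (map fj)).isOpenEmbedding.injective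
    rw [← Scheme.Hom.comp_apply, hw'f, Scheme.Hom.comp_apply, hw, hx']
  have hbase : w ≫ i.toBase = w' ≫ j.toBase := by
    rw [← map_toBase fi, ← map_toBase fj, ← Category.assoc, ← hw'f, Category.assoc]
  obtain ⟨gi, gj, hgg, hpV⟩ := exists_basicOpen_le_affine_inter i.V.2 j.V.2 (i.toBase xi)
    ⟨toBase_mem i xi, by
      have h1 : (w ≫ i.toBase) p = (w' ≫ j.toBase) p := by rw [hbase]
      rw [Scheme.Hom.comp_apply, Scheme.Hom.comp_apply, hw] at h1
      rw [h1]
      exact toBase_mem j _⟩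
  let V : X.affineOpens := X.affineBasicOpen gi
  have hi : V.1 ≤ i.V.1 := X.basicOpen_le gi
  have hj : V.1 ≤ j.V.1 := hgg.le.trans (X.basicOpen_le gj)
  obtain ⟨φ, hφ⟩ := exists_SpecMap_fromSpec (w ≫ i.toBase) V.2
    (hp _ _ (by rw [Scheme.Hom.comp_apply, hw]; exact hpV))
  have hβ : i.incl ≫ Spec.preimage w = restr hi ≫ φ := by
    apply SpecMap_fromSpec_inj i.V.2
    rw [Spec.map_comp_assoc, Spec.map_comp_assoc, Spec.map_preimage, restr_fromSpec hi V.2 i.V.2,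
      hφ, toBase]
  have hβ' : j.incl ≫ Spec.preimage w' = restr hj ≫ φ := by
    apply SpecMap_fromSpec_inj j.V.2
    rw [Spec.map_comp_assoc, Spec.map_comp_assoc, Spec.map_preimage, restr_fromSpec hj V.2 j.V.2,
      hφ, hbase, toBase]
  obtain ⟨s, hs⟩ := i.nonempty
  have hnz : (Spec.preimage w).hom (i.incl.hom s) ∈ nonZeroDivisors R :=
    preimage_fromSpecStalk_nonZeroDivisors xi (i.generates_incl s hs).2
  obtain ⟨l, hli, hlj, γ, h1, h2⟩ := exists_common (Spec.preimage w) (Spec.preimage w') hi hj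
    ⟨gi, rfl⟩ ⟨gj, hgg⟩ φ hβ hβ' hnz (by
      rw [← map_restr hi, ← hβ, CommRingCat.hom_comp, ← Ideal.map_map,
        (i.generates_incl s hs).1, Ideal.map_span, Set.image_singleton])
  refine ⟨l, hli, hlj, Spec.map γ p, ?_, ?_⟩
  · rw [← Scheme.Hom.comp_apply, ← Spec.map_comp, h1, Spec.map_preimage, hw]
  · rw [← Scheme.Hom.comp_apply, ← Spec.map_comp, h2, Spec.map_preimage, hw']

instance : (functor I ⋙ Scheme.forget).IsLocallyDirected where
  cond fi fj xi xj hx := by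
    obtain ⟨l, hli, hlj, x, h1, h2⟩ := exists_common_point (leOfHom fi) (leOfHom fj) xi xj hx
    exact ⟨l, homOfLE hli, homOfLE hlj, x, h1, h2⟩

end ChartIndex

end Resolution
end

/-! ### The blow-up as a gluing of charts, and its universal property -/

noncomputable section
namespace Resolution

open Scheme.IdealSheafData ChartIndex

lemma isEffectiveCartier_of_openImmersion {Y : Scheme.{u}} {J : Y.IdealSheafData}
    (h : ∀ y : Y, ∃ (U : Scheme.{u}) (j : U ⟶ Y) (_ : IsOpenImmersion j) (u : U),
      j u = y ∧ IsEffectiveCartier (J.comap j)) : IsEffectiveCartier J := by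
  intro y
  obtain ⟨U, j, hj, u, rfl, hU⟩ := h y
  obtain ⟨V, hu, f, hf, hJ⟩ := hU u
  let e := (j.appIso V.1).commRingCatIsoToRingEquiv
  rw [ideal_comap_eq_map] at hJ
  refine ⟨⟨j ''ᵁ V.1, V.2.image_of_isOpenImmersion j⟩, ⟨u, hu, rfl⟩, e.symm f, ?_, ?_⟩
  · rw [← MulEquivClass.map_nonZeroDivisors e.symm]
    exact Submonoid.mem_map_of_mem _ hf
  · have h1 := congrArg (Ideal.map e.symm) hJ
    rw [Ideal.map_span, Set.image_singleton] at h1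
    rw [← h1]
    exact (Ideal.map_of_equiv e).symm

lemma isEffectiveCartier_comap_fromSpec {X : Scheme.{u}} {I : X.IdealSheafData}
    {R : CommRingCat.{u}} {V : X.affineOpens} (φ : Γ(X, V.1) ⟶ R) {s : R}
    (hs : s ∈ nonZeroDivisors R) (h : (I.ideal V).map φ.hom = Ideal.span {s}) :
    IsEffectiveCartier (I.comap (Spec.map φ ≫ V.2.fromSpec)) := by
  intro y
  have hle : (⊤ : (Spec Γ(X, V.1)).Opens) ≤ V.2.fromSpec ⁻¹ᵁ V.1 := by
    rw [V.2.fromSpec_preimage_self]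
  have h1 : (I.comap V.2.fromSpec).ideal ⟨⊤, isAffineOpen_top _⟩ =
      (I.ideal V).map (Scheme.ΓSpecIso Γ(X, V.1)).inv.hom := by
    rw [ideal_comap_of_le _ I V ⟨⊤, isAffineOpen_top _⟩ hle]
    have e : ∀ m : Opposite.op (⊤ : (Spec Γ(X, V.1)).Opens) ⟶ Opposite.op ⊤,
        (Spec Γ(X, V.1)).presheaf.map m = 𝟙 _ := fun m ↦ by
      rw [Subsingleton.elim m (𝟙 _)]
      exact (Spec Γ(X, V.1)).presheaf.map_id _
    rw [Scheme.Hom.appLE, V.2.fromSpec_app_self, Category.assoc, ← Functor.map_comp, e,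
      Category.comp_id]
  refine ⟨⟨⊤, isAffineOpen_top _⟩, trivial, (Scheme.ΓSpecIso R).inv.hom s, ?_, ?_⟩
  · have := MulEquivClass.map_nonZeroDivisors
      (Scheme.ΓSpecIso R).symm.commRingCatIsoToRingEquiv
    rw [← this]
    exact Submonoid.mem_map_of_mem _ hs
  · rw [comap_comp, ideal_comap_top_of_isAffine, h1, Ideal.map_map, ← CommRingCat.hom_comp,
      ← Set.image_singleton, ← Ideal.map_span, ← h, Ideal.map_map, ← CommRingCat.hom_comp]
    congr 2
    exact (Scheme.ΓSpecIso_inv_naturality φ).symm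

variable {X : Scheme.{u}} (I : X.IdealSheafData)

/-- The blow-up of `X` along the closed subscheme with ideal sheaf `I`. -/
def blowup : Scheme.{u} := colimit (ChartIndex.functor I)

/-- The inclusion of an affine chart of the blow-up. -/
def blowupChart (i : ChartIndex I) : Spec i.ring ⟶ blowup I := colimit.ι (ChartIndex.functor I) i

instance (i : ChartIndex I) : IsOpenImmersion (blowupChart I i) :=
  inferInstanceAs (IsOpenImmersion (colimit.ι (ChartIndex.functor I) i))

lemma map_blowupChart {i j : ChartIndex I} (h : i ≤ j) :
    Spec.map (ChartIndex.map h) ≫ blowupChart I j = blowupChart I i :=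
  colimit.w (ChartIndex.functor I) (homOfLE h)

/-- The structure map of the blow-up. -/
def blowupMap : blowup I ⟶ X := colimit.desc (ChartIndex.functor I)
  { pt := X
    ι := { app i := i.toBase
           naturality i j f := by
             change Spec.map (ChartIndex.map (leOfHom f)) ≫ j.toBase = i.toBase ≫ 𝟙 X
             rw [map_toBase, Category.comp_id] } }

lemma blowupChart_map (i : ChartIndex I) : blowupChart I i ≫ blowupMap I = i.toBase :=
  colimit.ι_desc _ _

lemma exists_blowupChart (x : blowup I) : ∃ (i : ChartIndex I) (y : Spec i.ring),
    blowupChart I i y = x :=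
  Scheme.IsLocallyDirected.ι_jointly_surjective (ChartIndex.functor I) x

lemma isEffectiveCartier_blowup : IsEffectiveCartier (I.comap (blowupMap I)) := by
  refine isEffectiveCartier_of_openImmersion fun x ↦ ?_
  obtain ⟨i, y, rfl⟩ := exists_blowupChart I x
  refine ⟨_, blowupChart I i, inferInstance, y, rfl, ?_⟩
  rw [← comap_comp, blowupChart_map]
  obtain ⟨s, hs⟩ := i.nonempty
  exact isEffectiveCartier_comap_fromSpec i.incl (i.generates_incl s hs).2
    (i.generates_incl s hs).1

lemma locallyOfFiniteType_blowupMap [IsLocallyNoetherian X] :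
    LocallyOfFiniteType (blowupMap I) := by
  have key : ∀ i : ChartIndex I, LocallyOfFiniteType (blowupChart I i ≫ blowupMap I) := by
    intro i
    rw [blowupChart_map, toBase]
    have hnoeth : IsNoetherianRing Γ(X, i.V.1) := IsLocallyNoetherian.component_noetherian i.V
    have : LocallyOfFiniteType (Spec.map i.incl) := by
      rw [HasRingHomProperty.Spec_iff (P := @LocallyOfFiniteType)]
      exact (RingHom.finiteType_algebraMap).mpr finiteType_chartRing
    have h2 : IsOpenImmersion i.V.2.fromSpec := i.V.2.isOpenImmersion_fromSpec
    have h3 : LocallyOfFiniteType i.V.2.fromSpec := locallyOfFiniteType_of_isOpenImmersion _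
    exact locallyOfFiniteType_comp (Spec.map i.incl) i.V.2.fromSpec
  let 𝒰 := Scheme.IsLocallyDirected.openCover (ChartIndex.functor I)
  let P : MorphismProperty Scheme.{u} := @LocallyOfFiniteType
  have : HasRingHomProperty P RingHom.FiniteType :=
    inferInstanceAs (HasRingHomProperty @LocallyOfFiniteType RingHom.FiniteType)
  exact (IsZariskiLocalAtSource.iff_of_openCover (P := P) 𝒰).mpr key

lemma exists_affine_nhd_span {T : Scheme.{u}} {E : T.IdealSheafData} (hE : IsEffectiveCartier E)
    (t : T) (O : T.Opens) (hO : t ∈ O) : ∃ N : T.affineOpens, t ∈ N.1 ∧ N.1 ≤ O ∧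
      ∃ f ∈ nonZeroDivisors Γ(T, N.1), E.ideal N = Ideal.span {f} := by
  obtain ⟨V, hx, f, hf, hEf⟩ := hE t
  obtain ⟨g, hgO, hgt⟩ := V.2.exists_basicOpen_le (V := O) ⟨t, hO⟩ hx
  have hloc := V.2.isLocalization_basicOpen g
  refine ⟨T.affineBasicOpen g, hgt, hgO, (T.presheaf.map (homOfLE (T.basicOpen_le g)).op).hom f,
    ?_, ?_⟩
  · exact IsLocalization.map_nonZeroDivisors_le (Submonoid.powers g) Γ(T, T.basicOpen g)
      (Submonoid.mem_map_of_mem _ hf)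
  · rw [← E.map_ideal_basicOpen V g, hEf, Ideal.map_span, Set.image_singleton]
    rfl

lemma ideal_map_appLE {T : Scheme.{u}} (g : T ⟶ X) (V : X.affineOpens) (N : T.affineOpens)
    (e : N.1 ≤ g ⁻¹ᵁ V.1) : (I.ideal V).map (g.appLE V.1 N.1 e).hom = (I.comap g).ideal N :=
  (ideal_comap_of_le g I V N e).symm

/-- A lift of an affine open subset through a chart. -/
lemma exists_lift_chart {T : Scheme.{u}} (l : T ⟶ blowup I) {N : T.Opens} (hN : IsAffineOpen N)
    (i : ChartIndex I) (h : ∀ y ∈ N, l y ∈ (blowupChart I i).opensRange) :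
    ∃ β : i.ring ⟶ Γ(T, N), Spec.map β ≫ blowupChart I i = hN.fromSpec ≫ l := by
  refine ⟨Spec.preimage (IsOpenImmersion.lift (blowupChart I i) (hN.fromSpec ≫ l) ?_), ?_⟩
  · rintro _ ⟨y, rfl⟩
    rw [Scheme.Hom.comp_apply]
    refine h _ ?_
    have : hN.fromSpec y ∈ Set.range hN.fromSpec := ⟨y, rfl⟩
    rwa [hN.range_fromSpec] at this
  · rw [Spec.map_preimage]
    exact IsOpenImmersion.lift_fac _ _ _

/-- Locally on `T` the two maps factor through charts `i` and `j`. Over a common affine open subset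
of `X` both factor through one smaller chart, by the same map. -/
lemma blowup_hom_ext {T : Scheme.{u}} {l l' : T ⟶ blowup I}
    (h : l ≫ blowupMap I = l' ≫ blowupMap I)
    (hC : IsEffectiveCartier (I.comap (l ≫ blowupMap I))) : l = l' := by
  refine Scheme.hom_ext_of_forall _ _ fun t ↦ ?_
  obtain ⟨i, y, hy⟩ := exists_blowupChart I (l t)
  obtain ⟨j, y', hy'⟩ := exists_blowupChart I (l' t)
  let g := l ≫ blowupMap I
  have hgi : g t = i.toBase y := by
    rw [← blowupChart_map, Scheme.Hom.comp_apply]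
    exact congrArg (blowupMap I) hy.symm
  have hgj : g t = j.toBase y' := by
    rw [← blowupChart_map, Scheme.Hom.comp_apply]
    exact congr($h t).trans (congrArg (blowupMap I) hy'.symm)
  obtain ⟨gi, gj, hgg, hp⟩ := exists_basicOpen_le_affine_inter i.V.2 j.V.2 (g t)
    ⟨hgi ▸ toBase_mem i y, hgj ▸ toBase_mem j y'⟩
  let V : X.affineOpens := X.affineBasicOpen gi
  have hi : V.1 ≤ i.V.1 := X.basicOpen_le gi
  have hj : V.1 ≤ j.V.1 := hgg.le.trans (X.basicOpen_le gj)
  obtain ⟨N, htN, hNO, e, he, hIe⟩ := exists_affine_nhd_span hC t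
    (g ⁻¹ᵁ V.1 ⊓ l ⁻¹ᵁ (blowupChart I i).opensRange ⊓ l' ⁻¹ᵁ (blowupChart I j).opensRange)
    ⟨⟨hp, y, hy⟩, y', hy'⟩
  obtain ⟨β, hβ⟩ := exists_lift_chart I l N.2 i fun y hy ↦ (hNO hy).1.2
  obtain ⟨β', hβ'⟩ := exists_lift_chart I l' N.2 j fun y hy ↦ (hNO hy).2
  have hNV : N.1 ≤ g ⁻¹ᵁ V.1 := fun y hy ↦ (hNO hy).1.1
  have hbase : ∀ (k : ChartIndex I) (β : k.ring ⟶ Γ(T, N.1)) (hk : V.1 ≤ k.V.1)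
      (_ : Spec.map β ≫ blowupChart I k ≫ blowupMap I = N.2.fromSpec ≫ g),
      k.incl ≫ β = restr hk ≫ g.appLE V.1 N.1 hNV := by
    intro k β hk h
    apply SpecMap_fromSpec_inj k.V.2
    rw [Spec.map_comp_assoc, Spec.map_comp_assoc, restr_fromSpec hk V.2 k.V.2,
      IsAffineOpen.SpecMap_appLE_fromSpec g V.2 N.2, ← h, blowupChart_map, toBase]
  obtain ⟨k, hki, hkj, γ, h1, h2⟩ := exists_common β β' hi hj ⟨gi, rfl⟩ ⟨gj, hgg⟩
    (g.appLE V.1 N.1 hNV) (hbase i β hi (by rw [reassoc_of% hβ]))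
    (hbase j β' hj (by rw [reassoc_of% hβ', ← h])) he
    ((ideal_map_appLE I g V N hNV).trans hIe)
  refine ⟨N.1, htN, ?_⟩
  have key : N.2.fromSpec ≫ l = N.2.fromSpec ≫ l' := by
    rw [← hβ, ← hβ', ← h1, ← h2, Spec.map_comp_assoc, Spec.map_comp_assoc, map_blowupChart,
      map_blowupChart]
  rw [← N.2.isoSpec_hom_fromSpec, Category.assoc, key, Category.assoc]

/-- At the point `t` the inverse image of `I` is generated by the image of a single section `s` of
`I`, and this persists on a basic open neighbourhood. The chart with `S = {s}` receives that
neighbourhood. -/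
lemma exists_local_lift {T : Scheme.{u}} (g : T ⟶ X) (hC : IsEffectiveCartier (I.comap g))
    (t : T) : ∃ (U : T.Opens) (_ : t ∈ U) (l : U.toScheme ⟶ blowup I),
      l ≫ blowupMap I = U.ι ≫ g := by
  obtain ⟨V, hV⟩ := exists_affine_mem (g t)
  obtain ⟨N, htN, hNV, f, hf, hIf⟩ := exists_affine_nhd_span hC t (g ⁻¹ᵁ V.1) hV
  let φ := g.appLE V.1 N.1 hNV
  have hIφ : (I.ideal V).map φ.hom = Ideal.span {f} := (ideal_map_appLE I g V N hNV).trans hIf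
  let := T.presheaf.algebra_section_stalk (U := N.1) ⟨t, htN⟩
  have hloc := N.2.isLocalization_stalk ⟨t, htN⟩
  let α := algebraMap Γ(T, N.1) (T.presheaf.stalk t)
  have hαf : α f ∈ nonZeroDivisors (T.presheaf.stalk t) :=
    IsLocalization.map_nonZeroDivisors_le (N.2.primeIdealOf ⟨t, htN⟩).asIdeal.primeCompl _
      (Submonoid.mem_map_of_mem _ hf)
  obtain ⟨s, hs, hsf⟩ := exists_mem_span_singleton_eq (α.comp φ.hom) (I.ideal V) hαf (by
    rw [← Ideal.map_map, hIφ, Ideal.map_span, Set.image_singleton])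
  -- `q` clears the denominators in the equality of the ideals of `s` and `f` at `t`; on its basic
  -- open subset the section `s` generates the inverse image of `I`.
  obtain ⟨q, hq, hqf⟩ := exists_notMem_smul_le (L := T.presheaf.stalk t)
    (N.2.primeIdealOf ⟨t, htN⟩).asIdeal (N := Ideal.span {f}) (M := Ideal.span {φ.hom s})
    ⟨{f}, by simp⟩ (by
      rw [← Ideal.map_le_iff_le_comap, Ideal.map_span, Ideal.map_span, Set.image_singleton,
        Set.image_singleton]
      exact hsf.ge)
  have htq : t ∈ T.basicOpen q := by
    rw [T.mem_basicOpen q t htN]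
    exact IsLocalization.map_units (T.presheaf.stalk t)
      (⟨q, hq⟩ : (N.2.primeIdealOf ⟨t, htN⟩).asIdeal.primeCompl)
  let N' : T.affineOpens := T.affineBasicOpen q
  have hN'N : N'.1 ≤ N.1 := T.basicOpen_le q
  let τ : Γ(T, N.1) ⟶ Γ(T, N'.1) := restr hN'N
  let : Algebra Γ(T, N.1) Γ(T, N'.1) := τ.hom.toAlgebra
  have hlocq : IsLocalization.Away q Γ(T, N'.1) :=
    N.2.isLocalization_of_eq_basicOpen q (homOfLE hN'N) rfl
  have hτ : ∀ a, τ.hom a = algebraMap Γ(T, N.1) Γ(T, N'.1) a := fun _ ↦ rfl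
  have hI' : (I.ideal V).map (φ ≫ τ).hom = Ideal.span {(φ ≫ τ).hom s} := by
    apply le_antisymm
    · rw [CommRingCat.hom_comp, ← Ideal.map_map, hIφ, Ideal.map_span, Set.image_singleton,
        Ideal.span_singleton_le_iff_mem]
      have h1 := Ideal.mem_map_of_mem τ.hom (hqf f (Ideal.mem_span_singleton_self f))
      have hqu : IsUnit (τ.hom q) := IsLocalization.Away.algebraMap_isUnit q
      rw [map_mul, Ideal.unit_mul_mem_iff_mem _ hqu, Ideal.map_span, Set.image_singleton] at h1
      exact h1
    · rw [Ideal.span_singleton_le_iff_mem]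
      exact Ideal.mem_map_of_mem _ hs
  have hnz : (φ ≫ τ).hom s ∈ nonZeroDivisors Γ(T, N'.1) := by
    refine mem_nonZeroDivisors_of_span_eq (b := τ.hom f) ?_ ?_
    · exact IsLocalization.map_nonZeroDivisors_le (Submonoid.powers q) Γ(T, N'.1)
        (Submonoid.mem_map_of_mem _ hf)
    · rw [← hI', CommRingCat.hom_comp, ← Ideal.map_map, hIφ, Ideal.map_span, Set.image_singleton]
  let i : ChartIndex I := ⟨V, {s}, by simpa using hs, Finset.singleton_nonempty s⟩
  obtain ⟨β, hβ⟩ := i.exists_lift (φ ≫ τ) (by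
    intro s' hs'
    rw [Finset.mem_singleton.mp hs']
    exact ⟨hI', hnz⟩)
  refine ⟨N'.1, htq, N'.2.isoSpec.hom ≫ Spec.map β ≫ blowupChart I i, ?_⟩
  rw [Category.assoc, Category.assoc, blowupChart_map, toBase, ← Spec.map_comp_assoc, hβ,
    Spec.map_comp_assoc, IsAffineOpen.SpecMap_appLE_fromSpec g V.2 N.2,
    restr_fromSpec_assoc hN'N N'.2 N.2, ← Category.assoc,
    N'.2.isoSpec_hom_fromSpec]

theorem isBlowup_blowupMap : IsBlowup (blowupMap I) I where
  cartier := isEffectiveCartier_blowup I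
  existsUnique_lift {T} g hg := by
    choose U hU l hl using exists_local_lift I g hg
    let 𝒰 : T.OpenCover := T.openCoverOfIsOpenCover U
      (TopologicalSpace.Opens.ext (Set.eq_univ_of_forall fun t ↦ by
        simpa using ⟨t, hU t⟩))
    let l' : ∀ t, 𝒰.X t ⟶ blowup I := l
    have hl' : ∀ t, l' t ≫ blowupMap I = 𝒰.f t ≫ g := hl
    have hcomp : ∀ t t', pullback.fst (𝒰.f t) (𝒰.f t') ≫ l' t =
        pullback.snd (𝒰.f t) (𝒰.f t') ≫ l' t' := by
      intro t t'
      refine blowup_hom_ext I ?_ ?_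
      · rw [Category.assoc, Category.assoc, hl', hl', pullback.condition_assoc]
      · rw [Category.assoc, hl', ← Category.assoc, comap_comp]
        exact hg.comap_of_isOpenImmersion _
    have hglue : 𝒰.glueMorphisms l' hcomp ≫ blowupMap I = g := by
      refine Scheme.Cover.hom_ext 𝒰 _ _ fun t ↦ ?_
      have h1 := Scheme.Cover.ι_glueMorphisms 𝒰 l' hcomp t
      rw [← Category.assoc, h1, hl']
    refine ⟨𝒰.glueMorphisms l' hcomp, hglue, fun m hm ↦ ?_⟩
    exact blowup_hom_ext I (hm.trans hglue.symm) (hm ▸ hg)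

variable {I}

/-- Blow-ups are unique up to isomorphism. -/
lemma IsBlowup.exists_iso {X' X'' : Scheme.{u}} {π : X' ⟶ X} {π' : X'' ⟶ X}
    (h : IsBlowup π I) (h' : IsBlowup π' I) : ∃ e : X' ≅ X'', e.hom ≫ π' = π := by
  obtain ⟨a, ha, -⟩ := h'.existsUnique_lift π h.cartier
  obtain ⟨b, hb, -⟩ := h.existsUnique_lift π' h'.cartier
  refine ⟨⟨a, b, ?_, ?_⟩, ha⟩
  · exact (h.existsUnique_lift π h.cartier).unique (by rw [Category.assoc, hb, ha])
      (Category.id_comp _)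
  · exact (h'.existsUnique_lift π' h'.cartier).unique (by rw [Category.assoc, ha, hb])
      (Category.id_comp _)

lemma IsBlowup.locallyOfFiniteType [IsLocallyNoetherian X] {X' : Scheme.{u}} {π : X' ⟶ X}
    (h : IsBlowup π I) : LocallyOfFiniteType π := by
  obtain ⟨e, he⟩ := h.exists_iso (isBlowup_blowupMap I)
  have := locallyOfFiniteType_blowupMap I
  rw [← he]
  infer_instance

end Resolution
end

/-! ### Local rings of smooth schemes over a field of characteristic zero -/

noncomputable section
namespace Resolution

section LocalAlgebra

variable (k A : Type*) [Field k] [CommRing A] [Algebra k A]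

lemma isUnit_natCast_of_algebra [CharZero k] {n : ℕ} (hn : n ≠ 0) : IsUnit (n : A) := by
  have h : IsUnit (n : k) := (Nat.cast_ne_zero.mpr hn).isUnit
  simpa using h.map (algebraMap k A)

/-- Since `k` is perfect, the residue field is formally smooth over `k`. The Jacobian criterion
applied to `A → A/𝔪` therefore gives parameters with dual derivations, also at non-closed points. -/
lemma exists_dual_of_essFiniteType [CharZero k] [IsLocalRing A] [Algebra.EssFiniteType k A]
    [Algebra.FormallySmooth k A] : ∃ (n : ℕ) (x : Fin n → A) (D : Fin n → Derivation k A A),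
    Ideal.span (Set.range x) = IsLocalRing.maximalIdeal A ∧
      ∀ i j, D i (x j) = if i = j then 1 else 0 := by
  have : IsNoetherianRing A := Algebra.EssFiniteType.isNoetherianRing k A
  have : Algebra.EssFiniteType k (IsLocalRing.ResidueField A) := Algebra.EssFiniteType.comp k A _
  have : Algebra.FormallySmooth k (IsLocalRing.ResidueField A) :=
    Algebra.FormallySmooth.of_perfectField
  obtain ⟨n, x, D, h1, h2⟩ := exists_dual_of_formallySmooth (k := k) (A := A)
    (R := IsLocalRing.ResidueField A) IsLocalRing.residue_surjective
  exact ⟨n, x, D, h1.trans IsLocalRing.ker_residue, h2⟩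

lemma isDomain_of_formallySmooth (k A : Type*) [Field k] [CommRing A] [Algebra k A] [CharZero k]
    [IsLocalRing A] [Algebra.EssFiniteType k A] [Algebra.FormallySmooth k A] : IsDomain A := by
  have : IsNoetherianRing A := Algebra.EssFiniteType.isNoetherianRing k A
  obtain ⟨n, x, D, h1, h2⟩ := exists_dual_of_essFiniteType k A
  exact isDomain_of_dual (D := fun i ↦ (D i).restrictScalars ℤ) h2
    (fun n hn ↦ isUnit_natCast_of_algebra k A hn) h1

lemma mem_maximalIdeal_pow_of_pow_mem (k A : Type*) [Field k] [CommRing A] [Algebra k A]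
    [CharZero k] [IsLocalRing A] [Algebra.EssFiniteType k A] [Algebra.FormallySmooth k A] {a : A} {e c : ℕ} (he : 0 < e)
    (h : a ^ e ∈ IsLocalRing.maximalIdeal A ^ (e * c)) : a ∈ IsLocalRing.maximalIdeal A ^ c := by
  obtain ⟨n, x, D, h1, h2⟩ := exists_dual_of_essFiniteType k A
  exact mem_pow_of_pow_mem_pow (D := fun i ↦ (D i).restrictScalars ℤ) h2
    (fun n hn ↦ isUnit_natCast_of_algebra k A hn) h1 he h

end LocalAlgebra

variable {k : Type u} [Field k]

/-- The `k`-algebra structure of the stalks of a `k`-scheme. -/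
abbrev stalkAlgebra {X : Scheme.{u}} (p : X ⟶ Spec (CommRingCat.of k)) (x : X) :
    Algebra k (X.presheaf.stalk x) :=
  ((Scheme.ΓSpecIso (CommRingCat.of k)).inv ≫ p.appTop ≫
    X.presheaf.germ ⊤ x trivial).hom.toAlgebra

lemma germ_algebraMap {X : Scheme.{u}} (p : X ⟶ Spec (CommRingCat.of k)) (V : X.Opens) (x : X)
    (hx : x ∈ V) (c : k) :
    (X.presheaf.germ V x hx).hom ((sectionsAlgebra p V).algebraMap c) =
      (stalkAlgebra p x).algebraMap c := by
  have e : p.appLE ⊤ V le_top ≫ X.presheaf.germ V x hx =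
      p.appTop ≫ X.presheaf.germ ⊤ x trivial := by
    change (p.app ⊤ ≫ X.presheaf.map _) ≫ X.presheaf.germ V x hx = _
    rw [Category.assoc, TopCat.Presheaf.germ_res]
    rfl
  exact congr(($e).hom ((Scheme.ΓSpecIso (CommRingCat.of k)).inv.hom c))

lemma stalkMap_algebraMap {X Y : Scheme.{u}} (f : X ⟶ Y) {p : Y ⟶ Spec (CommRingCat.of k)}
    {q : X ⟶ Spec (CommRingCat.of k)} (h : f ≫ p = q) (x : X) (c : k) :
    (f.stalkMap x).hom ((stalkAlgebra p (f x)).algebraMap c) =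
      (stalkAlgebra q x).algebraMap c := by
  subst h
  have e : p.appTop ≫ Y.presheaf.germ ⊤ (f x) trivial ≫ f.stalkMap x =
      (f ≫ p).appTop ≫ X.presheaf.germ ⊤ x trivial := by
    have h := f.germ_stalkMap ⊤ x trivial
    have h2 : p.appTop ≫ f.appTop ≫ X.presheaf.germ ⊤ x trivial =
        (f ≫ p).appTop ≫ X.presheaf.germ ⊤ x trivial := by
      rw [Scheme.Hom.comp_appTop, Category.assoc]
    rw [← h2]
    exact congrArg (p.appTop ≫ ·) h
  exact congr(($e).hom ((Scheme.ΓSpecIso (CommRingCat.of k)).inv.hom c))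

lemma sectionsAlgebra_property {Q : ∀ {R S : Type u} [CommRing R] [CommRing S], (R →+* S) → Prop}
    {P : MorphismProperty Scheme.{u}} [HasRingHomProperty P Q] {X : Scheme.{u}}
    {p : X ⟶ Spec (CommRingCat.of k)} :
    P p ↔ ∀ V : X.affineOpens, Q (sectionsAlgebra p V.1).algebraMap := by
  have hQ := (HasRingHomProperty.isLocal_ringHomProperty P).respectsIso
  have key : ∀ V : X.affineOpens,
      Q (sectionsAlgebra p V.1).algebraMap ↔ Q (p.appLE ⊤ V.1 le_top).hom := by
    intro V
    change Q ((Scheme.ΓSpecIso (CommRingCat.of k)).inv ≫ p.appLE ⊤ V.1 le_top).hom ↔ _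
    rw [CommRingCat.hom_comp, hQ.cancel_left_isIso]
  simp_rw [key]
  constructor
  · intro h V
    exact HasRingHomProperty.appLE P p h ⟨⊤, isAffineOpen_top _⟩ V _
  · intro h
    refine HasRingHomProperty.of_iSup_eq_top (P := P) (fun V : X.affineOpens ↦ V) ?_ h
    exact iSup_affineOpens_eq_top X

lemma isLocallyNoetherian_of_field {X : Scheme.{u}} (p : X ⟶ Spec (CommRingCat.of k))
    [LocallyOfFiniteType p] : IsLocallyNoetherian X :=
  LocallyOfFiniteType.isLocallyNoetherian p

lemma essFiniteType_stalk {X : Scheme.{u}} (p : X ⟶ Spec (CommRingCat.of k))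
    [h : LocallyOfFiniteType p] (x : X) :
    letI := stalkAlgebra p x; Algebra.EssFiniteType k (X.presheaf.stalk x) := by
  obtain ⟨V, hx⟩ := exists_affine_mem x
  let _ := sectionsAlgebra p V.1
  let _ := stalkAlgebra p x
  have h1 : Algebra.FiniteType k Γ(X, V.1) :=
    (sectionsAlgebra_property (P := @LocallyOfFiniteType)).mp h V
  let _ := TopCat.Presheaf.algebra_section_stalk X.presheaf (U := V.1) ⟨x, hx⟩
  have := V.2.isLocalization_stalk ⟨x, hx⟩
  have h2 : Algebra.EssFiniteType Γ(X, V.1) (X.presheaf.stalk x) :=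
    Algebra.EssFiniteType.of_isLocalization _ (V.2.primeIdealOf ⟨x, hx⟩).asIdeal.primeCompl
  have : IsScalarTower k Γ(X, V.1) (X.presheaf.stalk x) :=
    IsScalarTower.of_algebraMap_eq fun c ↦ (germ_algebraMap p V.1 x hx c).symm
  exact Algebra.EssFiniteType.comp k Γ(X, V.1) _

lemma formallySmooth_stalk {X : Scheme.{u}} (p : X ⟶ Spec (CommRingCat.of k))
    [h : Smooth p] (x : X) :
    letI := stalkAlgebra p x; Algebra.FormallySmooth k (X.presheaf.stalk x) := by
  obtain ⟨V, hx⟩ := exists_affine_mem x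
  let _ := sectionsAlgebra p V.1
  let _ := stalkAlgebra p x
  have h1 : Algebra.Smooth k Γ(X, V.1) :=
    (sectionsAlgebra_property (P := @Smooth)).mp h V
  let _ := TopCat.Presheaf.algebra_section_stalk X.presheaf (U := V.1) ⟨x, hx⟩
  have := V.2.isLocalization_stalk ⟨x, hx⟩
  have h2 : Algebra.FormallySmooth Γ(X, V.1) (X.presheaf.stalk x) :=
    Algebra.FormallySmooth.of_isLocalization (V.2.primeIdealOf ⟨x, hx⟩).asIdeal.primeCompl
  have : IsScalarTower k Γ(X, V.1) (X.presheaf.stalk x) :=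
    IsScalarTower.of_algebraMap_eq fun c ↦ (germ_algebraMap p V.1 x hx c).symm
  exact Algebra.FormallySmooth.comp k Γ(X, V.1) _

/-- Finite type over a field implies finite presentation, so smoothness can be tested prime by
prime. -/
lemma smooth_of_stalk {X : Scheme.{u}} (p : X ⟶ Spec (CommRingCat.of k))
    [h : LocallyOfFiniteType p] (H : ∀ x : X, letI := stalkAlgebra p x;
      Algebra.FormallySmooth k (X.presheaf.stalk x)) : Smooth p := by
  rw [sectionsAlgebra_property (P := @Smooth)]
  intro V
  let _ := sectionsAlgebra p V.1
  have h1 : Algebra.FiniteType k Γ(X, V.1) :=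
    (sectionsAlgebra_property (P := @LocallyOfFiniteType)).mp h V
  have h2 : Algebra.FinitePresentation k Γ(X, V.1) := Algebra.FinitePresentation.of_finiteType.mp h1
  change Algebra.Smooth k Γ(X, V.1)
  refine ⟨Algebra.smoothLocus_eq_univ_iff.mp (Set.eq_univ_of_forall fun q ↦ ?_), h2⟩
  let x : X := V.2.fromSpec q
  have hx : x ∈ V.1 := by
    have : x ∈ Set.range V.2.fromSpec := ⟨q, rfl⟩
    rwa [V.2.range_fromSpec] at this
  have hq : (V.2.primeIdealOf ⟨x, hx⟩) = q := by
    have h3 := V.2.fromSpec_primeIdealOf ⟨x, hx⟩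
    exact V.2.isOpenImmersion_fromSpec.base_open.injective h3
  let _ := stalkAlgebra p x
  let _ := TopCat.Presheaf.algebra_section_stalk X.presheaf (U := V.1) ⟨x, hx⟩
  have := V.2.isLocalization_stalk ⟨x, hx⟩
  have : IsScalarTower k Γ(X, V.1) (X.presheaf.stalk x) :=
    IsScalarTower.of_algebraMap_eq fun c ↦ (germ_algebraMap p V.1 x hx c).symm
  have h4 : Algebra.FormallySmooth k (X.presheaf.stalk x) := H x
  rw [← hq]
  let e := (IsLocalization.algEquiv (V.2.primeIdealOf ⟨x, hx⟩).asIdeal.primeCompl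
    (X.presheaf.stalk x)
    (Localization.AtPrime (V.2.primeIdealOf ⟨x, hx⟩).asIdeal)).restrictScalars k
  exact Algebra.FormallySmooth.of_equiv e

end Resolution
end

/-! ### Blow-ups of smooth schemes along smooth centers -/

noncomputable section
namespace Resolution

open Scheme.IdealSheafData

/-- Outside of the center the identity of `A` is an admissible test map, and its lift is the inverse
of `π`. -/
lemma HasBlowupLift.bijective {A A' : Type u} [CommRing A] [CommRing A'] [IsLocalRing A]
    {π : A →+* A'} [IsLocalHom π] (h : HasBlowupLift π (RingHom.id A') ⊤) :
    Function.Bijective π := by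
  obtain ⟨φ, h1, h2⟩ := h (RingHom.id A) π 1 rfl (one_mem _) (by simp)
    (by rw [Ideal.map_top, Ideal.span_singleton_one])
  exact ⟨Function.LeftInverse.injective fun a ↦ congr($h1 a),
    Function.RightInverse.surjective fun a ↦ congr($h2 a)⟩

/-- Writing `π xᵢ = e dᵢ` and `e = ∑ cᵢ π xᵢ` gives `∑ cᵢ dᵢ = 1`, so some `dᵢ` is a unit of the
local ring. The index selects the chart that contains the point. -/
lemma exists_span_map_eq {A A' : Type*} [CommRing A] [CommRing A'] [IsLocalRing A']
    (π : A →+* A') {n : ℕ} (x : Fin n → A) {e : A'} (he : e ∈ nonZeroDivisors A')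
    (h : (Ideal.span (Set.range x)).map π = Ideal.span {e}) :
    ∃ i, Ideal.span {π (x i)} = Ideal.span {e} := by
  rw [Ideal.map_span, ← Set.range_comp] at h
  have h1 : ∀ i, ∃ d, e * d = π (x i) := fun i ↦ by
    have : π (x i) ∈ Ideal.span {e} := h ▸ Ideal.subset_span ⟨i, rfl⟩
    obtain ⟨d, hd⟩ := Ideal.mem_span_singleton.mp this
    exact ⟨d, hd.symm⟩
  choose d hd using h1
  obtain ⟨c, hc⟩ := (Ideal.mem_span_range_iff_exists_fun).mp
    (h ▸ Ideal.mem_span_singleton_self e : e ∈ Ideal.span (Set.range (π ∘ x)))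
  have hsum : ∑ i, c i * d i = 1 := by
    refine (mul_cancel_left_mem_nonZeroDivisors he).mp ?_
    rw [mul_one, Finset.mul_sum]
    refine (Finset.sum_congr rfl fun i _ ↦ ?_).trans hc
    rw [Function.comp_apply, ← hd i]; ring
  by_contra! H
  have : (1 : A') ∈ IsLocalRing.maximalIdeal A' := by
    rw [← hsum]
    refine sum_mem fun i _ ↦ Ideal.mul_mem_left _ _ ?_
    rw [IsLocalRing.mem_maximalIdeal]
    intro hu
    refine H i ?_
    rw [← hd i]
    exact Ideal.span_singleton_mul_right_unit hu e
  exact (IsLocalRing.maximalIdeal.isMaximal A').ne_top ((Ideal.eq_top_iff_one _).mpr this)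

variable {k : Type u} [Field k]

lemma isNoetherianRing_stalk {X : Scheme.{u}} (p : X ⟶ Spec (CommRingCat.of k)) [Smooth p] (x : X) :
    IsNoetherianRing (X.presheaf.stalk x) := by
  let _ := stalkAlgebra p x
  have := essFiniteType_stalk p x
  exact Algebra.EssFiniteType.isNoetherianRing k _

lemma isDomain_stalk [CharZero k] {X : Scheme.{u}}
    (p : X ⟶ Spec (CommRingCat.of k)) [Smooth p] (x : X) :
    IsDomain (X.presheaf.stalk x) := by
  let _ := stalkAlgebra p x
  have := essFiniteType_stalk p x
  have := formallySmooth_stalk p x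
  exact isDomain_of_formallySmooth k _

lemma mem_maximalIdeal_pow_stalk [CharZero k] {X : Scheme.{u}}
    (p : X ⟶ Spec (CommRingCat.of k)) [Smooth p] (x : X)
    {a : X.presheaf.stalk x} {e c : ℕ} (he : 0 < e)
    (h : a ^ e ∈ IsLocalRing.maximalIdeal (X.presheaf.stalk x) ^ (e * c)) :
    a ∈ IsLocalRing.maximalIdeal (X.presheaf.stalk x) ^ c := by
  let _ := stalkAlgebra p x
  have := essFiniteType_stalk p x
  have := formallySmooth_stalk p x
  exact mem_maximalIdeal_pow_of_pow_mem k _ he h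

lemma isReduced_of_smooth [CharZero k] {X : Scheme.{u}}
    (p : X ⟶ Spec (CommRingCat.of k)) [Smooth p] : IsReduced X := by
  have : ∀ x : X, _root_.IsReduced (X.presheaf.stalk x) := fun x ↦ by
    have := isDomain_stalk p x
    infer_instance
  exact isReduced_of_isReduced_stalk X

variable {X Z : Scheme.{u}} {p : X ⟶ Spec (CommRingCat.of k)} {q : Z ⟶ Spec (CommRingCat.of k)}

lemma surjective_stalkMap_of_isClosedImmersion (j : Z ⟶ X) [IsClosedImmersion j] (z : Z) :
    Function.Surjective (j.stalkMap z).hom :=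
  j.stalkMap_surjective z

/-- Smooth closed subschemes of smooth schemes are locally given by coordinates. -/
lemma exists_dual_ker [Smooth p] [Smooth q] (j : Z ⟶ X) [IsClosedImmersion j] (hj : j ≫ p = q)
    (z : Z) : letI := stalkAlgebra p (j z)
    ∃ (n : ℕ) (x : Fin n → X.presheaf.stalk (j z))
      (D : Fin n → Derivation k (X.presheaf.stalk (j z)) (X.presheaf.stalk (j z))),
      Ideal.span (Set.range x) = RingHom.ker (j.stalkMap z).hom ∧
        ∀ i l, D i (x l) = if i = l then 1 else 0 := by
  let _ := stalkAlgebra p (j z)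
  let _ := stalkAlgebra q z
  let _ : Algebra (X.presheaf.stalk (j z)) (Z.presheaf.stalk z) := (j.stalkMap z).hom.toAlgebra
  have : IsScalarTower k (X.presheaf.stalk (j z)) (Z.presheaf.stalk z) :=
    IsScalarTower.of_algebraMap_eq fun c ↦ (stalkMap_algebraMap j hj z c).symm
  have := formallySmooth_stalk p (j z)
  have := formallySmooth_stalk q z
  have := isNoetherianRing_stalk p (j z)
  exact exists_dual_of_formallySmooth (k := k) (A := X.presheaf.stalk (j z))
    (R := Z.presheaf.stalk z) (surjective_stalkMap_of_isClosedImmersion j z)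

lemma exists_subscheme_point {Y : X.IdealSheafData} {x : X} (hx : x ∈ Y.support) :
    ∃ y : Y.subscheme, Y.subschemeι y = x := by
  have h : x ∈ Set.range Y.subschemeι := by rw [range_subschemeι]; exact hx
  exact h

/-- The ideal of a smooth closed subscheme is generated by part of a coordinate system. -/
lemma exists_dual_stalkIdeal [Smooth p] {Y : X.IdealSheafData} (hY : Smooth (Y.subschemeι ≫ p))
    {x : X} (hx : x ∈ Y.support) : letI := stalkAlgebra p x
    ∃ (n : ℕ) (t : Fin n → X.presheaf.stalk x)
      (D : Fin n → Derivation k (X.presheaf.stalk x) (X.presheaf.stalk x)),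
      Ideal.span (Set.range t) = stalkIdeal Y x ∧
        ∀ i l, D i (t l) = if i = l then 1 else 0 := by
  obtain ⟨y, rfl⟩ := exists_subscheme_point hx
  have h := stalkIdeal_ker Y.subschemeι y
  rw [ker_subschemeι] at h
  rw [h]
  exact exists_dual_ker Y.subschemeι rfl y

lemma isPrime_stalkIdeal [CharZero k] {Y : X.IdealSheafData} (hY : Smooth (Y.subschemeι ≫ p))
    {x : X} (hx : x ∈ Y.support) : (stalkIdeal Y x).IsPrime := by
  obtain ⟨y, rfl⟩ := exists_subscheme_point hx
  have h := stalkIdeal_ker Y.subschemeι y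
  rw [ker_subschemeι] at h
  rw [h]
  have := isDomain_stalk (Y.subschemeι ≫ p) y
  exact RingHom.ker_isPrime _

/-- The blow-up of a smooth scheme along a smooth center is smooth. -/
theorem IsBlowup.smooth [CharZero k] [Smooth p] {X' : Scheme.{u}} {π : X' ⟶ X} {Y : X.IdealSheafData}
    (h : IsBlowup π Y) (hY : Smooth (Y.subschemeι ≫ p)) : Smooth (π ≫ p) := by
  have : IsLocallyNoetherian X := isLocallyNoetherian_of_field p
  have := h.locallyOfFiniteType
  refine smooth_of_stalk (π ≫ p) fun x ↦ ?_
  let _ := stalkAlgebra p (π x)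
  let _ := stalkAlgebra (π ≫ p) x
  have := formallySmooth_stalk p (π x)
  have := isNoetherianRing_stalk p (π x)
  have := isDomain_stalk p (π x)
  have hlift : HasBlowupLift (π.stalkMap x).hom (RingHom.id (X'.presheaf.stalk x))
      (stalkIdeal Y (π x)) := h.hasBlowupLift x _
  by_cases hx : π x ∈ Y.support
  · obtain ⟨n, t, D, hspan, hD⟩ := exists_dual_stalkIdeal hY hx
    obtain ⟨e, he, heq⟩ := h.cartier.exists_stalkIdeal_eq x
    rw [stalkIdeal_comap, ← hspan] at heq
    obtain ⟨i₀, hi₀⟩ := exists_span_map_eq (A' := X'.presheaf.stalk x) _ t he heq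
    rw [← hspan] at hlift
    refine hlift.formallySmooth (k := k) (stalkMap_algebraMap π rfl x) hD (i₀ := i₀)
      (fun n hn ↦ isUnit_natCast_of_algebra k _ hn) ?_ (heq.trans hi₀.symm) ?_
    · exact (mem_nonZeroDivisors_of_span_eq (A := X'.presheaf.stalk x) he hi₀)
    · have h1 : t i₀ ∈ IsLocalRing.maximalIdeal (X.presheaf.stalk (π x)) := by
        refine (mem_support_iff_stalkIdeal_le Y (π x)).mp hx ?_
        rw [← hspan]
        exact Ideal.subset_span ⟨i₀, rfl⟩
      exact fun hu ↦ h1 ((isUnit_map_iff (π.stalkMap x).hom _).mp hu)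
  · have h1 : stalkIdeal Y (π x) = ⊤ := by
      by_contra h1
      exact hx ((mem_support_iff_stalkIdeal Y _).mpr h1)
    rw [h1] at hlift
    exact formallySmooth_of_bijective (k := k) (π.stalkMap x).hom hlift.bijective
      (stalkMap_algebraMap π rfl x)

/-- The inverse image of a smooth closed subscheme containing the center is the exceptional
divisor plus the strict transform. -/
theorem IsBlowup.comap_mul_strictTransform [CharZero k] [Smooth p] [Smooth q] {X' : Scheme.{u}} {π : X' ⟶ X}
    {Y : X.IdealSheafData} (h : IsBlowup π Y) (j : Z ⟶ X) [IsClosedImmersion j] (hj : j ≫ p = q)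
    (hjY : j.ker ≤ Y) : Y.comap π * strictTransform π Y j.ker = j.ker.comap π := by
  have : IsLocallyNoetherian X := isLocallyNoetherian_of_field p
  have := h.locallyOfFiniteType
  have : IsLocallyNoetherian X' := isLocallyNoetherian_of_field (π ≫ p)
  refine ext_stalkIdeal fun x ↦ ?_
  rw [stalkIdeal_mul]
  by_cases hx : π x ∈ Y.support
  · have hxZ : stalkIdeal j.ker (π x) ≠ ⊤ := by
      intro h1
      have h2 := le_iff_stalkIdeal.mp hjY (π x)
      rw [h1, top_le_iff] at h2
      exact (mem_support_iff_stalkIdeal Y _).mp hx h2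
    have hxr : π x ∈ Set.range j := by
      by_contra h1
      exact hxZ (stalkIdeal_ker_eq_top j _ h1)
    obtain ⟨z, hz⟩ := hxr
    obtain ⟨e, he, heq⟩ := h.cartier.exists_stalkIdeal_eq x
    have hS := mem_stalkIdeal_strictTransform π (I := j.ker) h.cartier x heq
    have hlift : HasBlowupLift (π.stalkMap x).hom (RingHom.id (X'.presheaf.stalk x))
      (stalkIdeal Y (π x)) := h.hasBlowupLift x _
    have hle := le_iff_stalkIdeal.mp hjY (π x)
    rw [stalkIdeal_comap] at heq ⊢
    rw [stalkIdeal_comap] at hS ⊢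
    obtain ⟨a, ha, hspan⟩ := exists_mem_span_singleton_eq (B := X'.presheaf.stalk x) _ _ he heq
    -- The equation `e` of the exceptional divisor is replaced by the image of an element `a` of the
    -- ideal of the center; saturation does not depend on the choice.
    have hS' : ∀ b, b ∈ stalkIdeal (strictTransform π Y j.ker) x ↔
        ∃ n : ℕ, (π.stalkMap x).hom a ^ n * b ∈ (stalkIdeal j.ker (π x)).map (π.stalkMap x).hom := by
      intro b
      rw [hS]
      have h1 : ∀ n : ℕ, Ideal.span {(π.stalkMap x).hom a ^ n * b} = Ideal.span {e ^ n * b} := by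
        intro n
        rw [← Ideal.span_singleton_mul_span_singleton, ← Ideal.span_singleton_pow, hspan,
          Ideal.span_singleton_pow, Ideal.span_singleton_mul_span_singleton]
      have h2 : ∀ (I : Ideal (X'.presheaf.stalk x)) (n : ℕ),
          e ^ n * b ∈ I ↔ (π.stalkMap x).hom a ^ n * b ∈ I := fun I n ↦ by
        rw [← Ideal.span_singleton_le_iff_mem, ← h1, Ideal.span_singleton_le_iff_mem]
      exact exists_congr fun n ↦ h2 _ n
    have hn := mem_nonZeroDivisors_of_span_eq he hspan
    generalize hA : π.stalkMap x = πx at *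
    clear hA
    generalize π x = x₀ at *
    subst hz
    have hker := stalkIdeal_ker j z
    rw [hker] at hS' hle ⊢
    have := isDomain_stalk p (j z)
    have := isDomain_stalk q z
    refine map_mul_strict_eq hlift ha hn (heq.trans hspan.symm) hle (fun d ↦ ?_) hS'
    let _ := stalkAlgebra p (j z)
    let _ := stalkAlgebra q z
    have := formallySmooth_stalk p (j z)
    obtain ⟨n, t, D, hspan, hD⟩ := exists_dual_ker j hj z
    let ρ : X.presheaf.stalk (j z) →ₐ[k] Z.presheaf.stalk z :=
      ⟨(j.stalkMap z).hom, stalkMap_algebraMap j hj z⟩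
    -- Only the equations of `Z` matter here, so the second family of coordinates is empty. The
    -- truncation order is `d + 1`, with `d` arbitrary.
    obtain ⟨φ, hφ, -⟩ := exists_isTaylorHom ρ (surjective_stalkMap_of_isClosedImmersion j z)
      (z := t) (y := Fin.elim0) (D := Sum.elim D fun _ ↦ 0) (by
        rintro (i | i) (l | l)
        · simp [hD]
        · exact l.elim0
        · exact i.elim0
        · exact i.elim0) hspan.symm (Nat.succ_pos d)
    exact hφ.ker_inf_pow_le hle
  · have h1 : stalkIdeal Y (π x) = ⊤ := by
      by_contra h1
      exact hx ((mem_support_iff_stalkIdeal Y _).mpr h1)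
    have h2 : stalkIdeal (Y.comap π) x = ⊤ := by rw [stalkIdeal_comap, h1, Ideal.map_top]
    rw [h2, Ideal.top_mul]
    ext a
    rw [mem_stalkIdeal_strictTransform π (I := j.ker) h.cartier x (e := 1)
      (by rw [h2, Ideal.span_singleton_one])]
    simp

end Resolution
end

/-! ### Strict transforms as blow-ups of closed subschemes -/

noncomputable section
namespace Resolution

open Scheme.IdealSheafData

variable {X X' Z Z' : Scheme.{u}}

lemma stalkIdeal_bot (x : X) : stalkIdeal (⊥ : X.IdealSheafData) x = ⊥ := by
  obtain ⟨V, hV⟩ := exists_affine_mem x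
  rw [stalkIdeal_eq _ x V hV]
  simp

lemma comap_mul (I J : X.IdealSheafData) (f : X' ⟶ X) :
    (I * J).comap f = I.comap f * J.comap f :=
  ext_stalkIdeal fun x ↦ by simp [stalkIdeal_comap, Ideal.map_mul]

lemma comap_pow (I : X.IdealSheafData) (f : X' ⟶ X) (n : ℕ) :
    (I ^ n).comap f = I.comap f ^ n :=
  ext_stalkIdeal fun x ↦ by simp [stalkIdeal_comap, Ideal.map_pow]

lemma comap_eq_bot_iff {I : X.IdealSheafData} {f : X' ⟶ X} : I.comap f = ⊥ ↔ I ≤ f.ker := by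
  rw [← map_bot, le_map_iff_comap_le, le_bot_iff]

lemma ker_comap_self (f : X' ⟶ X) : f.ker.comap f = ⊥ := comap_eq_bot_iff.mpr le_rfl

/-- The exceptional divisor of a blow-up restricts to a Cartier divisor of the strict transform. -/
lemma isEffectiveCartier_comap_strict {π : X' ⟶ X} {Y I : X.IdealSheafData}
    [IsLocallyNoetherian X'] (hY : IsEffectiveCartier (Y.comap π)) (j' : Z' ⟶ X')
    [IsClosedImmersion j'] (hker : j'.ker = strictTransform π Y I) :
    IsEffectiveCartier ((Y.comap π).comap j') := by
  have : IsLocallyNoetherian Z' := LocallyOfFiniteType.isLocallyNoetherian j'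
  refine isEffectiveCartier_of_stalk fun z ↦ ?_
  obtain ⟨e, he, heq⟩ := hY.exists_stalkIdeal_eq (j' z)
  have hS := mem_stalkIdeal_strictTransform π (I := I) hY (j' z) heq
  have hk := stalkIdeal_ker j' z
  rw [hker] at hk
  refine ⟨(j'.stalkMap z).hom e, ?_, ?_⟩
  · rw [mem_nonZeroDivisors_iff_right]
    intro b hb
    obtain ⟨a, rfl⟩ := j'.stalkMap_surjective z b
    rw [← map_mul] at hb
    change a * e ∈ RingHom.ker (j'.stalkMap z).hom at hb
    rw [← hk, hS] at hb
    obtain ⟨n, hn⟩ := hb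
    change a ∈ RingHom.ker (j'.stalkMap z).hom
    rw [← hk, hS]
    exact ⟨n + 1, by rwa [pow_succ, mul_assoc, mul_comm e a]⟩
  · rw [stalkIdeal_comap, heq, Ideal.map_span, Set.image_singleton]

/-- The strict transform of a closed subscheme is its blow-up. -/
theorem IsBlowup.strict {π : X' ⟶ X} {Y : X.IdealSheafData} [IsLocallyNoetherian X']
    (h : IsBlowup π Y) {j : Z ⟶ X} [IsClosedImmersion j]
    (hmul : Y.comap π * strictTransform π Y j.ker = j.ker.comap π) {j' : Z' ⟶ X'}
    [IsClosedImmersion j'] (hker : j'.ker = strictTransform π Y j.ker) {g : Z' ⟶ Z}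
    (comm : j' ≫ π = g ≫ j) : IsBlowup g (Y.comap j) where
  cartier := by
    rw [← comap_comp, ← comm, comap_comp]
    exact isEffectiveCartier_comap_strict h.cartier j' hker
  existsUnique_lift {T} f hf := by
    rw [← comap_comp] at hf
    obtain ⟨l, hl, hu⟩ := h.existsUnique_lift _ hf
    -- The lift to the ambient blow-up lands in the strict transform: the product of the ideals of
    -- the exceptional divisor and of the strict transform pulls back to zero, and the first factor
    -- is locally generated by a nonzerodivisor.
    have hle : j'.ker ≤ l.ker := by
      rw [hker, ← comap_eq_bot_iff]
      have h1 : (Y.comap π).comap l * (strictTransform π Y j.ker).comap l = ⊥ := by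
        rw [← comap_mul, hmul, ← comap_comp, hl, comap_comp, ker_comap_self, comap_bot]
      refine ext_stalkIdeal fun x ↦ ?_
      rw [← hl, comap_comp] at hf
      obtain ⟨e, he, heq⟩ := hf.exists_stalkIdeal_eq x
      have h2 := congrArg (stalkIdeal · x) h1
      simp only [stalkIdeal_mul, heq, stalkIdeal_bot] at h2
      rw [stalkIdeal_bot, eq_bot_iff]
      intro a ha
      have h3 : e * a ∈ (⊥ : Ideal (T.presheaf.stalk x)) :=
        h2 ▸ Ideal.mul_mem_mul (Ideal.mem_span_singleton_self e) ha
      exact (mul_left_mem_nonZeroDivisors_eq_zero_iff he).mp h3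
    refine ⟨IsClosedImmersion.lift j' l hle, ?_, fun m hm ↦ ?_⟩
    · change _ ≫ g = f
      rw [← cancel_mono j, Category.assoc, ← comm, ← Category.assoc, IsClosedImmersion.lift_fac, hl]
    · rw [← cancel_mono j', IsClosedImmersion.lift_fac]
      refine hu _ ?_
      simp only [Category.assoc]
      rw [comm, ← Category.assoc, hm]

lemma exists_strict_lift {π : X' ⟶ X} {Y : X.IdealSheafData} {j : Z ⟶ X} [IsClosedImmersion j]
    (hmul : Y.comap π * strictTransform π Y j.ker = j.ker.comap π) {j' : Z' ⟶ X'}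
    (hker : j'.ker = strictTransform π Y j.ker) : ∃ g : Z' ⟶ Z, j' ≫ π = g ≫ j := by
  have hle : j.ker ≤ (j' ≫ π).ker := by
    rw [← comap_eq_bot_iff, comap_comp, comap_eq_bot_iff, hker, ← hmul]
    refine le_iff_stalkIdeal.mpr fun x ↦ ?_
    rw [stalkIdeal_mul]
    exact Ideal.mul_le_right
  exact ⟨IsClosedImmersion.lift j _ hle, (IsClosedImmersion.lift_fac ..).symm⟩

/-- A closed subscheme of `Z`, contained in a closed subscheme `j`, is a closed subscheme
of the latter. -/
lemma isIso_comap_snd {Y : X.IdealSheafData} (j : Z ⟶ X) [IsClosedImmersion j] (h : j.ker ≤ Y) :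
    IsIso (pullback.snd j Y.subschemeι) := by
  let l := IsClosedImmersion.lift j Y.subschemeι (by rwa [ker_subschemeι])
  have hl : l ≫ j = Y.subschemeι := IsClosedImmersion.lift_fac ..
  have hc : l ≫ j = 𝟙 _ ≫ Y.subschemeι := by rw [hl, Category.id_comp]
  refine ⟨pullback.lift l (𝟙 _) hc, ?_, pullback.lift_snd _ _ _⟩
  apply pullback.hom_ext
  · rw [Category.assoc, pullback.lift_fst, Category.id_comp, ← cancel_mono j, Category.assoc, hl,
      pullback.condition]
  · rw [Category.assoc, pullback.lift_snd, Category.id_comp, Category.comp_id]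

variable {k : Type u} [Field k]

lemma smooth_comap_center {p : X ⟶ Spec (CommRingCat.of k)} {q : Z ⟶ Spec (CommRingCat.of k)}
    {Y : X.IdealSheafData} (hY : Smooth (Y.subschemeι ≫ p)) (j : Z ⟶ X) [IsClosedImmersion j]
    (hj : j ≫ p = q) (h : j.ker ≤ Y) : Smooth ((Y.comap j).subschemeι ≫ q) := by
  have := isIso_comap_snd j h
  have e : (Y.comap j).subschemeι ≫ q =
      (Y.comapIso j).hom ≫ pullback.snd j Y.subschemeι ≫ Y.subschemeι ≫ p := by
    rw [← comapIso_hom_fst_assoc, ← hj, pullback.condition_assoc]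
  rw [e]
  infer_instance

lemma smooth_of_ker_eq {p : X ⟶ Spec (CommRingCat.of k)} (i : Z ⟶ X) (j : Z' ⟶ X)
    [IsClosedImmersion i] [IsClosedImmersion j] (h : i.ker = j.ker) (hi : Smooth (i ≫ p)) :
    Smooth (j ≫ p) := by
  have := IsClosedImmersion.isIso_lift i j h
  rw [← IsClosedImmersion.lift_fac i j h.le, Category.assoc]
  infer_instance

lemma comap_map_of_isClosedImmersion (j : Z ⟶ X) [IsClosedImmersion j] (I : Z.IdealSheafData) :
    (I.map j).comap j = I := by
  refine ext_stalkIdeal fun z ↦ ?_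
  obtain ⟨V, hV⟩ := exists_affine_mem (j z)
  let U : Z.affineOpens := ⟨_, V.2.preimage j⟩
  rw [stalkIdeal_eq _ z U hV, stalkIdeal_eq _ z U hV, ideal_comap_of_le j _ V U le_rfl,
    ideal_map_of_isAffineHom, ← Scheme.Hom.app_eq_appLE,
    Ideal.map_comap_of_surjective _ (j.app_surjective V.1 V.2)]

lemma support_map_of_isClosedImmersion (j : Z ⟶ X) [IsClosedImmersion j] (I : Z.IdealSheafData) :
    ((I.map j).support : Set X) = j '' I.support := by
  rw [support_map]
  exact (j.isClosedEmbedding.isClosedMap _ I.support.isClosed).closure_eq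

lemma radical_eq_of_isReduced (Y : X.IdealSheafData) [IsReduced Y.subscheme] : Y.radical = Y := by
  ext V : 2
  rw [radical_ideal]
  have h : Y.ideal V = RingHom.ker (Y.subschemeι.app V.1).hom := by
    rw [← Scheme.Hom.ker_apply, ker_subschemeι]
  rw [h]
  exact (RingHom.ker_isRadical_iff_reduced_of_surjective
    (Y.subschemeι.app_surjective V.1 V.2)).mpr inferInstance |>.radical

/-- For a reduced subscheme, containment of supports suffices. This applies to smooth centers, which
are known to lie in the strict transform only as sets. -/
lemma le_of_support_subset {I Y : X.IdealSheafData} [IsReduced Y.subscheme]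
    (h : (Y.support : Set X) ⊆ I.support) : I ≤ Y := by
  rw [← radical_eq_of_isReduced Y, ← vanishingIdeal_support]
  exact le_support_iff_le_vanishingIdeal.mp (show Y.support ≤ I.support from h)

end Resolution
end

/-! ### Existence of the transformed ideals -/

noncomputable section
namespace Resolution

open Scheme.IdealSheafData

section Colon

open scoped Classical in
lemma map_colon_of_isLocalization {A B : Type*} [CommRing A] [CommRing B] [Algebra A B]
    (M : Submonoid A) [IsLocalization M B] (L E : Ideal A) (hE : E.FG) :
    (L.colon (E : Set A)).map (algebraMap A B) =
      (L.map (algebraMap A B)).colon (E.map (algebraMap A B) : Set B) := by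
  apply le_antisymm
  · rw [Ideal.map_le_iff_le_comap]
    intro a ha
    rw [Ideal.mem_comap, Submodule.mem_colon]
    intro e he
    refine Submodule.span_induction (p := fun e _ ↦ algebraMap A B a • e ∈ L.map (algebraMap A B))
      ?_ ?_ ?_ ?_ he
    · rintro _ ⟨e, he, rfl⟩
      rw [smul_eq_mul, ← map_mul]
      exact Ideal.mem_map_of_mem _ (Submodule.mem_colon.mp ha e he)
    · simp
    · intro x y _ _ hx hy
      rw [smul_add]
      exact add_mem hx hy
    · intro c x _ hx
      rw [smul_comm]
      exact Submodule.smul_mem _ _ hx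
  · intro b hb
    obtain ⟨a, s, rfl⟩ := IsLocalization.exists_mk'_eq M b
    obtain ⟨S, rfl⟩ := hE
    have h1 : ∀ e ∈ S, ∃ m ∈ M, m * (a * e) ∈ L := by
      intro e he
      have h2 := Submodule.mem_colon.mp hb (algebraMap A B e)
        (Ideal.mem_map_of_mem _ (Ideal.subset_span he))
      have h3 : algebraMap A B (a * e) ∈ L.map (algebraMap A B) := by
        have h4 := Ideal.mul_mem_left _ (algebraMap A B s) h2
        rwa [smul_eq_mul, ← mul_assoc, IsLocalization.mk'_spec', ← map_mul] at h4
      exact (IsLocalization.algebraMap_mem_map_algebraMap_iff M B L _).mp h3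
    choose! m hm hmL using h1
    have h5 : (∏ e ∈ S, m e) * a ∈ L.colon ((Ideal.span S : Ideal A) : Set A) := by
      rw [Submodule.mem_colon]
      intro e he
      refine Submodule.span_induction (p := fun e _ ↦ ((∏ e ∈ S, m e) * a) • e ∈ L)
        ?_ ?_ ?_ ?_ he
      · intro e he
        rw [← Finset.mul_prod_erase S m he, smul_eq_mul, mul_comm (m e), mul_assoc, mul_assoc]
        exact Ideal.mul_mem_left _ _ (hmL e he)
      · simp
      · intro x y _ _ hx hy
        rw [smul_add]
        exact add_mem hx hy
      · intro c x _ hx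
        rw [smul_comm]
        exact Submodule.smul_mem _ _ hx
    refine (IsLocalization.mk'_mem_map_algebraMap_iff M B _ a s).mpr
      ⟨∏ e ∈ S, m e, prod_mem hm, h5⟩

variable {X : Scheme.{u}} [IsLocallyNoetherian X]

/-- The quotient `L : E` of ideal sheaves on a locally Noetherian scheme. -/
def colon (L E : X.IdealSheafData) : X.IdealSheafData where
  ideal V := (L.ideal V).colon (E.ideal V : Set Γ(X, V.1))
  map_ideal_basicOpen V f := by
    let _ : Algebra Γ(X, V.1) Γ(X, (X.affineBasicOpen f).1) :=
      (X.presheaf.map (homOfLE <| X.basicOpen_le f).op).hom.toAlgebra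
    have : IsLocalization (Submonoid.powers f) Γ(X, (X.affineBasicOpen f).1) :=
      V.2.isLocalization_basicOpen f
    have : IsNoetherianRing Γ(X, V.1) := IsLocallyNoetherian.component_noetherian V
    rw [← map_ideal_basicOpen, ← map_ideal_basicOpen]
    exact map_colon_of_isLocalization (B := Γ(X, (X.affineBasicOpen f).1)) (Submonoid.powers f) _ _
      (IsNoetherian.noetherian _)

/-- An ideal sheaf contained in a power of an invertible ideal sheaf is divisible by it. -/
lemma exists_eq_pow_mul {E L : X.IdealSheafData} (hE : IsEffectiveCartier E) {b : ℕ}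
    (h : L ≤ E ^ b) : ∃ K : X.IdealSheafData, L = E ^ b * K := by
  refine ⟨colon L (E ^ b), ext_stalkIdeal fun x ↦ ?_⟩
  obtain ⟨V, hx, f, hf, hV⟩ := hE x
  rw [stalkIdeal_eq _ x V hx, stalkIdeal_eq _ x V hx]
  congr 1
  have h1 := h V
  simp only [ideal_mul, Pi.mul_apply]
  change _ = (E ^ b).ideal V * (L.ideal V).colon ((E ^ b).ideal V : Set Γ(X, V.1))
  have h2 : (E ^ b).ideal V = Ideal.span {f ^ b} := by
    rw [ideal_pow, Pi.pow_apply, hV, Ideal.span_singleton_pow]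
  rw [h2] at h1 ⊢
  ext a
  rw [Ideal.mem_span_singleton_mul]
  constructor
  · intro ha
    obtain ⟨c, rfl⟩ := Ideal.mem_span_singleton.mp (h1 ha)
    refine ⟨c, ?_, rfl⟩
    rw [Submodule.mem_colon_span_singleton, smul_eq_mul, mul_comm]
    exact ha
  · rintro ⟨c, hc, rfl⟩
    rw [Submodule.mem_colon_span_singleton, smul_eq_mul, mul_comm] at hc
    exact hc

end Colon

/-- The order at the prime `q`, a generization of `𝔭`, is read off at `𝔭` as membership in a
symbolic power: the elements outside of `q` that clear denominators stay outside of `P`. -/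
lemma exists_mul_mem_pow {B L₁ L₂ : Type*} [CommRing B] [CommRing L₁] [CommRing L₂] [Algebra B L₁]
    [Algebra B L₂] (𝔭 q : Ideal B) [𝔭.IsPrime] [q.IsPrime] [IsLocalization.AtPrime L₁ 𝔭]
    [IsLocalization.AtPrime L₂ q] [IsLocalRing L₂] (P : Ideal L₁) [hP : P.IsPrime]
    (hq : q = P.comap (algebraMap B L₁)) (J : Ideal B) {b : ℕ}
    (hJ : J.map (algebraMap B L₂) ≤ IsLocalRing.maximalIdeal L₂ ^ b) :
    ∀ f ∈ J.map (algebraMap B L₁), ∃ s ∉ P, s * f ∈ P ^ b := by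
  intro f hf
  obtain ⟨⟨⟨g, hg⟩, t⟩, hgt⟩ := (IsLocalization.mem_map_algebraMap_iff 𝔭.primeCompl L₁).mp hf
  have h1 := hJ (Ideal.mem_map_of_mem (algebraMap B L₂) hg)
  rw [← IsLocalization.AtPrime.map_eq_maximalIdeal q L₂, ← Ideal.map_pow,
    IsLocalization.algebraMap_mem_map_algebraMap_iff q.primeCompl L₂] at h1
  obtain ⟨m, hm, hmg⟩ := h1
  have hm' : algebraMap B L₁ m ∉ P := fun h ↦ hm (hq ▸ h)
  have ht : algebraMap B L₁ t ∉ P := fun h ↦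
    hP.ne_top (Ideal.eq_top_of_isUnit_mem _ h (IsLocalization.map_units L₁ t))
  refine ⟨algebraMap B L₁ m * algebraMap B L₁ t, fun h ↦ (hP.mem_or_mem h).elim hm' ht, ?_⟩
  have h2 := Ideal.mem_map_of_mem (algebraMap B L₁) hmg
  rw [map_mul] at h2
  rw [mul_assoc, mul_comm (algebraMap B L₁ t), hgt]
  rw [Ideal.map_pow] at h2
  refine Ideal.pow_right_mono ?_ b h2
  rw [hq]
  exact Ideal.map_comap_le

variable {X : Scheme.{u}}

/-- The prime ideal of `Y` at `x` corresponds to a point `η`, the generic point of the part of `Y`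
through `x`. The bound on the order of `J` at `η` says that `J` lies in a symbolic power at `x`. -/
lemma exists_mul_mem_stalkIdeal_pow {J Y : X.IdealSheafData} {b : ℕ}
    (h : ∀ y ∈ Y.support, stalkIdeal J y ≤ IsLocalRing.maximalIdeal (X.presheaf.stalk y) ^ b)
    (x : X) (hP : (stalkIdeal Y x).IsPrime) :
    ∀ f ∈ stalkIdeal J x, ∃ s ∉ stalkIdeal Y x, s * f ∈ stalkIdeal Y x ^ b := by
  obtain ⟨V, hx⟩ := exists_affine_mem x
  let _ := TopCat.Presheaf.algebra_section_stalk X.presheaf (U := V.1) ⟨x, hx⟩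
  have := V.2.isLocalization_stalk ⟨x, hx⟩
  let Q : PrimeSpectrum Γ(X, V.1) :=
    ⟨(stalkIdeal Y x).comap (X.presheaf.germ V.1 x hx).hom, hP.comap _⟩
  let η : X := V.2.fromSpec Q
  have hη : η ∈ V.1 := by
    have : η ∈ Set.range V.2.fromSpec := ⟨Q, rfl⟩
    rwa [V.2.range_fromSpec] at this
  have hQ : V.2.primeIdealOf ⟨η, hη⟩ = Q :=
    V.2.isOpenImmersion_fromSpec.base_open.injective (V.2.fromSpec_primeIdealOf ⟨η, hη⟩)
  let _ := TopCat.Presheaf.algebra_section_stalk X.presheaf (U := V.1) ⟨η, hη⟩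
  have hloc := V.2.isLocalization_stalk ⟨η, hη⟩
  rw [hQ] at hloc
  have h1 : η ∈ Y.support := by
    rw [mem_support_iff_stalkIdeal_le, stalkIdeal_eq Y η V hη]
    refine (Ideal.map_mono (J := Q.asIdeal) fun a ha ↦ ?_).trans
      (IsLocalization.AtPrime.map_eq_maximalIdeal Q.asIdeal (X.presheaf.stalk η)).le
    exact germ_mem_stalkIdeal Y hx ha
  have h2 := h η h1
  rw [stalkIdeal_eq J η V hη] at h2
  have h3 := exists_mul_mem_pow (V.2.primeIdealOf ⟨x, hx⟩).asIdeal Q.asIdeal (stalkIdeal Y x) rfl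
    (J.ideal V) h2
  rw [stalkIdeal_eq J x V hx]
  exact h3

variable {k : Type u} [Field k] [CharZero k]

/-- If `J` has order at least `b` along a smooth subscheme `Y`, then `J ⊆ I(Y)ᵇ`. -/
lemma le_pow_of_smooth {p : X ⟶ Spec (CommRingCat.of k)} [Smooth p] {Y : X.IdealSheafData}
    (hY : Smooth (Y.subschemeι ≫ p)) {J : X.IdealSheafData} {b : ℕ}
    (h : ∀ y ∈ Y.support, stalkIdeal J y ≤ IsLocalRing.maximalIdeal (X.presheaf.stalk y) ^ b) :
    J ≤ Y ^ b := by
  refine le_iff_stalkIdeal.mpr fun x ↦ ?_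
  rw [stalkIdeal_pow]
  obtain _ | b := b
  · simp
  by_cases hx : x ∈ Y.support
  · have hP := isPrime_stalkIdeal hY hx
    -- The order is now `b + 1`. Membership in the symbolic power keeps `b` successive derivatives
    -- of `J` inside the ideal of `Y`, and Euler's formula in the equations of `Y` upgrades this to
    -- the ordinary power.
    have h1 := diffIdeal_iterate_le_of_symbolic (K := ℤ) b (exists_mul_mem_stalkIdeal_pow h x hP)
    obtain ⟨n, t, D, hspan, hD⟩ := exists_dual_stalkIdeal hY hx
    rw [← hspan] at h1 ⊢
    let _ := stalkAlgebra p x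
    exact le_pow_of_diffIdeal_iterate_le (D := fun i ↦ (D i).restrictScalars ℤ) hD
      (fun n hn ↦ isUnit_natCast_of_algebra k _ hn) b h1
  · have h1 : stalkIdeal Y x = ⊤ := by
      by_contra h1
      exact hx ((mem_support_iff_stalkIdeal Y _).mpr h1)
    rw [h1, Ideal.top_pow]
    exact le_top

/-- The transform of a couple under an admissible blow-up exists. -/
lemma Couple.exists_transform (A : Couple k) (hA : Smooth A.str) {Y : A.W.IdealSheafData}
    (hY : Smooth (Y.subschemeι ≫ A.str)) (hsub : (Y.support : Set A.W) ⊆ A.Sing)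
    {W' : Scheme.{u}} {π : W' ⟶ A.W} (h : IsBlowup π Y) :
    ∃ J' : W'.IdealSheafData, A.J.comap π = Y.comap π ^ A.b * J' := by
  have : IsLocallyNoetherian A.W := isLocallyNoetherian_of_field A.str
  have := h.locallyOfFiniteType
  have : IsLocallyNoetherian W' := isLocallyNoetherian_of_field (π ≫ A.str)
  have h1 : A.J ≤ Y ^ A.b := le_pow_of_smooth hY fun y hy ↦ (mem_Sing_iff A y).mp (hsub hy)
  refine exists_eq_pow_mul h.cartier ?_
  rw [← comap_pow]
  exact comap_mono π h1

end Resolution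
end

/-! ### Couples with coefficient couples along sequences of transformations -/

noncomputable section
namespace Resolution

open Scheme.IdealSheafData

section StalkMapOf

variable {X Y Z : Scheme.{u}}

/-- The map on stalks `𝒪_y → 𝒪_x` induced by `f`, if `f x = y`. -/
def stalkMapOf (f : X ⟶ Y) {x : X} {y : Y} (h : f x = y) :
    Y.presheaf.stalk y ⟶ X.presheaf.stalk x :=
  Y.presheaf.stalkSpecializes (h ▸ specializes_rfl) ≫ f.stalkMap x

lemma stalkMapOf_rfl (f : X ⟶ Y) (x : X) : stalkMapOf f (rfl : f x = f x) = f.stalkMap x := by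
  simp [stalkMapOf]

lemma stalkMapOf_comp (f : X ⟶ Y) (g : Y ⟶ Z) {x : X} {y : Y} {z : Z} (h : f x = y)
    (h' : g y = z) (h'' : (f ≫ g) x = z) :
    stalkMapOf g h' ≫ stalkMapOf f h = stalkMapOf (f ≫ g) h'' := by
  subst h h'
  have e : stalkMapOf (f ≫ g) h'' = (f ≫ g).stalkMap x := stalkMapOf_rfl (f ≫ g) x
  rw [stalkMapOf_rfl, stalkMapOf_rfl, e, Scheme.Hom.stalkMap_comp]

lemma stalkIdeal_comap_of_eq (f : X ⟶ Y) (I : Y.IdealSheafData) {x : X} {y : Y} (h : f x = y) :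
    stalkIdeal (I.comap f) x = (stalkIdeal I y).map (stalkMapOf f h).hom := by
  subst h
  rw [stalkMapOf_rfl, stalkIdeal_comap]

lemma IsBlowup.hasBlowupLift_of_eq {π : X ⟶ Y} {I : Y.IdealSheafData} (hπ : IsBlowup π I) {x : X}
    {y : Y} (h : π x = y) {R : Type u} [CommRing R] [IsLocalRing R]
    (ρ : X.presheaf.stalk x →+* R) [IsLocalHom ρ] :
    HasBlowupLift (stalkMapOf π h).hom ρ (stalkIdeal I y) := by
  subst h
  rw [stalkMapOf_rfl]
  exact hπ.hasBlowupLift x ρ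

end StalkMapOf

variable {k : Type u} [Field k]

/-- The couple `C`, on a smooth closed subscheme of a smooth scheme, is at every point given by
a coefficient ideal of the couple `A`. -/
structure Adapted (A C : Couple k) (i : C.W ⟶ A.W) : Prop where
  closed : IsClosedImmersion i
  comm : i ≫ A.str = C.str
  smooth : Smooth A.str
  smooth_sub : Smooth C.str
  b_eq : C.b = A.b.factorial
  coeff : ∀ x : C.W, IsCoeffAt A.b (i.stalkMap x).hom (stalkIdeal A.J (i x)) (stalkIdeal C.J x)

variable [CharZero k] {A C A' C' : Couple k} {i : C.W ⟶ A.W}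

/-- This is `IsCoeffAt.le_pow_iff` for the maximal ideal, where powers can be removed because `C.W`
is smooth. -/
lemma Adapted.mem_Sing_iff (h : Adapted A C i) (x : C.W) : i x ∈ A.Sing ↔ x ∈ C.Sing := by
  have := h.closed
  have := h.smooth_sub
  rw [Resolution.mem_Sing_iff, Resolution.mem_Sing_iff, h.b_eq]
  have hm := IsLocalRing.map_maximalIdeal_of_surjective (i.stalkMap x).hom (i.stalkMap_surjective x)
  have key := (h.coeff x).le_pow_iff (IsLocalRing.maximalIdeal (A.W.presheaf.stalk (i x))) ?_ ?_
  · rwa [hm] at key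
  · exact IsLocalRing.le_maximalIdeal (RingHom.ker_ne_top _)
  · rw [hm]
    exact fun a e c he ha ↦ mem_maximalIdeal_pow_stalk C.str x he ha

lemma Adapted.Sing_eq (h : Adapted A C i) (hA : A.Sing ⊆ i.ker.support) :
    A.Sing = i '' C.Sing := by
  have := h.closed
  have h1 : (i.ker.support : Set A.W) = Set.range i := by
    rw [Scheme.Hom.support_ker]
    exact i.isClosedEmbedding.isClosed_range.closure_eq
  rw [h1] at hA
  apply Set.Subset.antisymm
  · intro x hx
    obtain ⟨y, rfl⟩ := hA hx
    exact ⟨y, (h.mem_Sing_iff y).mp hx, rfl⟩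
  · rintro _ ⟨y, hy, rfl⟩
    exact (h.mem_Sing_iff y).mpr hy

/-- Transformations preserve the relation between a couple and its coefficient couple. -/
theorem Adapted.step (h : Adapted A C i) (f : Transformation A A') (g : Transformation C C')
    {i' : C'.W ⟶ A'.W} (closed : IsClosedImmersion i') (comm : i' ≫ f.π = g.π ≫ i)
    (ker_eq : i'.ker = strictTransform f.π f.center i.ker) (center_sub : i.ker ≤ f.center)
    (center_eq : g.center = f.center.comap i) : Adapted A' C' i' := by
  have := h.closed
  have := h.smooth
  have := h.smooth_sub
  have hA' : Smooth A'.str := f.str_eq ▸ f.isBlowup.smooth f.smooth_center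
  have hC' : Smooth C'.str := g.str_eq ▸ g.isBlowup.smooth g.smooth_center
  have hcomm' : i' ≫ A'.str = C'.str := by
    rw [← f.str_eq, ← g.str_eq, ← Category.assoc, comm, Category.assoc, h.comm]
  have : IsLocallyNoetherian A'.W := isLocallyNoetherian_of_field A'.str
  refine ⟨closed, hcomm', hA', hC', by rw [g.b_eq, h.b_eq, f.b_eq], fun x ↦ ?_⟩
  have hx : f.π (i' x) = i (g.π x) := by
    rw [← Scheme.Hom.comp_apply, comm, Scheme.Hom.comp_apply]
  have hmul := f.isBlowup.comap_mul_strictTransform i h.comm center_sub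
  obtain ⟨e, he, heq⟩ := f.isBlowup.cartier.exists_stalkIdeal_eq (i' x)
  obtain ⟨e', he', heq'⟩ := (isEffectiveCartier_comap_strict f.isBlowup.cartier i'
    ker_eq).exists_stalkIdeal_eq x
  have hsq : stalkMapOf f.π hx ≫ i'.stalkMap x = i.stalkMap (g.π x) ≫ g.π.stalkMap x := by
    rw [← stalkMapOf_rfl, ← stalkMapOf_rfl, ← stalkMapOf_rfl,
      stalkMapOf_comp i' f.π rfl hx hx, stalkMapOf_comp g.π i rfl rfl rfl]
    congr 1
  rw [f.b_eq]
  refine (h.coeff (g.π x)).blowup (π := (stalkMapOf f.π hx).hom) (π' := (g.π.stalkMap x).hom)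
    (Y := stalkIdeal f.center (i (g.π x))) (e := e) (i'.stalkMap_surjective x)
    congr(($hsq).hom) ?_ (f.isBlowup.hasBlowupLift_of_eq hx _) he ?_ ?_ ?_ ?_ ?_
  · rw [← stalkIdeal_ker]
    exact le_iff_stalkIdeal.mp center_sub _
  -- The exceptional divisor cuts the strict transform in a Cartier divisor, so its local equation
  -- restricts to a nonzerodivisor.
  · refine mem_nonZeroDivisors_of_span_eq he' ?_
    rw [← heq', stalkIdeal_comap, heq, Ideal.map_span, Set.image_singleton]
  · rw [← stalkIdeal_comap_of_eq, heq]
  · rw [← stalkIdeal_comap_of_eq, ← stalkIdeal_ker, ← stalkIdeal_ker, ker_eq, ← stalkIdeal_mul,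
      hmul, stalkIdeal_comap_of_eq]
  · rw [← stalkIdeal_comap_of_eq, ← stalkIdeal_comap_of_eq, f.totalTransform_eq, stalkIdeal_mul,
      stalkIdeal_pow]
  · rw [← stalkIdeal_comap, ← stalkIdeal_comap, ← stalkIdeal_comap, ← center_eq,
      g.totalTransform_eq, stalkIdeal_mul, stalkIdeal_pow, h.b_eq]

namespace TransSeq

lemma Induces.adapted {B D : Couple k} {t : TransSeq A B} {s : TransSeq C D} {j : D.W ⟶ B.W}
    (hi : Adapted A C i) (h : Induces i t s j) : Adapted B D j ∧ j.ker = t.strict i.ker := by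
  induction h with
  | nil => exact ⟨hi, rfl⟩
  | snoc h f g j' closed comm ker_eq center_sub center_eq ih =>
    exact ⟨ih.1.step f g closed comm ker_eq center_sub center_eq, by rw [ker_eq, ih.2]; rfl⟩

/-- If the singular loci of all transforms of `A` lie in the strict transforms of a closed
subscheme with a coefficient couple, then sequences of transformations of `A` induce sequences of
transformations of the latter. -/
theorem descends_of_adapted (hi : Adapted A C i)
    (H : ∀ (B : Couple k) (t : TransSeq A B), B.Sing ⊆ (t.strict i.ker).support)
    {B : Couple k} (t : TransSeq A B) : t.Descends C i := by
  refine ⟨?_, fun D s j h ↦ ?_⟩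
  · induction t with
    | nil => exact ⟨_, _, _, Induces.nil⟩
    | @snoc B B' t f ih =>
      obtain ⟨D, s, j, h⟩ := ih
      obtain ⟨hj, hker⟩ := h.adapted hi
      have := hj.closed
      have := hj.smooth
      have := hj.smooth_sub
      have hsub := H _ t
      rw [← hker] at hsub
      have hred : IsReduced f.center.subscheme :=
        have := f.smooth_center
        isReduced_of_smooth (f.center.subschemeι ≫ B.str)
      -- The center lies in the singular locus and hence, by `H`, set-theoretically in the strict
      -- transform; being reduced, it is a subscheme of it.
      have hle : j.ker ≤ f.center := le_of_support_subset (f.center_subset.trans hsub)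
      have hmul := f.isBlowup.comap_mul_strictTransform j hj.comm hle
      have hB' : Smooth B'.str := f.str_eq ▸ f.isBlowup.smooth f.smooth_center
      have : IsLocallyNoetherian B'.W := isLocallyNoetherian_of_field B'.str
      obtain ⟨π, hπ⟩ := exists_strict_lift hmul
        (j' := (strictTransform f.π f.center j.ker).subschemeι) (ker_subschemeι _)
      have hblow := f.isBlowup.strict hmul (ker_subschemeι _) hπ
      have hsm := smooth_comap_center f.smooth_center j hj.comm hle
      have hsing : ((f.center.comap j).support : Set D.W) ⊆ D.Sing := by
        intro y hy
        rw [support_comap] at hy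
        exact (hj.mem_Sing_iff y).mp (f.center_subset hy)
      obtain ⟨K, hK⟩ := D.exists_transform hj.smooth_sub hsm hsing hblow
      let D' : Couple k := ⟨(strictTransform f.π f.center j.ker).subscheme, π ≫ D.str, K, D.b⟩
      let g : Transformation D D' := ⟨f.center.comap j, π, rfl, rfl, hsm, hsing, hblow, hK⟩
      exact ⟨D', s.snoc g, (strictTransform f.π f.center j.ker).subschemeι,
        h.snoc f g _ inferInstance hπ (ker_subschemeι _) hle rfl⟩
  · obtain ⟨hj, hker⟩ := h.adapted hi
    exact hj.Sing_eq (hker ▸ H _ t)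

/-- Conversely, sequences of transformations of the coefficient couple are induced by sequences
of transformations of `A`. -/
theorem ascends_of_adapted (hi : Adapted A C i)
    (H : ∀ (B : Couple k) (t : TransSeq A B), B.Sing ⊆ (t.strict i.ker).support)
    {D : Couple k} (s : TransSeq C D) : s.Ascends A i := by
  suffices h : ∃ (B : Couple k) (t : TransSeq A B) (j : D.W ⟶ B.W), Induces i t s j by
    obtain ⟨B, t, j, h⟩ := h
    obtain ⟨hj, hker⟩ := h.adapted hi
    exact ⟨B, t, j, h, hj.Sing_eq (hker ▸ H _ t)⟩
  induction s with
  | nil => exact ⟨_, _, _, Induces.nil⟩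
  | @snoc D D' s g ih =>
    obtain ⟨B, t, j, h⟩ := ih
    obtain ⟨hj, hker⟩ := h.adapted hi
    have := hj.closed
    have := hj.smooth
    have := hj.smooth_sub
    have : IsLocallyNoetherian B.W := isLocallyNoetherian_of_field B.str
    -- The center on the subscheme, viewed as a subscheme of the ambient scheme. It lies in the
    -- singular locus there because the pointwise comparison of singular loci needs no assumption
    -- outside of the subscheme.
    let Y := g.center.map j
    have hYj : Y.comap j = g.center := comap_map_of_isClosedImmersion j g.center
    have hle : j.ker ≤ Y := by
      rw [← map_bot]
      exact map_mono j bot_le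
    have hsm : Smooth (Y.subschemeι ≫ B.str) := by
      refine smooth_of_ker_eq (g.center.subschemeι ≫ j) Y.subschemeι (ker_subschemeι _).symm ?_
      rw [Category.assoc, hj.comm]
      exact g.smooth_center
    have hsing : (Y.support : Set B.W) ⊆ B.Sing := by
      rw [support_map_of_isClosedImmersion]
      rintro _ ⟨y, hy, rfl⟩
      exact (hj.mem_Sing_iff y).mpr (g.center_subset hy)
    have hπ := isBlowup_blowupMap Y
    obtain ⟨J', hJ'⟩ := B.exists_transform hj.smooth hsm hsing hπ
    let B' : Couple k := ⟨blowup Y, blowupMap Y ≫ B.str, J', B.b⟩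
    let f : Transformation B B' := ⟨Y, blowupMap Y, rfl, rfl, hsm, hsing, hπ, hJ'⟩
    have := hπ.locallyOfFiniteType
    have : IsLocallyNoetherian (blowup Y) := isLocallyNoetherian_of_field (blowupMap Y ≫ B.str)
    have hmul := hπ.comap_mul_strictTransform j hj.comm hle
    let S := strictTransform (blowupMap Y) Y j.ker
    obtain ⟨π, hπS⟩ := exists_strict_lift hmul (j' := S.subschemeι) (ker_subschemeι _)
    have hblow := hπ.strict hmul (ker_subschemeι _) hπS
    rw [hYj] at hblow
    -- The given blow-up and the strict transform are both blow-ups along the same center. The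
    -- isomorphism between them provides the embedding.
    obtain ⟨e, he⟩ := g.isBlowup.exists_iso hblow
    refine ⟨B', t.snoc f, e.hom ≫ S.subschemeι, h.snoc f g _ inferInstance ?_ ?_ hle hYj.symm⟩
    · change (e.hom ≫ S.subschemeι) ≫ blowupMap Y = g.π ≫ j
      rw [Category.assoc, hπS, ← Category.assoc, he]
    · rw [Scheme.Hom.ker_comp_of_isIso, ker_subschemeι]

end TransSeq

end Resolution
end

noncomputable section
namespace Resolution

/-! ### Coordinates and Taylor expansions -/

section Coordinates

open KaehlerDifferential

variable {k A B T R ι : Type*} [Field k] [CommRing A] [CommRing B] [CommRing T] [CommRing R]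
  [Algebra k A] [Algebra k B] [Algebra k R]

variable (k) in
/-- The differentials of the `x i` form a basis of the module of differentials. -/
def IsCoordinates (x : ι → A) : Prop :=
  LinearIndependent A (fun i ↦ D k A (x i)) ∧ Submodule.span A (Set.range fun i ↦ D k A (x i)) = ⊤

/-- `δ` is a derivation into `T`, an `A`-module through `τ`, so it factors through the
differentials, which are generated by the `d xᵢ`. This compares derivations composed with ring
homomorphisms on either side. -/
lemma eq_zero_of_derivation {x : ι → A}
    (hx : Submodule.span A (Set.range fun i ↦ D k A (x i)) = ⊤) (τ : A →+* T) (δ : A →+ T)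
    (hmul : ∀ a b, δ (a * b) = τ a * δ b + τ b * δ a) (hk : ∀ c, δ (algebraMap k A c) = 0)
    (h0 : ∀ i, δ (x i) = 0) (a : A) : δ a = 0 := by
  let _ : Module A T := Module.compHom T τ
  let _ : Module k T := Module.compHom T (τ.comp (algebraMap k A))
  have hsmul : ∀ (a : A) (t : T), a • t = τ a * t := fun _ _ ↦ rfl
  have hksmul : ∀ (c : k) (t : T), c • t = τ (algebraMap k A c) * t := fun _ _ ↦ rfl
  have : IsScalarTower k A T := ⟨fun c a t ↦ by
    rw [hsmul, hsmul, hksmul, Algebra.smul_def, map_mul, mul_assoc]⟩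
  let E : Derivation k A T := Derivation.mk' ⟨⟨δ, map_add δ⟩, fun c a ↦ by
      change δ (c • a) = c • δ a
      rw [Algebra.smul_def, hmul, hk, mul_zero, add_zero, hksmul]⟩ fun a b ↦ hmul a b
  have h1 : E.liftKaehlerDifferential = 0 := by
    refine LinearMap.ext_on_range hx fun i ↦ ?_
    rw [Derivation.liftKaehlerDifferential_comp_D]
    exact h0 i
  have h2 := E.liftKaehlerDifferential_comp_D a
  rw [h1] at h2
  exact h2.symm

/-- Derivations that are compatible on coordinates are compatible. -/
lemma map_derivation_eq {x : ι → A} (hx : IsCoordinates k x) (f : A →+* B)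
    (hf : ∀ c, f (algebraMap k A c) = algebraMap k B c) (d : Derivation k A A)
    (d' : Derivation k B B) (h : ∀ i, f (d (x i)) = d' (f (x i))) (a : A) :
    f (d a) = d' (f a) := by
  have key := eq_zero_of_derivation hx.2 f
    ((f : A →+ B).comp (d : A →+ A) - (d' : B →+ B).comp (f : A →+ B)) ?_ ?_ ?_ a
  · exact sub_eq_zero.mp key
  · intro a b
    have h1 : f (d (a * b)) - d' (f (a * b)) =
        f a * (f (d b) - d' (f b)) + f b * (f (d a) - d' (f a)) := by
      simp only [Derivation.leibniz, map_mul, map_add, smul_eq_mul]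
      ring
    exact h1
  · intro c
    have h1 : f (d (algebraMap k A c)) - d' (f (algebraMap k A c)) = 0 := by
      rw [hf, Derivation.map_algebraMap, Derivation.map_algebraMap, map_zero, sub_zero]
    exact h1
  · exact fun i ↦ sub_eq_zero.mpr (h i)

lemma IsCoordinates.exists_dual [DecidableEq ι] {x : ι → A} (hx : IsCoordinates k x) :
    ∃ d : ι → Derivation k A A, ∀ i j, d i (x j) = if i = j then 1 else 0 := by
  let b := Module.Basis.mk hx.1 hx.2.ge
  refine ⟨fun i ↦ (b.coord i).compDer (D k A), fun i j ↦ ?_⟩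
  have h : D k A (x j) = b j := (Module.Basis.mk_apply hx.1 hx.2.ge j).symm
  change b.coord i (D k A (x j)) = _
  rw [h, Module.Basis.coord_apply, Module.Basis.repr_self, Finsupp.single_apply]
  simp [eq_comm]

open TensorProduct in
/-- Coordinates stay coordinates after a formally étale extension, e.g. a localization. -/
lemma IsCoordinates.of_formallyEtale [Algebra A B] [IsScalarTower k A B] [Algebra.FormallyEtale A B]
    {x : ι → A} (hx : IsCoordinates k x) : IsCoordinates k fun i ↦ algebraMap A B (x i) := by
  let b := ((Module.Basis.mk hx.1 hx.2.ge).baseChange B).map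
    (tensorKaehlerEquivOfFormallyEtale k A B)
  have hb : ∀ i, b i = D k B (algebraMap A B (x i)) := fun i ↦ by
    simp [b]
  have hb' : (fun i ↦ D k B (algebraMap A B (x i))) = b := (funext hb).symm
  exact ⟨hb' ▸ b.linearIndependent, hb' ▸ b.span_eq⟩

/-- The differential operator `∂₁^m₁ ⋯ ∂ᵣ^mᵣ`. -/
def diffOp {r : ℕ} (d : Fin r → Derivation k A A) (m : Fin r → ℕ) : Module.End k A :=
  (List.ofFn fun i ↦ (d i : A →ₗ[k] A) ^ m i).prod

lemma diffOp_eq {r : ℕ} (d : Fin r → Derivation k A A) (m : Fin r → ℕ) :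
    diffOp d m = ((List.finRange r).map fun i ↦ ((d i : A →ₗ[k] A) ^ m i : Module.End k A)).prod := by
  rw [diffOp, List.ofFn_eq_map]

lemma map_diffOp {r : ℕ} {d : Fin r → Derivation k A A} {d' : Fin r → Derivation k B B}
    (f : A →+* B) (h : ∀ i a, f (d i a) = d' i (f a)) (m : Fin r → ℕ) (a : A) :
    f (diffOp d m a) = diffOp d' m (f a) := by
  rw [diffOp_eq, diffOp_eq]
  induction List.finRange r generalizing a with
  | nil => rfl
  | cons i l ih =>
    have hpow : ∀ (n : ℕ) (a : A), f (((d i : A →ₗ[k] A) ^ n) a) = ((d' i : B →ₗ[k] B) ^ n) (f a) := by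
      intro n
      induction n with
      | zero => intro a; rfl
      | succ n ihn =>
        intro a
        rw [pow_succ, pow_succ, Module.End.mul_apply, Module.End.mul_apply, ihn]
        exact congrArg _ (h i a)
    simp only [List.map_cons, List.prod_cons, Module.End.mul_apply]
    rw [hpow, ih]

/-- Lift the composite with `ρ` so that the equations `zᵢ` go to zero; the lift then factors through
`R`. -/
lemma formallySmooth_of_dual_ker {k A R : Type u} [Field k] [CommRing A] [CommRing R] [Algebra k A]
    [Algebra k R] [Algebra.FormallySmooth k A] (ρ : A →ₐ[k] R) (hρ : Function.Surjective ρ)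
    {ι : Type*} [Fintype ι] [DecidableEq ι] {z : ι → A} {d : ι → Derivation k A A}
    (hd : ∀ i j, d i (z j) = if i = j then 1 else 0)
    (hz : RingHom.ker ρ = Ideal.span (Set.range z)) : Algebra.FormallySmooth k R := by
  refine Algebra.FormallySmooth.of_comp_surjective fun B _ _ N hN g ↦ ?_
  obtain ⟨g', hg', h0⟩ := exists_lift_of_dual hd N hN (g.comp ρ) (fun _ ↦ 0) (fun i ↦ by
    have : ρ (z i) = 0 := by
      rw [← RingHom.mem_ker, hz]
      exact Ideal.subset_span ⟨i, rfl⟩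
    rw [AlgHom.comp_apply, this, map_zero, map_zero])
  have hker : RingHom.ker ρ ≤ RingHom.ker g' := by
    rw [hz, Ideal.span_le]
    rintro _ ⟨i, rfl⟩
    exact h0 i
  refine ⟨AlgHom.liftOfSurjective ρ hρ g' hker, ?_⟩
  have h1 : (AlgHom.liftOfSurjective ρ hρ g' hker).comp ρ = g' :=
    AlgHom.ext fun a ↦ AlgHom.liftOfSurjective_apply ρ hρ g' hker a
  rw [← AlgHom.cancel_right hρ, AlgHom.comp_assoc, h1, hg']

end Coordinates

section TaylorCoefficients

open MvPolynomial

variable {R : Type*} [CommRing R] {r c : ℕ}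

namespace Trunc

/-- Lowering of the truncation order. -/
def truncate : Trunc r (c + 1) R →+* Trunc r c R :=
  Ideal.Quotient.factor (Ideal.pow_le_pow_right (Nat.le_succ c))

lemma truncate_mk (p : MvPolynomial (Fin r) R) : truncate (mk r (c + 1) R p) = mk r c R p := rfl

/-- Partial derivatives of truncated polynomials. -/
def pderiv (i : Fin r) (t : Trunc r (c + 1) R) : Trunc r c R :=
  mk r c R (MvPolynomial.pderiv i (Function.surjInv mk_surjective t))

/-- Differentiation maps `(X)^(c+1)` into `(X)^c`; this is why it lowers the truncation order and
does not depend on the representative. -/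
lemma pderiv_mk (i : Fin r) (p : MvPolynomial (Fin r) R) :
    pderiv i (mk r (c + 1) R p) = mk r c R (MvPolynomial.pderiv i p) := by
  have h := Function.surjInv_eq (mk_surjective (b := c + 1)) (mk r (c + 1) R p)
  rw [mk_eq_mk_iff, mem_pow_idealOfVars_iff'] at h
  rw [pderiv, mk_eq_mk_iff, mem_pow_idealOfVars_iff', ← map_sub]
  intro β hβ
  rw [MvPolynomial.coeff_pderiv, h _ (by simpa using hβ), zero_mul]

lemma pderiv_add (i : Fin r) (s t : Trunc r (c + 1) R) :
    pderiv i (s + t) = pderiv i s + pderiv i t := by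
  obtain ⟨p, rfl⟩ := mk_surjective s
  obtain ⟨q, rfl⟩ := mk_surjective t
  rw [← map_add, pderiv_mk, pderiv_mk, pderiv_mk, map_add, map_add]

lemma pderiv_mul (i : Fin r) (s t : Trunc r (c + 1) R) :
    pderiv i (s * t) = truncate s * pderiv i t + truncate t * pderiv i s := by
  obtain ⟨p, rfl⟩ := mk_surjective s
  obtain ⟨q, rfl⟩ := mk_surjective t
  rw [← map_mul, pderiv_mk, pderiv_mk, pderiv_mk, truncate_mk, truncate_mk, ← map_mul, ← map_mul,
    ← map_add, Derivation.leibniz]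
  rfl

lemma pderiv_C (i : Fin r) (a : R) : pderiv i (C a : Trunc r (c + 1) R) = 0 := by
  rw [C, RingHom.comp_apply, pderiv_mk, MvPolynomial.pderiv_C, map_zero]

lemma pderiv_X (i j : Fin r) : pderiv i (X j : Trunc r (c + 1) R) = if i = j then 1 else 0 := by
  rw [X, pderiv_mk, MvPolynomial.pderiv_X]
  by_cases h : i = j
  · subst h; simp
  · rw [if_neg h, Pi.single_eq_of_ne (Ne.symm h), map_zero]

lemma coeff_truncate {β : Fin r →₀ ℕ} (hβ : β.degree < c) (t : Trunc r (c + 1) R) :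
    coeff β (truncate t) = coeff β t := by
  obtain ⟨p, rfl⟩ := mk_surjective t
  rw [truncate_mk, coeff_mk hβ, coeff_mk (by omega)]

lemma coeff_pderiv {β : Fin r →₀ ℕ} (hβ : β.degree < c) (i : Fin r) (t : Trunc r (c + 1) R) :
    coeff β (pderiv i t) = (β i + 1) * coeff (β + Finsupp.single i 1) t := by
  obtain ⟨p, rfl⟩ := mk_surjective t
  rw [pderiv_mk, coeff_mk hβ, coeff_mk (by simpa using hβ), MvPolynomial.coeff_pderiv,
    mul_comm]

end Trunc

variable {k A : Type*} [Field k] [CommRing A] [Algebra k A] [Algebra k R] {n b : ℕ}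
  {z : Fin r → A} {y : Fin n → A} {d : Fin r → Derivation k A A}

/-- The data of a Taylor expansion with respect to the coordinates `z, y`. -/
structure IsTaylorExpansion (z : Fin r → A) (y : Fin n → A) (ρ : A → R) (φ : A →+* Trunc r b R) :
    Prop where
  map_z : ∀ i, φ (z i) = Trunc.X i
  map_y : ∀ j, φ (y j) = Trunc.C (ρ (y j))
  map_algebraMap : ∀ c : k, φ (algebraMap k A c) = Trunc.C (algebraMap k R c)

/-- `φ ∘ ∂/∂zᵢ`, truncated by one order, and `∂/∂Xᵢ ∘ φ` are derivations over the truncation of `φ`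
that agree on constants and on coordinates, so they are equal. -/
lemma coeff_map_derivation (hx : IsCoordinates k (Sum.elim z y))
    (hz : ∀ i j, d i (z j) = if i = j then 1 else 0) (hy : ∀ i j, d i (y j) = 0) {ρ : A → R}
    {φ : A →+* Trunc r b R} (hφ : IsTaylorExpansion (k := k) z y ρ φ) {β : Fin r →₀ ℕ}
    (hβ : β.degree + 1 < b) (i : Fin r) (f : A) :
    Trunc.coeff β (φ (d i f)) = (β i + 1) * Trunc.coeff (β + Finsupp.single i 1) (φ f) := by
  obtain ⟨c, rfl⟩ : ∃ c, b = c + 1 := ⟨b - 1, by omega⟩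
  have hβ' : β.degree < c := by omega
  rw [← Trunc.coeff_pderiv hβ', ← Trunc.coeff_truncate hβ']
  congr 1
  let δ : A →+ Trunc r c R :=
    { toFun := fun a ↦ Trunc.truncate (φ (d i a)) - Trunc.pderiv i (φ a)
      map_zero' := by
        have := Trunc.pderiv_C (c := c) i (0 : R)
        rw [map_zero] at this
        simp [this]
      map_add' := fun a b ↦ by
        simp only [map_add, Trunc.pderiv_add]
        ring }
  refine sub_eq_zero.mp (eq_zero_of_derivation hx.2 (Trunc.truncate.comp φ) δ ?_ ?_ ?_ f)
  · intro a b
    simp only [δ, AddMonoidHom.coe_mk, ZeroHom.coe_mk, RingHom.comp_apply, Derivation.leibniz,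
      map_add, map_mul, smul_eq_mul, Trunc.pderiv_mul]
    ring
  · intro a
    simp only [δ, AddMonoidHom.coe_mk, ZeroHom.coe_mk, Derivation.map_algebraMap, map_zero,
      hφ.map_algebraMap, Trunc.pderiv_C, sub_zero]
  · rintro (j | j)
    · simp only [δ, AddMonoidHom.coe_mk, ZeroHom.coe_mk, Sum.elim_inl, hz, hφ.map_z,
        Trunc.pderiv_X]
      split_ifs <;> simp
    · simp only [δ, AddMonoidHom.coe_mk, ZeroHom.coe_mk, Sum.elim_inr, hy, hφ.map_y,
        Trunc.pderiv_C, map_zero, sub_zero]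

lemma prod_factorial_add_single (β : Fin r →₀ ℕ) (i : Fin r) :
    ∏ j, ((β + Finsupp.single i 1 : Fin r →₀ ℕ) j).factorial =
      (β i + 1) * ∏ j, (β j).factorial := by
  rw [← Finset.mul_prod_erase _ _ (Finset.mem_univ i),
    ← Finset.mul_prod_erase _ (fun j ↦ (β j).factorial) (Finset.mem_univ i), ← mul_assoc]
  congr 1
  · simp [Nat.factorial_succ]
  · refine Finset.prod_congr rfl fun j hj ↦ ?_
    rw [Finsupp.add_apply, Finsupp.single_eq_of_ne (Finset.ne_of_mem_erase hj), add_zero]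

/-- Iteration multiplies the factors `βᵢ + 1`; they are collected as factorials on both sides to
avoid division in `R`. -/
lemma coeff_map_derivation_pow (hx : IsCoordinates k (Sum.elim z y))
    (hz : ∀ i j, d i (z j) = if i = j then 1 else 0) (hy : ∀ i j, d i (y j) = 0) {ρ : A → R}
    {φ : A →+* Trunc r b R} (hφ : IsTaylorExpansion (k := k) z y ρ φ) (i : Fin r) (N : ℕ)
    (β : Fin r →₀ ℕ) (hβ : β.degree + N < b) (f : A) :
    (∏ j, (β j).factorial : ℕ) * Trunc.coeff β (φ (((d i : A →ₗ[k] A) ^ N) f)) =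
      (∏ j, ((β + Finsupp.single i N : Fin r →₀ ℕ) j).factorial : ℕ) *
        Trunc.coeff (β + Finsupp.single i N) (φ f) := by
  induction N generalizing β with
  | zero => simp
  | succ N ih =>
    rw [pow_succ', Module.End.mul_apply]
    have h1 := coeff_map_derivation hx hz hy hφ (β := β) (by omega) i (((d i : A →ₗ[k] A) ^ N) f)
    have h2 := ih (β + Finsupp.single i 1) (by simp; omega)
    rw [add_assoc, ← Finsupp.single_add, add_comm 1 N] at h2
    rw [← h2, prod_factorial_add_single]
    refine (congrArg _ h1).trans ?_
    push_cast
    ring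

/-- Taylor's formula. The variables are treated one after the other, along a list, and the exponents
already used accumulate in `β`. -/
lemma coeff_map_diffOp (hx : IsCoordinates k (Sum.elim z y))
    (hz : ∀ i j, d i (z j) = if i = j then 1 else 0) (hy : ∀ i j, d i (y j) = 0) {ρ : A → R}
    {φ : A →+* Trunc r b R} (hφ : IsTaylorExpansion (k := k) z y ρ φ) (α : Fin r →₀ ℕ)
    (hα : α.degree < b) (f : A) :
    Trunc.coeff 0 (φ (diffOp d α f)) =
      (∏ j, (α j).factorial : ℕ) * Trunc.coeff α (φ f) := by
  have key : ∀ (l : List (Fin r)) (β : Fin r →₀ ℕ),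
      (β + (l.map fun i ↦ Finsupp.single i (α i)).sum : Fin r →₀ ℕ).degree < b →
      (∏ j, (β j).factorial : ℕ) * Trunc.coeff β
        (φ ((l.map fun i ↦ ((d i : A →ₗ[k] A) ^ α i : Module.End k A)).prod f)) =
      (∏ j, ((β + (l.map fun i ↦ Finsupp.single i (α i)).sum : Fin r →₀ ℕ) j).factorial : ℕ) *
        Trunc.coeff (β + (l.map fun i ↦ Finsupp.single i (α i)).sum) (φ f) := by
    intro l
    induction l with
    | nil => simp
    | cons i l ih =>
      intro β hβ
      simp only [List.map_cons, List.sum_cons, List.prod_cons, Module.End.mul_apply] at hβ ⊢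
      rw [← add_assoc] at hβ ⊢
      rw [← ih _ hβ]
      refine coeff_map_derivation_pow hx hz hy hφ i (α i) β ?_ _
      simp only [map_add, Finsupp.degree_single] at hβ
      omega
  have hsum : ((List.finRange r).map fun i ↦ Finsupp.single i (α i)).sum = α := by
    rw [← List.ofFn_eq_map, List.sum_ofFn]
    exact Finsupp.univ_sum_single α
  have h := key (List.finRange r) 0 (by rwa [hsum, zero_add])
  rw [hsum, zero_add, ← diffOp_eq] at h
  simpa using h

end TaylorCoefficients

end Resolution
end

/-! ### Coefficient ideals in coordinates -/

noncomputable section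
namespace Resolution

open Scheme.IdealSheafData

/-- Coefficient ideals with respect to coordinates are coefficient ideals along the surjection
onto the functions on `z = 0`. -/
lemma isCoeffAt_of_isCoordinates {k : Type*} {A R : Type u} [Field k] [CharZero k] [CommRing A] [CommRing R]
    [Algebra k A] [Algebra k R] [Algebra.FormallySmooth k A] (ρ : A →ₐ[k] R)
    (hρ : Function.Surjective ρ) {r n b : ℕ} (hb : 0 < b) {z : Fin r → A} {y : Fin n → A}
    (hx : IsCoordinates k (Sum.elim z y))
    (hker : RingHom.ker ρ.toRingHom = Ideal.span (Set.range z)) {d : Fin r → Derivation k A A}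
    (hz : ∀ i j, d i (z j) = if i = j then 1 else 0) (hy : ∀ i j, d i (y j) = 0) (F : Set A) :
    IsCoeffAt b ρ.toRingHom (Ideal.span F) (Ideal.span {g | ∃ f ∈ F, ∃ m : Fin r → ℕ,
      ∑ i, m i < b ∧ g = ρ ((∏ i, ((m i).factorial : k))⁻¹ • diffOp d m f) ^
        (b.factorial / (b - ∑ i, m i))}) := by
  obtain ⟨D, hD⟩ := hx.exists_dual
  obtain ⟨φ, hφ, h1, h2⟩ := exists_isTaylorHom ρ hρ hD hker hb
  have hexp : IsTaylorExpansion (k := k) z y ρ φ := ⟨hφ.map_z, h1, h2⟩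
  -- The constant coefficient of `φ (∂^α f)` is the restriction of `∂^α f`; Taylor's formula equates
  -- it with `α!` times the coefficient of `φ f` at `α`.
  have key : ∀ (α : Fin r →₀ ℕ), α.degree < b → ∀ f, Trunc.coeff α (φ f) =
      ρ ((∏ i, ((α i).factorial : k))⁻¹ • diffOp d α f) := by
    intro α hα f
    have h3 := coeff_map_diffOp hx hz hy hexp α hα f
    rw [Trunc.coeff_zero_eq_const hb, hφ.const_eq] at h3
    have h4 : (∏ i, ((α i).factorial : k)) ≠ 0 :=
      Finset.prod_ne_zero_iff.mpr fun i _ ↦ Nat.cast_ne_zero.mpr (Nat.factorial_ne_zero _)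
    rw [map_smul]
    change _ = _ • ρ.toRingHom (diffOp d α f)
    rw [h3, eq_inv_smul_iff₀ h4, Algebra.smul_def]
    simp
  refine ⟨hb, r, z, φ, hφ, F, rfl, ?_⟩
  congr 1
  ext g
  constructor
  · rintro ⟨f, hf, m, hm, rfl⟩
    have hdeg : (Finsupp.equivFunOnFinite.symm m).degree = ∑ i, m i := by
      simp [Finsupp.degree_eq_sum]
    refine ⟨f, hf, Finsupp.equivFunOnFinite.symm m, hdeg ▸ hm, ?_⟩
    rw [key _ (hdeg ▸ hm), hdeg]
    rfl
  · rintro ⟨f, hf, α, hα, rfl⟩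
    refine ⟨f, hf, α, by rwa [← Finsupp.degree_eq_sum], ?_⟩
    rw [key α hα, ← Finsupp.degree_eq_sum]

variable {k : Type u} [Field k] {X : Scheme.{u}} {p : X ⟶ Spec (CommRingCat.of k)}

lemma stalkIdeal_ofIdealTop (a : Ideal Γ(X, ⊤)) (x : X) :
    stalkIdeal (ofIdealTop a) x = a.map (X.presheaf.germ ⊤ x trivial).hom := by
  obtain ⟨V, hx⟩ := exists_affine_mem x
  rw [stalkIdeal_eq _ x V hx, ofIdealTop_ideal, Ideal.map_map, ← CommRingCat.hom_comp]
  congr 2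
  exact X.presheaf.germ_res _ _ _

lemma germ_res_eq (V : X.Opens) (x : X) (hx : x ∈ V) (s : Γ(X, ⊤)) :
    (X.presheaf.germ V x hx).hom (res V s) = (X.presheaf.germ ⊤ x trivial).hom s :=
  congr($(X.presheaf.germ_res (homOfLE le_top) x hx).hom s)

lemma map_sectionsAlgebra {U V : X.Opens} (h : U ≤ V) (c : k) :
    (X.presheaf.map (homOfLE h).op).hom ((sectionsAlgebra p V).algebraMap c) =
      (sectionsAlgebra p U).algebraMap c := by
  have e : p.appLE ⊤ V le_top ≫ X.presheaf.map (homOfLE h).op = p.appLE ⊤ U le_top :=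
    Scheme.Hom.appLE_map _ _ _
  exact congr(($e).hom ((Scheme.ΓSpecIso (CommRingCat.of k)).inv.hom c))

lemma map_res {U V : X.Opens} (h : U ≤ V) (s : Γ(X, ⊤)) :
    (X.presheaf.map (homOfLE h).op).hom (res V s) = res U s := by
  have e : X.presheaf.map (homOfLE le_top).op ≫ X.presheaf.map (homOfLE h).op =
      X.presheaf.map (homOfLE (le_top : U ≤ ⊤)).op := by
    rw [← Functor.map_comp]; rfl
  exact congr(($e).hom s)

lemma IsCoordinateSystem.stalk {ι : Type} {t : ι → Γ(X, ⊤)} (h : IsCoordinateSystem p t) (x : X) :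
    letI := stalkAlgebra p x
    IsCoordinates k fun i ↦ (X.presheaf.germ ⊤ x trivial).hom (t i) := by
  obtain ⟨V, hx⟩ := exists_affine_mem x
  let _ := sectionsAlgebra p V.1
  let _ := stalkAlgebra p x
  let _ := TopCat.Presheaf.algebra_section_stalk X.presheaf (U := V.1) ⟨x, hx⟩
  have := V.2.isLocalization_stalk ⟨x, hx⟩
  have : IsScalarTower k Γ(X, V.1) (X.presheaf.stalk x) :=
    IsScalarTower.of_algebraMap_eq fun c ↦ (germ_algebraMap p V.1 x hx c).symm
  have : Algebra.FormallyEtale Γ(X, V.1) (X.presheaf.stalk x) :=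
    Algebra.FormallyEtale.of_isLocalization (V.2.primeIdealOf ⟨x, hx⟩).asIdeal.primeCompl
  have h1 : IsCoordinates k fun i ↦ res V.1 (t i) := h V
  have h2 := h1.of_formallyEtale (B := X.presheaf.stalk x)
  have h3 : (fun i ↦ algebraMap Γ(X, V.1) (X.presheaf.stalk x) (res V.1 (t i))) =
      fun i ↦ (X.presheaf.germ ⊤ x trivial).hom (t i) :=
    funext fun i ↦ germ_res_eq V.1 x hx (t i)
  rw [h3] at h2
  exact h2

section Existence

variable {r n : ℕ} {z : Fin r → Γ(X, ⊤)} {y : Fin n → Γ(X, ⊤)}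

/-- The partial derivatives with respect to the coordinates `z`. -/
lemma IsCoordinateSystem.exists_derivation (h : IsCoordinateSystem p (Sum.elim z y))
    (V : X.affineOpens) : letI := sectionsAlgebra p V.1
    ∃ d : Fin r → Derivation k Γ(X, V.1) Γ(X, V.1),
      (∀ i j, d i (res V.1 (z j)) = if i = j then 1 else 0) ∧ (∀ i j, d i (res V.1 (y j)) = 0) := by
  let _ := sectionsAlgebra p V.1
  have h1 : IsCoordinates k fun i ↦ res V.1 (Sum.elim z y i) := h V
  obtain ⟨d, hd⟩ := h1.exists_dual
  refine ⟨fun i ↦ d (Sum.inl i), fun i j ↦ ?_, fun i j ↦ ?_⟩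
  · simpa using hd (Sum.inl i) (Sum.inl j)
  · simpa using hd (Sum.inl i) (Sum.inr j)

/-- The generators of a coefficient ideal. -/
def coeffGenerators (p : X ⟶ Spec (CommRingCat.of k)) (b : ℕ) (F : Set Γ(X, ⊤)) (V : X.Opens)
    (d : letI := sectionsAlgebra p V; Fin r → Derivation k Γ(X, V) Γ(X, V)) : Set Γ(X, V) :=
  letI := sectionsAlgebra p V
  {g | ∃ f ∈ F, ∃ m : Fin r → ℕ, ∑ i, m i < b ∧
    g = ((∏ i, ((m i).factorial : k))⁻¹ • diffOp d m (res V f)) ^ (b.factorial / (b - ∑ i, m i))}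

lemma map_smul_diffOp {A B : Type*} [CommRing A] [CommRing B] [Algebra k A] [Algebra k B]
    {d : Fin r → Derivation k A A} {d' : Fin r → Derivation k B B} (f : A →+* B)
    (hf : ∀ c, f (algebraMap k A c) = algebraMap k B c) (h : ∀ i a, f (d i a) = d' i (f a))
    (c : k) (m : Fin r → ℕ) (a : A) : f (c • diffOp d m a) = c • diffOp d' m (f a) := by
  rw [Algebra.smul_def, map_mul, hf, map_diffOp f h, Algebra.smul_def]

/-- Derivations are determined by their values on coordinates, so the partial derivatives commute
with restriction whatever choices were made. The local ideals therefore glue to an ideal sheaf. -/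
lemma map_coeffGenerators (h : IsCoordinateSystem p (Sum.elim z y)) (b : ℕ) (F : Set Γ(X, ⊤))
    {U V : X.affineOpens} (hUV : U.1 ≤ V.1)
    (d : letI := sectionsAlgebra p V.1; Fin r → Derivation k Γ(X, V.1) Γ(X, V.1))
    (hz : ∀ i j, d i (res V.1 (z j)) = if i = j then 1 else 0) (hy : ∀ i j, d i (res V.1 (y j)) = 0)
    (d' : letI := sectionsAlgebra p U.1; Fin r → Derivation k Γ(X, U.1) Γ(X, U.1))
    (hz' : ∀ i j, d' i (res U.1 (z j)) = if i = j then 1 else 0)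
    (hy' : ∀ i j, d' i (res U.1 (y j)) = 0) :
    (Ideal.span (coeffGenerators p b F V.1 d)).map (X.presheaf.map (homOfLE hUV).op).hom =
      Ideal.span (coeffGenerators p b F U.1 d') := by
  let _ := sectionsAlgebra p V.1
  let _ := sectionsAlgebra p U.1
  let f := (X.presheaf.map (homOfLE hUV).op).hom
  have hf : ∀ c, f (algebraMap k Γ(X, V.1) c) = algebraMap k Γ(X, U.1) c :=
    map_sectionsAlgebra hUV
  have hres : ∀ s, f (res V.1 s) = res U.1 s := map_res hUV
  have hcomm : ∀ i a, f (d i a) = d' i (f a) := by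
    intro i
    have h1 : IsCoordinates k fun i ↦ res V.1 (Sum.elim z y i) := h V
    refine map_derivation_eq h1 f hf _ _ ?_
    rintro (j | j)
    · change f (d i (res V.1 (z j))) = d' i (f (res V.1 (z j)))
      rw [hz, hres, hz']
      split_ifs <;> simp
    · change f (d i (res V.1 (y j))) = d' i (f (res V.1 (y j)))
      rw [hy, hres, hy', map_zero]
  have key : ∀ (m : Fin r → ℕ) (N : ℕ) (s : Γ(X, ⊤)),
      f (((∏ i, ((m i).factorial : k))⁻¹ • diffOp d m (res V.1 s)) ^ N) =
        ((∏ i, ((m i).factorial : k))⁻¹ • diffOp d' m (res U.1 s)) ^ N := by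
    intro m N s
    rw [map_pow, map_smul_diffOp f hf hcomm, hres]
  rw [Ideal.map_span]
  congr 1
  ext g'
  constructor
  · rintro ⟨_, ⟨s, hs, m, hm, rfl⟩, rfl⟩
    exact ⟨s, hs, m, hm, key _ _ _⟩
  · rintro ⟨s, hs, m, hm, rfl⟩
    exact ⟨_, ⟨s, hs, m, hm, rfl⟩, key _ _ _⟩

lemma exists_isCoefficientIdeal (h : IsCoordinateSystem p (Sum.elim z y)) (b : ℕ)
    (F : Set Γ(X, ⊤)) (I : X.IdealSheafData) :
    ∃ K : I.subscheme.IdealSheafData, IsCoefficientIdeal p b z y F K := by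
  choose d hz hy using h.exists_derivation
  let C : X.IdealSheafData :=
    { ideal := fun V ↦ Ideal.span (coeffGenerators p b F V.1 (d V))
      map_ideal_basicOpen := fun V g ↦
        map_coeffGenerators h b F (U := X.affineBasicOpen g) (X.basicOpen_le g) _ (hz V) (hy V) _
          (hz _) (hy _) }
  exact ⟨C.comap I.subschemeι, C, rfl, fun V ↦ ⟨d V, hz V, hy V, rfl⟩⟩

end Existence

/-- The couple of a coefficient ideal is adapted to the original couple. -/
theorem adapted_of_isCoefficientIdeal [CharZero k] (A : Couple k) (hA : Smooth A.str)
    (hb : 0 < A.b) {r n : ℕ} {z : Fin r → Γ(A.W, ⊤)} {y : Fin n → Γ(A.W, ⊤)} {F : Set Γ(A.W, ⊤)}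
    (h : IsCoordinateSystem A.str (Sum.elim z y)) (hJ : A.J = ofIdealTop (Ideal.span F))
    {I : A.W.IdealSheafData} (hI : I = ofIdealTop (Ideal.span (Set.range z)))
    {K : I.subscheme.IdealSheafData} (hK : IsCoefficientIdeal A.str A.b z y F K) :
    Adapted A (A.onSubscheme I K A.b.factorial) I.subschemeι := by
  have hker : ∀ x : I.subscheme, RingHom.ker (I.subschemeι.stalkMap x).hom =
      Ideal.span (Set.range fun i ↦ (A.W.presheaf.germ ⊤ (I.subschemeι x) trivial).hom (z i)) := by
    intro x
    rw [← stalkIdeal_ker, ker_subschemeι]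
    refine (congrArg (stalkIdeal · (I.subschemeι x)) hI).trans ?_
    dsimp only
    rw [stalkIdeal_ofIdealTop, Ideal.map_span, ← Set.range_comp]
    rfl
  have helim : ∀ x : A.W, (fun i ↦ (A.W.presheaf.germ ⊤ x trivial).hom (Sum.elim z y i)) =
      Sum.elim (fun i ↦ (A.W.presheaf.germ ⊤ x trivial).hom (z i))
        fun i ↦ (A.W.presheaf.germ ⊤ x trivial).hom (y i) := fun x ↦ by
    ext (i | i) <;> rfl
  have hdual : ∀ x : A.W, letI := stalkAlgebra A.str x
      ∃ d : Fin r → Derivation k (A.W.presheaf.stalk x) (A.W.presheaf.stalk x),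
        (∀ i j, d i ((A.W.presheaf.germ ⊤ x trivial).hom (z j)) = if i = j then 1 else 0) ∧
        (∀ i j, d i ((A.W.presheaf.germ ⊤ x trivial).hom (y j)) = 0) := by
    intro x
    let _ := stalkAlgebra A.str x
    have h1 := h.stalk x
    obtain ⟨d, hd⟩ := h1.exists_dual
    refine ⟨fun i ↦ d (Sum.inl i), fun i j ↦ ?_, fun i j ↦ ?_⟩
    · simpa using hd (Sum.inl i) (Sum.inl j)
    · simpa using hd (Sum.inl i) (Sum.inr j)
  -- The equations `z` have dual derivations at every point, which makes the local rings of their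
  -- zero scheme formally smooth.
  have hsm : Smooth (I.subschemeι ≫ A.str) := by
    refine smooth_of_stalk _ fun x ↦ ?_
    let _ := stalkAlgebra A.str (I.subschemeι x)
    let _ := stalkAlgebra (I.subschemeι ≫ A.str) x
    have := formallySmooth_stalk A.str (I.subschemeι x)
    obtain ⟨d, hd, -⟩ := hdual (I.subschemeι x)
    exact formallySmooth_of_dual_ker
      (⟨(I.subschemeι.stalkMap x).hom, stalkMap_algebraMap I.subschemeι rfl x⟩ :
        A.W.presheaf.stalk (I.subschemeι x) →ₐ[k] I.subscheme.presheaf.stalk x)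
      (I.subschemeι.stalkMap_surjective x) hd (hker x)
  refine ⟨inferInstanceAs (IsClosedImmersion I.subschemeι), rfl, hA, hsm, rfl, fun x ↦ ?_⟩
  let x₀ := I.subschemeι x
  change IsCoeffAt A.b (I.subschemeι.stalkMap x).hom (stalkIdeal A.J x₀) (stalkIdeal K x)
  obtain ⟨C, hC, hCV⟩ := hK
  obtain ⟨V, hx⟩ := exists_affine_mem x₀
  let _ := sectionsAlgebra A.str V.1
  let _ := stalkAlgebra A.str x₀
  let _ := stalkAlgebra (I.subschemeι ≫ A.str) x
  have := formallySmooth_stalk A.str x₀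
  obtain ⟨d, hdz, hdy, hd⟩ := hCV V
  obtain ⟨d', hdz', hdy'⟩ := hdual x₀
  let γ := (A.W.presheaf.germ V.1 x₀ hx).hom
  have hγ : ∀ s, γ (res V.1 s) = (A.W.presheaf.germ ⊤ x₀ trivial).hom s := germ_res_eq V.1 x₀ hx
  have hγk : ∀ c, γ (algebraMap k Γ(A.W, V.1) c) = algebraMap k (A.W.presheaf.stalk x₀) c :=
    germ_algebraMap A.str V.1 x₀ hx
  -- The partial derivatives on sections over `V` and on the stalk agree on coordinates, hence
  -- everywhere; so the global generators have the expected germs.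
  have hcomm : ∀ i a, γ (d i a) = d' i (γ a) := by
    intro i
    have h1 : IsCoordinates k fun i ↦ res V.1 (Sum.elim z y i) := h V
    refine map_derivation_eq h1 γ hγk _ _ ?_
    rintro (j | j)
    · change γ (d i (res V.1 (z j))) = d' i (γ (res V.1 (z j)))
      rw [hdz, hγ, hdz']
      split_ifs <;> simp
    · change γ (d i (res V.1 (y j))) = d' i (γ (res V.1 (y j)))
      rw [hdy, hγ, hdy', map_zero]
  let ρ : A.W.presheaf.stalk x₀ →ₐ[k] I.subscheme.presheaf.stalk x :=
    ⟨(I.subschemeι.stalkMap x).hom, stalkMap_algebraMap I.subschemeι rfl x⟩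
  have hcoord := h.stalk x₀
  rw [helim] at hcoord
  have key := isCoeffAt_of_isCoordinates ρ (I.subschemeι.stalkMap_surjective x) hb hcoord (hker x)
    hdz' hdy' ((A.W.presheaf.germ ⊤ x₀ trivial).hom '' F)
  have e1 : stalkIdeal A.J x₀ = Ideal.span ((A.W.presheaf.germ ⊤ x₀ trivial).hom '' F) := by
    rw [hJ, stalkIdeal_ofIdealTop, Ideal.map_span]
  have hpow : ∀ (m : Fin r → ℕ) (N : ℕ) (s : Γ(A.W, ⊤)),
      ρ (γ (((∏ i, ((m i).factorial : k))⁻¹ • diffOp d m (res V.1 s)) ^ N)) =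
        ρ ((∏ i, ((m i).factorial : k))⁻¹ •
          diffOp d' m ((A.W.presheaf.germ ⊤ x₀ trivial).hom s)) ^ N := by
    intro m N s
    rw [map_pow, map_pow, map_smul_diffOp γ hγk hcomm, hγ]
  have e2 : stalkIdeal K x = Ideal.span {g | ∃ f ∈ (A.W.presheaf.germ ⊤ x₀ trivial).hom '' F,
      ∃ m : Fin r → ℕ, ∑ i, m i < A.b ∧
        g = ρ ((∏ i, ((m i).factorial : k))⁻¹ • diffOp d' m f) ^
          (A.b.factorial / (A.b - ∑ i, m i))} := by
    rw [hC]
    refine (stalkIdeal_comap I.subschemeι C x).trans ?_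
    rw [stalkIdeal_eq C x₀ V hx, hd, Ideal.map_span, Ideal.map_span]
    congr 1
    ext g
    constructor
    · rintro ⟨_, ⟨_, ⟨f, hf, m, hm, rfl⟩, rfl⟩, rfl⟩
      exact ⟨_, ⟨f, hf, rfl⟩, m, hm, hpow _ _ _⟩
    · rintro ⟨_, ⟨f, hf, rfl⟩, m, hm, rfl⟩
      exact ⟨_, ⟨_, ⟨f, hf, m, hm, rfl⟩, rfl⟩, hpow _ _ _⟩
  rw [e1, e2]
  exact key

end Resolution
end

noncomputable section
namespace Resolution

open Scheme.IdealSheafData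

/-! ### Hypersurfaces of maximal contact -/

variable {k : Type u} [Field k]

/-- The closed subscheme with ideal sheaf `H` is a smooth hypersurface, and its equations are
obtained by at most `b - 1` derivations from `J`. -/
structure MaximalContact (A : Couple k) (H : A.W.IdealSheafData) : Prop where
  smooth : Smooth A.str
  pos : 0 < A.b
  cartier : IsEffectiveCartier H
  smooth_sub : Smooth (H.subschemeι ≫ A.str)
  le_diffIdeal : ∀ x, stalkIdeal H x ≤ (diffIdeal ℤ)^[A.b - 1] (stalkIdeal A.J x)

/-- At a point of order at least `b`, fewer than `b` derivations keep `J` inside the maximal ideal.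
The point is its own center, so the trivial denominator suffices. -/
lemma MaximalContact.Sing_subset {A : Couple k} {H : A.W.IdealSheafData}
    (h : MaximalContact A H) : A.Sing ⊆ H.support := by
  intro x hx
  refine (mem_support_iff_stalkIdeal_le H x).mpr ((h.le_diffIdeal x).trans ?_)
  refine diffIdeal_iterate_le_of_symbolic (A.b - 1) fun f hf ↦
    ⟨1, (Ideal.ne_top_iff_one _).mp Ideal.IsPrime.ne_top', ?_⟩
  rw [one_mul, Nat.sub_add_cancel h.pos]
  exact (mem_Sing_iff A x).mp hx hf

/-- In a local domain a factor of a nonzero principal ideal is principal. Some product `e s` must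
generate the ideal of `a`, since otherwise `a` lies in `a` times the maximal ideal; cancelling `e`
shows that `s` generates `S`. -/
lemma isEffectiveCartier_of_mul_eq {X : Scheme.{u}} [IsLocallyNoetherian X]
    [∀ x : X, IsDomain (X.presheaf.stalk x)] {E L S : X.IdealSheafData}
    (hL : ∀ x, ∃ a ≠ 0, stalkIdeal L x = Ideal.span {a}) (h : E * S = L) :
    IsEffectiveCartier S := by
  refine isEffectiveCartier_of_stalk fun x ↦ ?_
  obtain ⟨a, ha, haL⟩ := hL x
  have h1 := congrArg (stalkIdeal · x) h
  simp only [stalkIdeal_mul, haL] at h1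
  have hne : stalkIdeal E x * stalkIdeal S x ≠ ⊥ := by
    rw [h1]
    simpa using ha
  by_contra! H
  have hmul : ∀ e ∈ stalkIdeal E x, ∀ s ∈ stalkIdeal S x, ∃ c, e * s = a * c := fun e he s hs ↦ by
    obtain ⟨c, hc⟩ := Ideal.mem_span_singleton.mp (h1 ▸ Ideal.mul_mem_mul he hs)
    exact ⟨c, hc⟩
  have hle : stalkIdeal E x * stalkIdeal S x ≤
      Ideal.span {a} * IsLocalRing.maximalIdeal (X.presheaf.stalk x) := by
    rw [Ideal.mul_le]
    intro e he s hs
    obtain ⟨c, hc⟩ := hmul e he s hs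
    rw [hc]
    refine Ideal.mul_mem_mul (Ideal.mem_span_singleton_self a) fun hcu ↦ ?_
    have he0 : e ≠ 0 := by
      rintro rfl
      rw [zero_mul] at hc
      exact mul_ne_zero ha hcu.ne_zero hc.symm
    have hs0 : s ≠ 0 := by
      rintro rfl
      rw [mul_zero] at hc
      exact mul_ne_zero ha hcu.ne_zero hc.symm
    refine H s (mem_nonZeroDivisors_of_ne_zero hs0) (le_antisymm (fun t ht ↦ ?_)
      ((Ideal.span_singleton_le_iff_mem _).mpr hs))
    obtain ⟨c', hc'⟩ := hmul e he t ht
    obtain ⟨u, rfl⟩ := hcu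
    rw [Ideal.mem_span_singleton]
    refine ⟨↑u⁻¹ * c', mul_left_cancel₀ he0 ?_⟩
    rw [← mul_assoc, hc, hc', mul_assoc, Units.mul_inv_cancel_left]
  rw [h1] at hle
  obtain ⟨m, hm, hma⟩ := Ideal.mem_span_singleton_mul.mp (hle (Ideal.mem_span_singleton_self a))
  have : m = 1 := mul_left_cancel₀ ha (hma.trans (mul_one a).symm)
  exact (Ideal.ne_top_iff_one _).mp Ideal.IsPrime.ne_top' (this ▸ hm)

/-- Maximal contact persists under transformations. -/
theorem MaximalContact.step [CharZero k] {A A' : Couple k} {H : A.W.IdealSheafData}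
    (h : MaximalContact A H) (f : Transformation A A') :
    MaximalContact A' (strictTransform f.π f.center H) := by
  have := h.smooth
  have := h.smooth_sub
  have hA' : Smooth A'.str := f.str_eq ▸ f.isBlowup.smooth f.smooth_center
  have : IsLocallyNoetherian A'.W := isLocallyNoetherian_of_field A'.str
  have hred : IsReduced f.center.subscheme :=
    have := f.smooth_center
    isReduced_of_smooth (f.center.subschemeι ≫ A.str)
  have hle : H ≤ f.center := le_of_support_subset (f.center_subset.trans h.Sing_subset)
  have hmul := f.isBlowup.comap_mul_strictTransform (p := A.str) H.subschemeι rfl (by rwa [ker_subschemeι])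
  have hsub : Smooth ((strictTransform f.π f.center H).subschemeι ≫ A'.str) := by
    obtain ⟨π, hπ⟩ := exists_strict_lift hmul
      (j' := (strictTransform f.π f.center H).subschemeι) (by rw [ker_subschemeι, ker_subschemeι])
    have hblow := f.isBlowup.strict hmul (by rw [ker_subschemeι, ker_subschemeι]) hπ
    have hsm := smooth_comap_center f.smooth_center H.subschemeι rfl (by rwa [ker_subschemeι])
    have h1 := hblow.smooth hsm
    rwa [← f.str_eq, ← Category.assoc, hπ, Category.assoc]
  rw [ker_subschemeι] at hmul
  have hdom : ∀ x : A'.W, IsDomain (A'.W.presheaf.stalk x) := isDomain_stalk A'.str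
  have hlocal : ∀ x : A'.W, ∃ s ∈ stalkIdeal f.center (f.π x),
      (f.π.stalkMap x).hom s ∈ nonZeroDivisors (A'.W.presheaf.stalk x) ∧
      (stalkIdeal f.center (f.π x)).map (f.π.stalkMap x).hom =
        Ideal.span {(f.π.stalkMap x).hom s} := by
    intro x
    obtain ⟨e, he, heq⟩ := f.isBlowup.cartier.exists_stalkIdeal_eq x
    rw [stalkIdeal_comap] at heq
    obtain ⟨s, hs, hse⟩ := exists_mem_span_singleton_eq (B := A'.W.presheaf.stalk x) _ _ he heq
    exact ⟨s, hs, mem_nonZeroDivisors_of_span_eq (A := A'.W.presheaf.stalk x) he hse,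
      heq.trans hse.symm⟩
  have hlift : ∀ x : A'.W, HasBlowupLift (f.π.stalkMap x).hom
      (RingHom.id (A'.W.presheaf.stalk x)) (stalkIdeal f.center (f.π x)) :=
    fun x ↦ f.isBlowup.hasBlowupLift x _
  refine ⟨hA', f.b_eq ▸ h.pos, isEffectiveCartier_of_mul_eq (fun x ↦ ?_) hmul, hsub, fun x ↦ ?_⟩
  · obtain ⟨s, hs, hs0, hspan⟩ := hlocal x
    have := isDomain_stalk A.str (f.π x)
    have hinj := (HasBlowupLift.exists_fraction (hlift x) hs hs0 hspan).1
    obtain ⟨a, ha, haH⟩ := h.cartier.exists_stalkIdeal_eq (f.π x)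
    refine ⟨(f.π.stalkMap x).hom a, ?_, ?_⟩
    · rw [map_ne_zero_iff _ hinj]
      exact nonZeroDivisors.ne_zero ha
    · rw [stalkIdeal_comap, haH, Ideal.map_span, Set.image_singleton]
  · obtain ⟨s, hs, hs0, hspan⟩ := hlocal x
    -- The exponent `b` is split as `1 + (b - 1)`: the `b - 1` derivations consume `b - 1`
    -- exceptional factors, and the remaining one is cancelled against the factor by which the
    -- inverse image of `H` exceeds its strict transform.
    have h1 : (stalkIdeal A.J (f.π x)).map (f.π.stalkMap x).hom ≤
        Ideal.span {(f.π.stalkMap x).hom s} ^ (1 + (A.b - 1)) * stalkIdeal A'.J x := by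
      rw [← hspan, ← stalkIdeal_comap, ← stalkIdeal_comap, f.totalTransform_eq, stalkIdeal_mul,
        stalkIdeal_pow, Nat.add_sub_cancel' h.pos]
    have h2 := HasBlowupLift.map_diffIdeal_iterate_le (hlift x) hs hs0 hspan (A.b - 1) h1
    rw [pow_one] at h2
    intro a ha
    have h3 : (f.π.stalkMap x).hom s * a ∈ stalkIdeal (H.comap f.π) x := by
      rw [← hmul, stalkIdeal_mul, stalkIdeal_comap, hspan]
      exact Ideal.mul_mem_mul (Ideal.mem_span_singleton_self _) ha
    rw [stalkIdeal_comap] at h3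
    obtain ⟨c, hc, hca⟩ := Ideal.mem_span_singleton_mul.mp
      (h2 (Ideal.map_mono (h.le_diffIdeal (f.π x)) h3))
    rw [f.b_eq, ← (mul_cancel_left_mem_nonZeroDivisors hs0).mp hca]
    exact hc

lemma MaximalContact.strict [CharZero k] {A B : Couple k} {H : A.W.IdealSheafData}
    (h : MaximalContact A H) (t : TransSeq A B) : MaximalContact B (t.strict H) := by
  induction t with
  | nil => exact h
  | snoc t f ih => exact ih.step f

section Algebra

open KaehlerDifferential

variable {A L ι : Type*} [CommRing A] [CommRing L] [Algebra k A] [Algebra k L]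
  [Fintype ι] [DecidableEq ι] {x : ι → A}

lemma sum_smul_derivation_apply {ι : Type*} (s : Finset ι) (c : ι → L) (d : ι → Derivation k L L)
    (a : L) : (∑ i ∈ s, c i • d i) a = ∑ i ∈ s, c i * d i a :=
  map_sum (⟨⟨fun D : Derivation k L L ↦ D a, rfl⟩, fun _ _ ↦ rfl⟩ : Derivation k L L →+ L) _ s

lemma derivation_eq_sum (hx : IsCoordinates k x) {d : ι → Derivation k A A}
    (hd : ∀ i j, d i (x j) = if i = j then 1 else 0) (D : Derivation k A A) (a : A) :
    D a = ∑ i, D (x i) * d i a := by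
  rw [← sum_smul_derivation_apply]
  refine map_derivation_eq hx (RingHom.id A) (fun _ ↦ rfl) D _ (fun j ↦ ?_) a
  rw [RingHom.id_apply, RingHom.id_apply, sum_smul_derivation_apply]
  simp [hd]

/-- In the presence of coordinates, derivations of ideals commute with étale extensions. -/
lemma map_diffIdeal (σ : A →+* L)
    (hσ : ∀ c, σ (algebraMap k A c) = algebraMap k L c) (hx : IsCoordinates k x) (hx' : IsCoordinates k fun i ↦ σ (x i))
    (J : Ideal A) : (diffIdeal k J).map σ = diffIdeal k (J.map σ) := by
  obtain ⟨d, hd⟩ := hx.exists_dual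
  obtain ⟨d', hd'⟩ := hx'.exists_dual
  have hcomm : ∀ i a, σ (d i a) = d' i (σ a) := fun i ↦
    map_derivation_eq hx σ hσ _ _ fun j ↦ by rw [hd, hd']; split_ifs <;> simp
  apply le_antisymm
  · rw [Ideal.map_le_iff_le_comap, diffIdeal_le_iff]
    refine ⟨fun f hf ↦ le_diffIdeal _ (Ideal.mem_map_of_mem σ hf), fun D f hf ↦ ?_⟩
    rw [Ideal.mem_comap, derivation_eq_sum hx hd D, map_sum]
    refine sum_mem fun i _ ↦ ?_
    rw [map_mul, hcomm]
    exact Ideal.mul_mem_left _ _ (deriv_mem_diffIdeal _ (Ideal.mem_map_of_mem σ hf))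
  · refine diffIdeal_le_iff.mpr ⟨Ideal.map_mono (le_diffIdeal J), fun D f hf ↦ ?_⟩
    refine Submodule.span_induction (p := fun f _ ↦ f ∈ J.map σ ∧ D f ∈ (diffIdeal k J).map σ)
      ?_ ?_ ?_ ?_ hf |>.2
    · rintro _ ⟨f, hf, rfl⟩
      refine ⟨Ideal.mem_map_of_mem σ hf, ?_⟩
      rw [derivation_eq_sum hx' hd' D]
      refine sum_mem fun i _ ↦ ?_
      rw [← hcomm]
      exact Ideal.mul_mem_left _ _ (Ideal.mem_map_of_mem σ (deriv_mem_diffIdeal _ hf))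
    · simp
    · rintro f g - - ⟨hf, hf'⟩ ⟨hg, hg'⟩
      exact ⟨add_mem hf hg, by rw [map_add]; exact add_mem hf' hg'⟩
    · rintro c f - ⟨hf, hf'⟩
      refine ⟨Ideal.mul_mem_left _ _ hf, ?_⟩
      rw [smul_eq_mul, Derivation.leibniz, smul_eq_mul, smul_eq_mul]
      exact add_mem (Ideal.mul_mem_left _ _ hf')
        (Ideal.mul_mem_right _ _ (Ideal.map_mono (le_diffIdeal J) hf))

lemma map_diffIdeal_iterate (σ : A →+* L)
    (hσ : ∀ c, σ (algebraMap k A c) = algebraMap k L c) (hx : IsCoordinates k x) (hx' : IsCoordinates k fun i ↦ σ (x i))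
    (n : ℕ) (J : Ideal A) : ((diffIdeal k)^[n] J).map σ = (diffIdeal k)^[n] (J.map σ) := by
  induction n generalizing J with
  | zero => rfl
  | succ n ih =>
    rw [Function.iterate_succ_apply, Function.iterate_succ_apply, ih, map_diffIdeal σ hσ hx hx']

/-- Coordinates control derivations over `k`, while `MaximalContact` uses derivations over `ℤ`, for
which the lifting to blow-ups is stated. This is the passage from the former to the latter. -/
lemma diffIdeal_le_of_isScalarTower (K : Type*) [CommRing K] [Algebra K k] [Algebra K A]
    [IsScalarTower K k A] (J : Ideal A) : diffIdeal k J ≤ diffIdeal K J :=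
  diffIdeal_le_iff.mpr ⟨le_diffIdeal J, fun D _ hf ↦ deriv_mem_diffIdeal (D.restrictScalars K) hf⟩

lemma diffIdeal_iterate_le_of_isScalarTower (K : Type*) [CommRing K] [Algebra K k] [Algebra K A]
    [IsScalarTower K k A] (n : ℕ) (J : Ideal A) :
    (diffIdeal k)^[n] J ≤ (diffIdeal K)^[n] J :=
  Monotone.iterate_le_of_le (f := diffIdeal (A := A) k) (g := diffIdeal (A := A) K)
    (fun _ _ h ↦ diffIdeal_mono h) (fun J ↦ diffIdeal_le_of_isScalarTower K J) n J

/-- A coordinate may be exchanged for a function whose derivative with respect to it is a unit. -/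
lemma IsCoordinates.exchange {n : ℕ} {x : Fin (n + 1) → A} (hx : IsCoordinates k x)
    {d : Derivation k A A} {i : Fin (n + 1)} (hd : ∀ j, d (x j) = if i = j then 1 else 0) {z : A}
    (hz : IsUnit (d z)) :
    IsCoordinates k (Sum.elim (fun _ : Fin 1 ↦ z) fun j : Fin n ↦ x (i.succAbove j)) := by
  let b := Module.Basis.mk hx.1 hx.2.ge
  have hb : ∀ j, b j = D k A (x j) := Module.Basis.mk_apply hx.1 hx.2.ge
  -- The derivation `d`, dual to `x i`, is the `i`-th coordinate functional of the basis of
  -- differentials. So `D z` has a unit as its `i`-th coordinate and may replace the `i`-th basis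
  -- vector.
  have hcoord : ∀ a, b.coord i (D k A a) = d a := by
    have h1 : b.coord i = d.liftKaehlerDifferential := b.ext fun j ↦ by
      rw [Module.Basis.coord_apply, Module.Basis.repr_self, hb,
        Derivation.liftKaehlerDifferential_comp_D, hd, Finsupp.single_apply]
      simp [eq_comm]
    intro a
    rw [h1, Derivation.liftKaehlerDifferential_comp_D]
  have hcoord_ne : ∀ j, b.coord i (D k A (x (i.succAbove j))) = 0 := fun j ↦ by
    rw [hcoord, hd, if_neg (Fin.succAbove_ne i j).symm]
  constructor
  · rw [Fintype.linearIndependent_iff]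
    intro c hc
    simp only [Fintype.sum_sum_type, Sum.elim_inl, Sum.elim_inr, Finset.univ_unique,
      Finset.sum_singleton] at hc
    have h1 := congrArg (b.coord i) hc
    simp only [map_add, map_smul, map_sum, hcoord_ne, hcoord, smul_eq_mul, mul_zero,
      Finset.sum_const_zero, add_zero, map_zero] at h1
    have h2 : c (Sum.inl default) = 0 := (hz.mul_left_eq_zero).mp h1
    rw [h2, zero_smul, zero_add] at hc
    have h3 : LinearIndependent A fun j : Fin n ↦ D k A (x (i.succAbove j)) :=
      hx.1.comp _ Fin.succAbove_right_injective
    have h4 := Fintype.linearIndependent_iff.mp h3 _ hc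
    rintro (j | j)
    · rw [Subsingleton.elim j default]
      exact h2
    · exact h4 j
  · rw [eq_top_iff, ← hx.2, Submodule.span_le]
    set P := Submodule.span A (Set.range fun j ↦ D k A ((Sum.elim (fun _ : Fin 1 ↦ z)
      fun j : Fin n ↦ x (i.succAbove j)) j))
    have hPz : D k A z ∈ P := Submodule.subset_span ⟨Sum.inl 0, rfl⟩
    have hPx : ∀ j, D k A (x (i.succAbove j)) ∈ P := fun j ↦ Submodule.subset_span ⟨Sum.inr j, rfl⟩
    have hsum : D k A z = d z • D k A (x i) +
        ∑ j, b.coord (i.succAbove j) (D k A z) • D k A (x (i.succAbove j)) := by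
      conv_lhs => rw [← b.sum_repr (D k A z), Fin.sum_univ_succAbove _ i]
      simp only [← Module.Basis.coord_apply, hcoord, hb]
    have hPi : D k A (x i) ∈ P := by
      have h1 : d z • D k A (x i) ∈ P := by
        rw [← sub_eq_iff_eq_add.mpr hsum]
        exact sub_mem hPz (sum_mem fun j _ ↦ Submodule.smul_mem _ _ (hPx j))
      obtain ⟨u, hu⟩ := hz
      rw [← hu] at h1
      have h2 := Submodule.smul_mem P (↑u⁻¹ : A) h1
      rwa [smul_smul, Units.inv_mul, one_smul] at h2
    rintro _ ⟨j, rfl⟩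
    rcases Fin.eq_self_or_eq_succAbove i j with rfl | ⟨j, rfl⟩
    · exact hPi
    · exact hPx j

end Algebra

end Resolution
end

/-! ### Local existence of hypersurfaces of maximal contact -/

noncomputable section
namespace Resolution

open Scheme.IdealSheafData

variable {k : Type u} [Field k] {X : Scheme.{u}} {p : X ⟶ Spec (CommRingCat.of k)}

/-- Coordinates exist locally on smooth schemes. -/
lemma exists_isCoordinates [Smooth p] (x : X) : ∃ (V : X.affineOpens) (_ : x ∈ V.1),
    letI := sectionsAlgebra p V.1
    ∃ (n : ℕ) (t : Fin n → Γ(X, V.1)), IsCoordinates k t := by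
  obtain ⟨U, hU, V, hV, hx, e, h⟩ := Smooth.exists_isStandardSmooth p x
  have hUtop : U = ⊤ := by
    refine top_le_iff.mp fun y _ ↦ ?_
    have : y = p x := Subsingleton.elim (α := PrimeSpectrum k) _ _
    rw [this]
    exact e hx
  subst hUtop
  refine ⟨⟨V, hV⟩, hx, ?_⟩
  let _ := sectionsAlgebra p V
  have h1 : (algebraMap k Γ(X, V)).IsStandardSmooth := by
    change RingHom.IsStandardSmooth ((Scheme.ΓSpecIso (CommRingCat.of k)).inv ≫ p.appLE ⊤ V _).hom
    rw [CommRingCat.hom_comp, RingHom.isStandardSmooth_respectsIso.cancel_left_isIso]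
    exact h
  have h2 : Algebra.IsStandardSmooth k Γ(X, V) := RingHom.isStandardSmooth_algebraMap.mp h1
  obtain ⟨ι, σ, _, _, ⟨P⟩⟩ := h2.out
  -- In a standard smooth presentation the variables that are not paired with relations have
  -- differentials forming a basis.
  let κ := ((Set.range P.map)ᶜ : Set ι)
  have : Finite κ := Subtype.finite
  obtain ⟨n, ⟨e'⟩⟩ := Finite.exists_equiv_fin κ
  let b := P.basisKaehler.reindex e'
  have hb : (fun i ↦ KaehlerDifferential.D k Γ(X, V) (P.val (e'.symm i).1)) = b := by
    funext i
    rw [Module.Basis.reindex_apply]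
    exact (P.basisKaehler_apply _).symm
  refine ⟨n, fun i ↦ P.val (e'.symm i).1, ?_, ?_⟩
  · rw [hb]; exact b.linearIndependent
  · rw [hb]; exact b.span_eq

/-- On an affine scheme, coordinates are determined by the global sections. -/
lemma isCoordinateSystem_of_isAffine [IsAffine X] {ι : Type} {t : ι → Γ(X, ⊤)}
    (h : letI := sectionsAlgebra p ⊤; IsCoordinates k t) : IsCoordinateSystem p t := by
  intro V
  let _ := sectionsAlgebra p ⊤
  let _ := sectionsAlgebra p V.1
  let _ : Algebra Γ(X, ⊤) Γ(X, V.1) := (X.presheaf.map (homOfLE (le_top : V.1 ≤ ⊤)).op).hom.toAlgebra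
  have : IsScalarTower k Γ(X, ⊤) Γ(X, V.1) :=
    IsScalarTower.of_algebraMap_eq fun c ↦ (map_sectionsAlgebra le_top c).symm
  have h1 : ((𝟙 X : X ⟶ X).appLE ⊤ V.1 le_top).hom.Etale :=
    HasRingHomProperty.appLE @Etale (𝟙 X) inferInstance ⟨⊤, isAffineOpen_top X⟩ V le_top
  have h2 : (𝟙 X : X ⟶ X).appLE ⊤ V.1 le_top = X.presheaf.map (homOfLE (le_top : V.1 ≤ ⊤)).op := by
    change (𝟙 X : X ⟶ X).app ⊤ ≫ X.presheaf.map _ = _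
    rw [Scheme.Hom.id_app]
    exact Category.id_comp _
  rw [h2] at h1
  have h3 : Algebra.Etale Γ(X, ⊤) Γ(X, V.1) := h1
  exact h.of_formallyEtale (B := Γ(X, V.1))

lemma exists_eq_ofIdealTop_span [IsAffine X] [IsLocallyNoetherian X] (J : X.IdealSheafData) :
    ∃ (q : ℕ) (f : Fin q → Γ(X, ⊤)), J = ofIdealTop (Ideal.span (Set.range f)) := by
  have : IsNoetherianRing Γ(X, ⊤) :=
    IsLocallyNoetherian.component_noetherian ⟨⊤, isAffineOpen_top X⟩
  obtain ⟨q, f, hf⟩ := Submodule.fg_iff_exists_fin_generating_family.mp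
    (IsNoetherian.noetherian (J.ideal ⟨⊤, isAffineOpen_top X⟩))
  refine ⟨q, f, ?_⟩
  have h1 : Ideal.span (Set.range f) = J.ideal ⟨⊤, isAffineOpen_top X⟩ := hf
  rw [h1]
  exact (equivOfIsAffine.symm_apply_apply J).symm

section Restriction

variable (A : Couple k) (U V : A.W.affineOpens) (hUV : U.1 ≤ V.1)

lemma le_preimage_ι {U V : A.W.Opens} (hUV : U ≤ V) :
    (⊤ : U.toScheme.Opens) ≤ U.ι ⁻¹ᵁ V := by
  intro y _
  exact hUV y.2

/-- Restriction of sections over `V` to global sections of an open subscheme. -/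
def restrictHom {U V : A.W.Opens} (hUV : U ≤ V) : Γ(A.W, V) →+* Γ((A.restrict U).W, ⊤) :=
  (U.ι.appLE V ⊤ (le_preimage_ι A hUV)).hom

lemma restrictHom_algebraMap {U V : A.W.Opens} (hUV : U ≤ V) (c : k) :
    restrictHom A hUV ((sectionsAlgebra A.str V).algebraMap c) =
      (sectionsAlgebra (A.restrict U).str ⊤).algebraMap c := by
  have e : A.str.appLE ⊤ V le_top ≫ U.ι.appLE V ⊤ (le_preimage_ι A hUV) =
      (U.ι ≫ A.str).appLE ⊤ ⊤ le_top := Scheme.Hom.appLE_comp_appLE _ _ _ _ _ _ _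
  exact congr(($e).hom ((Scheme.ΓSpecIso (CommRingCat.of k)).inv.hom c))

lemma isUnit_restrictHom {V : A.W.Opens} (g : Γ(A.W, V)) :
    IsUnit (restrictHom A (A.W.basicOpen_le g) g) := by
  have h1 := RingedSpace.isUnit_res_basicOpen A.W.toRingedSpace g
  have e : A.W.presheaf.map (homOfLE (A.W.basicOpen_le g)).op ≫
      (A.W.basicOpen g).ι.appLE (A.W.basicOpen g) ⊤ (le_preimage_ι A le_rfl) =
      (A.W.basicOpen g).ι.appLE V ⊤ (le_preimage_ι A (A.W.basicOpen_le g)) :=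
    Scheme.Hom.map_appLE _ _ _
  have h2 := h1.map ((A.W.basicOpen g).ι.appLE (A.W.basicOpen g) ⊤ (le_preimage_ι A le_rfl)).hom
  have h3 : restrictHom A (A.W.basicOpen_le g) g =
      ((A.W.basicOpen g).ι.appLE (A.W.basicOpen g) ⊤ (le_preimage_ι A le_rfl)).hom
        ((A.W.presheaf.map (homOfLE (A.W.basicOpen_le g)).op).hom g) := congr(($e).hom g).symm
  rw [h3]
  exact h2

lemma isCoordinates_restrictHom {ι : Type} {t : ι → Γ(A.W, V.1)}
    (h : letI := sectionsAlgebra A.str V.1; IsCoordinates k t) :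
    letI := sectionsAlgebra (A.restrict U.1).str ⊤
    IsCoordinates k fun i ↦ restrictHom A hUV (t i) := by
  let _ := sectionsAlgebra A.str V.1
  let _ := sectionsAlgebra (A.restrict U.1).str ⊤
  let _ : Algebra Γ(A.W, V.1) Γ((A.restrict U.1).W, ⊤) := (restrictHom A hUV).toAlgebra
  have : IsScalarTower k Γ(A.W, V.1) Γ((A.restrict U.1).W, ⊤) :=
    IsScalarTower.of_algebraMap_eq fun c ↦ (restrictHom_algebraMap A hUV c).symm
  have : IsAffine U.1 := U.2
  have h1 : (restrictHom A hUV).Etale :=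
    HasRingHomProperty.appLE @Etale U.1.ι inferInstance V ⟨⊤, isAffineOpen_top U.1.toScheme⟩ _
  have h2 : Algebra.Etale Γ(A.W, V.1) Γ((A.restrict U.1).W, ⊤) := h1
  exact h.of_formallyEtale (B := Γ((A.restrict U.1).W, ⊤))

lemma stalkIdeal_restrict (y : (A.restrict U.1).W) : stalkIdeal (A.restrict U.1).J y =
    (A.J.ideal V).map
      (((A.restrict U.1).W.presheaf.germ ⊤ y trivial).hom.comp (restrictHom A hUV)) := by
  have : IsAffine U.1 := U.2
  refine (stalkIdeal_eq (A.J.comap U.1.ι) y ⟨⊤, isAffineOpen_top U.1.toScheme⟩ trivial).trans ?_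
  rw [ideal_comap_of_le U.1.ι A.J V ⟨⊤, isAffineOpen_top U.1.toScheme⟩ (le_preimage_ι A hUV),
    Ideal.map_map]
  rfl

/-- Coordinates make iterated derivatives commute with restriction and localization. A condition on
sections over `V` thus yields the stalkwise condition of `MaximalContact` at every point of `U`. -/
lemma germ_restrictHom_mem {N : ℕ} {t : Fin N → Γ(A.W, V.1)}
    (h : letI := sectionsAlgebra A.str V.1; IsCoordinates k t) (n : ℕ) {s : Γ(A.W, V.1)}
    (hs : letI := sectionsAlgebra A.str V.1; s ∈ (diffIdeal k)^[n] (A.J.ideal V))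
    (y : (A.restrict U.1).W) :
    ((A.restrict U.1).W.presheaf.germ ⊤ y trivial).hom (restrictHom A hUV s) ∈
      (diffIdeal ℤ)^[n] (stalkIdeal (A.restrict U.1).J y) := by
  have : IsAffine (A.restrict U.1).W := U.2
  let _ := sectionsAlgebra A.str V.1
  have h1 := (isCoordinateSystem_of_isAffine (isCoordinates_restrictHom A U V hUV h)).stalk y
  let _ := stalkAlgebra (A.restrict U.1).str y
  let σ := ((A.restrict U.1).W.presheaf.germ ⊤ y trivial).hom.comp (restrictHom A hUV)
  have hσ : ∀ c, σ (algebraMap k Γ(A.W, V.1) c) =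
      algebraMap k ((A.restrict U.1).W.presheaf.stalk y) c := fun c ↦
    (congrArg _ (restrictHom_algebraMap A hUV c)).trans
      (germ_algebraMap (A.restrict U.1).str ⊤ y trivial c)
  have h2 := map_diffIdeal_iterate σ hσ h h1 n (A.J.ideal V)
  have h3 := Ideal.mem_map_of_mem σ hs
  rw [h2] at h3
  have h4 := diffIdeal_iterate_le_of_isScalarTower ℤ n _ h3
  rw [stalkIdeal_restrict A U V hUV y]
  exact h4

end Restriction

/-- A function whose order is at most `b` has a `b`-th derivative that does not vanish. -/
lemma exists_derivation_of_ord_le [CharZero k] (A : Couple k) (hA : Smooth A.str) (x : A.W)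
    (hord : ord A.J x ≤ A.b) {V : A.W.affineOpens} (hx : x ∈ V.1) {N : ℕ}
    {t : Fin N → Γ(A.W, V.1)} (ht : letI := sectionsAlgebra A.str V.1; IsCoordinates k t) :
    letI := sectionsAlgebra A.str V.1
    ∃ s ∈ (diffIdeal k)^[A.b] (A.J.ideal V), x ∈ A.W.basicOpen s := by
  let _ := sectionsAlgebra A.str V.1
  let _ := stalkAlgebra A.str x
  by_contra! H
  have := essFiniteType_stalk A.str x
  have := formallySmooth_stalk A.str x
  let _ := TopCat.Presheaf.algebra_section_stalk A.W.presheaf (U := V.1) ⟨x, hx⟩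
  have := V.2.isLocalization_stalk ⟨x, hx⟩
  have : IsScalarTower k Γ(A.W, V.1) (A.W.presheaf.stalk x) :=
    IsScalarTower.of_algebraMap_eq fun c ↦ (germ_algebraMap A.str V.1 x hx c).symm
  have : Algebra.FormallyEtale Γ(A.W, V.1) (A.W.presheaf.stalk x) :=
    Algebra.FormallyEtale.of_isLocalization (V.2.primeIdealOf ⟨x, hx⟩).asIdeal.primeCompl
  have h1 := ht.of_formallyEtale (B := A.W.presheaf.stalk x)
  let γ := (A.W.presheaf.germ V.1 x hx).hom
  have h2 : ((diffIdeal k)^[A.b] (A.J.ideal V)).map γ = (diffIdeal k)^[A.b] (stalkIdeal A.J x) := by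
    rw [stalkIdeal_eq A.J x V hx]
    exact map_diffIdeal_iterate γ (germ_algebraMap A.str V.1 x hx) ht h1 _ _
  have h3 : (diffIdeal k)^[A.b] (stalkIdeal A.J x) ≤
      IsLocalRing.maximalIdeal (A.W.presheaf.stalk x) := by
    rw [← h2, Ideal.map_le_iff_le_comap]
    intro s hs hu
    exact H s hs ((A.W.mem_basicOpen s x hx).mpr hu)
  -- If all derivatives up to order `b` lay in the maximal ideal, Euler's formula in a system of
  -- parameters would give order at least `b + 1` at `x`.
  obtain ⟨n, w, D, hw, hD⟩ := exists_dual_of_essFiniteType k (A.W.presheaf.stalk x)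
  rw [← hw] at h3
  have h4 := le_pow_of_diffIdeal_iterate_le hD (fun n hn ↦ isUnit_natCast_of_algebra k _ hn) _ h3
  rw [hw, ← le_ord_iff] at h4
  have h5 := h4.trans hord
  exact absurd (Nat.cast_le.mp h5) (by omega)

lemma isEmpty_subscheme_top (X : Scheme.{u}) : IsEmpty (⊤ : X.IdealSheafData).subscheme := by
  refine ⟨fun y ↦ ?_⟩
  have h : (⊤ : X.IdealSheafData).subschemeι y ∈ Set.range (⊤ : X.IdealSheafData).subschemeι :=
    ⟨y, rfl⟩
  rw [range_subschemeι] at h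
  have h1 := (mem_support_iff_stalkIdeal _ _).mp h
  exact h1 (stalkIdeal_top _)

lemma smooth_subscheme_top [LocallyOfFiniteType p] :
    Smooth ((⊤ : X.IdealSheafData).subschemeι ≫ p) :=
  smooth_of_stalk _ fun y ↦ ((isEmpty_subscheme_top X).false y).elim

/-- Local hypersurfaces of maximal contact, with coefficient ideals. -/
theorem exists_maximalContact [CharZero k] (A : Couple k) (hA : Smooth A.str) (hb : 0 < A.b)
    (x : A.W) (hord : ord A.J x ≤ A.b) :
    ∃ (U : A.W.Opens) (_ : x ∈ U) (H : (A.restrict U).W.IdealSheafData)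
      (K : H.subscheme.IdealSheafData), MaximalContact (A.restrict U) H ∧
      Adapted (A.restrict U) ((A.restrict U).onSubscheme H K A.b.factorial) H.subschemeι ∧
      (H ≠ ⊤ → ∃ (n q : ℕ) (z : Fin 1 → Γ((A.restrict U).W, ⊤))
        (y : Fin n → Γ((A.restrict U).W, ⊤)) (f : Fin q → Γ((A.restrict U).W, ⊤)),
        IsCoordinateSystem (A.restrict U).str (Sum.elim z y) ∧
        H = ofIdealTop (Ideal.span (Set.range z)) ∧
        (A.restrict U).J = ofIdealTop (Ideal.span (Set.range f)) ∧
        IsCoefficientIdeal (A.restrict U).str A.b z y (Set.range f) K) := by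
  obtain ⟨V, hx, N, t, ht⟩ := exists_isCoordinates (p := A.str) x
  let _ := sectionsAlgebra A.str V.1
  have hsmooth : ∀ U : A.W.Opens, Smooth (A.restrict U).str := fun U ↦
    inferInstanceAs (Smooth (U.ι ≫ A.str))
  have hnoeth : ∀ U : A.W.Opens, IsLocallyNoetherian (A.restrict U).W := fun U ↦
    have := hsmooth U
    isLocallyNoetherian_of_field (A.restrict U).str
  -- If some derivative of order at most `b - 1` is a unit at `x`, no point near `x` has order `b`,
  -- and the empty hypersurface, with ideal `⊤`, will do.
  by_cases hΔ : ∃ g ∈ (diffIdeal k)^[A.b - 1] (A.J.ideal V), x ∈ A.W.basicOpen g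
  · obtain ⟨g, hg, hxg⟩ := hΔ
    let U : A.W.affineOpens := A.W.affineBasicOpen g
    have := hsmooth U.1
    have := hnoeth U.1
    refine ⟨U.1, hxg, ⊤, ⊤, ⟨hsmooth U.1, hb, ?_, smooth_subscheme_top, fun y ↦ ?_⟩,
      ⟨inferInstanceAs (IsClosedImmersion (⊤ : (A.restrict U.1).W.IdealSheafData).subschemeι), rfl,
        hsmooth U.1, smooth_subscheme_top, rfl,
        fun y ↦ ((isEmpty_subscheme_top (A.restrict U.1).W).false y).elim⟩,
      fun h ↦ (h rfl).elim⟩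
    · exact isEffectiveCartier_of_stalk fun y ↦
        ⟨1, one_mem _, by rw [stalkIdeal_top, Ideal.span_singleton_one]⟩
    · have h1 := germ_restrictHom_mem A U V (A.W.basicOpen_le g) ht _ hg y
      have h2 := (isUnit_restrictHom A g).map ((A.restrict U.1).W.presheaf.germ ⊤ y trivial).hom
      exact le_top.trans (Ideal.eq_top_of_isUnit_mem _ h1 h2).ge
  · obtain ⟨s, hs, hxs⟩ := exists_derivation_of_ord_le A hA x hord hx ht
    obtain ⟨d, hd⟩ := ht.exists_dual
    -- Otherwise all derivatives of order at most `b - 1` vanish at `x`, while one of order at most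
    -- `b` does not. The latter involves a partial derivative, nonzero at `x`, of one of the former;
    -- this `z` is the equation of the hypersurface.
    have hz : ∃ z ∈ (diffIdeal k)^[A.b - 1] (A.J.ideal V), ∃ i, x ∈ A.W.basicOpen (d i z) := by
      push Not at hΔ
      by_contra! H
      have h1 : diffIdeal k ((diffIdeal k)^[A.b - 1] (A.J.ideal V)) ≤
          (IsLocalRing.maximalIdeal (A.W.presheaf.stalk x)).comap
            (A.W.presheaf.germ V.1 x hx).hom := by
        refine diffIdeal_le_iff.mpr ⟨fun f hf hu ↦ hΔ f hf ((A.W.mem_basicOpen f x hx).mpr hu),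
          fun D f hf ↦ ?_⟩
        rw [derivation_eq_sum ht hd D]
        refine sum_mem fun i _ ↦ Ideal.mul_mem_left _ _ fun hu ↦ H f hf i ?_
        exact (A.W.mem_basicOpen _ x hx).mpr hu
      rw [← Function.iterate_succ_apply' (diffIdeal k), Nat.succ_eq_add_one,
        Nat.sub_add_cancel hb] at h1
      exact h1 hs ((A.W.mem_basicOpen s x hx).mp hxs)
    obtain ⟨z, hz, i, hxi⟩ := hz
    obtain _ | n := N
    · exact i.elim0
    let U : A.W.affineOpens := A.W.affineBasicOpen (d i z)
    have hUV : U.1 ≤ V.1 := A.W.basicOpen_le (d i z)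
    have := hsmooth U.1
    have := hnoeth U.1
    have : IsAffine (A.restrict U.1).W := U.2
    let _ := sectionsAlgebra (A.restrict U.1).str ⊤
    have ht' := isCoordinates_restrictHom A U V hUV ht
    obtain ⟨d', hd'⟩ := ht'.exists_dual
    have hdz : IsUnit (d' i (restrictHom A hUV z)) := by
      rw [← map_derivation_eq ht (restrictHom A hUV) (restrictHom_algebraMap A hUV) (d i) (d' i)]
      · exact isUnit_restrictHom A (d i z)
      · intro j
        rw [hd, hd']
        split_ifs <;> simp
    have hcoord : IsCoordinateSystem (A.restrict U.1).str
        (Sum.elim (fun _ : Fin 1 ↦ restrictHom A hUV z)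
          fun j : Fin n ↦ restrictHom A hUV (t (i.succAbove j))) :=
      isCoordinateSystem_of_isAffine (ht'.exchange (hd' i) hdz)
    obtain ⟨q, f, hf⟩ := exists_eq_ofIdealTop_span (A.restrict U.1).J
    let H : (A.restrict U.1).W.IdealSheafData :=
      ofIdealTop (Ideal.span (Set.range fun _ : Fin 1 ↦ restrictHom A hUV z))
    obtain ⟨K, hK⟩ := exists_isCoefficientIdeal hcoord A.b (Set.range f) H
    have hadapted := adapted_of_isCoefficientIdeal (A.restrict U.1) (hsmooth U.1) hb hcoord hf
      (I := H) rfl hK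
    have hH : ∀ y, stalkIdeal H y = Ideal.span {((A.restrict U.1).W.presheaf.germ ⊤ y trivial).hom
        (restrictHom A hUV z)} := fun y ↦ by
      rw [stalkIdeal_ofIdealTop, Set.range_const, Ideal.map_span, Set.image_singleton]
    refine ⟨U.1, hxi, H, K, ⟨hsmooth U.1, hb, ?_, hadapted.smooth_sub, fun y ↦ ?_⟩, hadapted,
      fun _ ↦ ⟨n, q, _, _, f, hcoord, rfl, hf, hK⟩⟩
    · refine isEffectiveCartier_of_stalk fun y ↦ ⟨_, ?_, hH y⟩
      have := isDomain_stalk (A.restrict U.1).str y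
      -- The equation is nonzero in every local ring because, as a coordinate, it has derivative `1`
      -- with respect to itself.
      refine mem_nonZeroDivisors_of_ne_zero fun h0 ↦ ?_
      let _ := stalkAlgebra (A.restrict U.1).str y
      obtain ⟨e, he⟩ := (hcoord.stalk y).exists_dual
      have h1 := he (Sum.inl 0) (Sum.inl 0)
      rw [if_pos rfl] at h1
      refine zero_ne_one (h1.symm.trans ?_).symm
      exact (congrArg _ h0).trans (map_zero _)
    · rw [hH, Ideal.span_singleton_le_iff_mem]
      exact germ_restrictHom_mem A U V hUV ht _ hz y

end Resolution
end

/-! ### Restriction to open subsets, and the theorem -/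

noncomputable section
namespace Resolution

open Scheme.IdealSheafData

section RestrictSing

variable {k : Type u} [Field k]

/-- One inclusion is `le_ord_comap`; the other uses the inverse of the isomorphism of stalks along
an open immersion. -/
lemma mem_Sing_restrict_iff (A : Couple k) (U : A.W.Opens) (x : U.toScheme) :
    x ∈ (A.restrict U).Sing ↔ U.ι x ∈ A.Sing := by
  refine ⟨fun h ↦ ?_, fun h ↦ le_trans h (le_ord_comap A.J U.ι x)⟩
  have h1 : (stalkIdeal A.J (U.ι x)).map (U.ι.stalkMap x).hom ≤
      IsLocalRing.maximalIdeal (U.toScheme.presheaf.stalk x) ^ A.b :=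
    (stalkIdeal_comap U.ι A.J x).ge.trans ((mem_Sing_iff (A.restrict U) x).mp h)
  let e := (asIso (U.ι.stalkMap x)).commRingCatIsoToRingEquiv
  have h2 := Ideal.map_mono (f := e.symm.toRingHom) h1
  rw [Ideal.map_pow, Ideal.map_map] at h2
  have : IsLocalHom e.symm.toRingHom := ⟨fun a h ↦ (isUnit_map_iff e.symm a).mp h⟩
  have h3 : (IsLocalRing.maximalIdeal (U.toScheme.presheaf.stalk x)).map e.symm.toRingHom ≤
      IsLocalRing.maximalIdeal (A.W.presheaf.stalk (U.ι x)) :=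
    Ideal.map_le_iff_le_comap.mpr (IsLocalRing.maximalIdeal_comap e.symm.toRingHom).ge
  have h4 : e.symm.toRingHom.comp (U.ι.stalkMap x).hom = RingHom.id _ :=
    RingHom.ext fun a ↦ e.symm_apply_apply a
  rw [h4, Ideal.map_id] at h2
  exact (mem_Sing_iff A _).mpr (h2.trans (Ideal.pow_right_mono h3 _))

lemma Sing_inter_eq_image (A : Couple k) (U : A.W.Opens) :
    A.Sing ∩ (U : Set A.W) = U.ι '' (A.restrict U).Sing := by
  ext x
  refine ⟨fun ⟨h, hx⟩ ↦ ⟨⟨x, hx⟩, (mem_Sing_restrict_iff A U ⟨x, hx⟩).mpr h, rfl⟩, ?_⟩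
  rintro ⟨y, hy, rfl⟩
  exact ⟨(mem_Sing_restrict_iff A U y).mp hy, y.2⟩

lemma TransSeq.iSup_pullOpen_eq_top {A B : Couple k} (t : TransSeq A B) {Λ : Type*}
    {U : Λ → A.W.Opens} (hU : ⨆ l, U l = ⊤) : ⨆ l, t.pullOpen (U l) = ⊤ := by
  induction t with
  | nil => exact hU
  | snoc t f ih =>
    refine eq_top_iff.mpr fun x _ ↦ TopologicalSpace.Opens.mem_iSup.mpr ?_
    obtain ⟨l, hl⟩ := TopologicalSpace.Opens.mem_iSup.mp
      (ih.ge (TopologicalSpace.Opens.mem_top (f.π x)))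
    exact ⟨l, hl⟩

end RestrictSing

end Resolution
end

theorem mainTheorem5 {k : Type u} [Field k] [CharZero k] :
    -- Local hypersurfaces, stability, and the couples on them.
    (∀ (A : Couple k), Smooth A.str → QuasiCompact A.str → 0 < A.b →
      IsGreatest (Set.range (ord A.J)) (A.b : ℕ∞) →
      ∃ (Λ : Type u) (U : Λ → A.W.Opens)
        (H : ∀ l, (A.restrict (U l)).W.IdealSheafData)
        (K : ∀ l, (H l).subscheme.IdealSheafData),
        (⨆ l, U l) = ⊤ ∧
        (∀ l, IsSmoothHypersurface (A.restrict (U l)).str (H l)) ∧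
        -- `K l` is a coefficient ideal on the hypersurface `z = 0` (if this is not empty)
        (∀ l, H l ≠ ⊤ → ∃ (n q : ℕ) (z : Fin 1 → Γ((A.restrict (U l)).W, ⊤))
          (y : Fin n → Γ((A.restrict (U l)).W, ⊤)) (f : Fin q → Γ((A.restrict (U l)).W, ⊤)),
          IsCoordinateSystem (A.restrict (U l)).str (Sum.elim z y) ∧
          H l = Scheme.IdealSheafData.ofIdealTop (Ideal.span (Set.range z)) ∧
          (A.restrict (U l)).J = Scheme.IdealSheafData.ofIdealTop (Ideal.span (Set.range f)) ∧
          IsCoefficientIdeal (A.restrict (U l)).str A.b z y (Set.range f) (K l)) ∧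
        -- the hypersurface contains the singular locus
        (∀ l, (A.restrict (U l)).Sing ⊆ (H l).support) ∧
        -- and its strict transforms, which are smooth hypersurfaces, contain the later ones
        (∀ (B : Couple k) (t : TransSeq A B), (⨆ l, t.pullOpen (U l)) = ⊤ ∧
          ∀ l, B.Sing ∩ (t.pullOpen (U l) : Set B.W) =
              (t.pullOpen (U l)).ι '' (B.restrict (t.pullOpen (U l))).Sing ∧
            IsSmoothHypersurface (B.restrict (t.pullOpen (U l))).str
              ((t.restrict (U l)).strict (H l)) ∧
            (B.restrict (t.pullOpen (U l))).Sing ⊆ ((t.restrict (U l)).strict (H l)).support) ∧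
        -- induced sequences of transformations of `(K l, b!)`, with the same singular loci
        (∀ (B : Couple k) (t : TransSeq A B) (l : Λ), (t.restrict (U l)).Descends
          ((A.restrict (U l)).onSubscheme (H l) (K l) A.b.factorial) (H l).subschemeι) ∧
        -- conversely, sequences for `(K l, b!)` are induced by sequences over `U l`
        (∀ (l : Λ) (D : Couple k)
          (s : TransSeq ((A.restrict (U l)).onSubscheme (H l) (K l) A.b.factorial) D),
          s.Ascends (A.restrict (U l)) (H l).subschemeι)) ∧
    -- Coefficient ideals of one function, on smooth subschemes of any codimension.
    (∀ (A : Couple k), Smooth A.str → QuasiCompact A.str → 0 < A.b →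
      IsGreatest (Set.range (ord A.J)) (A.b : ℕ∞) →
      ∀ (r n : ℕ) (z : Fin r → Γ(A.W, ⊤)) (y : Fin n → Γ(A.W, ⊤)) (f : Γ(A.W, ⊤))
        (I : A.W.IdealSheafData),
        IsCoordinateSystem A.str (Sum.elim z y) →
        A.J = Scheme.IdealSheafData.ofIdealTop (Ideal.span {f}) →
        I = Scheme.IdealSheafData.ofIdealTop (Ideal.span (Set.range z)) →
        (∀ (B : Couple k) (t : TransSeq A B), B.Sing ⊆ (t.strict I).support) →
        ∃ K : I.subscheme.IdealSheafData,
          IsCoefficientIdeal A.str A.b z y {f} K ∧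
          (∀ (B : Couple k) (t : TransSeq A B),
            t.Descends (A.onSubscheme I K A.b.factorial) I.subschemeι) ∧
          (∀ (D : Couple k) (s : TransSeq (A.onSubscheme I K A.b.factorial) D),
            s.Ascends A I.subschemeι)) := by
  refine ⟨fun A hA _ hb hord ↦ ?_, fun A hA _ hb _ r n z y f I hz hJ hI hS ↦ ?_⟩
  -- The covering is indexed by the points of `W`. Maximality of `b` provides the bound on the order
  -- at each of them.
  · choose U hU H K hmax hadapted hcoeff using fun x ↦
      exists_maximalContact A hA hb x (hord.2 ⟨x, rfl⟩)
    have hcover : ⨆ x, U x = ⊤ := eq_top_iff.mpr fun x _ ↦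
      TopologicalSpace.Opens.mem_iSup.mpr ⟨x, hU x⟩
    -- This holds for all sequences over `U x`, not only for restrictions of sequences over `W`; the
    -- converse direction needs it in this generality.
    have hS : ∀ (x : A.W) (B : Couple k) (t : TransSeq (A.restrict (U x)) B),
        B.Sing ⊆ (t.strict (H x).subschemeι.ker).support := fun x B t ↦ by
      rw [Scheme.IdealSheafData.ker_subschemeι]
      exact ((hmax x).strict t).Sing_subset
    refine ⟨A.W, U, H, K, hcover, fun x ↦ ⟨(hmax x).cartier, (hmax x).smooth_sub⟩, hcoeff,
      fun x ↦ (hmax x).Sing_subset, fun B t ↦ ⟨t.iSup_pullOpen_eq_top hcover, fun x ↦ ?_⟩,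
      fun B t x ↦ TransSeq.descends_of_adapted (hadapted x) (hS x) _,
      fun x D s ↦ TransSeq.ascends_of_adapted (hadapted x) (hS x) s⟩
    have h := (hmax x).strict (t.restrict (U x))
    exact ⟨Sing_inter_eq_image B _, ⟨h.cartier, h.smooth_sub⟩, h.Sing_subset⟩
  · obtain ⟨K, hK⟩ := exists_isCoefficientIdeal hz A.b {f} I
    have hadapted := adapted_of_isCoefficientIdeal A hA hb hz hJ hI hK
    have hS' : ∀ (B : Couple k) (t : TransSeq A B),
        B.Sing ⊆ (t.strict I.subschemeι.ker).support := fun B t ↦ by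
      rw [Scheme.IdealSheafData.ker_subschemeι]
      exact hS B t
    exact ⟨K, hK, fun B t ↦ TransSeq.descends_of_adapted hadapted hS' t,
      fun D s ↦ TransSeq.ascends_of_adapted hadapted hS' s⟩
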